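/- All manifolds are smooth, Hausdorff and $\sigma$-compact, and all structures on them are smooth. Let $(M,c_M)$ be an oriented conformal manifold of even dimension $2m$, and let $(N,c_N)$ be an oriented conformal manifold of even dimension $2m+2k$ endowed with a Weyl connection $D^N$, that is, a torsion-free connection on $TN$ which preserves $c_N$. (A Weyl connection on $M$ may be given too, but it plays no role.) Let $\varphi:M\to N$ be an immersion; if $k=0$ suppose that $\varphi$ preserves the orientations. Orient the normal bundle $(TM)^\perp$ (orthogonal complement with respect to $c_N$) so that $TN|_M=TM\oplus(TM)^\perp$ preserves orientations. The *positive maximal isotropic spaces* of an oriented conformal vector space of even dimension are the eigenspaces, for $-\mathrm i$, of its positive orthogonal complex structures. Let $Q_M\to M$ and $\pi:Q\to M$ be the bundles of positive maximal isotropic spaces of $(TM,c_M)$ and of $\bigl((TM)^\perp,c_N|_{(TM)^\perp}\bigr)$, respectively. Let $p$ be a section of $Q_M$, regarded also as a subbundle of $T^{\mathbb C}M$, and let $J^p$ be the almost complex structure on $M$ whose eigenbundle for $-\mathrm i$ is $p$. The fibres of $\pi$ are complex submanifolds of Grassmannians, so that $(\ker\mathrm d\pi)^{\mathbb C}=(\ker\mathrm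 d\pi)^{1,0}\oplus(\ker\mathrm d\pi)^{0,1}$. Let $\Pi:TN|_M\to(TM)^\perp$ be the orthogonal projection. Let $\mathcal J^p$ be the almost complex structure on $Q$ whose eigenbundle for $+\mathrm i$ is $$\mathscr G_0\oplus(\ker\mathrm d\pi)^{0,1},$$ where $\mathscr G_0\subseteq T^{\mathbb C}Q$ consists of the complex vectors which are horizontal for the connection induced by $\Pi\circ D^N$ on $Q$ and which are projected by $\mathrm d\pi$ into $\overline p$. An almost complex structure is *integrable* if the sections of its eigenbundle for $-\mathrm i$ are closed under the bracket. For $X,Y\in T_xM$ and $U,V\in(T_xM)^\perp$ put $$A(X,Y,U,V)=\sum_a\Bigl(c_N(D^N_XZ_a,U)\,c_N(D^N_YZ_a,V)-c_N(D^N_YZ_a,U)\,c_N(D^N_XZ_a,V)\Bigr),$$ where $\{Z_a\}$ is a local frame of $TM$ which is orthonormal with respect to $c_N|_{TM}$ (that is, orthonormal for the metric induced on $M$ by a representative of $c_N$, by which $c_N$ is evaluated). Let $W$ be the Weyl tensor of $(N,c_N)$, as a tensor of type $(0,4)$ and with the sign for which $W(X,Y,U,V)=-g(R(X,Y)U,V)$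 when a representative $g$ of $c_N$ is Ricci-flat, $R(X,Y)=[\nabla_X,\nabla_Y]-\nabla_{[X,Y]}$ being the curvature of its Levi-Civita connection $\nabla$ ($W=0$ in dimension at most two). Extend $W$ and $A$ complex multilinearly. Then $\mathcal J^p$ exists, is unique, and does not depend on the Weyl connection $D^N$ of $(N,c_N)$. Moreover, the following assertions are equivalent: (i) $\mathcal J^p$ is integrable. (ii) $J^p$ is integrable and $(W+A)(X,Y,U,V)=0$ for all $x\in M$, $q\in Q_x$, $X,Y\in p_x$ and $U,V\in q$ (that is, $(W+A)(\Lambda^2_xp,\Lambda^2q)=0$ for all $x\in M$ and $q\in Q_x$). -/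

import Mathlib

open scoped Manifold ContDiff Topology
open Bundle

noncomputable section

namespace Twistor

/-- The standard model space `ℝⁿ`. -/
abbrev Model (n : ℕ) : Type := EuclideanSpace ℝ (Fin n)

/-! ### Metrics, connections, curvature, orientations -/

section OneManifold

variable {n : ℕ} {N : Type*} [TopologicalSpace N] [ChartedSpace (Model n) N]

/-- The tangent space of an `n`-dimensional manifold. -/
abbrev Tan (n : ℕ) {N : Type*} [TopologicalSpace N] [ChartedSpace (Model n) N] (x : N) : Type :=
  TangentSpace (𝓡 n) x

variable [IsManifold (𝓡 n) ∞ N]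

variable (n N) in
/-- Smooth Riemannian metrics on `N`. A conformal structure on `N` is the class of such a metric up
to multiplication by positive smooth functions; below it is always given by a representative. -/
abbrev Metric : Type _ :=
  ContMDiffRiemannianMetric (𝓡 n) ∞ (Model n) (TangentSpace (𝓡 n) : N → Type)

variable (n N) in
/-- Covariant derivatives on the tangent bundle; `D σ x v` is `D_v σ` at `x`. -/
abbrev Connection : Type _ :=
  CovariantDerivative (𝓡 n) (Model n) (TangentSpace (𝓡 n) : N → Type)

/-- `D g = α ⊗ g`. -/
def IsCompatible (g : Metric n N) (α : ∀ x : N, Tan n x →L[ℝ] ℝ) (D : Connection n N) : Prop :=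
  ∀ (σ τ : ∀ x : N, Tan n x) (x : N),
    MDifferentiableAt (𝓡 n) (𝓡 n).tangent (fun y => TotalSpace.mk' (Model n) y (σ y)) x →
    MDifferentiableAt (𝓡 n) (𝓡 n).tangent (fun y => TotalSpace.mk' (Model n) y (τ y)) x →
    ∀ v : Tan n x,
      mvfderiv (𝓡 n) (fun y => g.inner y (σ y) (τ y)) x v =
        α x v * g.inner x (σ x) (τ x) + g.inner x (D σ x v) (τ x) + g.inner x (σ x) (D τ x v)

/-- `D` is a Weyl connection of the conformal structure of `g`: a smooth torsion free connection
preserving the conformal structure. -/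
structure IsWeyl (g : Metric n N) (D : Connection n N) : Prop where
  smooth : D.ContMDiffCovariantDerivative ∞
  torsion_free : D.torsion = 0
  conformal : ∃ α, IsCompatible g α D

/-- `D` is the Levi-Civita connection of `g`. -/
structure IsLeviCivita (g : Metric n N) (D : Connection n N) : Prop where
  smooth : D.ContMDiffCovariantDerivative ∞
  torsion_free : D.torsion = 0
  metric : IsCompatible g (fun _ => 0) D

/-- A (local) vector field extending the tangent vector `v`, smooth near the base point of `v`. -/
def ext {x : N} (v : Tan n x) : ∀ y : N, Tan n y :=
  FiberBundle.extend (E := (TangentSpace (𝓡 n) : N → Type)) (Model n) v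

/-- The covariant derivative of the Levi-Civita connection of `g` (on differentiable fields it is
uniquely determined). -/
def leviCivita (g : Metric n N) : (∀ x : N, Tan n x) → ∀ x : N, Tan n x →L[ℝ] Tan n x :=
  Classical.epsilon fun nab => ∃ D : Connection n N, IsLeviCivita g D ∧ nab = D.toFun

/-- The curvature `R(u,v)w = D_u D_v w - D_v D_u w - D_[u,v] w` at `x`, computed on extensions of
the vectors `u, v, w`. -/
def curvature (D : (∀ x : N, Tan n x) → ∀ x : N, Tan n x →L[ℝ] Tan n x) (x : N)
    (u v w : Tan n x) : Tan n x :=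
  D (fun y => D (ext w) y (ext v y)) x u - D (fun y => D (ext w) y (ext u y)) x v
    - D (ext w) x (VectorField.mlieBracket (𝓡 n) (ext u) (ext v) x)

/-- The `i`-th vector of the coordinate basis of `T_x N = ℝⁿ`. -/
def coord (x : N) (i : Fin n) : Tan n x := (EuclideanSpace.single i (1 : ℝ) : Model n)

/-- The Ricci tensor `Ric(v,w)` of `g`, the trace of `u ↦ R(u,v)w`. -/
def ricci (g : Metric n N) (x : N) (v w : Tan n x) : ℝ :=
  ∑ i : Fin n, (show Model n from curvature (leviCivita g) x (coord x i) v w) i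

/-- The scalar curvature of `g`, the trace of the Ricci tensor with respect to `g`. -/
def scalar (g : Metric n N) (x : N) : ℝ :=
  ∑ i : Fin n, ∑ j : Fin n,
    ((Matrix.of fun k l : Fin n => g.inner x (coord x k) (coord x l))⁻¹ : Matrix _ _ ℝ) i j *
      ricci g x (coord x i) (coord x j)

/-- The Schouten tensor of `g` (in dimension at least three). -/
def schouten (g : Metric n N) (x : N) (v w : Tan n x) : ℝ :=
  (ricci g x v w - scalar g x / (2 * ((n : ℝ) - 1)) * g.inner x v w) / ((n : ℝ) - 2)

/-- The Weyl tensor `W(u,v,w,t)` as a form of type `(0,4)`. It rescales as `g` does under a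
conformal change of `g`. The sign is that for which `W(u,v,w,t) = - g(R(u,v)w,t)` if `g` is Ricci
flat, where `R(u,v) = [∇_u, ∇_v] - ∇_[u,v]`. -/
def weyl (g : Metric n N) (x : N) (u v w t : Tan n x) : ℝ :=
  if n ≤ 2 then 0 else
    -(g.inner x (curvature (leviCivita g) x u v w) t
      - schouten g x v w * g.inner x u t + schouten g x u w * g.inner x v t
      - g.inner x v w * schouten g x u t + g.inner x u w * schouten g x v t)

/-- A choice `o` of orientations of the tangent spaces of `N` is an orientation of the manifold `N`
if it is locally constant in the local trivializations of the tangent bundle. -/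
def IsOrientation (o : ∀ x : N, Orientation ℝ (Tan n x) (Fin n)) : Prop :=
  ∀ x : N, ∀ᶠ y in 𝓝 x,
    ∀ (hx : x ∈ (trivializationAt (Model n) (TangentSpace (𝓡 n) : N → Type) x).baseSet)
      (hy : y ∈ (trivializationAt (Model n) (TangentSpace (𝓡 n) : N → Type) x).baseSet),
      Orientation.map (Fin n)
          ((trivializationAt (Model n) (TangentSpace (𝓡 n) : N → Type) x).linearEquivAt ℝ y hy)
          (o y) =
        Orientation.map (Fin n)
          ((trivializationAt (Model n) (TangentSpace (𝓡 n) : N → Type) x).linearEquivAt ℝ x hx)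
          (o x)

/-- The pull-back by `ψ : P → N` of the connection `D`, applied to a section `U` of `ψ^*(TN)` and a
vector `ξ` tangent to `P` at `p`: if `U = ∑ Uⁱ (Eᵢ ∘ ψ)`, with `Eᵢ` the local frame of `TN` given by
the local trivialization at `ψ p`, then this is `∑ dUⁱ(ξ) Eᵢ + Uⁱ D_{dψ(ξ)} Eᵢ`. -/
def alongDeriv {E : Type*} [NormedAddCommGroup E] [NormedSpace ℝ E] {H : Type*} [TopologicalSpace H]
    (I : ModelWithCorners ℝ E H) {P : Type*} [TopologicalSpace P] [ChartedSpace H P]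
    (D : Connection n N) (ψ : P → N) (U : ∀ p : P, Tan n (ψ p)) (p : P) (ξ : TangentSpace I p) :
    Tan n (ψ p) :=
  (trivializationAt (Model n) (TangentSpace (𝓡 n) : N → Type) (ψ p)).symm (ψ p)
      (mvfderiv I (fun q => (trivializationAt (Model n) (TangentSpace (𝓡 n) : N → Type) (ψ p)
        ⟨ψ q, U q⟩).2) p ξ)
    + D (ext (U p)) (ψ p) (mfderiv I (𝓡 n) ψ p ξ)

end OneManifold

/-! ### Complex distributions and almost complex structures

Complex tangent vectors `ξ + iη` are pairs `(ξ, η)` of real tangent vectors, and complex vector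
fields are pairs of real vector fields. -/

section Distributions

variable {E : Type*} [NormedAddCommGroup E] [NormedSpace ℝ E] {H : Type*} [TopologicalSpace H]
  (I : ModelWithCorners ℝ E H) {P : Type*} [TopologicalSpace P] [ChartedSpace H P]
  [IsManifold I ∞ P]

/-- `X` is a smooth vector field on `P`. -/
def IsSmoothField (X : ∀ z : P, TangentSpace I z) : Prop :=
  ContMDiff I I.tangent ∞ fun z => (TotalSpace.mk' E z (X z) : TangentBundle I P)

/-- Let `S` be a closed submanifold of `P` and let `F` be a complex distribution on `S`, that is,
`F z` is a space of complex vectors tangent to `S` at `z`, for `z ∈ S`. Then `F` is integrable if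
the bracket of any two sections of `F` is a section of `F`. Vector fields on `S` are given as
restrictions of vector fields on `P`. -/
def IsInvolutive (S : Set P) (F : ∀ z : P, Set (TangentSpace I z × TangentSpace I z)) : Prop :=
  ∀ X₁ X₂ Y₁ Y₂ : ∀ z : P, TangentSpace I z,
    IsSmoothField I X₁ → IsSmoothField I X₂ → IsSmoothField I Y₁ → IsSmoothField I Y₂ →
    (∀ z ∈ S, (X₁ z, X₂ z) ∈ F z) → (∀ z ∈ S, (Y₁ z, Y₂ z) ∈ F z) →
    ∀ z ∈ S,
      (VectorField.mlieBracket I X₁ Y₁ z - VectorField.mlieBracket I X₂ Y₂ z,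
        VectorField.mlieBracket I X₁ Y₂ z + VectorField.mlieBracket I X₂ Y₁ z) ∈ F z

/-- The tangent space at `z` of a submanifold `S` of `P`, spanned by the velocities at `z` of the
smooth curves contained in `S`. -/
def tangentTo (S : Set P) (z : P) : Submodule ℝ (TangentSpace I z) :=
  Submodule.span ℝ {ξ | ∃ γ : ℝ → P, ContMDiff 𝓘(ℝ, ℝ) I ∞ γ ∧ (∀ t, γ t ∈ S) ∧
    ∃ h : γ 0 = z, h ▸ (mfderiv 𝓘(ℝ, ℝ) I γ 0 (1 : ℝ)) = ξ}

/-- Almost complex structures on a closed submanifold `S` of `P`. -/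
structure AlmostComplex (S : Set P) where
  /-- The endomorphism of the tangent space. -/
  toFun : ∀ z : S, tangentTo I S z.1 →ₗ[ℝ] tangentTo I S z.1
  sq : ∀ (z : S) (ξ : tangentTo I S z.1), toFun z (toFun z ξ) = -ξ
  smooth : ∀ X : ∀ z : P, TangentSpace I z, IsSmoothField I X →
    ∀ hX : ∀ z : S, X z.1 ∈ tangentTo I S z.1,
    ∃ Y : ∀ z : P, TangentSpace I z, IsSmoothField I Y ∧
      ∀ z : S, Y z.1 = (toFun z ⟨X z.1, hX z⟩ : TangentSpace I z.1)

variable {I}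

/-- The eigenbundle of (the complexification of) `J` corresponding to `i`. -/
def AlmostComplex.eigenI {S : Set P} (J : AlmostComplex I S) (z : P) :
    Set (TangentSpace I z × TangentSpace I z) :=
  {ζ | ∃ (hz : z ∈ S) (h₁ : ζ.1 ∈ tangentTo I S z) (h₂ : ζ.2 ∈ tangentTo I S z),
    (J.toFun ⟨z, hz⟩ ⟨ζ.1, h₁⟩ : TangentSpace I z) = -ζ.2 ∧
    (J.toFun ⟨z, hz⟩ ⟨ζ.2, h₂⟩ : TangentSpace I z) = ζ.1}

/-- The eigenbundle of (the complexification of) `J` corresponding to `-i`. -/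
def AlmostComplex.eigenNegI {S : Set P} (J : AlmostComplex I S) (z : P) :
    Set (TangentSpace I z × TangentSpace I z) :=
  {ζ | ∃ (hz : z ∈ S) (h₁ : ζ.1 ∈ tangentTo I S z) (h₂ : ζ.2 ∈ tangentTo I S z),
    (J.toFun ⟨z, hz⟩ ⟨ζ.1, h₁⟩ : TangentSpace I z) = ζ.2 ∧
    (J.toFun ⟨z, hz⟩ ⟨ζ.2, h₂⟩ : TangentSpace I z) = -ζ.1}

/-- An almost complex structure is integrable if its `-i` eigenbundle is integrable. -/
def AlmostComplex.IsIntegrable {S : Set P} (J : AlmostComplex I S) : Prop :=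
  IsInvolutive I S J.eigenNegI

end Distributions

/-! ### Positive maximal isotropic spaces

A positive maximal isotropic space is given by the positive orthogonal complex structure `K` of
which it is the eigenspace corresponding to `-i`; so the space is `{u + iKu}`. -/

section Submanifold

variable {m k : ℕ}
  {M : Type*} [TopologicalSpace M] [ChartedSpace (Model (m * 2)) M] [IsManifold (𝓡 (m * 2)) ∞ M]
  {N : Type*} [TopologicalSpace N] [ChartedSpace (Model (m * 2 + k * 2)) N]
  [IsManifold (𝓡 (m * 2 + k * 2)) ∞ N]

/-- `p` is a (smooth) section of the bundle `Q_M` of positive maximal isotropic spaces on `M`, given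
by the positive orthogonal almost complex structure `J`. -/
structure IsSectionQM (g : Metric (m * 2) M)
    (o : ∀ x : M, Orientation ℝ (Tan (m * 2) x) (Fin (m * 2)))
    (J : ∀ x : M, Tan (m * 2) x →L[ℝ] Tan (m * 2) x) : Prop where
  smooth : ContMDiff (𝓡 (m * 2)) ((𝓡 (m * 2)).prod 𝓘(ℝ, Model (m * 2) →L[ℝ] Model (m * 2))) ∞
    fun x => TotalSpace.mk' (Model (m * 2) →L[ℝ] Model (m * 2))
      (E := fun x : M => Tan (m * 2) x →L[ℝ] Tan (m * 2) x) x (J x)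
  sq : ∀ (x : M) (v : Tan (m * 2) x), J x (J x v) = -v
  orthogonal : ∀ (x : M) (v w : Tan (m * 2) x), g.inner x (J x v) (J x w) = g.inner x v w
  positive : ∀ x : M, ∃ b : Module.Basis (Fin (m * 2)) ℝ (Tan (m * 2) x), b.orientation = o x ∧
    ∀ i : Fin m, b (finProdFinEquiv (i, 1)) = J x (b (finProdFinEquiv (i, 0)))

/-- The `-i` eigenbundle `p` of `J`. -/
def eigenNegI (J : ∀ x : M, Tan (m * 2) x →L[ℝ] Tan (m * 2) x) (x : M) :
    Set (Tan (m * 2) x × Tan (m * 2) x) :=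
  {ζ | J x ζ.1 = ζ.2 ∧ J x ζ.2 = -ζ.1}

/-- The `i` eigenbundle of `J`, the conjugate of `p`. -/
def eigenPosI (J : ∀ x : M, Tan (m * 2) x →L[ℝ] Tan (m * 2) x) (x : M) :
    Set (Tan (m * 2) x × Tan (m * 2) x) :=
  {ζ | J x ζ.1 = -ζ.2 ∧ J x ζ.2 = ζ.1}

variable (φ : C^∞⟮𝓡 (m * 2), M; 𝓡 (m * 2 + k * 2), N⟯)

/-- The differential of `φ`. -/
abbrev dif (x : M) : Tan (m * 2) x →L[ℝ] Tan (m * 2 + k * 2) (φ x) :=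
  mfderiv (𝓡 (m * 2)) (𝓡 (m * 2 + k * 2)) φ x

/-- The normal space `(T_x M)^⊥`. -/
def normal (g : Metric (m * 2 + k * 2) N) (x : M) :
    Submodule ℝ (Tan (m * 2 + k * 2) (φ x)) where
  carrier := {u | ∀ v : Tan (m * 2) x, g.inner (φ x) (dif φ x v) u = 0}
  add_mem' ha hb v := by simp [ha v, hb v]
  zero_mem' v := by simp
  smul_mem' c u hu v := by simp [hu v]

instance (x : M) : AddCommGroup ((φ *ᵖ (TangentSpace (𝓡 (m * 2 + k * 2)) : N → Type)) x) :=
  inferInstanceAs (AddCommGroup (TangentSpace (𝓡 (m * 2 + k * 2)) (φ x)))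

instance (x : M) :
    IsTopologicalAddGroup ((φ *ᵖ (TangentSpace (𝓡 (m * 2 + k * 2)) : N → Type)) x) :=
  inferInstanceAs (IsTopologicalAddGroup (TangentSpace (𝓡 (m * 2 + k * 2)) (φ x)))

instance (x : M) : ContinuousSMul ℝ ((φ *ᵖ (TangentSpace (𝓡 (m * 2 + k * 2)) : N → Type)) x) :=
  inferInstanceAs (ContinuousSMul ℝ (TangentSpace (𝓡 (m * 2 + k * 2)) (φ x)))

/-- The fibre at `x` of the bundle of endomorphisms of the pull-back of `TN` by `φ`. -/
abbrev EndFibre (x : M) : Type :=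
  (φ *ᵖ (TangentSpace (𝓡 (m * 2 + k * 2)) : N → Type)) x →L[ℝ]
    (φ *ᵖ (TangentSpace (𝓡 (m * 2 + k * 2)) : N → Type)) x

/-- The model fibre of the bundle of endomorphisms of the pull-back of `TN`. -/
abbrev EndModel (m k : ℕ) : Type := Model (m * 2 + k * 2) →L[ℝ] Model (m * 2 + k * 2)

/-- The total space of the bundle of endomorphisms of the pull-back of `TN` by `φ`. -/
abbrev EndTotal : Type _ := TotalSpace (EndModel m k) (EndFibre φ)

/-- The model with corners of `EndTotal φ`. -/
abbrev EndI (m k : ℕ) := (𝓡 (m * 2)).prod 𝓘(ℝ, EndModel m k)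

/-- An endomorphism in the pull-back of `TN`, as a map of the tangent space. -/
def act (z : EndTotal φ) (u : Tan (m * 2 + k * 2) (φ z.proj)) : Tan (m * 2 + k * 2) (φ z.proj) :=
  z.2 u


/-- The bundle `Q` of positive maximal isotropic spaces on `((TM)^⊥, g|)`, as a closed submanifold of
`EndTotal φ`: a positive orthogonal complex structure `K` on the normal space is extended by zero on
the tangent space. The normal space is oriented in such a way that `TN|_M = TM ⊕ (TM)^⊥` preserves
orientations, that is, a positive basis of `T_x M` followed by a positive basis of the normal space
is a positive basis of `T_{φ(x)} N`. -/
structure IsPositiveNormal (g : Metric (m * 2 + k * 2) N)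
    (oM : ∀ x : M, Orientation ℝ (Tan (m * 2) x) (Fin (m * 2)))
    (oN : ∀ y : N, Orientation ℝ (Tan (m * 2 + k * 2) y) (Fin (m * 2 + k * 2)))
    (z : EndTotal φ) : Prop where
  tangent : ∀ v : Tan (m * 2) z.proj, act φ z (dif φ z.proj v) = 0
  normal_mem : ∀ u ∈ normal φ g z.proj, act φ z u ∈ normal φ g z.proj
  sq : ∀ u ∈ normal φ g z.proj, act φ z (act φ z u) = -u
  orthogonal : ∀ u ∈ normal φ g z.proj, ∀ v ∈ normal φ g z.proj,
    g.inner (φ z.proj) (act φ z u) (act φ z v) = g.inner (φ z.proj) u v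
  positive : ∃ (b : Module.Basis (Fin (m * 2)) ℝ (Tan (m * 2) z.proj))
    (c : Module.Basis (Fin (m * 2 + k * 2)) ℝ (Tan (m * 2 + k * 2) (φ z.proj))),
    b.orientation = oM z.proj ∧ c.orientation = oN (φ z.proj) ∧
    (∀ i : Fin (m * 2), c (Fin.castAdd (k * 2) i) = dif φ z.proj (b i)) ∧
    (∀ j : Fin (k * 2), c (Fin.natAdd (m * 2) j) ∈ normal φ g z.proj) ∧
    ∀ j : Fin k, c (Fin.natAdd (m * 2) (finProdFinEquiv (j, 1))) =
      act φ z (c (Fin.natAdd (m * 2) (finProdFinEquiv (j, 0))))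

/-- The total space of the bundle `Q`. -/
def normalTwistor (g : Metric (m * 2 + k * 2) N)
    (oM : ∀ x : M, Orientation ℝ (Tan (m * 2) x) (Fin (m * 2)))
    (oN : ∀ y : N, Orientation ℝ (Tan (m * 2 + k * 2) y) (Fin (m * 2 + k * 2))) :
    Set (EndTotal φ) :=
  {z | IsPositiveNormal φ g oM oN z}

/-- The space `q = {u + iKu}` of complex normal vectors given by `z = (x, K)` in `Q`. -/
def isotropicSpace (g : Metric (m * 2 + k * 2) N) (z : EndTotal φ) :
    Set (Tan (m * 2 + k * 2) (φ z.proj) × Tan (m * 2 + k * 2) (φ z.proj)) :=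
  {ζ | ζ.1 ∈ normal φ g z.proj ∧ ζ.2 = act φ z ζ.1}

/-- The differential of the projection `EndTotal φ → M`. -/
abbrev difProj (z : EndTotal φ) : TangentSpace (EndI m k) z →L[ℝ] Tan (m * 2) z.proj :=
  mfderiv (EndI m k) (𝓡 (m * 2)) (TotalSpace.proj : EndTotal φ → M) z

/-- The covariant derivative, with respect to `ξ` tangent to `EndTotal φ` at `z = (x, K)`, of the
tautological endomorphism, the connection being the one induced on endomorphisms of the normal
bundle by the orthogonal projection `Π ∘ D` of `D`; it is given as the bilinear form
`(u, v) ↦ g((∇_ξ K) u, v)` on the normal space. As `v` is normal, it suffices to pair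
`D_ξ (K U) - K (D_ξ U)` with `v`, where `U` is an extension of `u`. On vectors tangent to `Q` this
is the projection to the tangent space of the fibre given by the connection induced by `Π ∘ D`
on `Q`. -/
def vertical (g : Metric (m * 2 + k * 2) N) (D : Connection (m * 2 + k * 2) N) (z : EndTotal φ)
    (ξ : TangentSpace (EndI m k) z) (u v : Tan (m * 2 + k * 2) (φ z.proj)) : ℝ :=
  g.inner (φ z.proj)
    (alongDeriv (EndI m k) D (fun z' : EndTotal φ => φ z'.proj)
        (fun z' => act φ z' (ext u (φ z'.proj))) z ξ
      - act φ z (D (ext u) (φ z.proj) (dif φ z.proj (difProj φ z ξ)))) v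

section Distribution

variable (g : Metric (m * 2 + k * 2) N)
  (oM : ∀ x : M, Orientation ℝ (Tan (m * 2) x) (Fin (m * 2)))
  (oN : ∀ y : N, Orientation ℝ (Tan (m * 2 + k * 2) y) (Fin (m * 2 + k * 2)))
  (J : ∀ x : M, Tan (m * 2) x →L[ℝ] Tan (m * 2) x) (D : Connection (m * 2 + k * 2) N)

/-- The complex vectors tangent to `Q` at `z` which are horizontal with respect to the connection
induced by `Π ∘ D` on `Q` and which are projected into the conjugate of `p`. -/
def horizontalPart (z : EndTotal φ) :
    Set (TangentSpace (EndI m k) z × TangentSpace (EndI m k) z) :=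
  {ζ | ζ.1 ∈ tangentTo (EndI m k) (normalTwistor φ g oM oN) z ∧
    ζ.2 ∈ tangentTo (EndI m k) (normalTwistor φ g oM oN) z ∧
    (∀ u ∈ normal φ g z.proj, ∀ v ∈ normal φ g z.proj,
      vertical φ g D z ζ.1 u v = 0 ∧ vertical φ g D z ζ.2 u v = 0) ∧
    (difProj φ z ζ.1, difProj φ z ζ.2) ∈ eigenPosI J z.proj}

/-- The vectors of type `(0,1)` tangent at `z = (x, K)` to the fibre of `Q`. The fibre is a complex
submanifold of the Grassmannian by `K ↦ q = {u + iKu}`, and `T_q Gr = Hom(q, V / q)`, `V` being the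
complexified normal space. A vertical vector `ξ`, with `B = ∇_ξ K`, is mapped to
`u + iKu ↦ iBu mod q`, so `ξ₁ + iξ₂` is of type `(0,1)` if and only if `B₁ u + i B₂ u` is in `q`, that
is `B₂ u = K B₁ u`, for any normal `u`; here this is paired with a normal vector `v`. -/
def verticalPart (z : EndTotal φ) :
    Set (TangentSpace (EndI m k) z × TangentSpace (EndI m k) z) :=
  {ζ | ζ.1 ∈ tangentTo (EndI m k) (normalTwistor φ g oM oN) z ∧
    ζ.2 ∈ tangentTo (EndI m k) (normalTwistor φ g oM oN) z ∧
    difProj φ z ζ.1 = 0 ∧ difProj φ z ζ.2 = 0 ∧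
    ∀ u ∈ normal φ g z.proj, ∀ v ∈ normal φ g z.proj,
      vertical φ g D z ζ.2 u v = -vertical φ g D z ζ.1 u (act φ z v)}

/-- The complex distribution on `Q` which is the sum of the two preceding ones. -/
def twistorDistribution (z : EndTotal φ) :
    Set (TangentSpace (EndI m k) z × TangentSpace (EndI m k) z) :=
  {ζ | z ∈ normalTwistor φ g oM oN ∧ ∃ ζ₀ ∈ horizontalPart φ g oM oN J D z,
    ∃ ζ₁ ∈ verticalPart φ g oM oN D z, ζ = ζ₀ + ζ₁}

/-- `𝒥` is the almost complex structure `𝒥^p` on `Q` constructed with the Weyl connection `D`: its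
eigenbundle corresponding to `i` is `twistorDistribution`. -/
def IsTwistorStructure (𝒥 : AlmostComplex (EndI m k) (normalTwistor φ g oM oN)) : Prop :=
  ∀ z : EndTotal φ, 𝒥.eigenI z = twistorDistribution φ g oM oN J D z

end Distribution

/-- `Z` is an orthonormal frame of `T_x M` with respect to the metric induced by `g`, that is, the
value at `x` of a conformal frame for the conformal structure induced on `M`. -/
def IsFrame (g : Metric (m * 2 + k * 2) N) (x : M) (Z : Fin (m * 2) → Tan (m * 2) x) : Prop :=
  ∀ a b, g.inner (φ x) (dif φ x (Z a)) (dif φ x (Z b)) = if a = b then 1 else 0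

/-- The tensor `A(X,Y,U,V)`, for `X, Y` tangent and `U, V` normal to `M` at `x`, computed with the
frame `Z` at `x`. As `U` and `V` are normal, the frame may be extended arbitrarily near `x`. -/
def termA (g : Metric (m * 2 + k * 2) N) (D : Connection (m * 2 + k * 2) N) (x : M)
    (Z : Fin (m * 2) → Tan (m * 2) x) (X Y : Tan (m * 2) x) (U V : Tan (m * 2 + k * 2) (φ x)) : ℝ :=
  ∑ a : Fin (m * 2),
    (g.inner (φ x) (alongDeriv (𝓡 (m * 2)) D φ (fun y => dif φ y (ext (Z a) y)) x X) U *
        g.inner (φ x) (alongDeriv (𝓡 (m * 2)) D φ (fun y => dif φ y (ext (Z a) y)) x Y) V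
      - g.inner (φ x) (alongDeriv (𝓡 (m * 2)) D φ (fun y => dif φ y (ext (Z a) y)) x Y) U *
        g.inner (φ x) (alongDeriv (𝓡 (m * 2)) D φ (fun y => dif φ y (ext (Z a) y)) x X) V)

/-- `W + A` on two tangent and two normal vectors. -/
def weylPlusA (g : Metric (m * 2 + k * 2) N) (D : Connection (m * 2 + k * 2) N) (x : M)
    (Z : Fin (m * 2) → Tan (m * 2) x) (X Y : Tan (m * 2) x) (U V : Tan (m * 2 + k * 2) (φ x)) : ℝ :=
  weyl g (φ x) (dif φ x X) (dif φ x Y) U V + termA φ g D x Z X Y U V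

end Submanifold

/-- The complex multilinear extension of a real multilinear map, evaluated at the complex vectors
`a.1 + i a.2`, `b.1 + i b.2`, `c.1 + i c.2`, `d.1 + i d.2`. -/
def extC {V U : Type*} (T : V → V → U → U → ℝ) (a b : V × V) (c d : U × U) : ℂ :=
  ∑ i : Fin 2, ∑ j : Fin 2, ∑ r : Fin 2, ∑ s : Fin 2,
    Complex.I ^ (i.val + j.val + r.val + s.val) *
      (T (![a.1, a.2] i) (![b.1, b.2] j) (![c.1, c.2] r) (![d.1, d.2] s) : ℂ)

end Twistor

end

open Twistor

noncomputable section

set_option linter.unusedSectionVars false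

namespace Twistor

/-! Write a point of Q as (x, K), with K a positive orthogonal complex structure of the normal
space, and let R be the curvature of the normal connection Π ∘ D. The structure to be constructed
acts as J on horizontal vectors and as B ↦ -K B on vertical ones. Its +i eigenbundle determines it,
which gives uniqueness (`AlmostComplex.ext_eigenI`). Two Weyl connections of one conformal class
differ by an expression in a one-form β. On a normal bundle its only effect is to add a multiple of
the identity to the connection, which commutes with K and so does not change ∇K
(`vertical_eq_of_isWeyl`). Hence the structure may be built with the Levi-Civita connection of the
representative, which is itself obtained by correcting the given Weyl connection
(`exists_isLeviCivita`).

Integrability is the vanishing of the Nijenhuis tensor, computed in `nijenhuis_cs`. Its horizontal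
part is the Nijenhuis tensor of J. Its vertical part is -([Im, K] + K [Re, K]), where Re + i Im is
the curvature R on X + iJX and Y + iJY. Paired with normal vectors, this says that R vanishes on Λ²p
and on Λ² of the conjugate of q (`g_comm_eq_obstruction`).

Two facts turn this into condition (ii). By the Ricci equation (`LocalImmersion.g_curv_normal`) the
curvature R is the ambient curvature minus A. The Schouten terms of the ambient curvature all
contain a product of a tangent and a normal vector, so on these arguments R = -(W + A)
(`g_curv_eq`). Moreover conjugate spaces may be exchanged with the spaces themselves
(`switch_condition`): for orthonormal u, v with Ku orthogonal to v, changing the sign of K on the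
complex plane spanned by u and v changes it on a space of even complex dimension, so the result is
again positive. A two-plane in the conjugate of q therefore lies in another positive isotropic space
q'. The condition is imposed on all q in the fibre, so the two versions are equivalent.

The computations are made in a local model: an open set U of E, a fixed vector space V and Q as a
subset of E × End V. The set Q is cut out by equations and positivity; its tangent spaces, spanned
by velocities of curves, are shown to be exactly the solutions of the linearized equations
(`AdaptedGeometry.mem_curveTan_iff`). In order to work with endomorphisms of all of V, the normal
connection is extended to D + (2Π - 1) DΠ, which is metric and preserves Π. The structure `loc`
carries the manifold situation to the model by charts, and vector fields are glued by partitions of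
unity. -/

/-! ### Square roots near the identity and nondegenerate forms. -/

/-- Inverse function theorem for squaring at 1, where the derivative is multiplication by 2. The
last conclusion is the local uniqueness of the root, through which a root inherits the symmetries of
its square. -/
theorem exists_local_sqrt (A : Type*) [NormedRing A] [NormedAlgebra ℝ A] [CompleteSpace A] :
    ∃ r : A → A, r 1 = 1 ∧ (∀ᶠ H in 𝓝 (1 : A), ContDiffAt ℝ ∞ r H ∧ r H * r H = H) ∧
      ∀ᶠ H in 𝓝 (1 : A), r (H * H) = H := by
  have hf : ContDiffAt ℝ ω (fun x : A => x * x) 1 := contDiffAt_id.mul contDiffAt_id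
  let e : A ≃L[ℝ] A := ContinuousLinearEquiv.smulLeft (Units.mk0 (2 : ℝ) two_ne_zero)
  have hf' : HasFDerivAt (fun x : A => x * x) (e : A →L[ℝ] A) 1 := by
    have h := (hasFDerivAt_id (𝕜 := ℝ) (1 : A)).mul' (hasFDerivAt_id (𝕜 := ℝ) (1 : A))
    refine h.congr_fderiv ?_
    ext x
    simp [e, two_smul, Units.smul_def]
  have hs : HasStrictFDerivAt (fun x : A => x * x) (e : A →L[ℝ] A) 1 :=
    hf.hasStrictFDerivAt' hf' (by simp)
  have h1 : hs.localInverse (fun x : A => x * x) e 1 1 = 1 := by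
    have := hs.localInverse_apply_image
    simpa using this
  refine ⟨hs.localInverse _ _ _, h1, ?_, ?_⟩
  · have h2 : ContDiffAt ℝ ω (hs.localInverse (fun x : A => x * x) e 1) ((1 : A) * 1) :=
      hf.to_localInverse hf' (by simp)
    rw [mul_one] at h2
    have h3 := hs.eventually_right_inverse
    rw [mul_one] at h3
    filter_upwards [h2.eventually (by simp), h3] with H h4 h5
    exact ⟨h4.of_le (by exact_mod_cast le_top), h5⟩
  · exact hs.eventually_left_inverse

section Forms
variable {V : Type*} [NormedAddCommGroup V] [NormedSpace ℝ V] [FiniteDimensional ℝ V]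

theorem isInvertible_of_pos (b : V →L[ℝ] V →L[ℝ] ℝ) (hb : ∀ u, u ≠ 0 → 0 < b u u) :
    b.IsInvertible := by
  have hinj : Function.Injective b.toLinearMap := by
    rw [← LinearMap.ker_eq_bot, LinearMap.ker_eq_bot']
    intro u hu
    by_contra h
    have := hb u h
    have h2 : b u = 0 := hu
    simp [h2] at this
  have hfin : Module.finrank ℝ V = Module.finrank ℝ (V →L[ℝ] ℝ) := by
    rw [← (LinearMap.toContinuousLinearMap (𝕜 := ℝ) (E := V) (F' := ℝ)).finrank_eq]
    exact (Subspace.dual_finrank_eq (K := ℝ) (V := V)).symm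
  let e := LinearEquiv.ofInjectiveOfFinrankEq b.toLinearMap hinj hfin
  refine ⟨e.toContinuousLinearEquiv, ?_⟩
  ext u v
  rfl

theorem form_inverse_apply {b : V →L[ℝ] V →L[ℝ] ℝ} (hb : b.IsInvertible) (a : V →L[ℝ] ℝ) :
    b (b.inverse a) = a := by
  obtain ⟨e, rfl⟩ := hb
  simp

theorem inverse_form_apply {b : V →L[ℝ] V →L[ℝ] ℝ} (hb : b.IsInvertible) (u : V) :
    b.inverse (b u) = u := by
  obtain ⟨e, rfl⟩ := hb
  simp

theorem form_ext {b : V →L[ℝ] V →L[ℝ] ℝ} (hb : b.IsInvertible) {u v : V}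
    (h : ∀ w, b u w = b v w) : u = v := by
  rw [← inverse_form_apply hb u, ← inverse_form_apply hb v]
  congr 1
  ext w
  exact h w

end Forms

/-! ### The local model of the twistor bundle and its local isometries. -/

/-- A Euclidean vector bundle `V` on an open set `U` of `E`, with a metric connection `Γ` preserving
the decomposition given by the orthogonal projection `pr`, and an almost complex structure `J`
on `U`. -/
structure AdaptedGeometry (E V : Type*) [NormedAddCommGroup E] [NormedSpace ℝ E]
    [NormedAddCommGroup V] [NormedSpace ℝ V] where
  U : Set E
  isOpen : IsOpen U
  g : E → V →L[ℝ] V →L[ℝ] ℝ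
  pr : E → V →L[ℝ] V
  Γ : E → E →L[ℝ] V →L[ℝ] V
  J : E → E →L[ℝ] E
  Pos : E → (V →L[ℝ] V) → Prop
  contDiff_g : ContDiffOn ℝ ∞ g U
  contDiff_pr : ContDiffOn ℝ ∞ pr U
  contDiff_Γ : ContDiffOn ℝ ∞ Γ U
  contDiff_J : ContDiffOn ℝ ∞ J U
  g_symm : ∀ y ∈ U, ∀ u v, g y u v = g y v u
  g_pos : ∀ y ∈ U, ∀ u, u ≠ 0 → 0 < g y u u
  pr_idem : ∀ y ∈ U, pr y * pr y = pr y
  pr_adj : ∀ y ∈ U, ∀ u v, g y (pr y u) v = g y u (pr y v)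
  compat : ∀ y ∈ U, ∀ X u v, fderiv ℝ g y X u v = g y (Γ y X u) v + g y u (Γ y X v)
  pr_par : ∀ y ∈ U, ∀ X, fderiv ℝ pr y X + (Γ y X * pr y - pr y * Γ y X) = 0
  J_sq : ∀ y ∈ U, ∀ X, J y (J y X) = -X
  -- The only property of positivity used by the local theory: it survives conjugation by maps close
  -- to the identity which respect the projections.
  pos_transport : ∀ (c : ℝ → E) (T : ℝ → V →L[ℝ] V), ContinuousAt c 0 → ContinuousAt T 0 →
    c 0 ∈ U → T 0 = 1 → (∀ᶠ t in 𝓝 0, T t * pr (c 0) = pr (c t) * T t) →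
    ∀ K, Pos (c 0) K → ∀ᶠ t in 𝓝 0, Pos (c t) (T t * K * Ring.inverse (T t))

namespace AdaptedGeometry

variable {E V : Type*} [NormedAddCommGroup E] [NormedSpace ℝ E]
    [NormedAddCommGroup V] [NormedSpace ℝ V] (G : AdaptedGeometry E V)

/-- The local form of the twistor bundle. -/
def Q : Set (E × (V →L[ℝ] V)) :=
  {p | p.1 ∈ G.U ∧ G.pr p.1 * p.2 = p.2 ∧ p.2 * G.pr p.1 = p.2 ∧ p.2 * p.2 = -G.pr p.1 ∧
    (∀ u v, G.g p.1 (p.2 u) v = -G.g p.1 u (p.2 v)) ∧ G.Pos p.1 p.2}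

/-- The covariant derivative of the tautological endomorphism. -/
def cov (p : E × (V →L[ℝ] V)) (ξ : E × (V →L[ℝ] V)) : V →L[ℝ] V :=
  ξ.2 + (G.Γ p.1 ξ.1 * p.2 - p.2 * G.Γ p.1 ξ.1)

/-- The tangent spaces of the twistor bundle. -/
def IsTan (p : E × (V →L[ℝ] V)) (ξ : E × (V →L[ℝ] V)) : Prop :=
  G.pr p.1 * G.cov p ξ = G.cov p ξ ∧ G.cov p ξ * G.pr p.1 = G.cov p ξ ∧
    p.2 * G.cov p ξ + G.cov p ξ * p.2 = 0 ∧
    ∀ u v, G.g p.1 (G.cov p ξ u) v = -G.g p.1 u (G.cov p ξ v)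

variable [FiniteDimensional ℝ E] [FiniteDimensional ℝ V]

theorem isInvertible_g {y : E} (hy : y ∈ G.U) : (G.g y).IsInvertible :=
  isInvertible_of_pos _ (G.g_pos y hy)

/-- Local isometries of the bundle preserving the decomposition. -/
theorem exists_isometry {y₀ : E} (hy₀ : y₀ ∈ G.U) :
    ∃ T : E → V →L[ℝ] V, T y₀ = 1 ∧ ∀ᶠ y in 𝓝 y₀, ContDiffAt ℝ ∞ T y ∧
      T y * G.pr y₀ = G.pr y * T y ∧ (∀ u v, G.g y (T y u) (T y v) = G.g y₀ u v) ∧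
      IsUnit (T y) := by
  obtain ⟨r, hr1, hr, hrl⟩ := exists_local_sqrt (V →L[ℝ] V)
  have hU : ∀ᶠ y in 𝓝 y₀, y ∈ G.U := G.isOpen.mem_nhds hy₀
  have hcd {F : Type _} [NormedAddCommGroup F] [NormedSpace ℝ F] {h : E → F}
      (hh : ContDiffOn ℝ ∞ h G.U) {y : E} (hy : y ∈ G.U) : ContDiffAt ℝ ∞ h y :=
    hh.contDiffAt (G.isOpen.mem_nhds hy)
  -- A maps the image and the kernel of `pr y₀` to those of `pr y`, and is the identity at y₀. It
  -- need not be isometric; this is corrected by polar decomposition.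
  let A : E → V →L[ℝ] V := fun y => G.pr y * G.pr y₀ + (1 - G.pr y) * (1 - G.pr y₀)
  have hA : ∀ y ∈ G.U, ContDiffAt ℝ ∞ A y := fun y hy =>
    ((hcd G.contDiff_pr hy).mul contDiffAt_const).add
      ((contDiffAt_const.sub (hcd G.contDiff_pr hy)).mul contDiffAt_const)
  have hid := G.pr_idem y₀ hy₀
  have hA0 : A y₀ = 1 := by
    simp only [A, hid, sub_mul, mul_sub, one_mul, mul_one]
    abel
  have hApr : ∀ y ∈ G.U, A y * G.pr y₀ = G.pr y * A y := by
    intro y hy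
    have h1 := G.pr_idem y hy
    simp only [A, add_mul, mul_add, sub_mul, mul_sub, one_mul, mul_one, mul_assoc, hid]
    simp only [← mul_assoc, h1]
    abel
  have hinv := G.isInvertible_g hy₀
  -- H is the metric at y pulled back by A, expressed through the metric at y₀. The isometry will be
  -- A H^(-1/2).
  let H : E → V →L[ℝ] V := fun y => (G.g y₀).inverse ∘L
    ((ContinuousLinearMap.compL ℝ V V ℝ).flip (A y) ∘L (G.g y ∘L A y))
  have hH : ∀ y ∈ G.U, ContDiffAt ℝ ∞ H y := fun y hy =>
    contDiffAt_const.clm_comp (((ContinuousLinearMap.contDiff _).contDiffAt.comp y (hA y hy)).clm_comp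
      ((hcd G.contDiff_g hy).clm_comp (hA y hy)))
  have hHg : ∀ y u v, G.g y₀ (H y u) v = G.g y (A y u) (A y v) := by
    intro y u v
    simp only [H, ContinuousLinearMap.comp_apply]
    rw [form_inverse_apply hinv]
    simp
  have hH0 : H y₀ = 1 := by
    ext u
    refine form_ext hinv fun w => ?_
    rw [hHg, hA0]
    rfl
  have hHt : Filter.Tendsto H (𝓝 y₀) (𝓝 1) := by
    have := (hH y₀ hy₀).continuousAt
    rwa [ContinuousAt, hH0] at this
  -- the adjoint
  let adj : (V →L[ℝ] V) → V →L[ℝ] V := fun B => (G.g y₀).inverse ∘L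
    ((ContinuousLinearMap.compL ℝ V V ℝ).flip B ∘L G.g y₀)
  have hadj : ∀ B u v, G.g y₀ (adj B u) v = G.g y₀ u (B v) := by
    intro B u v
    simp only [adj, ContinuousLinearMap.comp_apply]
    rw [form_inverse_apply hinv]
    simp
  have hadjc : Continuous adj := by
    have : ContDiff ℝ 0 adj := contDiff_const.clm_comp
      ((ContinuousLinearMap.contDiff _).clm_comp contDiff_const)
    exact this.continuous
  have hadj1 : adj 1 = 1 := by
    ext u
    refine form_ext hinv fun w => ?_
    rw [hadj]; rfl
  have hadjmul : ∀ B C, adj (B * C) = adj C * adj B := by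
    intro B C
    ext u
    refine form_ext hinv fun w => ?_
    rw [hadj, mul_apply_eq_comp, mul_apply_eq_comp, hadj, hadj]
  have hr1c : Filter.Tendsto r (𝓝 1) (𝓝 1) := by
    have := hr.self_of_nhds.1.continuousAt
    rwa [ContinuousAt, hr1] at this
  -- Reflection in the image of `pr y₀`; an endomorphism commutes with the projection exactly when
  -- conjugation by ρ fixes it.
  let ρ : V →L[ℝ] V := 2 * G.pr y₀ - 1
  have hρ : ρ * ρ = 1 := by
    have : ρ * ρ = 4 * (G.pr y₀ * G.pr y₀) - 4 * G.pr y₀ + 1 := by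
      simp only [ρ]; noncomm_ring
    rw [this, hid]; abel
  -- Near 1 the root is unique. The adjoint of the root of H and its conjugate by ρ are also roots
  -- of H, hence equal to it: the root is self-adjoint and commutes with `pr y₀`.
  have hgood : ∀ᶠ B in 𝓝 (1 : V →L[ℝ] V), r (B * B) = B ∧ r (adj B * adj B) = adj B ∧
      r ((ρ * B * ρ) * (ρ * B * ρ)) = ρ * B * ρ := by
    refine hrl.and (Filter.Eventually.and ?_ ?_)
    · have : Filter.Tendsto adj (𝓝 1) (𝓝 1) := by
        have := hadjc.tendsto 1
        rwa [hadj1] at this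
      exact this.eventually hrl
    · have : Filter.Tendsto (fun B => ρ * B * ρ) (𝓝 1) (𝓝 1) := by
        have h : Continuous fun B => ρ * B * ρ := by fun_prop
        have := h.tendsto 1
        rwa [mul_one, hρ] at this
      exact this.eventually hrl
  have hunit : ∀ᶠ B in 𝓝 (1 : V →L[ℝ] V), IsUnit B :=
    Units.isOpen.mem_nhds isUnit_one
  have hAt : Filter.Tendsto A (𝓝 y₀) (𝓝 1) := by
    have := (hA y₀ hy₀).continuousAt
    rwa [ContinuousAt, hA0] at this
  refine ⟨fun y => A y * Ring.inverse (r (H y)), by simp [hA0, hH0, hr1], ?_⟩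
  filter_upwards [hU, hHt.eventually hr, (hr1c.comp hHt).eventually hgood,
    (hr1c.comp hHt).eventually hunit, hAt.eventually hunit] with y hy h1 h2 h3 hAu
  simp only [Function.comp_apply] at h2 h3
  obtain ⟨h2a, h2b, h2c⟩ := h2
  set R := r (H y) with hR
  obtain ⟨w, hw⟩ := h3
  have hRinv : Ring.inverse R = ↑w⁻¹ := by rw [← hw, Ring.inverse_unit]
  have hRR : R * R = H y := h1.2
  have hselfH : adj (H y) = H y := by
    ext u
    refine form_ext hinv fun v => ?_
    rw [hadj, G.g_symm _ hy₀, hHg, hHg, G.g_symm _ hy]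
  have hself : adj R = R := by
    rw [← hadjmul, hRR, hselfH, ← hR] at h2b
    exact h2b.symm
  have hprH : H y * G.pr y₀ = G.pr y₀ * H y := by
    ext u
    refine form_ext hinv fun v => ?_
    have e1 := DFunLike.congr_fun (hApr y hy)
    simp only [mul_apply_eq_comp] at e1 ⊢
    rw [hHg, G.pr_adj y₀ hy₀, hHg, e1, e1, G.pr_adj y hy]
  have hρH : ρ * H y * ρ = H y := by
    have : ρ * H y = H y * ρ := by
      simp only [ρ, sub_mul, mul_sub, one_mul, mul_one, two_mul, add_mul, mul_add, hprH]
    rw [this, mul_assoc, hρ, mul_one]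
  have hρR : ρ * R * ρ = R := by
    have h : (ρ * R * ρ) * (ρ * R * ρ) = ρ * (R * R) * ρ := by
      calc (ρ * R * ρ) * (ρ * R * ρ) = ρ * R * (ρ * ρ) * R * ρ := by noncomm_ring
        _ = _ := by rw [hρ]; noncomm_ring
    rw [h, hRR, hρH, ← hR] at h2c
    exact h2c.symm
  have hprR : R * G.pr y₀ = G.pr y₀ * R := by
    have h : ρ * R = R * ρ := by
      calc ρ * R = ρ * (ρ * R * ρ) := by rw [hρR]
        _ = (ρ * ρ) * R * ρ := by noncomm_ring
        _ = _ := by rw [hρ, one_mul]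
    simp only [ρ, sub_mul, mul_sub, one_mul, mul_one, two_mul, add_mul, mul_add] at h
    have h' : (2 : ℝ) • (R * G.pr y₀) = (2 : ℝ) • (G.pr y₀ * R) := by
      rw [two_smul, two_smul]
      exact (sub_left_injective h).symm
    exact smul_right_injective _ (two_ne_zero (α := ℝ)) h'
  refine ⟨(hA y hy).mul ?_, ?_, ?_, ?_⟩
  · have h := contDiffAt_ringInverse ℝ w (n := ∞)
    rw [hw, hR] at h
    exact h.comp y (h1.1.comp y (hH y hy))
  · rw [hRinv]
    have : (↑w⁻¹ : V →L[ℝ] V) * G.pr y₀ = G.pr y₀ * ↑w⁻¹ := by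
      rw [Units.inv_mul_eq_iff_eq_mul, ← mul_assoc, hw, hprR, ← hw, mul_assoc, Units.mul_inv,
        mul_one]
    rw [mul_assoc, this, ← mul_assoc, hApr y hy, mul_assoc]
  · intro u v
    rw [hRinv]
    simp only [mul_apply_eq_comp]
    rw [← hHg, ← hRR, mul_apply_eq_comp]
    have e2 : ∀ v, R ((↑w⁻¹ : V →L[ℝ] V) v) = v := by
      intro v
      rw [← hw, ← mul_apply_eq_comp, Units.mul_inv]
      rfl
    rw [e2, ← hself, hadj, e2]
  · rw [hRinv]
    exact hAu.mul w⁻¹.isUnit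

end AdaptedGeometry

/-! ### Tangent spaces spanned by velocities of curves. -/

section Curves
variable {W : Type*} [NormedAddCommGroup W] [NormedSpace ℝ W]

/-- The span of the velocities at `p` of smooth curves in `Q`. -/
def curveTan (Q : Set W) (p : W) : Submodule ℝ W :=
  Submodule.span ℝ {v | ∃ γ : ℝ → W, ContDiff ℝ ∞ γ ∧ (∀ t, γ t ∈ Q) ∧ γ 0 = p ∧ deriv γ 0 = v}

/-- The parameter t is replaced by ε sin(t/ε), which stays in the interval where c is defined and
smooth and has derivative 1 at 0. -/
theorem exists_global_curve {Q : Set W} {c : ℝ → W}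
    (hc : ∀ᶠ t in 𝓝 0, ContDiffAt ℝ ∞ c t ∧ c t ∈ Q) :
    ∃ γ : ℝ → W, ContDiff ℝ ∞ γ ∧ (∀ t, γ t ∈ Q) ∧ γ 0 = c 0 ∧ deriv γ 0 = deriv c 0 := by
  obtain ⟨δ, hδ, h⟩ := Metric.eventually_nhds_iff.1 hc
  let ε := δ / 2
  have hε : 0 < ε := half_pos hδ
  have hs : ∀ t : ℝ, dist (ε * Real.sin (t / ε)) 0 < δ := by
    intro t
    rw [Real.dist_eq, sub_zero, abs_mul, abs_of_pos hε]
    calc ε * |Real.sin (t / ε)| ≤ ε * 1 := by gcongr; exact Real.abs_sin_le_one _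
      _ < δ := by rw [mul_one]; exact half_lt_self hδ
  refine ⟨fun t => c (ε * Real.sin (t / ε)), ?_, fun t => (h (hs t)).2, by simp, ?_⟩
  · rw [contDiff_iff_contDiffAt]
    intro t
    refine (h (hs t)).1.comp t (f := fun t => ε * Real.sin (t / ε)) ?_
    exact (contDiff_const.mul (Real.contDiff_sin.comp (contDiff_id.div_const _))).contDiffAt
  · have h1 : HasDerivAt (fun t : ℝ => ε * Real.sin (t / ε)) 1 0 := by
      have := ((Real.hasDerivAt_sin (0 / ε)).comp (0 : ℝ)
        ((hasDerivAt_id (0 : ℝ)).div_const ε)).const_mul ε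
      simpa [hε.ne'] using this
    have h2 : DifferentiableAt ℝ c (ε * Real.sin (0 / ε)) :=
      (h (hs 0)).1.differentiableAt (by simp)
    have h3 := h2.hasDerivAt.scomp (0 : ℝ) h1
    have := h3.deriv
    simpa [Function.comp_def] using this

theorem mem_curveTan {Q : Set W} {c : ℝ → W} {p v : W}
    (hc : ∀ᶠ t in 𝓝 0, ContDiffAt ℝ ∞ c t ∧ c t ∈ Q) (h0 : c 0 = p) (hv : deriv c 0 = v) :
    v ∈ curveTan Q p := by
  obtain ⟨γ, h1, h2, h3, h4⟩ := exists_global_curve hc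
  exact Submodule.subset_span ⟨γ, h1, h2, h3.trans h0, h4.trans hv⟩

theorem fderiv_eq_zero_of_mem_curveTan {F : Type*} [NormedAddCommGroup F] [NormedSpace ℝ F]
    {Q : Set W} {p v : W} (hv : v ∈ curveTan Q p) {h : W → F} (hd : DifferentiableAt ℝ h p)
    (h0 : ∀ᶠ q in 𝓝 p, q ∈ Q → h q = 0) : fderiv ℝ h p v = 0 := by
  suffices curveTan Q p ≤ LinearMap.ker (fderiv ℝ h p).toLinearMap from this hv
  refine Submodule.span_le.2 ?_
  rintro _ ⟨γ, h1, h2, h3, rfl⟩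
  subst h3
  have hγ : HasDerivAt γ (deriv γ 0) 0 :=
    (h1.contDiffAt.differentiableAt (by simp)).hasDerivAt
  have hc := hd.hasFDerivAt.comp_hasDerivAt (0 : ℝ) hγ
  have hz : (h ∘ γ) =ᶠ[𝓝 0] fun _ => 0 := by
    filter_upwards [hγ.continuousAt.eventually h0] with t ht
    exact ht (h2 t)
  have := hc.deriv
  rw [hz.deriv_eq, deriv_const] at this
  exact this.symm

end Curves

namespace AdaptedGeometry

variable {E V : Type*} [NormedAddCommGroup E] [NormedSpace ℝ E]
    [NormedAddCommGroup V] [NormedSpace ℝ V] (G : AdaptedGeometry E V)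

/-- The equations of the twistor bundle. -/
def constraint₁ (p : E × (V →L[ℝ] V)) : V →L[ℝ] V := G.pr p.1 * p.2 - p.2

/-- An equation of the twistor bundle. -/
def constraint₂ (p : E × (V →L[ℝ] V)) : V →L[ℝ] V := p.2 * G.pr p.1 - p.2

/-- An equation of the twistor bundle. -/
def constraint₃ (p : E × (V →L[ℝ] V)) : V →L[ℝ] V := p.2 * p.2 + G.pr p.1

/-- An equation of the twistor bundle. -/
def constraint₄ (u v : V) (p : E × (V →L[ℝ] V)) : ℝ := G.g p.1 (p.2 u) v + G.g p.1 u (p.2 v)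

theorem constraint_eq_zero {p : E × (V →L[ℝ] V)} (hp : p ∈ G.Q) :
    G.constraint₁ p = 0 ∧ G.constraint₂ p = 0 ∧ G.constraint₃ p = 0 ∧
      ∀ u v, G.constraint₄ u v p = 0 := by
  obtain ⟨h0, h1, h2, h3, h4, -⟩ := hp
  refine ⟨by rw [constraint₁, h1, sub_self], by rw [constraint₂, h2, sub_self],
    by rw [constraint₃, h3, neg_add_cancel], fun u v => by rw [constraint₄, h4, neg_add_cancel]⟩

variable {G}

theorem contDiffAt_comp_fst {F : Type*} [NormedAddCommGroup F] [NormedSpace ℝ F] {h : E → F}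
    (hh : ContDiffOn ℝ ∞ h G.U) {p : E × (V →L[ℝ] V)} (hp : p.1 ∈ G.U) :
    ContDiffAt ℝ ∞ (fun q : E × (V →L[ℝ] V) => h q.1) p :=
  (hh.contDiffAt (G.isOpen.mem_nhds hp)).comp p contDiffAt_fst

theorem hasFDerivAt_comp_fst {F : Type*} [NormedAddCommGroup F] [NormedSpace ℝ F] {h : E → F}
    (hh : ContDiffOn ℝ ∞ h G.U) {p : E × (V →L[ℝ] V)} (hp : p.1 ∈ G.U) :
    HasFDerivAt (fun q : E × (V →L[ℝ] V) => h q.1)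
      ((fderiv ℝ h p.1) ∘L ContinuousLinearMap.fst ℝ E (V →L[ℝ] V)) p :=
  ((hh.contDiffAt (G.isOpen.mem_nhds hp)).differentiableAt (by simp)).hasFDerivAt.comp p
    hasFDerivAt_fst

variable (G)

theorem contDiffAt_constraint {p : E × (V →L[ℝ] V)} (hp : p.1 ∈ G.U) :
    ContDiffAt ℝ ∞ G.constraint₁ p ∧ ContDiffAt ℝ ∞ G.constraint₂ p ∧
      ContDiffAt ℝ ∞ G.constraint₃ p ∧ ∀ u v, ContDiffAt ℝ ∞ (G.constraint₄ u v) p := by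
  have h1 := contDiffAt_comp_fst G.contDiff_pr hp
  have h2 := contDiffAt_comp_fst G.contDiff_g hp
  have h3 : ContDiffAt ℝ ∞ (fun q : E × (V →L[ℝ] V) => q.2) p := contDiffAt_snd
  refine ⟨(h1.mul h3).sub h3, (h3.mul h1).sub h3, (h3.mul h3).add h1, fun u v => ?_⟩
  exact ((h2.clm_apply (h3.clm_apply contDiffAt_const)).clm_apply contDiffAt_const).add
    ((h2.clm_apply contDiffAt_const).clm_apply (h3.clm_apply contDiffAt_const))

set_option synthInstance.maxHeartbeats 100000 in
theorem fderiv_constraint {p : E × (V →L[ℝ] V)} (hp : p.1 ∈ G.U) (ξ : E × (V →L[ℝ] V)) :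
    fderiv ℝ G.constraint₁ p ξ = fderiv ℝ G.pr p.1 ξ.1 * p.2 + G.pr p.1 * ξ.2 - ξ.2 ∧
    fderiv ℝ G.constraint₂ p ξ = ξ.2 * G.pr p.1 + p.2 * fderiv ℝ G.pr p.1 ξ.1 - ξ.2 ∧
    fderiv ℝ G.constraint₃ p ξ = ξ.2 * p.2 + p.2 * ξ.2 + fderiv ℝ G.pr p.1 ξ.1 ∧
    ∀ u v, fderiv ℝ (G.constraint₄ u v) p ξ =
      fderiv ℝ G.g p.1 ξ.1 (p.2 u) v + G.g p.1 (ξ.2 u) v +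
        (fderiv ℝ G.g p.1 ξ.1 u (p.2 v) + G.g p.1 u (ξ.2 v)) := by
  have h1 := hasFDerivAt_comp_fst G.contDiff_pr hp
  have h2 := hasFDerivAt_comp_fst G.contDiff_g hp
  have h3 : HasFDerivAt (fun q : E × (V →L[ℝ] V) => q.2)
    (ContinuousLinearMap.snd ℝ E (V →L[ℝ] V)) p := hasFDerivAt_snd
  refine ⟨?_, ?_, ?_, fun u v => ?_⟩
  · have h : HasFDerivAt G.constraint₁ _ p := (h1.mul' h3).sub h3
    rw [h.fderiv]; simp; abel
  · have h : HasFDerivAt G.constraint₂ _ p := (h3.mul' h1).sub h3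
    rw [h.fderiv]; simp; abel
  · have h : HasFDerivAt G.constraint₃ _ p := (h3.mul' h3).add h1
    rw [h.fderiv]; simp; abel
  · have h3a (w : V) := h3.clm_apply (hasFDerivAt_const w p)
    have h2a := h2.clm_apply (h3a u)
    have h2b := h2.clm_apply (hasFDerivAt_const u p)
    have h : HasFDerivAt (G.constraint₄ u v) _ p :=
      (h2a.clm_apply (hasFDerivAt_const v p)).add (h2b.clm_apply (h3a v))
    rw [h.fderiv]; simp; abel

/-- As g and `pr` are parallel for Γ, their derivatives are commutators with Γ, and the linearized
equations see the fibre component of ξ only through `cov`. -/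
theorem fderiv_constraint_eq_zero_iff {p : E × (V →L[ℝ] V)} (hp : p ∈ G.Q)
    (ξ : E × (V →L[ℝ] V)) : (fderiv ℝ G.constraint₁ p ξ = 0 ∧ fderiv ℝ G.constraint₂ p ξ = 0 ∧
      fderiv ℝ G.constraint₃ p ξ = 0 ∧ ∀ u v, fderiv ℝ (G.constraint₄ u v) p ξ = 0) ↔
      G.IsTan p ξ := by
  obtain ⟨h0, h1, h2, h3, h4, -⟩ := hp
  obtain ⟨f1, f2, f3, f4⟩ := G.fderiv_constraint h0 ξ
  have hd : fderiv ℝ G.pr p.1 ξ.1 = G.pr p.1 * G.Γ p.1 ξ.1 - G.Γ p.1 ξ.1 * G.pr p.1 := by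
    rw [← sub_eq_zero, ← G.pr_par p.1 h0 ξ.1]; abel
  simp only [IsTan, f1, f2, f3, f4]
  refine and_congr ?_ (and_congr ?_ (and_congr ?_ ?_))
  · rw [← sub_eq_zero (b := G.cov p ξ), hd, cov]
    refine Eq.congr_left ?_
    simp only [mul_add, mul_sub, sub_mul, ← mul_assoc, h1]
    simp only [mul_assoc, h1]
    abel
  · rw [← sub_eq_zero (b := G.cov p ξ), hd, cov]
    refine Eq.congr_left ?_
    simp only [add_mul, mul_sub, sub_mul, ← mul_assoc, h2]
    simp only [mul_assoc, h2]
    abel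
  · rw [hd, cov]
    refine Eq.congr_left ?_
    have : G.pr p.1 = - (p.2 * p.2) := by rw [h3, neg_neg]
    rw [this]
    noncomm_ring
  · refine forall_congr' fun u => forall_congr' fun v => ?_
    rw [← add_eq_zero_iff_eq_neg]
    refine Eq.congr_left ?_
    simp only [cov, add_apply, map_add, G.compat _ h0,
      sub_apply, mul_apply_eq_comp, map_sub, h4]
    ring

theorem conj_mem_Q {y y' : E} {K T : V →L[ℝ] V} (hp : (y, K) ∈ G.Q) (hy' : y' ∈ G.U)
    (hT : IsUnit T) (hpr : T * G.pr y = G.pr y' * T)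
    (hg : ∀ u v, G.g y' (T u) (T v) = G.g y u v)
    (hpos : G.Pos y' (T * K * Ring.inverse T)) : (y', T * K * Ring.inverse T) ∈ G.Q := by
  obtain ⟨w, rfl⟩ := hT
  rw [Ring.inverse_unit] at hpos ⊢
  obtain ⟨h0, h1, h2, h3, h4, -⟩ := hp
  simp only at h0 h1 h2 h3 h4
  have hpr' : (↑w⁻¹ : V →L[ℝ] V) * G.pr y' = G.pr y * ↑w⁻¹ := by
    rw [Units.inv_mul_eq_iff_eq_mul, ← mul_assoc, hpr, mul_assoc, Units.mul_inv, mul_one]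
  have hg' : ∀ u v, G.g y' ((w : V →L[ℝ] V) u) v = G.g y u ((↑w⁻¹ : V →L[ℝ] V) v) := by
    intro u v
    rw [← hg, ← mul_apply_eq_comp (w : V →L[ℝ] V), Units.mul_inv]
    rfl
  refine ⟨hy', ?_, ?_, ?_, ?_, hpos⟩
  · rw [← mul_assoc, ← mul_assoc, ← hpr, mul_assoc (w : V →L[ℝ] V), h1]
  · rw [mul_assoc, hpr', ← mul_assoc, mul_assoc (w : V →L[ℝ] V), h2]
  · calc (w : V →L[ℝ] V) * K * ↑w⁻¹ * (↑w * K * ↑w⁻¹) = ↑w * K * (↑w⁻¹ * ↑w) * K * ↑w⁻¹ := by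
          simp only [mul_assoc]
      _ = ↑w * (K * K) * ↑w⁻¹ := by simp only [Units.inv_mul, mul_one, mul_assoc]
      _ = -G.pr y' := by
        rw [h3, mul_neg, neg_mul, hpr, mul_assoc, Units.mul_inv, mul_one]
  · intro u v
    simp only [mul_apply_eq_comp]
    rw [hg', h4, ← hg, ← mul_apply_eq_comp (w : V →L[ℝ] V) (↑w⁻¹ : V →L[ℝ] V), Units.mul_inv]
    rfl

variable [FiniteDimensional ℝ E] [FiniteDimensional ℝ V]

theorem isTan_of_mem_curveTan {p ξ : E × (V →L[ℝ] V)} (hp : p ∈ G.Q) (h : ξ ∈ curveTan G.Q p) :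
    G.IsTan p ξ := by
  rw [← G.fderiv_constraint_eq_zero_iff hp]
  obtain ⟨c1, c2, c3, c4⟩ := G.contDiffAt_constraint hp.1
  refine ⟨?_, ?_, ?_, fun u v => ?_⟩
  · exact fderiv_eq_zero_of_mem_curveTan h (c1.differentiableAt (by simp))
      (.of_forall fun q hq => (G.constraint_eq_zero hq).1)
  · exact fderiv_eq_zero_of_mem_curveTan h (c2.differentiableAt (by simp))
      (.of_forall fun q hq => (G.constraint_eq_zero hq).2.1)
  · exact fderiv_eq_zero_of_mem_curveTan h (c3.differentiableAt (by simp))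
      (.of_forall fun q hq => (G.constraint_eq_zero hq).2.2.1)
  · exact fderiv_eq_zero_of_mem_curveTan h ((c4 u v).differentiableAt (by simp))
      (.of_forall fun q hq => (G.constraint_eq_zero hq).2.2.2 u v)

theorem IsTan.sub {p ξ η : E × (V →L[ℝ] V)} (hp : p ∈ G.Q) (h : G.IsTan p ξ)
    (h' : G.IsTan p η) : G.IsTan p (ξ - η) := by
  rw [← G.fderiv_constraint_eq_zero_iff hp] at h h' ⊢
  simp only [map_sub, h, h', sub_self, implies_true, and_self]

/-- The curve carries K along the segment y + tX by conjugation with the local isometries. Only the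
base component of its velocity matters; it need not be horizontal for Γ. -/
theorem exists_horizontal_curveTan {y : E} {K : V →L[ℝ] V} (hp : (y, K) ∈ G.Q) (X : E) :
    ∃ B, (X, B) ∈ curveTan G.Q (y, K) := by
  obtain ⟨T, hT0, hT⟩ := G.exists_isometry hp.1
  let l : ℝ → E := fun t => y + t • X
  have hl : ContDiff ℝ ∞ l := contDiff_const.add (contDiff_id.smul contDiff_const)
  have hl0 : l 0 = y := by simp [l]
  have hlt : Filter.Tendsto l (𝓝 0) (𝓝 y) := by
    have := hl.continuous.tendsto 0
    rwa [hl0] at this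
  have hTl : ContinuousAt (T ∘ l) 0 := by
    refine ContinuousAt.comp ?_ hl.continuous.continuousAt
    rw [hl0]
    exact hT.self_of_nhds.1.continuousAt
  have hev := hlt.eventually hT
  have hpos := G.pos_transport l (T ∘ l) hl.continuous.continuousAt hTl (by rw [hl0]; exact hp.1)
    (by simp [hl0, hT0]) (by
      filter_upwards [hev] with t ht
      rw [hl0]
      exact ht.2.1) K (by rw [hl0]; exact hp.2.2.2.2.2)
  let c : ℝ → E × (V →L[ℝ] V) := fun t => (l t, T (l t) * K * Ring.inverse (T (l t)))
  have hc : ∀ᶠ t in 𝓝 0, ContDiffAt ℝ ∞ c t ∧ c t ∈ G.Q := by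
    filter_upwards [hev, hpos, hlt.eventually (G.isOpen.mem_nhds hp.1)] with t h1 h2 h3
    obtain ⟨h4, h5, h6, h7⟩ := h1
    refine ⟨?_, G.conj_mem_Q hp h3 h7 h5 h6 h2⟩
    have h8 : ContDiffAt ℝ ∞ (T ∘ l) t := h4.comp t hl.contDiffAt
    refine hl.contDiffAt.prodMk ((h8.mul contDiffAt_const).mul ?_)
    obtain ⟨w, hw⟩ := h7
    have h9 := contDiffAt_ringInverse ℝ w (n := ∞)
    rw [hw] at h9
    exact h9.comp t h8
  have hd : HasDerivAt c (deriv c 0) 0 :=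
    (hc.self_of_nhds.1.differentiableAt (by simp)).hasDerivAt
  have h1 : (deriv c 0).1 = X := by
    have h2 : HasDerivAt l (deriv c 0).1 0 := hd.fst
    have h3 : HasDerivAt l X 0 := by
      have := ((hasDerivAt_id (0 : ℝ)).smul_const X).const_add y
      rw [one_smul] at this
      exact this
    exact h2.unique h3
  refine ⟨(deriv c 0).2, mem_curveTan hc ?_ ?_⟩
  · simp [c, hl0, hT0]
  · rw [← h1]

/-- K is conjugated by the Cayley transforms C(t) = (1 + tA)(1 - tA)⁻¹, which are isometries since A
is skew. As C'(0) = 2A, the velocity is [2A, K]; the choice A = KD/4 makes this D, because K and D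
anticommute and K²D = -D. -/
theorem vertical_mem_curveTan {y : E} {K D : V →L[ℝ] V} (hp : (y, K) ∈ G.Q)
    (hD : G.IsTan (y, K) (0, D)) : ((0 : E), D) ∈ curveTan G.Q (y, K) := by
  obtain ⟨d1, d2, d3, d4⟩ := hD
  simp only [cov, map_zero, zero_mul, mul_zero, sub_zero, add_zero] at d1 d2 d3 d4
  obtain ⟨h0, h1, h2, h3, h4, h5⟩ := id hp
  simp only at h0 h1 h2 h3 h4
  let A : V →L[ℝ] V := (1 / 4 : ℝ) • (K * D)
  have hA : ∀ u v, G.g y (A u) v = -G.g y u (A v) := by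
    intro u v
    have e : D (K v) = -K (D v) := by
      have := DFunLike.congr_fun d3 v
      exact eq_neg_of_add_eq_zero_right this
    simp [A, h4, d4, e]
  have hApr : A * G.pr y = G.pr y * A := by
    simp only [A, smul_mul_assoc, mul_smul_comm, mul_assoc, d2]
    rw [← mul_assoc, h1]
  let Mt : ℝ → V →L[ℝ] V := fun t => 1 + t • A
  let Nt : ℝ → V →L[ℝ] V := fun t => 1 - t • A
  have hM : ContDiff ℝ ∞ Mt := contDiff_const.add (contDiff_id.smul contDiff_const)
  have hN : ContDiff ℝ ∞ Nt := contDiff_const.sub (contDiff_id.smul contDiff_const)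
  have hM0 : Mt 0 = 1 := by simp [Mt]
  have hN0 : Nt 0 = 1 := by simp [Nt]
  have hunit : ∀ᶠ B in 𝓝 (1 : V →L[ℝ] V), IsUnit B := Units.isOpen.mem_nhds isUnit_one
  have hMu : ∀ᶠ t in 𝓝 0, IsUnit (Mt t) := by
    refine (hM.continuous.tendsto 0).eventually ?_
    rwa [hM0]
  have hNu : ∀ᶠ t in 𝓝 0, IsUnit (Nt t) := by
    refine (hN.continuous.tendsto 0).eventually ?_
    rwa [hN0]
  let C : ℝ → (V →L[ℝ] V) := fun t => Mt t * Ring.inverse (Nt t)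
  have hC0 : C 0 = 1 := by simp [C, hM0, hN0]
  have hCd : ∀ t, IsUnit (Nt t) → ContDiffAt ℝ ∞ C t := by
    intro t ht
    obtain ⟨w, hw⟩ := ht
    have h9 := contDiffAt_ringInverse ℝ w (n := ∞)
    rw [hw] at h9
    exact hM.contDiffAt.mul (h9.comp t hN.contDiffAt)
  have hCpr : ∀ t, IsUnit (Nt t) → C t * G.pr y = G.pr y * C t := by
    intro t ht
    obtain ⟨w, hw⟩ := ht
    simp only [C, ← hw, Ring.inverse_unit]
    have e1 : (w : V →L[ℝ] V) * G.pr y = G.pr y * w := by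
      rw [hw]; simp [Nt, sub_mul, mul_sub, hApr]
    have e2 : (↑w⁻¹ : V →L[ℝ] V) * G.pr y = G.pr y * ↑w⁻¹ := by
      rw [Units.inv_mul_eq_iff_eq_mul, ← mul_assoc, e1, mul_assoc, Units.mul_inv, mul_one]
    have e3 : Mt t * G.pr y = G.pr y * Mt t := by simp [Mt, add_mul, mul_add, hApr]
    rw [mul_assoc, e2, ← mul_assoc, e3, mul_assoc]
  have hCg : ∀ t, IsUnit (Nt t) → ∀ u v, G.g y (C t u) (C t v) = G.g y u v := by
    intro t ht u v
    obtain ⟨w, hw⟩ := ht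
    have e : ∀ u, ∃ a, u = Nt t a ∧ C t u = Mt t a := by
      intro u
      refine ⟨(↑w⁻¹ : V →L[ℝ] V) u, ?_, ?_⟩
      · rw [← hw, ← mul_apply_eq_comp, Units.mul_inv]; rfl
      · simp only [C, ← hw, Ring.inverse_unit]; rfl
    obtain ⟨a, ha, ha'⟩ := e u
    obtain ⟨b, hb, hb'⟩ := e v
    rw [ha', hb', ha, hb]
    simp [Mt, Nt, hA]
    ring
  have hpos := G.pos_transport (fun _ => y) C continuousAt_const
    (hCd 0 (by rw [hN0]; exact isUnit_one)).continuousAt h0 hC0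
    (hNu.mono fun t ht => hCpr t ht) K h5
  let Kt : ℝ → V →L[ℝ] V := fun t => C t * K * Ring.inverse (C t)
  have hCu : ∀ t, IsUnit (Mt t) → IsUnit (Nt t) → IsUnit (C t) := by
    rintro t ht ⟨w, hw⟩
    refine ht.mul ?_
    rw [← hw, Ring.inverse_unit]
    exact w⁻¹.isUnit
  have hc : ∀ᶠ t in 𝓝 0, ContDiffAt ℝ ∞ (fun t => (y, Kt t)) t ∧ (y, Kt t) ∈ G.Q := by
    filter_upwards [hMu, hNu, hpos] with t t1 t2 t3
    refine ⟨contDiffAt_const.prodMk (((hCd t t2).mul contDiffAt_const).mul ?_),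
      G.conj_mem_Q hp h0 (hCu t t1 t2) (hCpr t t2) (hCg t t2) t3⟩
    obtain ⟨w, hw⟩ := hCu t t1 t2
    have h9 := contDiffAt_ringInverse ℝ w (n := ∞)
    rw [hw] at h9
    exact h9.comp t (hCd t t2)
  have hC' : HasDerivAt C (2 • A) 0 := by
    have a1 : HasDerivAt C (deriv C 0) 0 :=
      ((hCd 0 hNu.self_of_nhds).differentiableAt (by simp)).hasDerivAt
    have a2 : HasDerivAt Mt A 0 := by
      have := ((hasDerivAt_id (0 : ℝ)).smul_const A).const_add 1
      rw [one_smul] at this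
      exact this
    have a3 : HasDerivAt Nt (-A) 0 := by
      have := ((hasDerivAt_id (0 : ℝ)).smul_const A).const_sub 1
      rw [one_smul] at this
      exact this
    have a4 := a1.mul a3
    -- The derivative of C is read off from the product C(t) N(t) = M(t), with both factors equal to
    -- 1 at t = 0; the same device gives the derivative of the conjugate of K below.
    have a5 : (C * Nt) =ᶠ[𝓝 0] Mt := by
      filter_upwards [hNu] with t ht
      obtain ⟨w, hw⟩ := ht
      simp only [Pi.mul_apply, C, ← hw, Ring.inverse_unit, mul_assoc, Units.inv_mul, mul_one]
    have a6 := (a2.congr_of_eventuallyEq a5).unique a4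
    rw [hC0, hN0, mul_one, one_mul] at a6
    have : deriv C 0 = 2 • A := by rw [two_smul]; nth_rewrite 1 [a6]; abel
    rwa [this] at a1
  have hK0 : Kt 0 = K := by simp [Kt, hC0]
  have hd : HasDerivAt (fun t => (y, Kt t)) (deriv (fun t => (y, Kt t)) 0) 0 :=
    (hc.self_of_nhds.1.differentiableAt (by simp)).hasDerivAt
  have hfst : (deriv (fun t => (y, Kt t)) 0).1 = 0 := by
    have b0 : HasDerivAt (fun _ : ℝ => y) (deriv (fun t => (y, Kt t)) 0).1 0 := hd.fst
    exact b0.unique (hasDerivAt_const _ _)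
  have hsnd : (deriv (fun t => (y, Kt t)) 0).2 = D := by
    have b1 : HasDerivAt Kt _ 0 := hd.snd
    have b2 := b1.mul hC'
    have b3 := hC'.mul_const K
    have b4 : (Kt * C) =ᶠ[𝓝 0] fun t => C t * K := by
      filter_upwards [hMu, hNu] with t t1 t2
      obtain ⟨w, hw⟩ := hCu t t1 t2
      simp only [Pi.mul_apply, Kt, ← hw, Ring.inverse_unit, mul_assoc, Units.inv_mul, mul_one]
    have b5 := (b3.congr_of_eventuallyEq b4).unique b2
    rw [hC0, hK0, mul_one] at b5
    have e : D * K = -(K * D) := eq_neg_of_add_eq_zero_right d3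
    have b6 : (2 • A) * K - K * (2 • A) = D := by
      simp only [A, two_smul, add_mul, mul_add, smul_mul_assoc, mul_smul_comm, mul_assoc, e,
        mul_neg]
      rw [← mul_assoc K K D, h3, neg_mul, d1, neg_neg]
      module
    rw [← b6, b5]; abel
  refine mem_curveTan hc (by simp [hK0]) ?_
  rw [← hsnd, ← hfst]

theorem mem_curveTan_iff {p ξ : E × (V →L[ℝ] V)} (hp : p ∈ G.Q) :
    ξ ∈ curveTan G.Q p ↔ G.IsTan p ξ := by
  refine ⟨G.isTan_of_mem_curveTan hp, fun h => ?_⟩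
  obtain ⟨y, K⟩ := p
  obtain ⟨X, B⟩ := ξ
  -- After subtracting a velocity with the same base component only a vertical vector is left.
  obtain ⟨B', hB'⟩ := G.exists_horizontal_curveTan hp X
  have h' := G.isTan_of_mem_curveTan hp hB'
  have h2 : G.IsTan (y, K) (0, B - B') := by
    have : ((0 : E), B - B') = (X, B) - (X, B') := by simp
    rw [this]
    exact IsTan.sub G hp h h'
  have h3 := add_mem hB' (G.vertical_mem_curveTan hp h2)
  simpa using h3

end AdaptedGeometry

/-! ### Lie brackets and the Nijenhuis tensor of the twistor structure. -/

section Brackets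
variable {W : Type*} [NormedAddCommGroup W] [NormedSpace ℝ W]
open VectorField

/-- The second derivatives of c cancel by symmetry, leaving X(Yc) - Y(Xc). This is how brackets are
shown to be tangent to a set given by equations. -/
theorem fderiv_lieBracket {F : Type*} [NormedAddCommGroup F] [NormedSpace ℝ F] {c : W → F} {p : W}
    (hc : ContDiffAt ℝ ∞ c p) {X Y : W → W} (hX : DifferentiableAt ℝ X p)
    (hY : DifferentiableAt ℝ Y p) :
    fderiv ℝ c p (lieBracket ℝ X Y p) =
      fderiv ℝ (fun q => fderiv ℝ c q (Y q)) p (X p) -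
        fderiv ℝ (fun q => fderiv ℝ c q (X q)) p (Y p) := by
  have hd : DifferentiableAt ℝ (fderiv ℝ c) p :=
    (hc.fderiv_right (m := 1) (by norm_cast)).differentiableAt (by simp)
  have hs : IsSymmSndFDerivAt ℝ c p := hc.isSymmSndFDerivAt (by simp; norm_cast)
  rw [fderiv_clm_apply hd hX, fderiv_clm_apply hd hY, lieBracket]
  simp only [add_apply, ContinuousLinearMap.comp_apply, ContinuousLinearMap.flip_apply, map_sub]
  rw [hs.eq (X p) (Y p)]
  abel

/-- If the vector fields `X₁, X₂ = Φ X₁, Y₁, Y₂ = Φ Y₁` are tangent to `Q` along `Q`, then the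
failure of `[X₁ + i X₂, Y₁ + i Y₂]` to be of the same type is given by the derivative of `Φ`. -/
theorem lieBracket_sub_of_eqOn {Q : Set W} {p : W} {Φ : W → W →L[ℝ] W}
    (hΦ : DifferentiableAt ℝ Φ p) {X₁ X₂ Y₁ Y₂ : W → W}
    (hX₁ : DifferentiableAt ℝ X₁ p) (hX₂ : DifferentiableAt ℝ X₂ p)
    (hY₁ : DifferentiableAt ℝ Y₁ p) (hY₂ : DifferentiableAt ℝ Y₂ p)
    (tX₁ : X₁ p ∈ curveTan Q p) (tX₂ : X₂ p ∈ curveTan Q p)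
    (tY₁ : Y₁ p ∈ curveTan Q p) (tY₂ : Y₂ p ∈ curveTan Q p)
    (eX : ∀ᶠ q in 𝓝 p, q ∈ Q → Φ q (X₁ q) = X₂ q) (eX' : ∀ᶠ q in 𝓝 p, q ∈ Q → Φ q (X₂ q) = -X₁ q)
    (eY : ∀ᶠ q in 𝓝 p, q ∈ Q → Φ q (Y₁ q) = Y₂ q)
    (eY' : ∀ᶠ q in 𝓝 p, q ∈ Q → Φ q (Y₂ q) = -Y₁ q) :
    lieBracket ℝ X₁ Y₂ p + lieBracket ℝ X₂ Y₁ p -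
        Φ p (lieBracket ℝ X₁ Y₁ p - lieBracket ℝ X₂ Y₂ p) =
      fderiv ℝ Φ p (X₁ p) (Y₁ p) - fderiv ℝ Φ p (X₂ p) (Y₂ p) +
        fderiv ℝ Φ p (Y₂ p) (X₂ p) - fderiv ℝ Φ p (Y₁ p) (X₁ p) := by
  -- Differentiation of Φ A = B. The equation holds on Q only, so it may be differentiated only in
  -- directions tangent to Q.
  have key : ∀ {A B : W → W} {v : W}, DifferentiableAt ℝ A p → DifferentiableAt ℝ B p →
      v ∈ curveTan Q p → (∀ᶠ q in 𝓝 p, q ∈ Q → Φ q (A q) = B q) →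
      fderiv ℝ Φ p v (A p) + Φ p (fderiv ℝ A p v) = fderiv ℝ B p v := by
    intro A B v hA hB hv h
    have := fderiv_eq_zero_of_mem_curveTan hv (h := fun q => Φ q (A q) - B q)
      ((hΦ.clm_apply hA).sub hB) (h.mono fun q hq hq' => sub_eq_zero.2 (hq hq'))
    rw [fderiv_fun_sub (hΦ.clm_apply hA) hB, fderiv_clm_apply hΦ hA] at this
    simp only [sub_apply, add_apply, ContinuousLinearMap.comp_apply,
      ContinuousLinearMap.flip_apply] at this
    rw [← sub_eq_zero, ← this]
    abel
  have n1' : fderiv ℝ (-X₁) p = -fderiv ℝ X₁ p := fderiv_neg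
  have n2' : fderiv ℝ (-Y₁) p = -fderiv ℝ Y₁ p := fderiv_neg
  have k1 := key hY₁ hY₂ tX₁ eY
  have k2 := key hY₂ hY₁.neg tX₂ eY'
  have k3 := key hX₁ hX₂ tY₁ eX
  have k4 := key hX₂ hX₁.neg tY₂ eX'
  have k2' : fderiv ℝ Φ p (X₂ p) (Y₂ p) + Φ p (fderiv ℝ Y₂ p (X₂ p)) = -fderiv ℝ Y₁ p (X₂ p) := by
    rw [k2, n2']; rfl
  have k4' : fderiv ℝ Φ p (Y₂ p) (X₂ p) + Φ p (fderiv ℝ X₂ p (Y₂ p)) = -fderiv ℝ X₁ p (Y₂ p) := by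
    rw [k4, n1']; rfl
  simp only [lieBracket, map_sub]
  rw [← k1, ← k3, ← neg_eq_iff_eq_neg.2 k2', ← neg_eq_iff_eq_neg.2 k4']
  abel

end Brackets

/-- The noncommutative algebra behind `nijenhuis_cs`. Here a, b, a', b' stand for Γ on X, Y, JX, JY,
the elements C and C' for the covariant derivatives of K along X and Y, the letters p to s' for
derivatives of Γ, and the nᵢ for Γ on derivatives of J. All terms in C and C' cancel because K
anticommutes with them; K² = -1 is available only on C and C', as K vanishes on tangent vectors. -/
theorem nijenhuis_ring {R : Type*} [Ring R] {K C C' : R} (h1 : K * C = -(C * K))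
    (h1' : K * C' = -(C' * K)) (h2 : K * (K * C) = -C) (h2' : K * (K * C') = -C')
    (a b a' b' p q r s p' q' r' s' n₁ n₂ n₃ n₄ : R) :
    let B₁ := C - (a * K - K * a)
    let B₂ := C' - (b * K - K * b)
    let B₁' := -(a' * K - K * a') - K * C
    let B₂' := -(b' * K - K * b') - K * C'
    (-((q + n₁) * K + b' * B₁ - (B₁ * b' + K * (q + n₁))) - (B₁ * C' +
        K * (p * K + b * B₁ - (B₁ * b + K * p)))) -
      (-((-r + n₂) * K + (-b) * B₁' - (B₁' * (-b) + K * (-r + n₂))) - (B₁' * (-(K * C')) +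
        K * (s * K + b' * B₁' - (B₁' * b' + K * s)))) +
      (-((-r' + n₃) * K + (-a) * B₂' - (B₂' * (-a) + K * (-r' + n₃))) - (B₂' * (-(K * C)) +
        K * (s' * K + a' * B₂' - (B₂' * a' + K * s')))) -
      (-((q' + n₄) * K + a' * B₂ - (B₂ * a' + K * (q' + n₄))) - (B₂ * C +
        K * (p' * K + a * B₂ - (B₂ * a + K * p')))) =
    -((n₁ - n₂ + n₃ - n₄) * K - K * (n₁ - n₂ + n₃ - n₄))
      - (((q - r' + (a * b' - b' * a)) + (r - q' + (a' * b - b * a'))) * K -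
        K * ((q - r' + (a * b' - b' * a)) + (r - q' + (a' * b - b * a'))))
      - K * (((p - p' + (a * b - b * a)) - (s - s' + (a' * b' - b' * a'))) * K -
        K * ((p - p' + (a * b - b * a)) - (s - s' + (a' * b' - b' * a')))) := by
  have h3 : ∀ x, K * (C * x) = -(C * (K * x)) := fun x => by
    rw [← mul_assoc, h1, neg_mul, mul_assoc]
  have h3' : ∀ x, K * (C' * x) = -(C' * (K * x)) := fun x => by
    rw [← mul_assoc, h1', neg_mul, mul_assoc]
  have h4 : C * (K * K) = -C := by
    rw [← h2, h1, mul_neg, h3, neg_neg]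
  have h4' : C' * (K * K) = -C' := by
    rw [← h2', h1', mul_neg, h3', neg_neg]
  have h5 : ∀ x, C * (K * (K * x)) = -(C * x) := fun x => by
    rw [← mul_assoc K, ← mul_assoc C, h4, neg_mul]
  have h5' : ∀ x, C' * (K * (K * x)) = -(C' * x) := fun x => by
    rw [← mul_assoc K, ← mul_assoc C', h4', neg_mul]
  intro B₁ B₂ B₁' B₂'
  simp only [B₁, B₂, B₁', B₂', mul_add, add_mul, mul_sub, sub_mul, neg_mul, mul_neg, neg_neg,
    mul_assoc, neg_sub, h1, h1', h3, h3', h4, h4', h5, h5']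
  abel

section Generic
variable {E A : Type*} [NormedAddCommGroup E] [NormedSpace ℝ E] [NormedRing A] [NormedAlgebra ℝ A]

/-- The covariant derivative of the tautological section of an algebra bundle. -/
def covAux (Γ : E →L[ℝ] A) (K : A) : (E × A) →L[ℝ] A :=
  ContinuousLinearMap.snd ℝ E A + (((ContinuousLinearMap.mul ℝ A).flip K -
    ContinuousLinearMap.mul ℝ A K) ∘L Γ) ∘L ContinuousLinearMap.fst ℝ E A

/-- The almost complex structure on the total space of an algebra bundle determined by an almost
complex structure `J` on the base, the connection `Γ` and the multiplication by `-K` on vertical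
vectors at `K`. -/
def csAux (J : E →L[ℝ] E) (Γ : E →L[ℝ] A) (K : A) : (E × A) →L[ℝ] E × A :=
  (J ∘L ContinuousLinearMap.fst ℝ E A).prod
    (-((((ContinuousLinearMap.mul ℝ A).flip K - ContinuousLinearMap.mul ℝ A K) ∘L Γ) ∘L
      (J ∘L ContinuousLinearMap.fst ℝ E A)) - ContinuousLinearMap.mul ℝ A K ∘L covAux Γ K)

variable {W : Type*} [NormedAddCommGroup W] [NormedSpace ℝ W] {J : W → E →L[ℝ] E}
  {Γ : W → E →L[ℝ] A} {K : W → A} {p : W}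

theorem contDiffAt_adAux (hΓ : ContDiffAt ℝ ∞ Γ p) (hK : ContDiffAt ℝ ∞ K p) :
    ContDiffAt ℝ ∞ (fun q => ((ContinuousLinearMap.mul ℝ A).flip (K q) -
      ContinuousLinearMap.mul ℝ A (K q)) ∘L Γ q) p :=
  (((ContinuousLinearMap.mul ℝ A).flip.contDiff.contDiffAt.comp p hK).sub
    ((ContinuousLinearMap.mul ℝ A).contDiff.contDiffAt.comp p hK)).clm_comp hΓ

theorem contDiffAt_csAux (hJ : ContDiffAt ℝ ∞ J p) (hΓ : ContDiffAt ℝ ∞ Γ p)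
    (hK : ContDiffAt ℝ ∞ K p) : ContDiffAt ℝ ∞ (fun q => csAux (J q) (Γ q) (K q)) p := by
  have h4 := contDiffAt_adAux hΓ hK
  have h5 := hJ.clm_comp (contDiffAt_const (c := ContinuousLinearMap.fst ℝ E A))
  have h6 : ContDiffAt ℝ ∞ (fun q => covAux (Γ q) (K q)) p :=
    contDiffAt_const.add (h4.clm_comp contDiffAt_const)
  have h7 := ((h4.clm_comp h5).neg).sub
    (((ContinuousLinearMap.mul ℝ A).contDiff.contDiffAt.comp p hK).clm_comp h6)
  have h8 := (contDiffAt_const (c := ContinuousLinearMap.inl ℝ E A)).clm_comp h5 |>.add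
    ((contDiffAt_const (c := ContinuousLinearMap.inr ℝ E A)).clm_comp h7)
  refine h8.congr_of_eventuallyEq (Filter.Eventually.of_forall fun q => ?_)
  ext x <;> simp [csAux]

-- Along the line p + tη the formula reduces to the product rule for functions of one real variable.
set_option synthInstance.maxHeartbeats 400000 in
set_option maxHeartbeats 1000000 in
theorem fderiv_csAux (hJ : ContDiffAt ℝ ∞ J p) (hΓ : ContDiffAt ℝ ∞ Γ p)
    (hK : ContDiffAt ℝ ∞ K p) (η : W) (ξ : E × A) :
    fderiv ℝ (fun q => csAux (J q) (Γ q) (K q)) p η ξ = (fderiv ℝ J p η ξ.1,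
      -((fderiv ℝ Γ p η (J p ξ.1) + Γ p (fderiv ℝ J p η ξ.1)) * K p +
          Γ p (J p ξ.1) * fderiv ℝ K p η - (fderiv ℝ K p η * Γ p (J p ξ.1) + K p *
            (fderiv ℝ Γ p η (J p ξ.1) + Γ p (fderiv ℝ J p η ξ.1)))) -
        (fderiv ℝ K p η * covAux (Γ p) (K p) ξ + K p *
          (fderiv ℝ Γ p η ξ.1 * K p + Γ p ξ.1 * fderiv ℝ K p η -
          (fderiv ℝ K p η * Γ p ξ.1 + K p * fderiv ℝ Γ p η ξ.1)))) := by
  have hd := (contDiffAt_csAux hJ hΓ hK).differentiableAt (by simp)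
  have hline : HasDerivAt (fun t : ℝ => p + t • η) η 0 := by
    have := ((hasDerivAt_id (0 : ℝ)).smul_const η).const_add p
    rw [one_smul] at this
    exact this
  have hl0 : p + (0 : ℝ) • η = p := by simp
  have h1' : HasDerivAt (fun t : ℝ => csAux (J (p + t • η)) (Γ (p + t • η)) (K (p + t • η)))
      (fderiv ℝ (fun q => csAux (J q) (Γ q) (K q)) p η) 0 :=
    HasFDerivAt.comp_hasDerivAt (x := (0 : ℝ)) (f := fun t : ℝ => p + t • η)
      (l := fun q => csAux (J q) (Γ q) (K q)) (by rw [hl0]; exact hd.hasFDerivAt) hline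
  have h1 := h1'.clm_apply (hasDerivAt_const (0 : ℝ) ξ)
  have h2 : HasDerivAt (fun t : ℝ => Γ (p + t • η)) (fderiv ℝ Γ p η) 0 :=
    HasFDerivAt.comp_hasDerivAt (x := (0 : ℝ)) (f := fun t : ℝ => p + t • η)
      (l := Γ) (by rw [hl0]; exact (hΓ.differentiableAt (by simp)).hasFDerivAt) hline
  have h3 : HasDerivAt (fun t : ℝ => K (p + t • η)) (fderiv ℝ K p η) 0 :=
    HasFDerivAt.comp_hasDerivAt (x := (0 : ℝ)) (f := fun t : ℝ => p + t • η)
      (l := K) (by rw [hl0]; exact (hK.differentiableAt (by simp)).hasFDerivAt) hline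
  have h0 : HasDerivAt (fun t : ℝ => J (p + t • η)) (fderiv ℝ J p η) 0 :=
    HasFDerivAt.comp_hasDerivAt (x := (0 : ℝ)) (f := fun t : ℝ => p + t • η)
      (l := J) (by rw [hl0]; exact (hJ.differentiableAt (by simp)).hasFDerivAt) hline
  have h4 := h0.clm_apply (hasDerivAt_const (0 : ℝ) ξ.1)
  have h5 := h2.clm_apply h4
  have h6 := h2.clm_apply (hasDerivAt_const (0 : ℝ) ξ.1)
  have h7 := ((h5.mul h3).sub (h3.mul h5)).neg.sub
    (h3.mul (((h6.mul h3).sub (h3.mul h6)).const_add ξ.2))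
  have h8 := h1.unique (h4.prodMk h7)
  have e : covAux (Γ p) (K p) ξ = ξ.2 + (Γ p ξ.1 * K p - K p * Γ p ξ.1) := rfl
  simp only [hl0, map_zero, add_zero, Pi.sub_apply, Pi.mul_apply] at h8
  rw [e]
  exact h8

end Generic

namespace AdaptedGeometry

variable {E V : Type*} [NormedAddCommGroup E] [NormedSpace ℝ E]
    [NormedAddCommGroup V] [NormedSpace ℝ V] (G : AdaptedGeometry E V)

/-- The horizontal lift. -/
def hor (p : E × (V →L[ℝ] V)) (X : E) : E × (V →L[ℝ] V) :=
  (X, -(G.Γ p.1 X * p.2 - p.2 * G.Γ p.1 X))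

theorem cov_hor (p : E × (V →L[ℝ] V)) (X : E) : G.cov p (G.hor p X) = 0 := by
  simp [cov, hor]

theorem isTan_hor (p : E × (V →L[ℝ] V)) (X : E) : G.IsTan p (G.hor p X) := by
  simp [IsTan, cov_hor]

/-- The almost complex structure in terms of the connection. -/
def cs (p : E × (V →L[ℝ] V)) : (E × (V →L[ℝ] V)) →L[ℝ] E × (V →L[ℝ] V) :=
  csAux (G.J p.1) (G.Γ p.1) p.2

theorem cs_apply (p ξ : E × (V →L[ℝ] V)) : G.cs p ξ = (G.J p.1 ξ.1,
    -(G.Γ p.1 (G.J p.1 ξ.1) * p.2 - p.2 * G.Γ p.1 (G.J p.1 ξ.1)) - p.2 * G.cov p ξ) := rfl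

theorem cov_cs (p ξ : E × (V →L[ℝ] V)) : G.cov p (G.cs p ξ) = -(p.2 * G.cov p ξ) := by
  rw [cs_apply, cov]
  dsimp only
  abel

theorem ext_cov (p : E × (V →L[ℝ] V)) {ξ η : E × (V →L[ℝ] V)} (h1 : ξ.1 = η.1) (h2 : G.cov p ξ = G.cov p η) :
    ξ = η := by
  simp only [cov, h1, add_left_inj] at h2
  exact Prod.ext h1 h2

theorem mul_mul_cov {p ξ : E × (V →L[ℝ] V)} (hp : p ∈ G.Q) (h : G.IsTan p ξ) :
    p.2 * (p.2 * G.cov p ξ) = -G.cov p ξ := by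
  rw [← mul_assoc, hp.2.2.2.1, neg_mul, h.1]

/-- `cs` is defined on the whole of E × End V, but it squares to -1 only on vectors tangent to Q,
where K² acts as -1 on the covariant derivative. -/
theorem cs_cs {p ξ : E × (V →L[ℝ] V)} (hp : p ∈ G.Q) (h : G.IsTan p ξ) :
    G.cs p (G.cs p ξ) = -ξ := by
  refine G.ext_cov p (G.J_sq p.1 hp.1 ξ.1) ?_
  rw [cov_cs, cov_cs, mul_neg, neg_neg, G.mul_mul_cov hp h]
  simp [cov]
  abel

theorem IsTan.cs {p ξ : E × (V →L[ℝ] V)} (hp : p ∈ G.Q) (h : G.IsTan p ξ) :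
    G.IsTan p (G.cs p ξ) := by
  obtain ⟨d1, d2, d3, d4⟩ := id h
  have d5 := eq_neg_of_add_eq_zero_right d3
  refine ⟨?_, ?_, ?_, fun u v => ?_⟩
  · rw [cov_cs, mul_neg, ← mul_assoc, hp.2.1]
  · rw [cov_cs, neg_mul, mul_assoc, d2]
  · rw [cov_cs, neg_mul, mul_neg, mul_assoc, d5, mul_neg, neg_neg, neg_add_cancel]
  · rw [cov_cs]
    have e : G.cov p ξ (p.2 v) = -p.2 (G.cov p ξ v) := DFunLike.congr_fun d5 v
    simp [hp.2.2.2.2.1, d4, e]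

theorem contDiffAt_cs {p : E × (V →L[ℝ] V)} (hp : p.1 ∈ G.U) : ContDiffAt ℝ ∞ G.cs p :=
  contDiffAt_csAux (contDiffAt_comp_fst G.contDiff_J hp) (contDiffAt_comp_fst G.contDiff_Γ hp)
    contDiffAt_snd

theorem contDiffAt_hor {p : E × (V →L[ℝ] V)} (hp : p.1 ∈ G.U) {X : E × (V →L[ℝ] V) → E}
    (hX : ContDiffAt ℝ ∞ X p) : ContDiffAt ℝ ∞ (fun q => G.hor q (X q)) p :=
  hX.prodMk ((contDiffAt_adAux (contDiffAt_comp_fst G.contDiff_Γ hp) contDiffAt_snd).clm_apply hX).neg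

/-- The curvature of the connection. -/
def curv (y : E) (X Y : E) : V →L[ℝ] V :=
  fderiv ℝ G.Γ y X Y - fderiv ℝ G.Γ y Y X + (G.Γ y X * G.Γ y Y - G.Γ y Y * G.Γ y X)

/-- The Nijenhuis tensor of `J`. -/
def nijJ (y : E) (X Y : E) : E :=
  fderiv ℝ G.J y X Y - fderiv ℝ G.J y (G.J y X) (G.J y Y) + fderiv ℝ G.J y (G.J y Y) (G.J y X) -
    fderiv ℝ G.J y Y X

/-- The real part of the curvature on `X + iJX` and `Y + iJY`. -/
def curvRe (y : E) (X Y : E) : V →L[ℝ] V := G.curv y X Y - G.curv y (G.J y X) (G.J y Y)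

/-- The imaginary part of the curvature on `X + iJX` and `Y + iJY`. -/
def curvIm (y : E) (X Y : E) : V →L[ℝ] V := G.curv y X (G.J y Y) + G.curv y (G.J y X) Y

theorem fderiv_cs {p : E × (V →L[ℝ] V)} (hp : p.1 ∈ G.U) (η ξ : E × (V →L[ℝ] V)) :
    fderiv ℝ G.cs p η ξ = (fderiv ℝ G.J p.1 η.1 ξ.1,
      -((fderiv ℝ G.Γ p.1 η.1 (G.J p.1 ξ.1) + G.Γ p.1 (fderiv ℝ G.J p.1 η.1 ξ.1)) * p.2 +
          G.Γ p.1 (G.J p.1 ξ.1) * η.2 - (η.2 * G.Γ p.1 (G.J p.1 ξ.1) + p.2 *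
            (fderiv ℝ G.Γ p.1 η.1 (G.J p.1 ξ.1) + G.Γ p.1 (fderiv ℝ G.J p.1 η.1 ξ.1)))) -
        (η.2 * G.cov p ξ + p.2 * (fderiv ℝ G.Γ p.1 η.1 ξ.1 * p.2 + G.Γ p.1 ξ.1 * η.2 -
          (η.2 * G.Γ p.1 ξ.1 + p.2 * fderiv ℝ G.Γ p.1 η.1 ξ.1)))) := by
  have h := fderiv_csAux (contDiffAt_comp_fst G.contDiff_J hp)
    (contDiffAt_comp_fst G.contDiff_Γ hp) (contDiffAt_snd (p := p)) η ξ
  rw [(hasFDerivAt_comp_fst G.contDiff_J hp).fderiv, (hasFDerivAt_comp_fst G.contDiff_Γ hp).fderiv,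
    fderiv_snd] at h
  exact h

/-- The result is the horizontal lift of the Nijenhuis tensor of J plus a vertical term in the
curvature. The vertical parts of X and Y do not contribute: the fibres are complex, and their
complex structure is parallel. -/
theorem nijenhuis_cs {p X Y : E × (V →L[ℝ] V)} (hp : p ∈ G.Q) (hX : G.IsTan p X)
    (hY : G.IsTan p Y) :
    fderiv ℝ G.cs p X Y - fderiv ℝ G.cs p (G.cs p X) (G.cs p Y) +
        fderiv ℝ G.cs p (G.cs p Y) (G.cs p X) - fderiv ℝ G.cs p Y X =
      (G.nijJ p.1 X.1 Y.1,
        -(G.Γ p.1 (G.nijJ p.1 X.1 Y.1) * p.2 - p.2 * G.Γ p.1 (G.nijJ p.1 X.1 Y.1)) -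
          (G.curvIm p.1 X.1 Y.1 * p.2 - p.2 * G.curvIm p.1 X.1 Y.1) -
          p.2 * (G.curvRe p.1 X.1 Y.1 * p.2 - p.2 * G.curvRe p.1 X.1 Y.1)) := by
  have hX2 : X.2 = G.cov p X - (G.Γ p.1 X.1 * p.2 - p.2 * G.Γ p.1 X.1) := by rw [cov]; abel
  have hY2 : Y.2 = G.cov p Y - (G.Γ p.1 Y.1 * p.2 - p.2 * G.Γ p.1 Y.1) := by rw [cov]; abel
  simp only [G.fderiv_cs hp.1, cov_cs]
  ext1
  · rfl
  · have h := nijenhuis_ring (eq_neg_of_add_eq_zero_left hX.2.2.1)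
      (eq_neg_of_add_eq_zero_left hY.2.2.1) (G.mul_mul_cov hp hX) (G.mul_mul_cov hp hY)
      (G.Γ p.1 X.1) (G.Γ p.1 Y.1) (G.Γ p.1 (G.J p.1 X.1)) (G.Γ p.1 (G.J p.1 Y.1))
      (fderiv ℝ G.Γ p.1 X.1 Y.1) (fderiv ℝ G.Γ p.1 X.1 (G.J p.1 Y.1))
      (fderiv ℝ G.Γ p.1 (G.J p.1 X.1) Y.1) (fderiv ℝ G.Γ p.1 (G.J p.1 X.1) (G.J p.1 Y.1))
      (fderiv ℝ G.Γ p.1 Y.1 X.1) (fderiv ℝ G.Γ p.1 Y.1 (G.J p.1 X.1))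
      (fderiv ℝ G.Γ p.1 (G.J p.1 Y.1) X.1) (fderiv ℝ G.Γ p.1 (G.J p.1 Y.1) (G.J p.1 X.1))
      (G.Γ p.1 (fderiv ℝ G.J p.1 X.1 Y.1))
      (G.Γ p.1 (fderiv ℝ G.J p.1 (G.J p.1 X.1) (G.J p.1 Y.1)))
      (G.Γ p.1 (fderiv ℝ G.J p.1 (G.J p.1 Y.1) (G.J p.1 X.1)))
      (G.Γ p.1 (fderiv ℝ G.J p.1 Y.1 X.1))
    simp only [← hX2, ← hY2] at h
    simp only [Prod.snd_sub, Prod.snd_add, cs_apply, G.J_sq p.1 hp.1, map_neg, nijJ, map_add,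
      map_sub, curvIm, curvRe, curv]
    exact h

/-- The functions obtained by differentiating c along X and Y vanish on Q, so their derivatives in
directions tangent to Q vanish as well. Applied to the equations of Q, this makes the bracket of
tangent fields tangent. -/
theorem fderiv_lieBracket_eq_zero [FiniteDimensional ℝ E] [FiniteDimensional ℝ V]
    {p : E × (V →L[ℝ] V)}
    (hp : p ∈ G.Q) {X Y : E × (V →L[ℝ] V) → E × (V →L[ℝ] V)}
    (hX : DifferentiableAt ℝ X p) (hY : DifferentiableAt ℝ Y p)
    (tX : ∀ᶠ q in 𝓝 p, q ∈ G.Q → G.IsTan q (X q)) (tY : ∀ᶠ q in 𝓝 p, q ∈ G.Q → G.IsTan q (Y q))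
    {F : Type*} [NormedAddCommGroup F] [NormedSpace ℝ F] {c : E × (V →L[ℝ] V) → F}
    (hc : ContDiffAt ℝ ∞ c p) (h : ∀ q ξ, q ∈ G.Q → G.IsTan q ξ → fderiv ℝ c q ξ = 0) :
    fderiv ℝ c p (VectorField.lieBracket ℝ X Y p) = 0 := by
  have mX := (G.mem_curveTan_iff hp).2 (tX.self_of_nhds hp)
  have mY := (G.mem_curveTan_iff hp).2 (tY.self_of_nhds hp)
  have hd : DifferentiableAt ℝ (fderiv ℝ c) p :=
    (hc.fderiv_right (m := 1) (by norm_cast)).differentiableAt (by simp)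
  rw [fderiv_lieBracket hc hX hY,
    fderiv_eq_zero_of_mem_curveTan mX (hd.clm_apply hY) (tY.mono fun q hq hq' => h q _ hq' (hq hq')),
    fderiv_eq_zero_of_mem_curveTan mY (hd.clm_apply hX) (tX.mono fun q hq hq' => h q _ hq' (hq hq')),
    sub_zero]

theorem isTan_lieBracket [FiniteDimensional ℝ E] [FiniteDimensional ℝ V] {p : E × (V →L[ℝ] V)}
    (hp : p ∈ G.Q) {X Y : E × (V →L[ℝ] V) → E × (V →L[ℝ] V)}
    (hX : DifferentiableAt ℝ X p) (hY : DifferentiableAt ℝ Y p)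
    (tX : ∀ᶠ q in 𝓝 p, q ∈ G.Q → G.IsTan q (X q)) (tY : ∀ᶠ q in 𝓝 p, q ∈ G.Q → G.IsTan q (Y q)) :
    G.IsTan p (VectorField.lieBracket ℝ X Y p) := by
  have key1 {c : E × (V →L[ℝ] V) → V →L[ℝ] V} (hc) (h) :=
    G.fderiv_lieBracket_eq_zero hp hX hY tX tY (c := c) hc h
  have key2 {c : E × (V →L[ℝ] V) → ℝ} (hc) (h) :=
    G.fderiv_lieBracket_eq_zero hp hX hY tX tY (c := c) hc h
  rw [← G.fderiv_constraint_eq_zero_iff hp]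
  obtain ⟨c1, c2, c3, c4⟩ := G.contDiffAt_constraint hp.1
  exact ⟨key1 c1 fun q ξ hq h => ((G.fderiv_constraint_eq_zero_iff hq ξ).2 h).1,
    key1 c2 fun q ξ hq h => ((G.fderiv_constraint_eq_zero_iff hq ξ).2 h).2.1,
    key1 c3 fun q ξ hq h => ((G.fderiv_constraint_eq_zero_iff hq ξ).2 h).2.2.1,
    fun u v => key2 (c4 u v) fun q ξ hq h => ((G.fderiv_constraint_eq_zero_iff hq ξ).2 h).2.2.2 u v⟩

end AdaptedGeometry

/-! ### A connection preserving a projection, and its curvature. -/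

section AdaptedConnection
variable {E A : Type*} [NormedAddCommGroup E] [NormedSpace ℝ E] [NormedRing A] [NormedAlgebra ℝ A]

/-- The covariant derivative `∇p` of an endomorphism with derivative `dp`. -/
def covEnd (p : A) (dp : E →L[ℝ] A) (Γ : E →L[ℝ] A) : E →L[ℝ] A :=
  dp + ((ContinuousLinearMap.mul ℝ A).flip p - ContinuousLinearMap.mul ℝ A p) ∘L Γ

/-- The connection `Γ + (2p - 1) ∇p`, which preserves the idempotent `p`. -/
def adaptAux (p : A) (dp : E →L[ℝ] A) (Γ : E →L[ℝ] A) : E →L[ℝ] A :=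
  Γ + ContinuousLinearMap.mul ℝ A (2 * p - 1) ∘L covEnd p dp Γ

theorem covEnd_apply (p : A) (dp Γ : E →L[ℝ] A) (X : E) :
    covEnd p dp Γ X = dp X + (Γ X * p - p * Γ X) := rfl

theorem adaptAux_apply (p : A) (dp Γ : E →L[ℝ] A) (X : E) :
    adaptAux p dp Γ X = Γ X + (2 * p - 1) * (dp X + (Γ X * p - p * Γ X)) := rfl

theorem contDiffAt_adaptAux {Γ : E → E →L[ℝ] A} {p : E → A} {y : E} (hΓ : ContDiffAt ℝ ∞ Γ y)
    (hp : ContDiffAt ℝ ∞ p y) : ContDiffAt ℝ ∞ (fun y => adaptAux (p y) (fderiv ℝ p y) (Γ y)) y :=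
  hΓ.add (((ContinuousLinearMap.mul ℝ A).contDiff.contDiffAt.comp y
    ((contDiffAt_const.mul hp).sub contDiffAt_const)).clm_comp
      ((hp.fderiv_right (by norm_cast)).add (contDiffAt_adAux hΓ hp)))

theorem fderiv_adaptAux {Γ : E → E →L[ℝ] A} {p : E → A} {y : E} (hΓ : ContDiffAt ℝ ∞ Γ y)
    (hp : ContDiffAt ℝ ∞ p y) (X Y : E) :
    fderiv ℝ (fun y => adaptAux (p y) (fderiv ℝ p y) (Γ y)) y X Y =
      fderiv ℝ Γ y X Y + (2 * fderiv ℝ p y X * (fderiv ℝ p y Y + (Γ y Y * p y - p y * Γ y Y)) +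
        (2 * p y - 1) * (fderiv ℝ (fderiv ℝ p) y X Y +
          ((fderiv ℝ Γ y X Y * p y + Γ y Y * fderiv ℝ p y X) -
            (fderiv ℝ p y X * Γ y Y + p y * fderiv ℝ Γ y X Y)))) := by
  have hline : HasDerivAt (fun t : ℝ => y + t • X) X 0 := by
    have := ((hasDerivAt_id (0 : ℝ)).smul_const X).const_add y
    rw [one_smul] at this
    exact this
  have hl0 : y + (0 : ℝ) • X = y := by simp
  have hdp : ContDiffAt ℝ ∞ (fderiv ℝ p) y := hp.fderiv_right (by norm_cast)
  have h1 : HasDerivAt (fun t : ℝ => adaptAux (p (y + t • X)) (fderiv ℝ p (y + t • X))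
      (Γ (y + t • X))) (fderiv ℝ (fun y => adaptAux (p y) (fderiv ℝ p y) (Γ y)) y X) 0 :=
    HasFDerivAt.comp_hasDerivAt (x := (0 : ℝ)) (f := fun t : ℝ => y + t • X)
      (l := fun y => adaptAux (p y) (fderiv ℝ p y) (Γ y)) (by
        rw [hl0]
        exact ((contDiffAt_adaptAux hΓ hp).differentiableAt (by simp)).hasFDerivAt) hline
  have h2 : HasDerivAt (fun t : ℝ => Γ (y + t • X)) (fderiv ℝ Γ y X) 0 :=
    HasFDerivAt.comp_hasDerivAt (x := (0 : ℝ)) (f := fun t : ℝ => y + t • X)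
      (l := Γ) (by rw [hl0]; exact (hΓ.differentiableAt (by simp)).hasFDerivAt) hline
  have h3 : HasDerivAt (fun t : ℝ => p (y + t • X)) (fderiv ℝ p y X) 0 :=
    HasFDerivAt.comp_hasDerivAt (x := (0 : ℝ)) (f := fun t : ℝ => y + t • X)
      (l := p) (by rw [hl0]; exact (hp.differentiableAt (by simp)).hasFDerivAt) hline
  have h4 : HasDerivAt (fun t : ℝ => fderiv ℝ p (y + t • X)) (fderiv ℝ (fderiv ℝ p) y X) 0 :=
    HasFDerivAt.comp_hasDerivAt (x := (0 : ℝ)) (f := fun t : ℝ => y + t • X)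
      (l := fderiv ℝ p) (by rw [hl0]; exact (hdp.differentiableAt (by simp)).hasFDerivAt) hline
  have h5 := h1.clm_apply (hasDerivAt_const (0 : ℝ) Y)
  have h6 := h2.clm_apply (hasDerivAt_const (0 : ℝ) Y)
  have h7 := h4.clm_apply (hasDerivAt_const (0 : ℝ) Y)
  have h8 := h6.add (((h3.const_mul 2).sub_const 1).mul
    (h7.add ((h6.mul h3).sub (h3.mul h6))))
  have h9 := h5.unique h8
  simp only [hl0, map_zero, add_zero, Pi.sub_apply, Pi.mul_apply, Pi.add_apply] at h9
  exact h9

/-- The algebra of `curvature_adaptAux`: a and b are the derivatives of the idempotent p along X and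
Y, G and H the values of Γ there, s the second derivative of p, and u, v the derivatives of Γ. The
hypotheses on a and b come from differentiating p² = p. -/
theorem adapt_ring {R : Type*} [Ring R] {p a b : R} (hp : p * p = p) (ha : a * p = a - p * a)
    (hb : b * p = b - p * b) (G H s u v : R) :
    p * ((u + (2 * a * (b + (H * p - p * H)) + (2 * p - 1) * (s + ((u * p + H * a) -
        (a * H + p * u))))) -
      (v + (2 * b * (a + (G * p - p * G)) + (2 * p - 1) * (s + ((v * p + G * b) -
        (b * G + p * v))))) +
      ((G + (2 * p - 1) * (a + (G * p - p * G))) * (H + (2 * p - 1) * (b + (H * p - p * H))) -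
        (H + (2 * p - 1) * (b + (H * p - p * H))) * (G + (2 * p - 1) * (a + (G * p - p * G))))) * p =
    p * ((u - v + (G * H - H * G)) + ((a + (G * p - p * G)) * (b + (H * p - p * H)) -
      (b + (H * p - p * H)) * (a + (G * p - p * G)))) * p := by
  have hp' : ∀ x, p * (p * x) = p * x := fun x => by rw [← mul_assoc, hp]
  have ha' : ∀ x, a * (p * x) = a * x - p * (a * x) := fun x => by
    rw [← mul_assoc, ha, sub_mul, mul_assoc]
  have hb' : ∀ x, b * (p * x) = b * x - p * (b * x) := fun x => by
    rw [← mul_assoc, hb, sub_mul, mul_assoc]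
  simp only [two_mul, mul_add, add_mul, mul_sub, sub_mul, one_mul, mul_assoc, hp, hp', ha,
    ha', hb, hb']
  abel

/-- The curvature of the adapted connection on the image of `p`. -/
theorem curvature_adaptAux {Γ : E → E →L[ℝ] A} {p : E → A} {y : E} (hΓ : ContDiffAt ℝ ∞ Γ y)
    (hp : ContDiffAt ℝ ∞ p y) (hpp : ∀ᶠ y in 𝓝 y, p y * p y = p y) {Γ' : E → E →L[ℝ] A}
    (hΓ' : Γ' = fun y => adaptAux (p y) (fderiv ℝ p y) (Γ y)) (X Y : E) :
    p y * (fderiv ℝ Γ' y X Y - fderiv ℝ Γ' y Y X + (Γ' y X * Γ' y Y - Γ' y Y * Γ' y X)) * p y =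
    p y * ((fderiv ℝ Γ y X Y - fderiv ℝ Γ y Y X + (Γ y X * Γ y Y - Γ y Y * Γ y X)) +
      (covEnd (p y) (fderiv ℝ p y) (Γ y) X * covEnd (p y) (fderiv ℝ p y) (Γ y) Y -
        covEnd (p y) (fderiv ℝ p y) (Γ y) Y * covEnd (p y) (fderiv ℝ p y) (Γ y) X)) * p y := by
  have hs : IsSymmSndFDerivAt ℝ p y := hp.isSymmSndFDerivAt (by simp; norm_cast)
  have hder : ∀ X, fderiv ℝ p y X * p y = fderiv ℝ p y X - p y * fderiv ℝ p y X := by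
    intro X
    have hd := (hp.differentiableAt (by simp)).hasFDerivAt
    have h1 := hd.mul' hd
    have h2 := h1.unique (hd.congr_of_eventuallyEq hpp)
    have h3 := DFunLike.congr_fun h2 X
    simp only [add_apply, smul_apply, smul_eq_mul, MulOpposite.smul_eq_mul_unop,
      MulOpposite.unop_op] at h3
    rw [eq_sub_iff_add_eq, add_comm]
    exact h3
  subst hΓ'
  simp only [fderiv_adaptAux hΓ hp, adaptAux_apply, covEnd_apply]
  rw [hs.eq Y X]
  exact adapt_ring hpp.self_of_nhds (hder X) (hder Y) _ _ _ _ _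

end AdaptedConnection

/-! ### Local submanifold geometry: normal projection, second fundamental form, Ricci equation. -/

/-- The local form of an immersion with differential `f` into a Riemannian manifold: `g` and `Γ` are
the metric and a metric connection on the pull-back `V` of the tangent bundle. -/
structure LocalImmersion (m k : ℕ) (E V : Type*) [NormedAddCommGroup E] [NormedSpace ℝ E]
    [NormedAddCommGroup V] [NormedSpace ℝ V] where
  U : Set E
  isOpen : IsOpen U
  g : E → V →L[ℝ] V →L[ℝ] ℝ
  f : E → E →L[ℝ] V
  Γ : E → E →L[ℝ] V →L[ℝ] V
  J : E → E →L[ℝ] E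
  oE : Orientation ℝ E (Fin (m * 2))
  oV : Orientation ℝ V (Fin (m * 2 + k * 2))
  contDiff_g : ContDiffOn ℝ ∞ g U
  contDiff_f : ContDiffOn ℝ ∞ f U
  contDiff_Γ : ContDiffOn ℝ ∞ Γ U
  contDiff_J : ContDiffOn ℝ ∞ J U
  g_symm : ∀ y ∈ U, ∀ u v, g y u v = g y v u
  g_pos : ∀ y ∈ U, ∀ u, u ≠ 0 → 0 < g y u u
  f_inj : ∀ y ∈ U, Function.Injective (f y)
  compat : ∀ y ∈ U, ∀ X u v, fderiv ℝ g y X u v = g y (Γ y X u) v + g y u (Γ y X v)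
  J_sq : ∀ y ∈ U, ∀ X, J y (J y X) = -X

namespace LocalImmersion

variable {m k : ℕ} {E V : Type*} [NormedAddCommGroup E] [NormedSpace ℝ E]
    [NormedAddCommGroup V] [NormedSpace ℝ V] (S : LocalImmersion m k E V)

/-- The normal vectors. -/
def IsNormal (y : E) (u : V) : Prop := ∀ X, S.g y (S.f y X) u = 0

/-- The induced metric. -/
def h (y : E) : E →L[ℝ] E →L[ℝ] ℝ :=
  (ContinuousLinearMap.compL ℝ E V ℝ).flip (S.f y) ∘L (S.g y ∘L S.f y)

theorem h_apply (y X Y : E) : S.h y X Y = S.g y (S.f y X) (S.f y Y) := rfl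

/-- The tangential part. -/
def tan (y : E) : V →L[ℝ] E :=
  (S.h y).inverse ∘L ((ContinuousLinearMap.compL ℝ E V ℝ).flip (S.f y) ∘L S.g y)

/-- The orthogonal projection to the normal space. -/
def pr (y : E) : V →L[ℝ] V := 1 - S.f y ∘L S.tan y

/-- Positive orthogonal complex structures. -/
def Pos (y : E) (K : V →L[ℝ] V) : Prop :=
  ∃ (b : Module.Basis (Fin (m * 2)) ℝ E) (c : Module.Basis (Fin (m * 2 + k * 2)) ℝ V),
    b.orientation = S.oE ∧ c.orientation = S.oV ∧
    (∀ i : Fin (m * 2), c (Fin.castAdd (k * 2) i) = S.f y (b i)) ∧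
    (∀ j : Fin (k * 2), S.IsNormal y (c (Fin.natAdd (m * 2) j))) ∧
    ∀ j : Fin k, c (Fin.natAdd (m * 2) (finProdFinEquiv (j, 1))) =
      K (c (Fin.natAdd (m * 2) (finProdFinEquiv (j, 0))))

variable [FiniteDimensional ℝ E] [FiniteDimensional ℝ V]

variable {S} {y : E} (hy : y ∈ S.U)
include hy

theorem isInvertible_g : (S.g y).IsInvertible := isInvertible_of_pos _ (S.g_pos y hy)

theorem isInvertible_h : (S.h y).IsInvertible :=
  isInvertible_of_pos _ fun X hX => S.g_pos y hy _ fun h => hX (S.f_inj y hy (by rw [map_zero]; exact h))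

theorem g_f_tan (u : V) (X : E) : S.g y (S.f y (S.tan y u)) (S.f y X) = S.g y u (S.f y X) := by
  rw [← h_apply]
  simp only [tan, ContinuousLinearMap.comp_apply]
  rw [form_inverse_apply (isInvertible_h hy)]
  rfl

theorem tan_f (X : E) : S.tan y (S.f y X) = X :=
  form_ext (isInvertible_h hy) fun Y => by rw [h_apply, g_f_tan hy, h_apply]

theorem pr_f (X : E) : S.pr y (S.f y X) = 0 := by
  simp [pr, tan_f hy]

theorem isNormal_pr (u : V) : S.IsNormal y (S.pr y u) := by
  intro X
  rw [S.g_symm y hy]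
  simp [pr, g_f_tan hy]

theorem tan_of_isNormal {u : V} (hu : S.IsNormal y u) : S.tan y u = 0 :=
  form_ext (isInvertible_h hy) fun Y => by
    rw [h_apply, g_f_tan hy, S.g_symm y hy, hu Y]; simp

theorem pr_of_isNormal {u : V} (hu : S.IsNormal y u) : S.pr y u = u := by
  simp [pr, tan_of_isNormal hy hu]

theorem isNormal_iff_pr {u : V} : S.IsNormal y u ↔ S.pr y u = u :=
  ⟨pr_of_isNormal hy, fun h => h ▸ isNormal_pr hy u⟩

theorem pr_pr : S.pr y * S.pr y = S.pr y := by
  ext u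
  exact pr_of_isNormal hy (isNormal_pr hy u)

theorem eq_f_of_pr_eq_zero {u : V} (hu : S.pr y u = 0) : u = S.f y (S.tan y u) := by
  simpa [pr, sub_eq_zero] using hu

theorem pr_adj (u v : V) : S.g y (S.pr y u) v = S.g y u (S.pr y v) := by
  have h1 : S.g y (S.pr y u) (S.f y (S.tan y v)) = 0 := by
    rw [S.g_symm y hy]; exact isNormal_pr hy u _
  have h2 : S.g y (S.f y (S.tan y u)) (S.pr y v) = 0 := isNormal_pr hy v _
  have h3 : ∀ w, w = S.pr y w + S.f y (S.tan y w) := fun w => by simp [pr]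
  conv_lhs => rw [h3 v, map_add, h1, add_zero]
  conv_rhs => rw [h3 u, map_add, add_apply, h2, add_zero]

theorem contDiffAt_tan : ContDiffAt ℝ ∞ S.tan y := by
  have hU := S.isOpen.mem_nhds hy
  have hg := S.contDiff_g.contDiffAt hU
  have hf := S.contDiff_f.contDiffAt hU
  have h1 : ContDiffAt ℝ ∞ (fun y => (ContinuousLinearMap.compL ℝ E V ℝ).flip (S.f y)) y :=
    (ContinuousLinearMap.contDiff _).contDiffAt.comp y hf
  have h2 : ContDiffAt ℝ ∞ S.h y := h1.clm_comp (hg.clm_comp hf)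
  obtain ⟨e, he⟩ := isInvertible_h hy
  have h3 : ContDiffAt ℝ ∞ ContinuousLinearMap.inverse (S.h y) := by
    rw [← he]; exact contDiffAt_map_inverse e
  exact (h3.comp y h2).clm_comp (h1.clm_comp hg)

theorem contDiffAt_pr : ContDiffAt ℝ ∞ S.pr y :=
  contDiffAt_const.sub ((S.contDiff_f.contDiffAt (S.isOpen.mem_nhds hy)).clm_comp
    (contDiffAt_tan hy))

omit hy [FiniteDimensional ℝ E] [FiniteDimensional ℝ V] in
variable (S) in
/-- The covariant derivative of the projection. -/
def P (y : E) : E →L[ℝ] V →L[ℝ] V := covEnd (S.pr y) (fderiv ℝ S.pr y) (S.Γ y)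

omit hy [FiniteDimensional ℝ E] [FiniteDimensional ℝ V] in
variable (S) in
/-- The connection which preserves the metric and the normal bundle. -/
def Γ' (y : E) : E →L[ℝ] V →L[ℝ] V := adaptAux (S.pr y) (fderiv ℝ S.pr y) (S.Γ y)

/-- Covariant derivative of the identity p² = p. It implies that `P` interchanges tangent and normal
vectors, so `P` encodes the second fundamental form together with its adjoint. -/
theorem P_anti (X : E) : S.P y X * S.pr y + S.pr y * S.P y X = S.P y X := by
  have hd := ((contDiffAt_pr hy).differentiableAt (by simp)).hasFDerivAt
  have h2 := (hd.mul' hd).unique (hd.congr_of_eventuallyEq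
    (Filter.mem_of_superset (S.isOpen.mem_nhds hy) fun z hz => pr_pr hz))
  have h3 := DFunLike.congr_fun h2 X
  simp only [add_apply, smul_apply, smul_eq_mul, MulOpposite.smul_eq_mul_unop,
    MulOpposite.unop_op] at h3
  have hp := pr_pr hy
  have hp' : ∀ x, S.pr y * (S.pr y * x) = S.pr y * x := fun x => by rw [← mul_assoc, hp]
  rw [P, covEnd_apply]
  conv_rhs => rw [← h3]
  simp only [mul_add, add_mul, mul_sub, sub_mul, mul_assoc, hp, hp']
  abel

/-- Derivative of the self-adjointness of the projection, with respect to a metric connection. -/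
theorem P_adj (X : E) (u v : V) : S.g y (S.P y X u) v = S.g y u (S.P y X v) := by
  have hd := ((contDiffAt_pr hy).differentiableAt (by simp)).hasFDerivAt
  have hg := ((S.contDiff_g.contDiffAt (S.isOpen.mem_nhds hy)).differentiableAt (by simp)).hasFDerivAt
  have h1 := (hg.clm_apply (hd.clm_apply (hasFDerivAt_const u y))).clm_apply (hasFDerivAt_const v y)
  have h2 := (hg.clm_apply (hasFDerivAt_const u y)).clm_apply (hd.clm_apply (hasFDerivAt_const v y))
  have h3 := DFunLike.congr_fun (h1.unique (h2.congr_of_eventuallyEq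
    (Filter.mem_of_superset (S.isOpen.mem_nhds hy) fun z hz => pr_adj hz u v))) X
  simp only [add_apply, ContinuousLinearMap.comp_apply, ContinuousLinearMap.flip_apply, zero_apply,
    map_zero, zero_add, S.compat y hy] at h3
  simp only [P, covEnd_apply, add_apply, sub_apply, mul_apply_eq_comp, map_add, map_sub]
  have e1 := pr_adj hy (S.Γ y X u) v
  have e2 := pr_adj hy u (S.Γ y X v)
  linarith

/-- By `P_anti` the correction (2p - 1)P equals the commutator pP - Pp of two self-adjoint maps. It
is therefore skew, and the connection stays metric. -/
theorem compat' (X : E) (u v : V) :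
    fderiv ℝ S.g y X u v = S.g y (S.Γ' y X u) v + S.g y u (S.Γ' y X v) := by
  rw [S.compat y hy]
  have h1 : S.g y (S.pr y (S.P y X u)) v = S.g y u (S.P y X (S.pr y v)) := by
    rw [pr_adj hy, P_adj hy]
  have h2 := P_adj hy X u v
  have h3 : S.P y X (S.pr y v) + S.pr y (S.P y X v) = S.P y X v := DFunLike.congr_fun (P_anti hy X) v
  have h4 : S.g y u (S.P y X (S.pr y v)) + S.g y u (S.pr y (S.P y X v)) = S.g y u (S.P y X v) := by
    rw [← map_add, h3]
  have h5 : ∀ w, S.Γ' y X w = S.Γ y X w + (2 • S.pr y (S.P y X w) - S.P y X w) := by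
    intro w
    change S.Γ y X w + _ = _
    rw [two_smul]
    congr 1
    have : (2 * S.pr y - 1 : V →L[ℝ] V) * S.P y X = S.pr y * S.P y X + S.pr y * S.P y X - S.P y X := by
      rw [sub_mul, two_mul, add_mul, one_mul]
    exact DFunLike.congr_fun this w
  simp only [h5, map_add, map_sub, add_apply, sub_apply, two_smul]
  linarith

/-- With pPp = 0, the commutator of (2p - 1)P with p is -P, which cancels the covariant derivative
of the projection for Γ. -/
theorem pr_par (X : E) :
    fderiv ℝ S.pr y X + (S.Γ' y X * S.pr y - S.pr y * S.Γ' y X) = 0 := by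
  have hP := P_anti hy X
  have hp := pr_pr hy
  have hp' : ∀ x, S.pr y * (S.pr y * x) = S.pr y * x := fun x => by rw [← mul_assoc, hp]
  have h1 : S.Γ' y X = S.Γ y X + (2 * S.pr y - 1) * S.P y X := rfl
  have h2 : fderiv ℝ S.pr y X = S.P y X - (S.Γ y X * S.pr y - S.pr y * S.Γ y X) := by
    simp [P, covEnd_apply]
  have h3 := eq_sub_of_add_eq hP
  rw [h1, h2]
  simp only [two_mul, mul_add, add_mul, mul_sub, sub_mul, mul_assoc, hp', one_mul, h3]
  abel

/-- The curvature of the connection. -/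
theorem pr_curv_pr (X Y : E) : S.pr y * (fderiv ℝ S.Γ' y X Y - fderiv ℝ S.Γ' y Y X +
      (S.Γ' y X * S.Γ' y Y - S.Γ' y Y * S.Γ' y X)) * S.pr y =
    S.pr y * ((fderiv ℝ S.Γ y X Y - fderiv ℝ S.Γ y Y X + (S.Γ y X * S.Γ y Y - S.Γ y Y * S.Γ y X)) +
      (S.P y X * S.P y Y - S.P y Y * S.P y X)) * S.pr y :=
  curvature_adaptAux (S.contDiff_Γ.contDiffAt (S.isOpen.mem_nhds hy)) (contDiffAt_pr hy)
    (Filter.mem_of_superset (S.isOpen.mem_nhds hy) fun _ hz => pr_pr hz) rfl X Y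

/-- Derivative of the identity `pr` ∘ f = 0: on tangent vectors `P` is minus the second fundamental
form. -/
theorem P_f (X Z : E) : S.P y X (S.f y Z) =
    -S.pr y (fderiv ℝ S.f y X Z + S.Γ y X (S.f y Z)) := by
  have hd := ((contDiffAt_pr hy).differentiableAt (by simp)).hasFDerivAt
  have hf := ((S.contDiff_f.contDiffAt (S.isOpen.mem_nhds hy)).differentiableAt (by simp)).hasFDerivAt
  have h1 := hd.clm_apply (hf.clm_apply (hasFDerivAt_const Z y))
  have h2 := DFunLike.congr_fun (h1.unique ((hasFDerivAt_const (0 : V) y).congr_of_eventuallyEq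
    (Filter.mem_of_superset (S.isOpen.mem_nhds hy) fun z hz => pr_f hz Z))) X
  simp only [add_apply, ContinuousLinearMap.comp_apply, ContinuousLinearMap.flip_apply, zero_apply,
    map_zero, zero_add] at h2
  simp only [P, covEnd_apply, add_apply, sub_apply, mul_apply_eq_comp, pr_f hy, map_zero, zero_sub,
    map_add, neg_add]
  rw [eq_neg_of_add_eq_zero_right h2]

/-- The expansion of a scalar product of tangent vectors in an orthonormal frame. -/
theorem g_tangent_frame {ι : Type*} [Fintype ι] [DecidableEq ι] {Z : ι → E}
    (hc : Fintype.card ι = Module.finrank ℝ E)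
    (hZ : ∀ a b, S.g y (S.f y (Z a)) (S.f y (Z b)) = if a = b then 1 else 0) (X Y : E) :
    S.g y (S.f y X) (S.f y Y) = ∑ a, S.g y (S.f y X) (S.f y (Z a)) * S.g y (S.f y Y) (S.f y (Z a)) := by
  have hli : LinearIndependent ℝ Z := by
    rw [Fintype.linearIndependent_iff]
    intro c hc a
    have h1 : S.g y (S.f y (∑ i, c i • Z i)) (S.f y (Z a)) = 0 := by rw [hc]; simp
    simpa [hZ] using h1
  let b := Module.Basis.mk hli (hli.span_eq_top_of_card_eq_finrank' hc).ge
  obtain ⟨c, hc⟩ : ∃ c : ι → ℝ, X = ∑ i, c i • Z i :=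
    ⟨b.repr X, by
    have := (b.sum_repr X).symm
    simpa only [b, Module.Basis.mk_apply] using this⟩
  subst hc
  simp [hZ, S.g_symm y hy (S.f y Y)]

theorem P_normal {u : V} (hu : S.IsNormal y u) (X : E) : S.pr y (S.P y X u) = 0 := by
  have h : S.P y X (S.pr y u) + S.pr y (S.P y X u) = S.P y X u := DFunLike.congr_fun (P_anti hy X) u
  rw [pr_of_isNormal hy hu] at h
  simpa using h

/-- The Gauss equation for the adapted connection on the normal bundle. -/
theorem g_curv_normal {ι : Type*} [Fintype ι] [DecidableEq ι] {Z : ι → E}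
    (hc : Fintype.card ι = Module.finrank ℝ E)
    (hZ : ∀ a b, S.g y (S.f y (Z a)) (S.f y (Z b)) = if a = b then 1 else 0) (X Y : E) {u v : V}
    (hu : S.IsNormal y u) (hv : S.IsNormal y v) :
    S.g y ((fderiv ℝ S.Γ' y X Y - fderiv ℝ S.Γ' y Y X +
      (S.Γ' y X * S.Γ' y Y - S.Γ' y Y * S.Γ' y X)) u) v =
    S.g y ((fderiv ℝ S.Γ y X Y - fderiv ℝ S.Γ y Y X + (S.Γ y X * S.Γ y Y - S.Γ y Y * S.Γ y X)) u) v
    - ∑ a, (S.g y (fderiv ℝ S.f y X (Z a) + S.Γ y X (S.f y (Z a))) u *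
          S.g y (fderiv ℝ S.f y Y (Z a) + S.Γ y Y (S.f y (Z a))) v -
        S.g y (fderiv ℝ S.f y Y (Z a) + S.Γ y Y (S.f y (Z a))) u *
          S.g y (fderiv ℝ S.f y X (Z a) + S.Γ y X (S.f y (Z a))) v) := by
  have key : ∀ B C : V →L[ℝ] V, S.pr y * B * S.pr y = S.pr y * C * S.pr y →
      S.g y (B u) v = S.g y (C u) v := by
    intro B C h
    have e : ∀ B : V →L[ℝ] V, S.g y (B u) v = S.g y ((S.pr y * B * S.pr y) u) v := fun B => by
      simp only [mul_apply_eq_comp]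
      rw [pr_of_isNormal hy hu, pr_adj hy, pr_of_isNormal hy hv]
    rw [e B, h, ← e C]
  have h1 : ∀ X {u}, S.IsNormal y u → ∀ Z, S.g y (S.P y X u) (S.f y Z) =
      -S.g y (fderiv ℝ S.f y X Z + S.Γ y X (S.f y Z)) u := by
    intro X u hu Z
    rw [P_adj hy, P_f hy, map_neg, ← pr_adj hy, pr_of_isNormal hy hu, S.g_symm y hy]
  -- `P` maps normal vectors to tangent ones, so the product of two such images can be expanded in
  -- the tangent frame Z. The commutator of `P` along X and Y thus contributes -A.
  have h2 : ∀ X Y, S.g y (S.P y X (S.P y Y u)) v =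
      ∑ a, S.g y (fderiv ℝ S.f y Y (Z a) + S.Γ y Y (S.f y (Z a))) u *
        S.g y (fderiv ℝ S.f y X (Z a) + S.Γ y X (S.f y (Z a))) v := by
    intro X Y
    rw [P_adj hy, eq_f_of_pr_eq_zero hy (P_normal hy hu Y),
      eq_f_of_pr_eq_zero hy (P_normal hy hv X), g_tangent_frame hy hc hZ]
    refine Finset.sum_congr rfl fun a _ => ?_
    rw [← eq_f_of_pr_eq_zero hy (P_normal hy hu Y), ← eq_f_of_pr_eq_zero hy (P_normal hy hv X),
      h1 _ hu, h1 _ hv, neg_mul_neg]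
  rw [key _ _ (pr_curv_pr hy X Y)]
  simp only [add_apply, sub_apply, mul_apply_eq_comp, map_add, map_sub, h2, Finset.sum_sub_distrib]
  abel

end LocalImmersion

/-! ### Orientations, and positivity under conjugation. -/

section Orientations
variable {V : Type*} [NormedAddCommGroup V] [NormedSpace ℝ V] [FiniteDimensional ℝ V]

theorem eventually_det_pos {T : ℝ → V →L[ℝ] V} (hT : ContinuousAt T 0) (h0 : T 0 = 1) :
    ∀ᶠ t in 𝓝 0, 0 < (T t).det := by
  have h1 : ContinuousAt (fun t => (T t).det) 0 :=
    ContinuousLinearMap.continuous_det.continuousAt.comp hT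
  have h2 : (T 0).det = 1 := by rw [h0]; exact LinearMap.det_id
  exact h1.eventually (isOpen_Ioi.mem_nhds (h2.symm ▸ one_pos :))

/-- The image of a basis by a map with positive determinant. -/
theorem exists_basis_of_det_pos {ι : Type*} [Fintype ι] [DecidableEq ι] (b : Module.Basis ι ℝ V)
    {T : V →L[ℝ] V} (hT : 0 < T.det) :
    ∃ b' : Module.Basis ι ℝ V, b'.orientation = b.orientation ∧ ∀ i, b' i = T (b i) := by
  have hu : IsUnit (LinearMap.det (T : V →ₗ[ℝ] V)) := hT.ne'.isUnit
  let e := LinearEquiv.ofIsUnitDet (f := (T : V →ₗ[ℝ] V)) (v := b) (v' := b)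
    (by rw [LinearMap.det_toMatrix]; exact hu)
  refine ⟨b.map e, ?_, fun i => rfl⟩
  symm
  rw [Module.Basis.orientation_eq_iff_det_pos]
  have : b.det (b.map e) = LinearMap.det (T : V →ₗ[ℝ] V) := by
    have := b.det_comp (T : V →ₗ[ℝ] V) b
    rw [b.det_self, mul_one] at this
    exact this
  rw [this]
  exact hT

theorem isUnit_of_det_pos {T : V →L[ℝ] V} (hT : 0 < T.det) : IsUnit T := by
  rw [ContinuousLinearMap.isUnit_iff_isUnit_toLinearMap, LinearMap.isUnit_iff_isUnit_det]
  exact hT.ne'.isUnit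

end Orientations

namespace LocalImmersion

variable {m k : ℕ} {E V : Type*} [NormedAddCommGroup E] [NormedSpace ℝ E]
    [NormedAddCommGroup V] [NormedSpace ℝ V] (S : LocalImmersion m k E V)
variable [FiniteDimensional ℝ E] [FiniteDimensional ℝ V]

/-- The two bases that witness positivity are pushed forward, the one of V by T and the one of E by
the map that T induces on tangent vectors. Positive determinants keep both orientations. -/
theorem pos_of_det_pos {y y' : E} (hy : y ∈ S.U) (hy' : y' ∈ S.U) {T : V →L[ℝ] V}
    (hT : T * S.pr y = S.pr y' * T) (hd : 0 < T.det) (hd' : 0 < (S.tan y' ∘L T ∘L S.f y).det)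
    {K : V →L[ℝ] V} (hK : S.Pos y K) : S.Pos y' (T * K * Ring.inverse T) := by
  obtain ⟨b, c, hb, hc, h1, h2, h3⟩ := hK
  obtain ⟨b', hb', h4⟩ := exists_basis_of_det_pos b hd'
  obtain ⟨c', hc', h5⟩ := exists_basis_of_det_pos c hd
  have hT' : ∀ u, T (S.pr y u) = S.pr y' (T u) := DFunLike.congr_fun hT
  refine ⟨b', c', hb'.trans hb, hc'.trans hc, fun i => ?_, fun j => ?_, fun j => ?_⟩
  · rw [h5, h4, h1]
    refine eq_f_of_pr_eq_zero hy' ?_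
    rw [← hT', pr_f hy, map_zero]
  · rw [isNormal_iff_pr hy', h5, ← hT', pr_of_isNormal hy (h2 j)]
  · rw [h5, h5, h3]
    simp only [mul_apply_eq_comp]
    congr 2
    have := Ring.inverse_mul_cancel T (isUnit_of_det_pos hd)
    exact (DFunLike.congr_fun this _).symm

/-- The associated geometry of the normal bundle. -/
def adapted : AdaptedGeometry E V where
  U := S.U
  isOpen := S.isOpen
  g := S.g
  pr := S.pr
  Γ := S.Γ'
  J := S.J
  Pos := S.Pos
  contDiff_g := S.contDiff_g
  contDiff_pr := fun _ hy => (contDiffAt_pr hy).contDiffWithinAt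
  contDiff_Γ := fun _ hy => (contDiffAt_adaptAux
    (S.contDiff_Γ.contDiffAt (S.isOpen.mem_nhds hy)) (contDiffAt_pr hy)).contDiffWithinAt
  contDiff_J := S.contDiff_J
  g_symm := S.g_symm
  g_pos := S.g_pos
  pr_idem := fun _ hy => pr_pr hy
  pr_adj := fun _ hy => pr_adj hy
  compat := fun _ hy => compat' hy
  pr_par := fun _ hy => pr_par hy
  J_sq := S.J_sq
  pos_transport := by
    intro c T hc hT h0 hT1 hpr K hK
    have e1 : ∀ᶠ t in 𝓝 (0 : ℝ), c t ∈ S.U := hc.eventually (S.isOpen.mem_nhds h0)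
    have h2 : ContinuousAt (fun t => S.tan (c t) ∘L T t ∘L S.f (c 0)) 0 := by
      have := (contDiffAt_tan h0).continuousAt
      have h3 : ContinuousAt (fun t => S.tan (c t)) 0 := ContinuousAt.comp this hc
      exact h3.clm_comp (hT.clm_comp continuousAt_const)
    have h3 : S.tan (c 0) ∘L T 0 ∘L S.f (c 0) = 1 := by
      ext X
      simp [hT1, tan_f h0]
    -- Both determinants are continuous and equal to 1 at t = 0.
    filter_upwards [hpr, e1, eventually_det_pos hT hT1, eventually_det_pos h2 h3]
      with t h4 h5 h6 h7
    exact S.pos_of_det_pos h0 h5 h4 h6 h7 hK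

end LocalImmersion

/-! ### Changing the sign of a complex structure on a complex plane. -/

section Rotation
variable {V : Type*} [NormedAddCommGroup V] [NormedSpace ℝ V] (B : V →L[ℝ] V →L[ℝ] ℝ)

/-- The orthogonal projection to the span of the orthonormal system `u`. -/
def frameProj (u : Fin 4 → V) : V →L[ℝ] V :=
  (B (u 0)).smulRight (u 0) + (B (u 1)).smulRight (u 1) + (B (u 2)).smulRight (u 2) +
    (B (u 3)).smulRight (u 3)

/-- The infinitesimal rotation `u 0 ↦ u 1 ↦ -u 0`, `u 2 ↦ -u 3`, `u 3 ↦ u 2`. -/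
def frameRot (u : Fin 4 → V) : V →L[ℝ] V :=
  (B (u 0)).smulRight (u 1) - (B (u 1)).smulRight (u 0) - (B (u 2)).smulRight (u 3) +
    (B (u 3)).smulRight (u 2)

variable {B} (hs : ∀ u v, B u v = B v u) {u : Fin 4 → V}
  (hu : ∀ i j, B (u i) (u j) = if i = j then 1 else 0)

theorem frameProj_apply (w : V) : frameProj B u w =
    B (u 0) w • u 0 + B (u 1) w • u 1 + B (u 2) w • u 2 + B (u 3) w • u 3 := rfl

theorem frameRot_apply (w : V) : frameRot B u w =
    B (u 0) w • u 1 - B (u 1) w • u 0 - B (u 2) w • u 3 + B (u 3) w • u 2 := rfl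

include hu in
theorem frameRot_basis : frameRot B u (u 0) = u 1 ∧ frameRot B u (u 1) = -u 0 ∧
    frameRot B u (u 2) = -u 3 ∧ frameRot B u (u 3) = u 2 := by
  simp [frameRot_apply, hu]

include hu in
theorem frameProj_basis (i : Fin 4) : frameProj B u (u i) = u i := by
  fin_cases i <;> simp [frameProj_apply, hu]

include hu in
theorem frameProj_mul_frameRot : frameProj B u * frameRot B u = frameRot B u := by
  ext w
  simp only [mul_apply_eq_comp, frameRot_apply, map_add, map_sub, map_smul, frameProj_basis hu]

include hu in
theorem frameProj_mul_self : frameProj B u * frameProj B u = frameProj B u := by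
  ext w
  rw [mul_apply_eq_comp]
  conv_lhs => rw [frameProj_apply (w := w)]
  simp only [map_add, map_smul, frameProj_basis hu]
  rw [frameProj_apply]

include hu in
theorem frameRot_mul_frameProj : frameRot B u * frameProj B u = frameRot B u := by
  obtain ⟨h0, h1, h2, h3⟩ := frameRot_basis hu
  ext w
  simp only [mul_apply_eq_comp, frameProj_apply, map_add, map_smul, h0, h1, h2, h3]
  rw [frameRot_apply]
  module

include hu in
theorem frameRot_mul_self : frameRot B u * frameRot B u = -frameProj B u := by
  obtain ⟨h0, h1, h2, h3⟩ := frameRot_basis hu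
  ext w
  rw [mul_apply_eq_comp]
  conv_lhs => rw [frameRot_apply (w := w)]
  simp only [map_add, map_sub, map_smul, h0, h1, h2, h3]
  change _ = -frameProj B u w
  rw [frameProj_apply]
  module

include hs in
theorem frameProj_adj (x y : V) : B (frameProj B u x) y = B x (frameProj B u y) := by
  simp only [frameProj_apply, map_add, map_smul, add_apply, smul_apply, smul_eq_mul, hs x]
  ring

include hs in
theorem frameRot_adj (x y : V) : B (frameRot B u x) y = -B x (frameRot B u y) := by
  simp only [frameRot_apply, map_add, map_sub, map_smul, add_apply, sub_apply, smul_apply,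
    smul_eq_mul, hs x]
  ring

variable (B u) in
/-- The rotation by a right angle. -/
def rotation : V →L[ℝ] V := 1 - frameProj B u + frameRot B u

variable (B u) in
/-- The inverse rotation. -/
def rotationInv : V →L[ℝ] V := 1 - frameProj B u - frameRot B u

include hu in
theorem rotation_mul_rotationInv : rotation B u * rotationInv B u = 1 := by
  simp only [rotation, rotationInv, add_mul, mul_sub, sub_mul, mul_one, one_mul,
    frameProj_mul_frameRot hu, frameProj_mul_self hu, frameRot_mul_frameProj hu,
    frameRot_mul_self hu]
  abel

include hu in
theorem rotationInv_mul_rotation : rotationInv B u * rotation B u = 1 := by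
  simp only [rotation, rotationInv, mul_add, mul_sub, sub_mul, mul_one, one_mul,
    frameProj_mul_frameRot hu, frameProj_mul_self hu, frameRot_mul_frameProj hu,
    frameRot_mul_self hu]
  abel

include hs hu in
theorem rotation_isometry (x y : V) : B (rotation B u x) (rotation B u y) = B x y := by
  have h1 : ∀ x y, B (rotation B u x) y = B x (rotationInv B u y) := by
    intro x y
    simp only [rotation, rotationInv, add_apply, sub_apply, map_add, map_sub, one_apply_eq_self,
      frameProj_adj hs, frameRot_adj hs]
    ring
  rw [h1, ← mul_apply_eq_comp, rotationInv_mul_rotation hu]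
  rfl

variable [FiniteDimensional ℝ V]

-- The rotation is the square of the rotation S by half the angle, in which cos 45° = sin 45° =
-- 1/√2. Its determinant is thus a square, and it is nonzero by invertibility.
include hu in
theorem rotation_det_pos : 0 < (rotation B u).det := by
  let s : ℝ := (√2)⁻¹
  have hs2 : s * s = 1 / 2 := by
    simp only [s, ← mul_inv, Real.mul_self_sqrt (zero_le_two), one_div]
  let S : V →L[ℝ] V := 1 - frameProj B u + s • (frameProj B u + frameRot B u)
  have h1 : S * S = rotation B u := by
    simp only [S, rotation, mul_add, add_mul, mul_sub, sub_mul, mul_one, one_mul, smul_mul_assoc,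
      mul_smul_comm, smul_smul, smul_add, hs2, frameProj_mul_frameRot hu, frameProj_mul_self hu,
      frameRot_mul_frameProj hu, frameRot_mul_self hu]
    module
  have hm : ∀ A C : V →L[ℝ] V, (A * C).det = A.det * C.det := fun A C =>
    LinearMap.det_comp (A : V →ₗ[ℝ] V) (C : V →ₗ[ℝ] V)
  have h2 : (rotation B u).det * (rotationInv B u).det = 1 := by
    rw [← hm, rotation_mul_rotationInv hu]
    exact LinearMap.det_id
  have h3 : (rotation B u).det ≠ 0 := left_ne_zero_of_mul_eq_one h2
  have h4 : 0 ≤ (rotation B u).det := by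
    rw [← h1, hm]
    exact mul_self_nonneg _
  exact lt_of_le_of_ne h4 h3.symm

end Rotation

namespace LocalImmersion

variable {m k : ℕ} {E V : Type*} [NormedAddCommGroup E] [NormedSpace ℝ E]
    [NormedAddCommGroup V] [NormedSpace ℝ V] (S : LocalImmersion m k E V)
variable [FiniteDimensional ℝ E] [FiniteDimensional ℝ V]

/-- Any positive orthogonal complex structure may be replaced by its opposite on a complex
two-dimensional subspace. -/
theorem exists_switch {y : E} {K : V →L[ℝ] V} (hK : (y, K) ∈ S.adapted.Q) {u v : V}
    (hu : S.IsNormal y u) (hv : S.IsNormal y v) (huu : S.g y u u = 1) (hvv : S.g y v v = 1)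
    (huv : S.g y u v = 0) (hKuv : S.g y (K u) v = 0) :
    ∃ K', (y, K') ∈ S.adapted.Q ∧ K' u = -K u ∧ K' v = -K v := by
  obtain ⟨hy, h1, h2, h3, h4, h5⟩ := id hK
  simp only at hy h1 h2 h3 h4 h5
  have hy' : y ∈ S.U := hy
  have hs := S.g_symm y hy
  have hKK : ∀ {w}, S.IsNormal y w → K (K w) = -w := fun {w} hw => by
    have : K (K w) = -S.pr y w := DFunLike.congr_fun h3 w
    rw [this, pr_of_isNormal hy' hw]
  have hKg : ∀ {x w}, S.IsNormal y w → S.g y (K x) (K w) = S.g y x w := fun {x w} hw => by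
    have : S.g y (K x) (K w) = -S.g y x (K (K w)) := h4 _ _
    rw [this, hKK hw, map_neg, neg_neg]
  have hskew : ∀ x w, S.g y (K x) w = -S.g y x (K w) := h4
  have hself : ∀ x, S.g y (K x) x = 0 := fun x => by
    have := hskew x x
    rw [hs x] at this
    linarith
  have hKn : ∀ w, S.IsNormal y (K w) := fun w => by
    rw [isNormal_iff_pr hy']; exact DFunLike.congr_fun h1 w
  have hvKu : S.g y u (K v) = 0 := by
    have := hskew u v
    rw [hKuv] at this; linarith
  let e : Fin 4 → V := ![u, v, K u, K v]
  have he : ∀ i j, S.g y (e i) (e j) = if i = j then 1 else 0 := by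
    intro i j
    fin_cases i <;> fin_cases j <;>
      simp [e, huu, hvv, huv, hs v u, hKg hu, hKg hv, hKuv, hself, hs u (K u), hs v (K v),
        hs v (K u), hvKu, hs (K v) u]
  have hen : ∀ i, S.IsNormal y (e i) := by
    intro i
    fin_cases i
    exacts [hu, hv, hKn u, hKn v]
  -- T turns u to v and Ku to -Kv, so on the span of these four vectors it anticommutes with K;
  -- conjugation by T changes K to -K there. Elsewhere T is the identity, and its determinant is
  -- positive, so positivity is kept.
  let T := rotation (S.g y) e
  have hd : 0 < T.det := rotation_det_pos he
  have hTu := isUnit_of_det_pos hd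
  have hif : ∀ i X, S.g y (e i) (S.f y X) = 0 := fun i X => by rw [hs]; exact hen i X
  have hTf : ∀ X, T (S.f y X) = S.f y X := by
    intro X
    simp [T, rotation, frameProj_apply, frameRot_apply, hif]
  have hpre : ∀ i, S.pr y (e i) = e i := fun i => pr_of_isNormal hy' (hen i)
  have hTpr : T * S.pr y = S.pr y * T := by
    ext w
    have e1 : ∀ i, S.g y (e i) (S.pr y w) = S.g y (e i) w := fun i => by
      rw [← pr_adj hy', hpre]
    simp only [mul_apply_eq_comp, T, rotation, add_apply, sub_apply, one_apply_eq_self,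
      frameProj_apply, frameRot_apply, e1, map_add, map_sub, map_smul, hpre]
  have hTg := rotation_isometry hs he
  have hinv : Ring.inverse T = rotationInv (S.g y) e := by
    have h6 := Ring.inverse_mul_cancel T hTu
    calc Ring.inverse T = Ring.inverse T * (T * rotationInv (S.g y) e) := by
          rw [rotation_mul_rotationInv he, mul_one]
      _ = _ := by rw [← mul_assoc, h6, one_mul]
  have hmem := S.adapted.conj_mem_Q (y' := y) hK hy hTu hTpr hTg
    (S.pos_of_det_pos hy hy hTpr hd (by
      have : S.tan y ∘L T ∘L S.f y = 1 := by
        ext X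
        simp [hTf, tan_f hy']
      rw [this]
      have h6 : (1 : E →L[ℝ] E).det = 1 := LinearMap.det_id
      exact h6.symm ▸ one_pos) h5)
  obtain ⟨r0, r1, r2, r3⟩ := frameRot_basis he
  have p0 := frameProj_basis he
  refine ⟨_, hmem, ?_, ?_⟩
  · have i0 : rotationInv (S.g y) e u = -v := by
      have : rotationInv (S.g y) e (e 0) = -e 1 := by
        simp [rotationInv, p0, r0]
      exact this
    have i1 : T (K v) = K u := by
      have : rotation (S.g y) e (e 3) = e 2 := by
        simp [rotation, p0, r3]
      exact this
    rw [hinv, mul_apply_eq_comp, mul_apply_eq_comp, i0, map_neg, map_neg, i1]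
  · have i0 : rotationInv (S.g y) e v = u := by
      have : rotationInv (S.g y) e (e 1) = e 0 := by
        simp [rotationInv, p0, r1]
      exact this
    have i1 : T (K u) = -K v := by
      have : rotation (S.g y) e (e 2) = -e 3 := by
        simp [rotation, p0, r2]
      exact this
    rw [hinv, mul_apply_eq_comp, mul_apply_eq_comp, i0, i1]

/-- A condition on all isotropic spaces is equivalent to the one on all conjugate isotropic
spaces. -/
theorem switch_condition {y : E} (H₁ H₂ : V →L[ℝ] V →L[ℝ] ℝ) (s₁ : ∀ u v, H₁ u v = -H₁ v u)
    (s₂ : ∀ u v, H₂ u v = -H₂ v u)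
    (h : ∀ K, (y, K) ∈ S.adapted.Q → ∀ u v, S.IsNormal y u → S.IsNormal y v →
      H₁ u v - H₁ (K u) (K v) + H₂ u (K v) + H₂ (K u) v = 0) {K : V →L[ℝ] V}
    (hK : (y, K) ∈ S.adapted.Q) {u v : V} (hu : S.IsNormal y u) (hv : S.IsNormal y v) :
    H₁ u v - H₁ (K u) (K v) - H₂ u (K v) - H₂ (K u) v = 0 := by
  obtain ⟨hy, h1, h2, h3, h4, h5⟩ := id hK
  simp only at hy h1 h2 h3 h4 h5
  have hy' : y ∈ S.U := hy
  have hs := S.g_symm y hy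
  have hKK : ∀ {w}, S.IsNormal y w → K (K w) = -w := fun {w} hw => by
    have : K (K w) = -S.pr y w := DFunLike.congr_fun h3 w
    rw [this, pr_of_isNormal hy' hw]
  have hskew : ∀ x w, S.g y (K x) w = -S.g y x (K w) := h4
  have hKg : ∀ {x w}, S.IsNormal y w → S.g y (K x) (K w) = S.g y x w := fun {x w} hw => by
    rw [hskew, hKK hw, map_neg, neg_neg]
  have hself : ∀ x, S.g y (K x) x = 0 := fun x => by
    have := hskew x x
    rw [hs x] at this
    linarith
  have z₁ : ∀ w, H₁ w w = 0 := fun w => by have := s₁ w w; linarith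
  have z₂ : ∀ w, H₂ w w = 0 := fun w => by have := s₂ w w; linarith
  have hn_add : ∀ {a b}, S.IsNormal y a → S.IsNormal y b → S.IsNormal y (a + b) :=
    fun ha hb X => by rw [map_add, ha X, hb X, add_zero]
  have hn_smul : ∀ (c : ℝ) {a}, S.IsNormal y a → S.IsNormal y (c • a) :=
    fun c {a} ha X => by rw [map_smul, ha X, smul_zero]
  have hKn : ∀ w, S.IsNormal y (K w) := fun w => by
    rw [isNormal_iff_pr hy']; exact DFunLike.congr_fun h1 w
  -- F is the form of the hypothesis with K replaced by -K, that is, evaluated on the conjugate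
  -- isotropic space.
  let F : V → V → ℝ := fun u v => H₁ u v - H₁ (K u) (K v) - H₂ u (K v) - H₂ (K u) v
  have Fadd : ∀ u v w, F u (v + w) = F u v + F u w := fun u v w => by
    simp only [F, map_add]; ring
  have Fsmul : ∀ u (c : ℝ) v, F u (c • v) = c * F u v := fun u c v => by
    simp only [F, map_smul, smul_eq_mul]; ring
  have Fsmul' : ∀ u (c : ℝ) v, F (c • u) v = c * F u v := fun u c v => by
    simp only [F, map_smul, smul_apply, smul_eq_mul]; ring
  -- By skew-symmetry F vanishes on the pairs (u, u) and (u, Ku). Multiples of u and Ku may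
  -- therefore be added to the second argument.
  have F1 : ∀ {u}, F u u = 0 := fun {u} => by
    simp only [F, z₁, s₂ u (K u)]; ring
  have F2 : ∀ {u}, S.IsNormal y u → F u (K u) = 0 := fun {u} hu => by
    simp only [F, hKK hu, z₂, s₁ u (K u), map_neg]; ring
  -- For an orthonormal pair with Ku orthogonal to v, the hypothesis for the switched structure,
  -- which is -K on u and v, is the claim for K.
  have base : ∀ {u v}, S.IsNormal y u → S.IsNormal y v → S.g y u u = 1 → S.g y v v = 1 →
      S.g y u v = 0 → S.g y (K u) v = 0 → F u v = 0 := by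
    intro u v hu hv a b c d
    obtain ⟨K', hK', e1, e2⟩ := S.exists_switch hK hu hv a b c d
    have := h K' hK' u v hu hv
    rw [e1, e2] at this
    simp only [map_neg, neg_apply, neg_neg] at this
    linarith
  have unit : ∀ {w}, S.IsNormal y w → w ≠ 0 →
      ∃ (c : ℝ) (w' : V), S.IsNormal y w' ∧ w = c • w' ∧ S.g y w' w' = 1 := by
    intro w hw hw0
    have hp := S.g_pos y hy w hw0
    have hq : √(S.g y w w) ≠ 0 := (Real.sqrt_pos.2 hp).ne'
    refine ⟨√(S.g y w w), (√(S.g y w w))⁻¹ • w, hn_smul _ hw, ?_, ?_⟩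
    · rw [smul_smul, mul_inv_cancel₀ hq, one_smul]
    · simp only [map_smul, smul_apply, smul_eq_mul]
      rw [← mul_assoc, ← mul_inv, Real.mul_self_sqrt hp.le, inv_mul_cancel₀ hp.ne']
  change F u v = 0
  by_cases hu0 : u = 0
  · simp [F, hu0]
  obtain ⟨c, u', hu', rfl, hu1⟩ := unit hu hu0
  rw [Fsmul']
  suffices F u' v = 0 by rw [this, mul_zero]
  -- The component of v orthogonal to u' and Ku'; after normalization the case of orthonormal pairs
  -- applies. If it is zero, as always for a normal plane, there is nothing left to prove.
  let w := v + ((-S.g y u' v) • u' + (-S.g y (K u') v) • K u')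
  have hw : S.IsNormal y w := hn_add hv (hn_add (hn_smul _ hu') (hn_smul _ (hKn _)))
  have hFw : F u' w = F u' v := by
    simp only [w, Fadd, Fsmul, F1, F2 hu', mul_zero, add_zero]
  rw [← hFw]
  by_cases hw0 : w = 0
  · simp [F, hw0]
  have g1 : S.g y u' w = 0 := by
    simp only [w, map_add, map_smul, smul_eq_mul, hu1, hs u' (K u'), hself]; ring
  have g2 : S.g y (K u') w = 0 := by
    simp only [w, map_add, map_smul, smul_eq_mul, hKg hu', hu1, hself]; ring
  obtain ⟨c', w', hw', e, hw1⟩ := unit hw hw0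
  have hc' : c' ≠ 0 := by rintro rfl; exact hw0 (by rw [e, zero_smul])
  rw [e] at g1 g2 ⊢
  rw [map_smul, smul_eq_mul, mul_eq_zero, or_iff_right hc'] at g1 g2
  rw [Fsmul, base hu' hw' hu1 hw1 g1 g2, mul_zero]

end LocalImmersion

namespace AdaptedGeometry
variable {E V : Type*} [NormedAddCommGroup E] [NormedSpace ℝ E]
    [NormedAddCommGroup V] [NormedSpace ℝ V] (G : AdaptedGeometry E V)

/-- The curvature of a metric connection is skew-symmetric. -/
theorem g_curv_skew {y : E} (hy : y ∈ G.U) (X Y : E) (u v : V) :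
    G.g y (G.curv y X Y u) v = -G.g y u (G.curv y X Y v) := by
  have hU := G.isOpen.mem_nhds hy
  have hgc := G.contDiff_g.contDiffAt hU
  have hg := (hgc.differentiableAt (by simp)).hasFDerivAt
  have hΓ := ((G.contDiff_Γ.contDiffAt hU).differentiableAt (by simp)).hasFDerivAt
  let q : E → ℝ := fun z => G.g z u v
  have hq : ∀ z ∈ G.U, HasFDerivAt q ((fderiv ℝ G.g z).flip u |>.flip v) z := fun z hz =>
    HasFDerivAt.congr_fderiv
    (((((G.contDiff_g.contDiffAt (G.isOpen.mem_nhds hz)).differentiableAt (by simp)).hasFDerivAt).clm_apply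
      (hasFDerivAt_const u z)).clm_apply (hasFDerivAt_const v z)) (by ext; simp)
  have hqc : ContDiffAt ℝ ∞ q y := (hgc.clm_apply contDiffAt_const).clm_apply contDiffAt_const
  have hs : IsSymmSndFDerivAt ℝ q y := hqc.isSymmSndFDerivAt (by simp; norm_cast)
  have hdq := ((hqc.fderiv_right (m := 1) (by norm_cast)).differentiableAt (by simp)).hasFDerivAt
  -- Differentiating the compatibility with the metric gives the second derivative of g(u, v) for
  -- constant u and v. Its symmetry in X and Y is the skew-symmetry of the curvature.
  have key : ∀ X Y, fderiv ℝ (fderiv ℝ q) y X Y =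
      G.g y (G.Γ y X (G.Γ y Y u)) v + G.g y (G.Γ y Y u) (G.Γ y X v) +
        G.g y (fderiv ℝ G.Γ y X Y u) v + (G.g y (G.Γ y X u) (G.Γ y Y v) +
        G.g y u (G.Γ y X (G.Γ y Y v)) + G.g y u (fderiv ℝ G.Γ y X Y v)) := by
    intro X Y
    have hc : ∀ w : V, HasFDerivAt (fun _ : E => w) (0 : E →L[ℝ] V) y := fun w =>
      hasFDerivAt_const w y
    have hΓY := hΓ.clm_apply (hasFDerivAt_const Y y)
    have h1 := hdq.clm_apply (hasFDerivAt_const Y y)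
    have h2 := (hg.clm_apply (hΓY.clm_apply (hc u))).clm_apply (hc v)
    have h3 := (hg.clm_apply (hc u)).clm_apply (hΓY.clm_apply (hc v))
    have h4 := DFunLike.congr_fun (h1.unique ((h2.add h3).congr_of_eventuallyEq
      (Filter.mem_of_superset hU fun z hz => by
        change fderiv ℝ q z Y = _
        rw [(hq z hz).fderiv]
        exact G.compat z hz Y u v))) X
    simp only [add_apply, ContinuousLinearMap.comp_apply, ContinuousLinearMap.flip_apply,
      zero_apply, map_zero, zero_add, G.compat y hy] at h4
    linarith
  have k1 := key X Y
  have k2 := key Y X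
  rw [hs.eq Y X] at k2
  simp only [curv, add_apply, sub_apply, mul_apply_eq_comp, map_add, map_sub]
  linarith

end AdaptedGeometry

/-! ### Adapted frames and nonemptiness of the fibres. -/

/-- Existence of orthonormal bases. -/
theorem exists_orthonormal_basis {W : Type*} [AddCommGroup W] [Module ℝ W] [FiniteDimensional ℝ W]
    (B : LinearMap.BilinForm ℝ W) (hs : ∀ u v, B u v = B v u) (hp : ∀ u, u ≠ 0 → 0 < B u u) {n : ℕ}
    (hn : Module.finrank ℝ W = n) :
    ∃ b : Module.Basis (Fin n) ℝ W, ∀ i j, B (b i) (b j) = if i = j then 1 else 0 := by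
  subst hn
  obtain ⟨v, hv⟩ := LinearMap.BilinForm.exists_orthogonal_basis (B := B) ⟨fun u v => by simpa using hs u v⟩
  have hq : ∀ i, √(B (v i) (v i)) ≠ 0 := fun i => (Real.sqrt_pos.2 (hp _ (v.ne_zero i))).ne'
  refine ⟨v.unitsSMul fun i => (Units.mk0 _ (hq i))⁻¹, fun i j => ?_⟩
  simp only [Module.Basis.unitsSMul_apply, Units.smul_def, Units.val_inv_eq_inv_val, Units.val_mk0,
    map_smul, LinearMap.smul_apply, smul_eq_mul]
  split_ifs with h
  · subst h
    rw [← mul_assoc, ← mul_inv, Real.mul_self_sqrt (hp _ (v.ne_zero i)).le,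
      inv_mul_cancel₀ (hp _ (v.ne_zero i)).ne']
  · have : B (v i) (v j) = 0 := hv h
    rw [this]; simp

namespace LocalImmersion

variable {m k : ℕ} {E V : Type*} [NormedAddCommGroup E] [NormedSpace ℝ E]
    [NormedAddCommGroup V] [NormedSpace ℝ V] (S : LocalImmersion m k E V)
variable [FiniteDimensional ℝ E] [FiniteDimensional ℝ V]

theorem exists_frame {y : E} (hy : y ∈ S.U) (hE : Module.finrank ℝ E = m * 2) :
    ∃ Z : Fin (m * 2) → E, ∀ a b, S.g y (S.f y (Z a)) (S.f y (Z b)) = if a = b then 1 else 0 := by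
  obtain ⟨b, hb⟩ := exists_orthonormal_basis
    ((ContinuousLinearMap.coeLM ℝ).comp (S.h y : E →ₗ[ℝ] E →L[ℝ] ℝ))
    (fun u v => S.g_symm y hy _ _)
    (fun u hu => S.g_pos y hy _ fun h => hu (S.f_inj y hy (by rw [map_zero]; exact h))) hE
  exact ⟨b, hb⟩

/-- A positive basis adapted to the immersion. -/
theorem exists_adapted_basis {y : E} (hy : y ∈ S.U) (hE : Module.finrank ℝ E = m * 2)
    (hV : Module.finrank ℝ V = m * 2 + k * 2) (hk : k ≠ 0) (b : Module.Basis (Fin (m * 2)) ℝ E) :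
    ∃ c : Module.Basis (Fin (m * 2 + k * 2)) ℝ V, c.orientation = S.oV ∧
      (∀ i : Fin (m * 2), c (Fin.castAdd (k * 2) i) = S.f y (b i)) ∧
      (∀ j : Fin (k * 2), S.IsNormal y (c (Fin.natAdd (m * 2) j))) ∧
      ∀ i j : Fin (k * 2), S.g y (c (Fin.natAdd (m * 2) i)) (c (Fin.natAdd (m * 2) j)) =
        if i = j then 1 else 0 := by
  let NS : Submodule ℝ V := LinearMap.ker (S.tan y : V →ₗ[ℝ] E)
  have hNS : ∀ u : V, u ∈ NS → S.IsNormal y u := fun u hu => by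
    rw [isNormal_iff_pr hy]
    have : S.tan y u = 0 := hu
    simp [pr, this]
  have hfr : Module.finrank ℝ NS = k * 2 := by
    have h1 := LinearMap.finrank_range_add_finrank_ker (S.tan y : V →ₗ[ℝ] E)
    have h2 : LinearMap.range (S.tan y : V →ₗ[ℝ] E) = ⊤ :=
      LinearMap.range_eq_top.2 fun X => ⟨S.f y X, tan_f hy X⟩
    rw [h2, finrank_top, hE, hV] at h1
    change m * 2 + Module.finrank ℝ NS = _ at h1
    omega
  obtain ⟨n, hn⟩ := exists_orthonormal_basis (W := NS)
    (((ContinuousLinearMap.coeLM ℝ).comp (S.g y : V →ₗ[ℝ] V →L[ℝ] ℝ)).compl₁₂ NS.subtype NS.subtype)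
    (fun u v => S.g_symm y hy _ _)
    (fun u hu => S.g_pos y hy _ fun h => hu (Subtype.ext h)) hfr
  have hn' : ∀ i j, S.g y (n i) (n j) = if i = j then 1 else 0 := hn
  let c₀ : Fin (m * 2 + k * 2) → V := Fin.addCases (fun i => S.f y (b i)) fun j => (n j : V)
  have hspan : ⊤ ≤ Submodule.span ℝ (Set.range c₀) := by
    intro u _
    have h1 : u = S.f y (S.tan y u) + S.pr y u := by simp [pr]
    rw [h1]
    have hpr : S.pr y u ∈ NS := tan_of_isNormal hy (isNormal_pr hy u)
    refine Submodule.add_mem _ ?_ ?_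
    · rw [← b.sum_repr (S.tan y u), map_sum]
      refine Submodule.sum_mem _ fun i _ => ?_
      rw [map_smul]
      exact Submodule.smul_mem _ _ (Submodule.subset_span ⟨Fin.castAdd _ i, by simp [c₀]⟩)
    · have h2 := congrArg NS.subtype (n.sum_repr ⟨S.pr y u, hpr⟩)
      rw [map_sum] at h2
      change _ = S.pr y u at h2
      rw [← h2]
      refine Submodule.sum_mem _ fun i _ => ?_
      rw [map_smul]
      exact Submodule.smul_mem _ _ (Submodule.subset_span ⟨Fin.natAdd _ i, by simp [c₀]⟩)
  have hli : LinearIndependent ℝ c₀ :=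
    linearIndependent_of_top_le_span_of_card_eq_finrank hspan (by simp [hV])
  let c₁ := Module.Basis.mk hli hspan
  have hc1 : ∀ i, c₁ (Fin.castAdd (k * 2) i) = S.f y (b i) := fun i => by simp [c₁, c₀]
  have hc2 : ∀ j, c₁ (Fin.natAdd (m * 2) j) = n j := fun j => by simp [c₁, c₀]
  let j₀ : Fin (k * 2) := ⟨0, by omega⟩
  -- A basis with the wrong orientation is corrected by reversing one normal vector; one exists
  -- since k ≠ 0.
  rcases c₁.orientation_eq_or_eq_neg S.oV with ho | ho
  · refine ⟨c₁, ho.symm, hc1, fun j => ?_, fun i j => ?_⟩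
    · rw [hc2]; exact hNS _ (n j).2
    · rw [hc2, hc2, hn']
  · have hval : ∀ j, ∃ ε : ℝ, ε * ε = 1 ∧ (c₁.unitsSMul (Function.update 1 (Fin.natAdd (m * 2) j₀) (-1)))
        (Fin.natAdd (m * 2) j) = ε • (n j : V) := by
      intro j
      rw [Module.Basis.unitsSMul_apply, hc2]
      by_cases h : j = j₀
      · subst h
        exact ⟨-1, by norm_num, by simp⟩
      · refine ⟨1, by norm_num, ?_⟩
        rw [Function.update_of_ne (fun h' => h (Fin.natAdd_injective _ _ h'))]
        simp
    choose ε hε hval using hval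
    refine ⟨c₁.unitsSMul (Function.update 1 (Fin.natAdd (m * 2) j₀) (-1)), ?_, fun i => ?_,
      fun j X => ?_, fun i j => ?_⟩
    · rw [c₁.orientation_neg_single, ho]
    · rw [Module.Basis.unitsSMul_apply, hc1, Function.update_of_ne]
      · simp
      · intro h
        have := congrArg Fin.val h
        simp at this
        omega
    · rw [hval, map_smul, hNS _ (n j).2 X, smul_zero]
    · rw [hval, hval, map_smul, map_smul, smul_apply, hn']
      split_ifs with h
      · subst h; simp [hε]
      · simp

/-- The vectors of a positive orthonormal normal frame are grouped in pairs, and K is the rotation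
by a right angle in each of the planes so obtained. -/
theorem exists_mem_Q {y : E} (hy : y ∈ S.U) (hE : Module.finrank ℝ E = m * 2)
    (hV : Module.finrank ℝ V = m * 2 + k * 2) (hk : k ≠ 0) (b : Module.Basis (Fin (m * 2)) ℝ E)
    (hb : b.orientation = S.oE) : ∃ K, (y, K) ∈ S.adapted.Q := by
  obtain ⟨c, hc, c1, c2, c3⟩ := S.exists_adapted_basis hy hE hV hk b
  obtain ⟨e, he⟩ : ∃ e : Fin k × Fin 2 ≃ Fin (k * 2), e = finProdFinEquiv := ⟨_, rfl⟩
  let w : Fin k × Fin 2 → V := fun j => c (Fin.natAdd (m * 2) (e j))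
  have hw : ∀ i j, S.g y (w i) (w j) = if i = j then 1 else 0 := fun i j => by
    simp only [w, c3, e.injective.eq_iff]
  -- The second index in a pair is 0 or 1, and 1 - ε is the other one: K maps the vector of index 0
  -- to that of index 1, and the latter to minus the former.
  let K : V →L[ℝ] V := LinearMap.toContinuousLinearMap (c.constr ℝ (Fin.addCases (fun _ => 0)
    fun j => (![1, -1] (e.symm j).2 : ℝ) •
      w ((e.symm j).1, 1 - (e.symm j).2)))
  have K1 : ∀ i, K (S.f y (b i)) = 0 := fun i => by
    rw [← c1]; simp [K]
  have K2 : ∀ j, K (w j) = (![1, -1] j.2 : ℝ) • w (j.1, 1 - j.2) := fun j => by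
    simp [K, w]
  have hwn : ∀ j, S.IsNormal y (w j) := fun j => c2 _
  have hpr1 : ∀ i, S.pr y (S.f y (b i)) = 0 := fun i => pr_f hy _
  have hpr2 : ∀ j, S.pr y (w j) = w j := fun j => pr_of_isNormal hy (hwn j)
  have hext : ∀ A B : V →L[ℝ] V, (∀ i, A (S.f y (b i)) = B (S.f y (b i))) →
      (∀ j, A (w j) = B (w j)) → A = B := by
    intro A B h1 h2
    have : (A : V →ₗ[ℝ] V) = B := by
      refine c.ext fun i => ?_
      refine Fin.addCases (fun i => ?_) (fun j => ?_) i
      · rw [c1]; exact h1 i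
      · have := h2 (e.symm j)
        simpa [w] using this
    exact ContinuousLinearMap.coe_injective this
  refine ⟨K, hy, ?_, ?_, ?_, ?_, ?_⟩
  · exact hext _ _ (fun i => by simp [K1]) fun j => by
      change S.pr y (K (w j)) = K (w j)
      rw [K2, map_smul, hpr2]
  · exact hext _ _ (fun i => by
      change K (S.pr y _) = _
      rw [hpr1, map_zero, K1]) fun j => by
      change K (S.pr y (w j)) = K (w j)
      rw [hpr2]
  · refine hext _ _ (fun i => ?_) fun j => ?_
    · change K (K _) = -S.pr y _
      rw [K1, hpr1, map_zero, neg_zero]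
    · change K (K _) = -S.pr y _
      rw [hpr2, K2, map_smul, K2, smul_smul]
      obtain ⟨j, ε⟩ := j
      fin_cases ε <;> simp
  · let A : LinearMap.BilinForm ℝ V := ((ContinuousLinearMap.coeLM ℝ).comp
      (S.g y : V →ₗ[ℝ] V →L[ℝ] ℝ)).compl₁₂ (K : V →ₗ[ℝ] V) LinearMap.id
    let B : LinearMap.BilinForm ℝ V := -((ContinuousLinearMap.coeLM ℝ).comp
      (S.g y : V →ₗ[ℝ] V →L[ℝ] ℝ)).compl₁₂ LinearMap.id (K : V →ₗ[ℝ] V)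
    have hAB : A = B := by
      have hcw : ∀ j, c (Fin.natAdd (m * 2) j) = w (e.symm j) := fun j => by simp [w]
      refine c.ext fun i => c.ext fun j => ?_
      change S.g y (K (c i)) (c j) = -S.g y (c i) (K (c j))
      refine Fin.addCases (fun i => ?_) (fun i => ?_) i <;>
        refine Fin.addCases (fun j => ?_) (fun j => ?_) j
      · rw [c1, c1, K1, K1]; simp
      · rw [c1, hcw, K1, K2, map_smul, hwn]; simp
      · rw [c1, hcw, K1, K2, map_smul, smul_apply, S.g_symm y hy, hwn]; simp
      · rw [hcw, hcw, K2, K2]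
        simp only [map_smul, smul_apply, smul_eq_mul, hw]
        generalize e.symm i = i'
        generalize e.symm j = j'
        obtain ⟨i, ε⟩ := i'
        obtain ⟨j, ε'⟩ := j'
        fin_cases ε <;> fin_cases ε' <;> by_cases h : i = j <;> simp [h]
    intro u v
    exact LinearMap.congr_fun (LinearMap.congr_fun hAB u) v
  · refine ⟨b, c, hb, hc, c1, c2, fun j => ?_⟩
    rw [← he]
    have := (K2 (j, 0)).symm
    simpa [w] using this

/-! ### The integrability criterion in the local model. -/

/-- The obstruction to the integrability. -/
def obstruction (y : E) (K : V →L[ℝ] V) (X Y : E) (u v : V) : ℝ :=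
  S.g y (S.adapted.curvRe y X Y u) v - S.g y (S.adapted.curvRe y X Y (K u)) (K v) +
    S.g y (S.adapted.curvIm y X Y u) (K v) + S.g y (S.adapted.curvIm y X Y (K u)) v

/-- The right-hand side is the real part of the curvature on X + iJX and Y + iJY, applied to u - iKu
and paired with v - iKv, hence on the conjugate of q. The imaginary part is minus the real part for
Kv in place of v, so the real part suffices when all normal v are allowed. -/
theorem g_comm_eq_obstruction {y : E} {K : V →L[ℝ] V} (hK : (y, K) ∈ S.adapted.Q) (X Y : E)
    {u v : V} (hv : S.IsNormal y v) :
    S.g y (((S.adapted.curvIm y X Y * K - K * S.adapted.curvIm y X Y) +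
      K * (S.adapted.curvRe y X Y * K - K * S.adapted.curvRe y X Y)) u) v =
    S.obstruction y K X Y u v := by
  obtain ⟨hy, h1, h2, h3, h4, h5⟩ := id hK
  simp only at hy h1 h2 h3 h4 h5
  have hy' : y ∈ S.U := hy
  have h6 : ∀ w, K (K w) = -S.pr y w := DFunLike.congr_fun h3
  have h4' : ∀ u w, S.g y (K u) w = -S.g y u (K w) := h4
  have h7 : ∀ w, S.g y (S.pr y w) v = S.g y w v := fun w => by
    rw [pr_adj hy', pr_of_isNormal hy' hv]
  simp only [add_apply, sub_apply, mul_apply_eq_comp, map_add, map_sub, h6, obstruction,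
    sub_neg_eq_add, h7, h4']
  ring

/-- The local form of the integrability condition. -/
theorem lieBracket_iff {p : E × (V →L[ℝ] V)} (hp : p ∈ S.adapted.Q)
    {X₁ X₂ Y₁ Y₂ : E × (V →L[ℝ] V) → E × (V →L[ℝ] V)}
    (hX₁ : DifferentiableAt ℝ X₁ p) (hX₂ : DifferentiableAt ℝ X₂ p)
    (hY₁ : DifferentiableAt ℝ Y₁ p) (hY₂ : DifferentiableAt ℝ Y₂ p)
    (tX : ∀ᶠ q in 𝓝 p, q ∈ S.adapted.Q → S.adapted.IsTan q (X₁ q) ∧ S.adapted.cs q (X₁ q) = X₂ q)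
    (tY : ∀ᶠ q in 𝓝 p, q ∈ S.adapted.Q → S.adapted.IsTan q (Y₁ q) ∧ S.adapted.cs q (Y₁ q) = Y₂ q) :
    let A := VectorField.lieBracket ℝ X₁ Y₁ p - VectorField.lieBracket ℝ X₂ Y₂ p
    let B := VectorField.lieBracket ℝ X₁ Y₂ p + VectorField.lieBracket ℝ X₂ Y₁ p
    S.adapted.IsTan p A ∧ S.adapted.IsTan p B ∧ (S.adapted.cs p A = B ↔
      S.adapted.nijJ p.1 (X₁ p).1 (Y₁ p).1 = 0 ∧ ∀ u v, S.IsNormal p.1 u → S.IsNormal p.1 v →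
        S.obstruction p.1 p.2 (X₁ p).1 (Y₁ p).1 u v = 0) := by
  intro A B
  have tX' : ∀ᶠ q in 𝓝 p, q ∈ S.adapted.Q → S.adapted.IsTan q (X₂ q) :=
    tX.mono fun q h hq => (h hq).2 ▸ (h hq).1.cs _ hq
  have tY' : ∀ᶠ q in 𝓝 p, q ∈ S.adapted.Q → S.adapted.IsTan q (Y₂ q) :=
    tY.mono fun q h hq => (h hq).2 ▸ (h hq).1.cs _ hq
  have tX₁ : ∀ᶠ q in 𝓝 p, q ∈ S.adapted.Q → S.adapted.IsTan q (X₁ q) := tX.mono fun q h hq => (h hq).1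
  have tY₁ : ∀ᶠ q in 𝓝 p, q ∈ S.adapted.Q → S.adapted.IsTan q (Y₁ q) := tY.mono fun q h hq => (h hq).1
  have b11 := S.adapted.isTan_lieBracket hp hX₁ hY₁ tX₁ tY₁
  have b22 := S.adapted.isTan_lieBracket hp hX₂ hY₂ tX' tY'
  have b12 := S.adapted.isTan_lieBracket hp hX₁ hY₂ tX₁ tY'
  have b21 := S.adapted.isTan_lieBracket hp hX₂ hY₁ tX' tY₁
  -- `cs` preserves tangent vectors, and -ξ is its square applied to ξ.
  have hneg : ∀ {ξ}, S.adapted.IsTan p ξ → S.adapted.IsTan p (-ξ) := fun {ξ} h => by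
    rw [← S.adapted.cs_cs hp h]; exact (h.cs _ hp).cs _ hp
  have hA : S.adapted.IsTan p A := b11.sub _ hp b22
  have hB : S.adapted.IsTan p B := by
    have := b12.sub _ hp (hneg b21)
    rwa [sub_neg_eq_add] at this
  refine ⟨hA, hB, ?_⟩
  have mem : ∀ {X : E × (V →L[ℝ] V) → E × (V →L[ℝ] V)},
      (∀ᶠ q in 𝓝 p, q ∈ S.adapted.Q → S.adapted.IsTan q (X q)) → X p ∈ curveTan S.adapted.Q p :=
    fun h => (S.adapted.mem_curveTan_iff hp).2 (h.self_of_nhds hp)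
  -- The defect of the bracket from being of the right type is the Nijenhuis expression of `cs`;
  -- only the values of the four fields at p enter it.
  have hN := lieBracket_sub_of_eqOn ((S.adapted.contDiffAt_cs hp.1).differentiableAt (by simp))
    hX₁ hX₂ hY₁ hY₂ (mem tX₁) (mem tX') (mem tY₁) (mem tY')
    (tX.mono fun q h hq => (h hq).2)
    (tX.mono fun q h hq => by rw [← (h hq).2, S.adapted.cs_cs hq (h hq).1])
    (tY.mono fun q h hq => (h hq).2)
    (tY.mono fun q h hq => by rw [← (h hq).2, S.adapted.cs_cs hq (h hq).1])
  have eX := (tX.self_of_nhds hp).2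
  have eY := (tY.self_of_nhds hp).2
  have hN2 := S.adapted.nijenhuis_cs hp (tX₁.self_of_nhds hp) (tY₁.self_of_nhds hp)
  rw [eX, eY] at hN2
  rw [hN2] at hN
  change B - S.adapted.cs p A = _ at hN
  have hdiff : S.adapted.IsTan p (B - S.adapted.cs p A) := hB.sub _ hp (hA.cs _ hp)
  rw [eq_comm, ← sub_eq_zero]
  set n := S.adapted.nijJ p.1 (X₁ p).1 (Y₁ p).1 with hn
  have aux : ∀ a b c d : V →L[ℝ] V, -(a - b) - c - d + (a - b) = -(c + d) := fun a b c d => by abel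
  have hcov : S.adapted.cov p (B - S.adapted.cs p A) =
      -((S.adapted.curvIm p.1 (X₁ p).1 (Y₁ p).1 * p.2 -
        p.2 * S.adapted.curvIm p.1 (X₁ p).1 (Y₁ p).1) +
      p.2 * (S.adapted.curvRe p.1 (X₁ p).1 (Y₁ p).1 * p.2 -
        p.2 * S.adapted.curvRe p.1 (X₁ p).1 (Y₁ p).1)) := by
    rw [hN]
    exact aux _ _ _ _
  have h1 : (B - S.adapted.cs p A).1 = n := by rw [hN]
  have hp' : (p.1, p.2) ∈ S.adapted.Q := hp
  have hy : p.1 ∈ S.U := hp.1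
  constructor
  · intro h0
    rw [h0] at hcov h1
    refine ⟨h1.symm, fun u v hu hv => ?_⟩
    have h4 := (neg_eq_iff_eq_neg.2 hcov).symm
    rw [show S.adapted.cov p 0 = 0 by simp [AdaptedGeometry.cov], neg_zero] at h4
    rw [← S.g_comm_eq_obstruction hp' _ _ hv, h4]
    simp
  · rintro ⟨h2, h3⟩
    -- The covariant derivative along a tangent vector is unchanged by `pr` on either side, so
    -- testing it on normal vectors is enough.
    have hC : S.adapted.cov p (B - S.adapted.cs p A) = 0 := by
      ext u
      refine form_ext (isInvertible_g hy) fun v => ?_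
      rw [← hdiff.1, ← hdiff.2.1]
      change S.g p.1 (S.pr p.1 (S.adapted.cov p (B - S.adapted.cs p A) (S.pr p.1 u))) v = _
      have h5 := S.g_comm_eq_obstruction hp' (X₁ p).1 (Y₁ p).1 (u := S.pr p.1 u) (isNormal_pr hy v)
      rw [h3 _ _ (isNormal_pr hy u) (isNormal_pr hy v), ← neg_eq_iff_eq_neg.2 hcov] at h5
      rw [pr_adj hy]
      simpa using h5
    refine S.adapted.ext_cov p (h1.trans h2) ?_
    rw [hC]
    simp [AdaptedGeometry.cov]

end LocalImmersion

/-! ### Tangent vectors, brackets and submanifolds in charts. -/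

section Coordinates
variable {F : Type*} [NormedAddCommGroup F] [NormedSpace ℝ F] {H : Type*} [TopologicalSpace H]
  (I : ModelWithCorners ℝ F H) {P : Type*} [TopologicalSpace P] [ChartedSpace H P]
  [IsManifold I ∞ P]

/-- The coordinates at `x` of tangent vectors in the chart at `x₀`. -/
def tcoord (x₀ x : P) : TangentSpace I x →L[ℝ] F :=
  (trivializationAt F (TangentSpace I : P → Type _) x₀).continuousLinearMapAt ℝ x

/-- The tangent vectors with given coordinates. -/
def tvec (x₀ x : P) : F →L[ℝ] TangentSpace I x :=
  (trivializationAt F (TangentSpace I : P → Type _) x₀).symmL ℝ x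

variable {I} {x₀ x : P}

theorem mem_baseSet_iff :
    x ∈ (trivializationAt F (TangentSpace I : P → Type _) x₀).baseSet ↔ x ∈ (chartAt H x₀).source := by
  rw [TangentBundle.trivializationAt_baseSet]

theorem mem_baseSet (hx : x ∈ (chartAt H x₀).source) :
    x ∈ (trivializationAt F (TangentSpace I : P → Type _) x₀).baseSet := mem_baseSet_iff.2 hx

theorem trivializationAt_apply_eq_tcoord (hx : x ∈ (chartAt H x₀).source) (ξ : TangentSpace I x) :
    trivializationAt F (TangentSpace I : P → Type _) x₀ ⟨x, ξ⟩ = (x, tcoord I x₀ x ξ) := by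
  rw [tcoord]
  exact ((trivializationAt F (TangentSpace I : P → Type _) x₀).apply_eq_prod_continuousLinearEquivAt ℝ
    x (mem_baseSet hx) ξ).trans (by
      rw [← Trivialization.coe_continuousLinearEquivAt_eq _ (mem_baseSet hx)])

theorem tvec_tcoord (hx : x ∈ (chartAt H x₀).source) (ξ : TangentSpace I x) :
    tvec I x₀ x (tcoord I x₀ x ξ) = ξ :=
  (trivializationAt F (TangentSpace I : P → Type _) x₀).symmL_continuousLinearMapAt (mem_baseSet hx) ξ

theorem tcoord_tvec (hx : x ∈ (chartAt H x₀).source) (v : F) :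
    tcoord I x₀ x (tvec I x₀ x v) = v :=
  (trivializationAt F (TangentSpace I : P → Type _) x₀).continuousLinearMapAt_symmL (mem_baseSet hx) v

theorem tcoord_injective (hx : x ∈ (chartAt H x₀).source) : Function.Injective (tcoord I x₀ x) :=
  Function.LeftInverse.injective (tvec_tcoord hx)

theorem tcoord_eq_mfderiv (hx : x ∈ (chartAt H x₀).source) :
    tcoord I x₀ x = mfderiv I 𝓘(ℝ, F) (extChartAt I x₀) x :=
  TangentBundle.continuousLinearMapAt_trivializationAt (I := I) hx

theorem tcoord_self (x : P) (ξ : TangentSpace I x) : tcoord I x x ξ = ξ := by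
  have h := TangentBundle.continuousLinearMapAt_trivializationAt_eq_core (I := I)
    (mem_chart_source H x)
  have h2 := (tangentBundleCore I P).coordChange_self (achart H x) x (mem_chart_source H x) ξ
  have h3 := DFunLike.congr_fun h ξ
  exact h3.trans h2

section
variable [I.Boundaryless]

theorem isSmoothField_contDiffAt {X : ∀ z : P, TangentSpace I z} (hX : IsSmoothField I X) {y : F}
    (hy : y ∈ (extChartAt I x₀).target) :
    ContDiffAt ℝ ∞ (fun y => tcoord I x₀ ((extChartAt I x₀).symm y) (X ((extChartAt I x₀).symm y))) y := by
  have hs : (extChartAt I x₀).symm y ∈ (chartAt H x₀).source := by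
    rw [← extChartAt_source I]; exact (extChartAt I x₀).map_target hy
  have h1 := ((trivializationAt F (TangentSpace I : P → Type _) x₀).contMDiffAt_section_iff
    (mem_baseSet hs)).1 (hX ((extChartAt I x₀).symm y))
  have h2 : ContMDiffAt 𝓘(ℝ, F) I ∞ (extChartAt I x₀).symm y :=
    (contMDiffOn_extChartAt_symm x₀).contMDiffAt ((isOpen_extChartAt_target x₀).mem_nhds hy)
  have h3 := (h1.comp y h2).contDiffAt
  refine h3.congr_of_eventuallyEq ?_
  filter_upwards [(isOpen_extChartAt_target (I := I) x₀).mem_nhds hy] with z hz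
  have hs : (extChartAt I x₀).symm z ∈ (chartAt H x₀).source := by
    rw [← extChartAt_source I]; exact (extChartAt I x₀).map_target hz
  rw [Function.comp_apply, trivializationAt_apply_eq_tcoord hs]

theorem contMDiffAt_tvec {X : F → F} (hx : x ∈ (chartAt H x₀).source)
    (hX : ContDiffAt ℝ ∞ X (extChartAt I x₀ x)) :
    ContMDiffAt I I.tangent ∞ (fun z => (TotalSpace.mk' F z (tvec I x₀ z (X (extChartAt I x₀ z))) :
      TangentBundle I P)) x := by
  rw [(trivializationAt F (TangentSpace I : P → Type _) x₀).contMDiffAt_section_iff (mem_baseSet hx)]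
  have h1 : ContMDiffAt I 𝓘(ℝ, F) ∞ (fun z => X (extChartAt I x₀ z)) x :=
    hX.contMDiffAt.comp x ((contMDiffAt_extChartAt' hx))
  refine h1.congr_of_eventuallyEq ?_
  filter_upwards [(chartAt H x₀).open_source.mem_nhds hx] with z hz
  rw [trivializationAt_apply_eq_tcoord hz, tcoord_tvec hz]

/-- The bracket on a manifold is defined by pulling back with the inverse of the chart at the point
x itself; near x this pull-back is the coordinate expression of the field. -/
theorem tcoord_mlieBracket (X Y : ∀ z : P, TangentSpace I z) :
    tcoord I x x (VectorField.mlieBracket I X Y x) = VectorField.lieBracket ℝ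
      (fun y => tcoord I x ((extChartAt I x).symm y) (X ((extChartAt I x).symm y)))
      (fun y => tcoord I x ((extChartAt I x).symm y) (Y ((extChartAt I x).symm y)))
      (extChartAt I x x) := by
  have key : ∀ X : ∀ z : P, TangentSpace I z,
      (VectorField.mpullbackWithin 𝓘(ℝ, F) I (extChartAt I x).symm X (Set.range I)) =ᶠ[𝓝 (extChartAt I x x)]
      (fun y => tcoord I x ((extChartAt I x).symm y) (X ((extChartAt I x).symm y)) : F → F) := by
    intro X
    filter_upwards [extChartAt_target_mem_nhds (I := I) x] with y hy
    have hs : (extChartAt I x).symm y ∈ (chartAt H x).source := by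
      rw [← extChartAt_source I]; exact (extChartAt I x).map_target hy
    rw [VectorField.mpullbackWithin_apply]
    obtain ⟨e, he⟩ := isInvertible_mfderivWithin_extChartAt_symm (I := I) hy
    rw [← he, ContinuousLinearMap.inverse_equiv, tcoord_eq_mfderiv hs]
    have h2 := mfderiv_extChartAt_comp_mfderivWithin_extChartAt_symm (I := I) hy
    rw [← he] at h2
    have h3 : mfderiv I 𝓘(ℝ, F) (extChartAt I x) ((extChartAt I x).symm y)
      (e (e.symm (X ((extChartAt I x).symm y)))) = e.symm (X ((extChartAt I x).symm y)) :=
      DFunLike.congr_fun h2 (e.symm (X ((extChartAt I x).symm y)))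
    rw [e.apply_symm_apply] at h3
    exact h3.symm
  rw [← VectorField.mlieBracketWithin_univ, VectorField.mlieBracketWithin_apply]
  have hx := mem_chart_source H x
  rw [tcoord_eq_mfderiv hx]
  obtain ⟨e, he⟩ := isInvertible_mfderiv_extChartAt (I := I) (mem_extChartAt_source (I := I) x)
  rw [← he, ContinuousLinearMap.inverse_equiv]
  have : (extChartAt I x).symm ⁻¹' Set.univ ∩ Set.range I = Set.univ := by
    rw [I.range_eq_univ]; simp
  rw [this]
  refine (e.apply_symm_apply _).trans ?_
  refine (congrFun (VectorField.lieBracketWithin_univ (𝕜 := ℝ) (E := F)) _).trans ?_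
  exact (key X).lieBracket_vectorField_eq (key Y)

/-- Curves in Q never leave the target of the chart, so they pull back globally. Curves in S lie in
the chart only for small times, which is all that `mem_curveTan` requires. -/
theorem mem_tangentTo_iff {S : Set P} {Q : Set F} (hx : x ∈ (chartAt H x₀).source)
    (hQ : Q ⊆ (extChartAt I x₀).target)
    (hS : ∀ᶠ z in 𝓝 x, z ∈ S → extChartAt I x₀ z ∈ Q)
    (hS' : ∀ y ∈ Q, (extChartAt I x₀).symm y ∈ S) {ξ : TangentSpace I x} :
    ξ ∈ tangentTo I S x ↔ tcoord I x₀ x ξ ∈ curveTan Q (extChartAt I x₀ x) := by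
  have hx' : x ∈ (extChartAt I x₀).source := by rwa [extChartAt_source]
  constructor
  · intro h
    suffices tangentTo I S x ≤ (curveTan Q (extChartAt I x₀ x)).comap (tcoord I x₀ x).toLinearMap from
      this h
    refine Submodule.span_le.2 ?_
    rintro _ ⟨γ, hγ, hγS, rfl, rfl⟩
    change tcoord I x₀ (γ 0) (mfderiv 𝓘(ℝ, ℝ) I γ 0 (1 : ℝ)) ∈ curveTan Q _
    refine mem_curveTan (c := fun t => extChartAt I x₀ (γ t)) ?_ rfl ?_
    · filter_upwards [(hγ 0).continuousAt.eventually hS,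
        (hγ 0).continuousAt.eventually ((chartAt H x₀).open_source.mem_nhds hx)] with t h1 h2
      exact ⟨((contMDiffAt_extChartAt' h2).comp t (hγ t)).contDiffAt, h1 (hγS t)⟩
    · have h1 : MDifferentiableAt I 𝓘(ℝ, F) (extChartAt I x₀) (γ 0) := mdifferentiableAt_extChartAt hx
      have h2 : MDifferentiableAt 𝓘(ℝ, ℝ) I γ 0 := (hγ 0).mdifferentiableAt (by simp)
      have h3 := mfderiv_comp (0 : ℝ) h1 h2
      rw [tcoord_eq_mfderiv hx]
      have h4 := DFunLike.congr_fun h3 (1 : ℝ)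
      rw [mfderiv_eq_fderiv] at h4
      exact h4
  · intro h
    rw [← tvec_tcoord hx ξ]
    suffices curveTan Q (extChartAt I x₀ x) ≤ (tangentTo I S x).comap (tvec I x₀ x).toLinearMap from
      this h
    refine Submodule.span_le.2 ?_
    rintro _ ⟨c, hc, hcQ, h0, rfl⟩
    refine Submodule.subset_span ⟨fun t => (extChartAt I x₀).symm (c t), fun t => ?_,
      fun t => hS' _ (hcQ t), ?_, ?_⟩
    · exact ((contMDiffOn_extChartAt_symm x₀).contMDiffAt
        ((isOpen_extChartAt_target x₀).mem_nhds (hQ (hcQ t)))).comp t hc.contMDiff.contMDiffAt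
    · change (extChartAt I x₀).symm (c 0) = x
      rw [h0, (extChartAt I x₀).left_inv hx']
    · have hx2 : (extChartAt I x₀).symm (c 0) = x := by rw [h0, (extChartAt I x₀).left_inv hx']
      subst hx2
      have hγ : ContMDiffAt 𝓘(ℝ, ℝ) I ∞ (fun t => (extChartAt I x₀).symm (c t)) 0 :=
        ((contMDiffOn_extChartAt_symm x₀).contMDiffAt
          ((isOpen_extChartAt_target x₀).mem_nhds (hQ (hcQ 0)))).comp 0 hc.contMDiff.contMDiffAt
      have h1 : MDifferentiableAt I 𝓘(ℝ, F) (extChartAt I x₀) ((extChartAt I x₀).symm (c 0)) :=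
        mdifferentiableAt_extChartAt hx
      have h2 := mfderiv_comp (0 : ℝ) h1 (hγ.mdifferentiableAt (by simp))
      refine tcoord_injective hx ?_
      change _ = tcoord I x₀ _ (tvec I x₀ _ _)
      rw [tcoord_tvec hx, tcoord_eq_mfderiv hx]
      have h4 := DFunLike.congr_fun h2 (1 : ℝ)
      have h5 : (extChartAt I x₀ ∘ fun t => (extChartAt I x₀).symm (c t)) = c := by
        ext1 t; exact (extChartAt I x₀).right_inv (hQ (hcQ t))
      rw [h5, mfderiv_eq_fderiv] at h4
      exact h4.symm

end
end Coordinates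

/-! ### Topology of total spaces and gluing of vector fields. -/

section TotalSpaces
variable {B F : Type*} (E : B → Type*) [TopologicalSpace B] [TopologicalSpace F]
  [TopologicalSpace (TotalSpace F E)] [∀ b, TopologicalSpace (E b)] [FiberBundle F E]

/-- Together with second countability this provides partitions of unity on the bundle of
endomorphisms. -/
theorem t2Space_totalSpace [T2Space B] [T2Space F] : T2Space (TotalSpace F E) := by
  refine ⟨fun x y hxy => ?_⟩
  have hc : Continuous (TotalSpace.proj : TotalSpace F E → B) := FiberBundle.continuous_proj F E
  by_cases h : x.proj = y.proj
  · let e := trivializationAt F E x.proj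
    have hx : x ∈ e.source := FiberBundle.mem_trivializationAt_proj_source
    have hy : y ∈ e.source := by
      rw [e.mem_source, ← h]; exact mem_baseSet_trivializationAt F E x.proj
    have hne : e x ≠ e y := fun h' => hxy (e.injOn hx hy h')
    obtain ⟨u, v, hu, hv, hxu, hyv, huv⟩ := t2_separation hne
    refine ⟨e.source ∩ e ⁻¹' u, e.source ∩ e ⁻¹' v, e.isOpen_inter_preimage hu,
      e.isOpen_inter_preimage hv, ⟨hx, hxu⟩, ⟨hy, hyv⟩, ?_⟩
    exact (huv.preimage e).mono Set.inter_subset_right Set.inter_subset_right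
  · obtain ⟨u, v, hu, hv, hxu, hyv, huv⟩ := t2_separation h
    exact ⟨_, _, hu.preimage hc, hv.preimage hc, hxu, hyv, huv.preimage _⟩

theorem secondCountableTopology_totalSpace [SecondCountableTopology B] [SecondCountableTopology F] :
    SecondCountableTopology (TotalSpace F E) := by
  obtain ⟨s, hs, hU⟩ := TopologicalSpace.countable_cover_nhds
    (f := fun b : B => (trivializationAt F E b).baseSet)
    fun b => (trivializationAt F E b).open_baseSet.mem_nhds (mem_baseSet_trivializationAt F E b)
  have : Countable s := hs
  have (b : s) : SecondCountableTopology (trivializationAt F E (b : B)).source :=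
    (trivializationAt F E (b : B)).toOpenPartialHomeomorph.secondCountableTopology_source
  refine TopologicalSpace.secondCountableTopology_of_countable_cover
    (U := fun b : s => (trivializationAt F E (b : B)).source)
    (fun b => (trivializationAt F E (b : B)).open_source) ?_
  refine Set.eq_univ_of_forall fun x => ?_
  have : x.proj ∈ ⋃ b ∈ s, (trivializationAt F E b).baseSet := by rw [hU]; trivial
  obtain ⟨b, hb, hx⟩ := Set.mem_iUnion₂.1 this
  exact Set.mem_iUnion.2 ⟨⟨b, hb⟩, (trivializationAt F E b).mem_source.2 hx⟩

end TotalSpaces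

section
variable {F : Type*} [NormedAddCommGroup F] [NormedSpace ℝ F] {H : Type*} [TopologicalSpace H]
  {I : ModelWithCorners ℝ F H} {P : Type*} [TopologicalSpace P] [ChartedSpace H P]
  [IsManifold I ∞ P] [FiniteDimensional ℝ F] [T2Space P] [SigmaCompactSpace P]

/-- Gluing of local vector fields with values in convex sets. -/
theorem exists_isSmoothField (t : ∀ x : P, Set (TangentSpace I x)) (ht : ∀ x, Convex ℝ (t x))
    (h : ∀ x₀ : P, ∃ X : ∀ x : P, TangentSpace I x, ∀ᶠ x in 𝓝 x₀, ContMDiffAt I I.tangent ∞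
      (fun z => (TotalSpace.mk' F z (X z) : TangentBundle I P)) x ∧ X x ∈ t x) :
    ∃ X : ∀ x : P, TangentSpace I x, IsSmoothField I X ∧ ∀ x, X x ∈ t x := by
  obtain ⟨s, hs⟩ := exists_contMDiffSection_forall_mem_convex_of_local I (n := ⊤) (F_fiber := F)
    (TangentSpace I : P → Type _) t ht fun x₀ => by
      obtain ⟨X, hX⟩ := h x₀
      exact ⟨_, hX, X, fun x hx => hx.1.contMDiffWithinAt, fun x hx => hx.2⟩
  exact ⟨s, s.contMDiff, hs⟩

/-- The value is prescribed at x₀ only, which is still a convex condition. Near any other point the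
zero field is admissible. -/
theorem exists_isSmoothField_extending [I.Boundaryless] (S : ∀ x : P, Submodule ℝ (TangentSpace I x)) {x₀ : P}
    {X : ∀ x : P, TangentSpace I x} (h : ∀ᶠ x in 𝓝 x₀, ContMDiffAt I I.tangent ∞
      (fun z => (TotalSpace.mk' F z (X z) : TangentBundle I P)) x ∧ X x ∈ S x) :
    ∃ Y : ∀ x : P, TangentSpace I x, IsSmoothField I Y ∧ (∀ x, Y x ∈ S x) ∧ Y x₀ = X x₀ := by
  obtain ⟨Y, h1, h2⟩ := exists_isSmoothField (I := I) (fun x => {v | v ∈ S x ∧ (x = x₀ → v = X x)})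
    (fun x => by
      intro v hv w hw a b _ _ hab
      refine ⟨(S x).add_mem ((S x).smul_mem _ hv.1) ((S x).smul_mem _ hw.1), fun hx => ?_⟩
      rw [hv.2 hx, hw.2 hx, ← add_smul, hab, one_smul])
    fun x => by
      by_cases hx : x = x₀
      · subst hx
        exact ⟨X, h.mono fun z hz => ⟨hz.1, hz.2, fun _ => rfl⟩⟩
      · refine ⟨fun _ => 0, ?_⟩
        filter_upwards [isOpen_ne.mem_nhds hx] with z hz
        refine ⟨?_, (S z).zero_mem, fun h => absurd h hz⟩
        exact contMDiff_zeroSection ℝ (TangentSpace I : P → Type _) z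
  exact ⟨Y, h1, fun x => (h2 x).1, (h2 x₀).2 rfl⟩

end

/-! ### Connections, metrics and curvature in charts. -/

section ChartDerivative
variable {F : Type*} [NormedAddCommGroup F] [NormedSpace ℝ F] {H : Type*} [TopologicalSpace H]
  {I : ModelWithCorners ℝ F H} {P : Type*} [TopologicalSpace P] [ChartedSpace H P]
  [IsManifold I ∞ P] {W : Type*} [NormedAddCommGroup W] [NormedSpace ℝ W] {x₀ x : P}

theorem mdifferentiableAt_section_iff {σ : ∀ z : P, TangentSpace I z}
    (hx : x ∈ (chartAt H x₀).source) :
    MDifferentiableAt I I.tangent (fun z => TotalSpace.mk' F z (σ z)) x ↔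
      MDifferentiableAt I 𝓘(ℝ, F) (fun z => tcoord I x₀ z (σ z)) x := by
  have h := (trivializationAt F (TangentSpace I : P → Type _) x₀).mdifferentiableAt_section_iff
    I σ (mem_baseSet hx)
  refine Iff.trans h ?_
  have : (fun z => ((trivializationAt F (TangentSpace I : P → Type _) x₀) ⟨z, σ z⟩).2) =ᶠ[𝓝 x]
      fun z => tcoord I x₀ z (σ z) := by
    filter_upwards [(chartAt H x₀).open_source.mem_nhds hx] with z hz
    rw [trivializationAt_apply_eq_tcoord hz]
  exact ⟨fun h => h.congr_of_eventuallyEq this.symm, fun h => h.congr_of_eventuallyEq this⟩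

theorem mvfderiv_congr {f g : P → W} (h : f =ᶠ[𝓝 x] g) : mvfderiv I f x = mvfderiv I g x := by
  ext ξ
  rw [mvfderiv, mvfderiv]
  change (mfderiv I 𝓘(ℝ, W) f x ξ : W) = (mfderiv I 𝓘(ℝ, W) g x ξ : W)
  rw [h.mfderiv_eq]
  rfl

variable [I.Boundaryless]

theorem mvfderiv_eq_fderiv {h : P → W} (hx : x ∈ (chartAt H x₀).source)
    (hh : MDifferentiableAt I 𝓘(ℝ, W) h x) (ξ : TangentSpace I x) :
    mvfderiv I h x ξ =
      fderiv ℝ (fun y => h ((extChartAt I x₀).symm y)) (extChartAt I x₀ x) (tcoord I x₀ x ξ) := by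
  have hx' : x ∈ (extChartAt I x₀).source := by rwa [extChartAt_source]
  have h1 : h =ᶠ[𝓝 x] (fun y => h ((extChartAt I x₀).symm y)) ∘ extChartAt I x₀ := by
    filter_upwards [(chartAt H x₀).open_source.mem_nhds hx] with z hz
    rw [Function.comp_apply, (extChartAt I x₀).left_inv (by rwa [extChartAt_source])]
  have h2 : MDifferentiableAt 𝓘(ℝ, F) 𝓘(ℝ, W) (fun y => h ((extChartAt I x₀).symm y))
      (extChartAt I x₀ x) := by
    refine MDifferentiableAt.comp (I' := I) _ ?_ ?_
    · rwa [(extChartAt I x₀).left_inv hx']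
    · exact ((contMDiffOn_extChartAt_symm (n := ∞) x₀).contMDiffAt ((isOpen_extChartAt_target x₀).mem_nhds
        ((extChartAt I x₀).map_source hx'))).mdifferentiableAt (by simp)
  have h3 : MDifferentiableAt I 𝓘(ℝ, F) (extChartAt I x₀) x := mdifferentiableAt_extChartAt hx
  rw [mvfderiv_congr h1, tcoord_eq_mfderiv hx]
  change mfderiv I 𝓘(ℝ, W) _ x ξ = _
  rw [mfderiv_comp x h2 h3, mfderiv_eq_fderiv]
  rfl

end ChartDerivative

section Christoffel
variable {n : ℕ} {N : Type*} [TopologicalSpace N] [ChartedSpace (Model n) N] [IsManifold (𝓡 n) ∞ N]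

/-- The flat connection given by the chart at `y₀`. -/
def flat (y₀ : N) (σ : ∀ y : N, Tan n y) (y : N) : Tan n y →L[ℝ] Tan n y :=
  (tvec (𝓡 n) y₀ y).comp (mvfderiv (𝓡 n) (fun z => tcoord (𝓡 n) y₀ z (σ z)) y)

theorem isCovariantDerivativeOn_flat (y₀ : N) :
    IsCovariantDerivativeOn (I := 𝓡 n) (Model n) (flat y₀) (chartAt (Model n) y₀).source where
  add {σ σ' y} hσ hσ' hy := by
    rw [mdifferentiableAt_section_iff hy] at hσ hσ'
    ext1 v
    have h : (fun z => tcoord (𝓡 n) y₀ z ((σ + σ') z)) =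
      (fun z => tcoord (𝓡 n) y₀ z (σ z)) + fun z => tcoord (𝓡 n) y₀ z (σ' z) := by
      funext z; exact map_add _ _ _
    change tvec (𝓡 n) y₀ y _ = tvec (𝓡 n) y₀ y _ + tvec (𝓡 n) y₀ y _
    rw [h, mvfderiv_add hσ hσ', ← map_add]
    rfl
  leibniz {σ g y} hσ hg hy := by
    rw [mdifferentiableAt_section_iff hy] at hσ
    ext1 v
    have h : (fun z => tcoord (𝓡 n) y₀ z ((g • σ) z)) =
      g • (fun z => tcoord (𝓡 n) y₀ z (σ z)) := by
      funext z; exact (tcoord (𝓡 n) y₀ z).map_smul _ _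
    change tvec (𝓡 n) y₀ y _ = g y • tvec (𝓡 n) y₀ y _ + mvfderiv (𝓡 n) g y v • σ y
    rw [h, mvfderiv_smul hg hσ]
    change tvec (𝓡 n) y₀ y (g y • _ + mvfderiv (𝓡 n) g y v • tcoord (𝓡 n) y₀ y (σ y)) = _
    rw [map_add, ContinuousLinearMap.map_smul, ContinuousLinearMap.map_smul, tvec_tcoord hy]

/-- The connection form of `D` in the chart at `y₀`. -/
def christoffel (D : Connection n N) (y₀ y : N) : Model n →L[ℝ] Model n →L[ℝ] Model n :=
  (LinearMap.mk₂ ℝ (fun v w : Model n => tcoord (𝓡 n) y₀ y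
    ((D.isCovariantDerivativeOn (s := (chartAt (Model n) y₀).source)).difference
      (isCovariantDerivativeOn_flat y₀) y (tvec (𝓡 n) y₀ y w) (tvec (𝓡 n) y₀ y v)))
    (by intros; rw [map_add, map_add, map_add])
    (by intros; rw [ContinuousLinearMap.map_smul, ContinuousLinearMap.map_smul, ContinuousLinearMap.map_smul])
    (by intros; rw [map_add, map_add]; exact map_add _ _ _)
    (by intros; rw [ContinuousLinearMap.map_smul, ContinuousLinearMap.map_smul]; exact (tcoord (𝓡 n) y₀ y).map_smul _ _)).toContinuousBilinearMap

theorem tcoord_covariant (D : Connection n N) {y₀ y : N} (hy : y ∈ (chartAt (Model n) y₀).source)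
    {σ : ∀ y : N, Tan n y}
    (hσ : MDifferentiableAt (𝓡 n) 𝓘(ℝ, Model n) (fun z => tcoord (𝓡 n) y₀ z (σ z)) y)
    (v : Tan n y) :
    tcoord (𝓡 n) y₀ y (D σ y v) = mvfderiv (𝓡 n) (fun z => tcoord (𝓡 n) y₀ z (σ z)) y v +
      christoffel D y₀ y (tcoord (𝓡 n) y₀ y v) (tcoord (𝓡 n) y₀ y (σ y)) := by
  have h1 : christoffel D y₀ y (tcoord (𝓡 n) y₀ y v) (tcoord (𝓡 n) y₀ y (σ y)) =
    tcoord (𝓡 n) y₀ y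
    ((D.isCovariantDerivativeOn (s := (chartAt (Model n) y₀).source)).difference
      (isCovariantDerivativeOn_flat y₀) y (tvec (𝓡 n) y₀ y (tcoord (𝓡 n) y₀ y (σ y)))
      (tvec (𝓡 n) y₀ y (tcoord (𝓡 n) y₀ y v))) := rfl
  rw [h1, tvec_tcoord hy, tvec_tcoord hy, IsCovariantDerivativeOn.difference_apply _ _ hy
    ((mdifferentiableAt_section_iff hy).2 hσ)]
  have h2 : tcoord (𝓡 n) y₀ y (flat y₀ σ y v) =
    mvfderiv (𝓡 n) (fun z => tcoord (𝓡 n) y₀ z (σ z)) y v := tcoord_tvec hy _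
  change _ = _ + tcoord (𝓡 n) y₀ y (D σ y v - flat y₀ σ y v)
  rw [map_sub, h2]
  abel

end Christoffel

section ChartFunctions
variable {F : Type*} [NormedAddCommGroup F] [NormedSpace ℝ F] {H : Type*} [TopologicalSpace H]
  {I : ModelWithCorners ℝ F H} [I.Boundaryless] {P : Type*} [TopologicalSpace P] [ChartedSpace H P]
  [IsManifold I ∞ P] {W : Type*} [NormedAddCommGroup W] [NormedSpace ℝ W] {x₀ x : P}

theorem contDiffOn_chart {h : P → W}
    (hh : ∀ x ∈ (chartAt H x₀).source, ContMDiffAt I 𝓘(ℝ, W) ∞ h x) :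
    ContDiffOn ℝ ∞ (fun y => h ((extChartAt I x₀).symm y)) (extChartAt I x₀).target := by
  intro y hy
  have hs : (extChartAt I x₀).symm y ∈ (chartAt H x₀).source := by
    rw [← extChartAt_source I]; exact (extChartAt I x₀).map_target hy
  have h2 : ContMDiffAt 𝓘(ℝ, F) I ∞ (extChartAt I x₀).symm y :=
    (contMDiffOn_extChartAt_symm x₀).contMDiffAt ((isOpen_extChartAt_target x₀).mem_nhds hy)
  exact ((hh _ hs).comp y h2).contDiffAt.contDiffWithinAt

theorem contMDiffAt_of_chart {h : P → W} (hx : x ∈ (chartAt H x₀).source)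
    (hh : ContDiffAt ℝ ∞ (fun y => h ((extChartAt I x₀).symm y)) (extChartAt I x₀ x)) :
    ContMDiffAt I 𝓘(ℝ, W) ∞ h x := by
  refine (hh.contMDiffAt.comp x (contMDiffAt_extChartAt' hx)).congr_of_eventuallyEq ?_
  filter_upwards [(chartAt H x₀).open_source.mem_nhds hx] with z hz
  rw [Function.comp_apply, (extChartAt I x₀).left_inv (by rwa [extChartAt_source])]

theorem contMDiffAt_chart_iff {h : P → W} (hx : x ∈ (chartAt H x₀).source) :
    ContMDiffAt I 𝓘(ℝ, W) ∞ h x ↔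
    ContDiffAt ℝ ∞ (fun y => h ((extChartAt I x₀).symm y)) (extChartAt I x₀ x) := by
  refine ⟨fun hh => ?_, contMDiffAt_of_chart hx⟩
  have hx' : x ∈ (extChartAt I x₀).source := by rwa [extChartAt_source]
  refine ContMDiffAt.contDiffAt (ContMDiffAt.comp (I' := I) _ ?_ ?_)
  · rwa [(extChartAt I x₀).left_inv hx']
  · exact (contMDiffOn_extChartAt_symm (n := ∞) x₀).contMDiffAt ((isOpen_extChartAt_target x₀).mem_nhds
        ((extChartAt I x₀).map_source hx'))

theorem contMDiffAt_section_iff_tcoord {σ : ∀ z : P, TangentSpace I z}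
    (hx : x ∈ (chartAt H x₀).source) :
    ContMDiffAt I I.tangent ∞ (fun z => (TotalSpace.mk' F z (σ z) : TangentBundle I P)) x ↔
      ContMDiffAt I 𝓘(ℝ, F) ∞ (fun z => tcoord I x₀ z (σ z)) x := by
  rw [(trivializationAt F (TangentSpace I : P → Type _) x₀).contMDiffAt_section_iff (mem_baseSet hx)]
  have : (fun z => ((trivializationAt F (TangentSpace I : P → Type _) x₀) ⟨z, σ z⟩).2) =ᶠ[𝓝 x]
      fun z => tcoord I x₀ z (σ z) := by
    filter_upwards [(chartAt H x₀).open_source.mem_nhds hx] with z hz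
    rw [trivializationAt_apply_eq_tcoord hz]
  exact ⟨fun h => h.congr_of_eventuallyEq this.symm, fun h => h.congr_of_eventuallyEq this⟩

theorem contDiffOn_bilin {V : Type*} [NormedAddCommGroup V] [NormedSpace ℝ V]
    [FiniteDimensional ℝ V] {B : F → V →L[ℝ] V →L[ℝ] W} {s : Set F}
    (h : ∀ v w, ContDiffOn ℝ ∞ (fun y => B y v w) s) : ContDiffOn ℝ ∞ B s :=
  contDiffOn_clm_apply.2 fun v => contDiffOn_clm_apply.2 fun w => h v w

theorem tcoord_ext {n : ℕ} {N : Type*} [TopologicalSpace N] [ChartedSpace (Model n) N]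
    [IsManifold (𝓡 n) ∞ N] {y y₁ : N} (hy : y ∈ (chartAt (Model n) y₁).source) (v : Tan n y₁) :
    ext v y = tvec (𝓡 n) y₁ y v := by
  have h := trivializationAt_apply_eq_tcoord (I := 𝓡 n) (mem_chart_source (Model n) y₁) v
  rw [tcoord_self] at h
  rw [ext, FiberBundle.extend, h]
  exact (Trivialization.symmL_apply (R := ℝ) (F := Model n) (trivializationAt (Model n)
    (TangentSpace (𝓡 n) : N → Type) y₁) (mem_baseSet hy) v).symm

/-- The change of coordinates on tangent spaces. -/
def tchange (I : ModelWithCorners ℝ F H) {P : Type*} [TopologicalSpace P] [ChartedSpace H P]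
    [IsManifold I ∞ P] (x₀ x₁ x : P) : F →L[ℝ] F := (tcoord I x₀ x).comp (tvec I x₁ x)

theorem contMDiffAt_tchange {x₁ : P} (hx : x ∈ (chartAt H x₀).source)
    (hx₁ : x ∈ (chartAt H x₁).source) :
    ContMDiffAt I 𝓘(ℝ, F →L[ℝ] F) ∞ (tchange I x₀ x₁) x := by
  refine (contMDiffAt_coordChangeL (IB := I) (n := ∞)
    (e := trivializationAt F (TangentSpace I : P → Type _) x₁)
    (e' := trivializationAt F (TangentSpace I : P → Type _) x₀) (mem_baseSet hx₁)
    (mem_baseSet hx)).congr_of_eventuallyEq ?_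
  filter_upwards [(chartAt H x₀).open_source.mem_nhds hx,
    (chartAt H x₁).open_source.mem_nhds hx₁] with z hz hz₁
  ext1 v
  refine Eq.trans ?_ (Trivialization.coordChangeL_apply (R := ℝ) _ _
    ⟨mem_baseSet hz₁, mem_baseSet hz⟩ v).symm
  rw [trivializationAt_apply_eq_tcoord hz, ← Trivialization.symmL_apply (R := ℝ) _ (mem_baseSet hz₁)]
  rfl

end ChartFunctions

section Hom
variable {n : ℕ} {N : Type*} [TopologicalSpace N] [ChartedSpace (Model n) N] [IsManifold (𝓡 n) ∞ N]

theorem contMDiffAt_hom_iff {A : ∀ y : N, Tan n y →L[ℝ] Tan n y} {y₀ y : N} {r : ℕ∞}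
    (hy : y ∈ (chartAt (Model n) y₀).source) :
    ContMDiffAt (𝓡 n) ((𝓡 n).prod 𝓘(ℝ, Model n →L[ℝ] Model n)) r
      (fun y => TotalSpace.mk' (Model n →L[ℝ] Model n)
        (E := fun y : N => Tan n y →L[ℝ] Tan n y) y (A y)) y ↔
    ContMDiffAt (𝓡 n) 𝓘(ℝ, Model n →L[ℝ] Model n) r
      (fun y => (tcoord (𝓡 n) y₀ y).comp ((A y).comp (tvec (𝓡 n) y₀ y))) y := by
  have h := (trivializationAt (Model n →L[ℝ] Model n) (fun y : N => Tan n y →L[ℝ] Tan n y)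
    y₀).contMDiffAt_section_iff (IB := 𝓡 n) (n := r) (s := A) (x₀ := y) ⟨mem_baseSet hy, mem_baseSet hy⟩
  exact h

theorem contDiffAt_metric (g : Metric n N) {y₀ y : N} (hy : y ∈ (chartAt (Model n) y₀).source)
    (v w : Model n) : ContMDiffAt (𝓡 n) 𝓘(ℝ, ℝ) ∞
      (fun y => g.inner y (tvec (𝓡 n) y₀ y v) (tvec (𝓡 n) y₀ y w)) y := by
  have h (v : Model n) := contMDiffAt_tvec (I := 𝓡 n) (X := fun _ => v) hy contDiffAt_const
  have h2 := (g.contMDiff y).clm_bundle_apply₂ (F₃ := ℝ) (E₃ := Trivial N ℝ) (h v) (h w)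
  have h3 := (contMDiffAt_totalSpace.1 h2).2
  exact h3

end Hom

section ChartDerivatives
variable {F : Type*} [NormedAddCommGroup F] [NormedSpace ℝ F] {H : Type*} [TopologicalSpace H]
  {I : ModelWithCorners ℝ F H} [I.Boundaryless] {P : Type*} [TopologicalSpace P] [ChartedSpace H P]
  [IsManifold I ∞ P] {W W' : Type*} [NormedAddCommGroup W] [NormedSpace ℝ W]
  [NormedAddCommGroup W'] [NormedSpace ℝ W'] {x₀ x : P}

theorem differentiableAt_chart {h : P → W} (hx : x ∈ (chartAt H x₀).source)
    (hh : MDifferentiableAt I 𝓘(ℝ, W) h x) :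
    DifferentiableAt ℝ (fun y => h ((extChartAt I x₀).symm y)) (extChartAt I x₀ x) := by
  have hx' : x ∈ (extChartAt I x₀).source := by rwa [extChartAt_source]
  refine MDifferentiableAt.differentiableAt (MDifferentiableAt.comp (I' := I) _ ?_ ?_)
  · rwa [(extChartAt I x₀).left_inv hx']
  · exact ((contMDiffOn_extChartAt_symm (n := ∞) x₀).contMDiffAt ((isOpen_extChartAt_target x₀).mem_nhds
      ((extChartAt I x₀).map_source hx'))).mdifferentiableAt (by simp)

theorem mvfderiv_clm_apply {A : P → W →L[ℝ] W'} {u : P → W}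
    (hA : MDifferentiableAt I 𝓘(ℝ, W →L[ℝ] W') A x) (hu : MDifferentiableAt I 𝓘(ℝ, W) u x)
    (ξ : TangentSpace I x) :
    mvfderiv I (fun q => A q (u q)) x ξ = mvfderiv I A x ξ (u x) + A x (mvfderiv I u x ξ) := by
  have hx := mem_chart_source H x
  rw [mvfderiv_eq_fderiv hx (hA.clm_apply hu), mvfderiv_eq_fderiv hx hA, mvfderiv_eq_fderiv hx hu,
    fderiv_clm_apply (differentiableAt_chart hx hA) (differentiableAt_chart hx hu), add_comm]
  have : (extChartAt I x).symm (extChartAt I x x) = x :=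
    (extChartAt I x).left_inv (mem_extChartAt_source x)
  simp only [this]
  rfl

theorem mvfderiv_comp_of_mdifferentiableAt {F' : Type*} [NormedAddCommGroup F'] [NormedSpace ℝ F']
    {H' : Type*} [TopologicalSpace H'] {I' : ModelWithCorners ℝ F' H'} {P' : Type*}
    [TopologicalSpace P'] [ChartedSpace H' P'] {f : P → P'} {h : P' → W}
    (hh : MDifferentiableAt I' 𝓘(ℝ, W) h (f x)) (hf : MDifferentiableAt I I' f x)
    (ξ : TangentSpace I x) :
    mvfderiv I (fun q => h (f q)) x ξ = mvfderiv I' h (f x) (mfderiv I I' f x ξ) :=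
  mfderiv_comp_apply x hh hf ξ

end ChartDerivatives

section
variable {n : ℕ} {N : Type*} [TopologicalSpace N] [ChartedSpace (Model n) N] [IsManifold (𝓡 n) ∞ N]

theorem mvfderiv_tcoord_tvec {y₀ y : N} (hy : y ∈ (chartAt (Model n) y₀).source) (v : Model n) :
    mvfderiv (𝓡 n) (fun z => tcoord (𝓡 n) y₀ z (tvec (𝓡 n) y₀ z v)) y = 0 := by
  rw [mvfderiv_congr (g := fun _ => v) (by
    filter_upwards [(chartAt (Model n) y₀).open_source.mem_nhds hy] with z hz using tcoord_tvec hz v)]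
  exact mvfderiv_const v

theorem mdifferentiableAt_tcoord_tvec {y₀ y : N} (hy : y ∈ (chartAt (Model n) y₀).source)
    (v : Model n) : MDifferentiableAt (𝓡 n) 𝓘(ℝ, Model n)
      (fun z => tcoord (𝓡 n) y₀ z (tvec (𝓡 n) y₀ z v)) y :=
  (mdifferentiableAt_const (c := v)).congr_of_eventuallyEq (by
    filter_upwards [(chartAt (Model n) y₀).open_source.mem_nhds hy] with z hz using tcoord_tvec hz v)

theorem tcoord_covariant_tvec (D : Connection n N) {y₀ y : N}
    (hy : y ∈ (chartAt (Model n) y₀).source) (v w : Model n) :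
    tcoord (𝓡 n) y₀ y (D (fun z => tvec (𝓡 n) y₀ z w) y (tvec (𝓡 n) y₀ y v)) =
      christoffel D y₀ y v w := by
  rw [tcoord_covariant D hy (mdifferentiableAt_tcoord_tvec hy w), mvfderiv_tcoord_tvec hy,
    tcoord_tvec hy, tcoord_tvec hy]
  exact zero_add _

/-- Smoothness of D is tested on fields smooth on the whole manifold. A coordinate field is
therefore first replaced by a global field which agrees with it on a closed neighbourhood C;
locality of D gives the symbols. -/
theorem contMDiffAt_christoffel [T2Space N] [SigmaCompactSpace N] {D : Connection n N}
    (hD : D.ContMDiffCovariantDerivative ∞) {y₀ y : N}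
    (hy : y ∈ (chartAt (Model n) y₀).source) (v w : Model n) :
    ContMDiffAt (𝓡 n) 𝓘(ℝ, Model n) ∞ (fun z => christoffel D y₀ z v w) y := by
  have : LocallyCompactSpace N := ChartedSpace.locallyCompactSpace (Model n) N
  obtain ⟨C, hC, hCc, hCs⟩ :=
    exists_mem_nhds_isClosed_subset ((chartAt (Model n) y₀).open_source.mem_nhds hy)
  obtain ⟨σ, hσ, hσC⟩ := exists_isSmoothField (I := 𝓡 n)
    (fun z => {u | z ∈ C → u = tvec (𝓡 n) y₀ z w})
    (fun z u hu u' hu' a b _ _ hab hz => by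
      rw [hu hz, hu' hz, ← add_smul, hab, one_smul])
    (fun x₀ => by
      by_cases hx : x₀ ∈ C
      · refine ⟨fun z => tvec (𝓡 n) y₀ z w, ?_⟩
        filter_upwards [(chartAt (Model n) y₀).open_source.mem_nhds (hCs hx)] with z hz
        exact ⟨contMDiffAt_tvec (I := 𝓡 n) (X := fun _ => w) hz contDiffAt_const, fun _ => rfl⟩
      · refine ⟨fun z => 0, ?_⟩
        filter_upwards [hCc.isOpen_compl.mem_nhds hx] with z hz
        exact ⟨(contMDiff_zeroSection ℝ (TangentSpace (𝓡 n) : N → Type)) z, fun h => absurd h hz⟩)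
  have h1 := (hD.contMDiff.contMDiff (σ := σ) hσ.contMDiffOn).contMDiffAt (x := y) Filter.univ_mem
  have h2 := (contMDiffAt_hom_iff (A := fun z => D σ z) (r := ⊤) hy).1 h1
  refine (h2.clm_apply (contMDiffAt_const (c := v))).congr_of_eventuallyEq ?_
  filter_upwards [(chartAt (Model n) y₀).open_source.mem_nhds hy, eventually_mem_nhds_iff.2 hC]
    with z hz hzC
  rw [← tcoord_covariant_tvec D hz]
  change tcoord (𝓡 n) y₀ z _ = tcoord (𝓡 n) y₀ z (D σ z (tvec (𝓡 n) y₀ z v))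
  rw [(D.isCovariantDerivativeOn (s := Set.univ)).congr_of_eventuallyEq (x := z)
    (σ := σ) (σ' := fun z => tvec (𝓡 n) y₀ z w) ((hσ z).mdifferentiableAt (by simp))
    ((mdifferentiableAt_section_iff hz).2 (mdifferentiableAt_tcoord_tvec hz w)) Filter.univ_mem
    (by filter_upwards [hzC] with z' hz' using hσC z' hz')]

variable {F : Type*} [NormedAddCommGroup F] [NormedSpace ℝ F] {H : Type*} [TopologicalSpace H]
  {I : ModelWithCorners ℝ F H} [I.Boundaryless] {P : Type*} [TopologicalSpace P] [ChartedSpace H P]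
  [IsManifold I ∞ P]

/-- `alongDeriv` is defined with the trivialization at ψ(p). On passing to the chart at y₀ the
derivative of the transition map enters in the same way in dU and in the covariant derivative of the
extension, so the usual formula dU + ΓU holds in any chart. -/
theorem tcoord_alongDeriv (D : Connection n N) {ψ : P → N} {U : ∀ p : P, Tan n (ψ p)} {p : P}
    {y₀ : N} (hp : ψ p ∈ (chartAt (Model n) y₀).source) (hψ : MDifferentiableAt I (𝓡 n) ψ p)
    (hU : MDifferentiableAt I 𝓘(ℝ, Model n) (fun q => tcoord (𝓡 n) y₀ (ψ q) (U q)) p)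
    (ξ : TangentSpace I p) :
    tcoord (𝓡 n) y₀ (ψ p) (alongDeriv I D ψ U p ξ) =
      mvfderiv I (fun q => tcoord (𝓡 n) y₀ (ψ q) (U q)) p ξ +
      christoffel D y₀ (ψ p) (tcoord (𝓡 n) y₀ (ψ p) (mfderiv I (𝓡 n) ψ p ξ))
        (tcoord (𝓡 n) y₀ (ψ p) (U p)) := by
  have hp₁ := mem_chart_source (Model n) (ψ p)
  have hev : ∀ᶠ q in 𝓝 p, ψ q ∈ (chartAt (Model n) (ψ p)).source ∧
      ψ q ∈ (chartAt (Model n) y₀).source :=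
    hψ.continuousAt (((chartAt (Model n) (ψ p)).open_source.inter
      (chartAt (Model n) y₀).open_source).mem_nhds ⟨hp₁, hp⟩)
  set U₁ : P → Model n := fun q => tcoord (𝓡 n) (ψ p) (ψ q) (U q) with hU₁
  have hA : MDifferentiableAt (𝓡 n) 𝓘(ℝ, Model n →L[ℝ] Model n) (tchange (𝓡 n) y₀ (ψ p)) (ψ p) :=
    (contMDiffAt_tchange hp hp₁).mdifferentiableAt (by simp)
  have hA' : MDifferentiableAt (𝓡 n) 𝓘(ℝ, Model n →L[ℝ] Model n) (tchange (𝓡 n) (ψ p) y₀) (ψ p) :=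
    (contMDiffAt_tchange hp₁ hp).mdifferentiableAt (by simp)
  have hU₁d : MDifferentiableAt I 𝓘(ℝ, Model n) U₁ p := by
    refine ((hA'.comp p hψ).clm_apply hU).congr_of_eventuallyEq ?_
    filter_upwards [hev] with q hq
    change _ = tcoord (𝓡 n) (ψ p) (ψ q) (tvec (𝓡 n) y₀ (ψ q) (tcoord (𝓡 n) y₀ (ψ q) (U q)))
    rw [tvec_tcoord hq.2]
  have h1 : mvfderiv I (fun q => tcoord (𝓡 n) y₀ (ψ q) (U q)) p ξ =
      mvfderiv (𝓡 n) (tchange (𝓡 n) y₀ (ψ p)) (ψ p) (mfderiv I (𝓡 n) ψ p ξ) (U₁ p) +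
      tcoord (𝓡 n) y₀ (ψ p) (tvec (𝓡 n) (ψ p) (ψ p) (mvfderiv I U₁ p ξ)) := by
    rw [mvfderiv_congr (g := fun q => tchange (𝓡 n) y₀ (ψ p) (ψ q) (U₁ q)),
      mvfderiv_clm_apply (A := fun q => tchange (𝓡 n) y₀ (ψ p) (ψ q)) (hA.comp p hψ) hU₁d,
      mvfderiv_comp_of_mdifferentiableAt hA hψ]
    · rfl
    · filter_upwards [hev] with q hq
      change _ = tcoord (𝓡 n) y₀ (ψ q) (tvec (𝓡 n) (ψ p) (ψ q) (tcoord (𝓡 n) (ψ p) (ψ q) (U q)))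
      rw [tvec_tcoord hq.1]
  have h2 : (fun z => tcoord (𝓡 n) y₀ z (ext (U p) z)) =ᶠ[𝓝 (ψ p)]
      fun z => tchange (𝓡 n) y₀ (ψ p) z (U₁ p) := by
    filter_upwards [(chartAt (Model n) (ψ p)).open_source.mem_nhds hp₁] with z hz
    rw [tcoord_ext hz, hU₁]
    change _ = tcoord (𝓡 n) y₀ z (tvec (𝓡 n) (ψ p) z (tcoord (𝓡 n) (ψ p) (ψ p) (U p)))
    rw [tcoord_self]
  have h3 : MDifferentiableAt (𝓡 n) 𝓘(ℝ, Model n) (fun z => tcoord (𝓡 n) y₀ z (ext (U p) z)) (ψ p) :=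
    (hA.clm_apply mdifferentiableAt_const).congr_of_eventuallyEq h2
  have h4 : ext (U p) (ψ p) = U p := FiberBundle.extend_apply_self _ _
  have h5 : mvfderiv I (fun q => (trivializationAt (Model n) (TangentSpace (𝓡 n) : N → Type) (ψ p)
      ⟨ψ q, U q⟩).2) p ξ = mvfderiv I U₁ p ξ := by
    rw [mvfderiv_congr (g := U₁)]
    filter_upwards [hev] with q hq
    rw [trivializationAt_apply_eq_tcoord hq.1]
  rw [alongDeriv, map_add, tcoord_covariant D hp h3, h1, h5, mvfderiv_congr h2, h4,
    mvfderiv_clm_apply hA mdifferentiableAt_const, mvfderiv_const,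
    ← Trivialization.symmL_apply (R := ℝ) _ (mem_baseSet hp₁)]
  change tcoord (𝓡 n) y₀ (ψ p) (tvec (𝓡 n) (ψ p) (ψ p) _) + ((_ + tchange _ _ _ _ (0 : Model n)) + _) = _
  rw [map_zero]
  abel

end

section
variable {n : ℕ} {N : Type*} [TopologicalSpace N] [ChartedSpace (Model n) N] [IsManifold (𝓡 n) ∞ N]

theorem ext_self {y : N} (v : Tan n y) : ext v y = v := FiberBundle.extend_apply_self _ _

theorem tcoord_eventuallyEq_ext {y : N} (v : Tan n y) :
    (fun z => tcoord (𝓡 n) y z (ext v z)) =ᶠ[𝓝 y] fun _ => tcoord (𝓡 n) y y v := by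
  filter_upwards [(chartAt (Model n) y).open_source.mem_nhds (mem_chart_source _ y)] with z hz
  rw [tcoord_ext hz]
  exact (tcoord_tvec hz _).trans (tcoord_self y v).symm

theorem ext_eq_tvec {y z : N} (hz : z ∈ (chartAt (Model n) y).source) (v : Tan n y) :
    ext v z = tvec (𝓡 n) y z (tcoord (𝓡 n) y y v) := by
  rw [tcoord_ext hz]
  exact congrArg _ (tcoord_self y v).symm

theorem mdifferentiableAt_tcoord_ext {y : N} (v : Tan n y) :
    MDifferentiableAt (𝓡 n) 𝓘(ℝ, Model n) (fun z => tcoord (𝓡 n) y z (ext v z)) y :=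
  mdifferentiableAt_const.congr_of_eventuallyEq (tcoord_eventuallyEq_ext v)

theorem mdifferentiableAt_ext {y : N} (v : Tan n y) :
    MDifferentiableAt (𝓡 n) (𝓡 n).tangent (fun y => TotalSpace.mk' (Model n) y (ext v y)) y :=
  (mdifferentiableAt_section_iff (mem_chart_source _ y)).2 (mdifferentiableAt_tcoord_ext v)

/-- Both extensions have constant coordinates in the chart at y. Hence the last term in the
definition of `curvature` vanishes. -/
theorem mlieBracket_ext {y : N} (u v : Tan n y) :
    VectorField.mlieBracket (𝓡 n) (ext u) (ext v) y = 0 := by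
  refine tcoord_injective (mem_chart_source _ y) ?_
  rw [tcoord_mlieBracket]
  have h (v : Tan n y) : (fun x => tcoord (𝓡 n) y ((extChartAt (𝓡 n) y).symm x)
      (ext v ((extChartAt (𝓡 n) y).symm x))) =ᶠ[𝓝 (extChartAt (𝓡 n) y y)]
      fun _ => tcoord (𝓡 n) y y v := by
    have h1 : Filter.Tendsto (extChartAt (𝓡 n) y).symm (𝓝 (extChartAt (𝓡 n) y y)) (𝓝 y) := by
      have := (continuousAt_extChartAt_symm (I := 𝓡 n) y)
      rwa [ContinuousAt, extChartAt_to_inv] at this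
    exact h1.eventually (tcoord_eventuallyEq_ext v)
  rw [(h u).lieBracket_vectorField_eq (h v), map_zero]
  simp [VectorField.lieBracket]

theorem covariant_ext (D : Connection n N) {y z : N} (hz : z ∈ (chartAt (Model n) y).source)
    (v : Tan n z) (w : Tan n y) : tcoord (𝓡 n) y z (D (ext w) z v) =
      christoffel D y z (tcoord (𝓡 n) y z v) (tcoord (𝓡 n) y y w) := by
  have h : (fun x => tcoord (𝓡 n) y x (ext w x)) =ᶠ[𝓝 z] fun _ => tcoord (𝓡 n) y y w := by
    filter_upwards [(chartAt (Model n) y).open_source.mem_nhds hz] with x hx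
    rw [tcoord_ext hx]
    exact (tcoord_tvec hx _).trans (tcoord_self y w).symm
  rw [tcoord_covariant D hz (mdifferentiableAt_const.congr_of_eventuallyEq h), mvfderiv_congr h,
    mvfderiv_const, show tcoord (𝓡 n) y z (ext w z) = _ from h.self_of_nhds]
  exact zero_add _

theorem christoffel_symm {D : Connection n N} (hD : D.torsion = 0) (y : N) (v w : Model n) :
    christoffel D y y v w = christoffel D y y w v := by
  have hy := mem_chart_source (Model n) y
  have h := (CovariantDerivative.torsion_eq_zero_iff (cov := D)).1 hD
    (mdifferentiableAt_ext (tvec (𝓡 n) y y v)) (mdifferentiableAt_ext (tvec (𝓡 n) y y w))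
  rw [mlieBracket_ext, ext_self, ext_self] at h
  have h2 := congrArg (tcoord (𝓡 n) y y) (sub_eq_zero.1 h)
  rw [covariant_ext D hy, covariant_ext D hy, tcoord_tvec hy, tcoord_tvec hy] at h2
  exact h2

theorem tcoord_curvature [T2Space N] [SigmaCompactSpace N] {D : Connection n N}
    (hD : D.ContMDiffCovariantDerivative ∞) {y : N} (u v w : Tan n y) :
    tcoord (𝓡 n) y y (curvature D y u v w) =
      fderiv ℝ (fun x => christoffel D y ((extChartAt (𝓡 n) y).symm x) (tcoord (𝓡 n) y y v)
        (tcoord (𝓡 n) y y w)) (extChartAt (𝓡 n) y y) (tcoord (𝓡 n) y y u) -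
      fderiv ℝ (fun x => christoffel D y ((extChartAt (𝓡 n) y).symm x) (tcoord (𝓡 n) y y u)
        (tcoord (𝓡 n) y y w)) (extChartAt (𝓡 n) y y) (tcoord (𝓡 n) y y v) +
      (christoffel D y y (tcoord (𝓡 n) y y u)
        (christoffel D y y (tcoord (𝓡 n) y y v) (tcoord (𝓡 n) y y w)) -
      christoffel D y y (tcoord (𝓡 n) y y v)
        (christoffel D y y (tcoord (𝓡 n) y y u) (tcoord (𝓡 n) y y w))) := by
  have hy := mem_chart_source (Model n) y
  have key (u v : Tan n y) : tcoord (𝓡 n) y y (D (fun z => D (ext w) z (ext v z)) y u) =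
      fderiv ℝ (fun x => christoffel D y ((extChartAt (𝓡 n) y).symm x) (tcoord (𝓡 n) y y v)
        (tcoord (𝓡 n) y y w)) (extChartAt (𝓡 n) y y) (tcoord (𝓡 n) y y u) +
      christoffel D y y (tcoord (𝓡 n) y y u)
        (christoffel D y y (tcoord (𝓡 n) y y v) (tcoord (𝓡 n) y y w)) := by
    have h : (fun z => tcoord (𝓡 n) y z (D (ext w) z (ext v z))) =ᶠ[𝓝 y]
        fun z => christoffel D y z (tcoord (𝓡 n) y y v) (tcoord (𝓡 n) y y w) := by
      filter_upwards [(chartAt (Model n) y).open_source.mem_nhds hy] with z hz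
      rw [covariant_ext D hz, ext_eq_tvec hz, tcoord_tvec hz]
    have hd := (contMDiffAt_christoffel hD hy (tcoord (𝓡 n) y y v)
      (tcoord (𝓡 n) y y w)).mdifferentiableAt (by simp)
    rw [tcoord_covariant D hy (hd.congr_of_eventuallyEq h), mvfderiv_congr h,
      mvfderiv_eq_fderiv hy hd, show tcoord (𝓡 n) y y (D (ext w) y (ext v y)) = _ from h.self_of_nhds]
  have h3 : tcoord (𝓡 n) y y (D (ext w) y (VectorField.mlieBracket (𝓡 n) (ext u) (ext v) y)) = 0 := by
    rw [mlieBracket_ext, map_zero, map_zero]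
  rw [curvature, map_sub, map_sub, key, key, h3]
  abel

/-- The components of a metric in the chart at `y₀`. -/
def metricCoord (g : Metric n N) (y₀ y : N) : Model n →L[ℝ] Model n →L[ℝ] ℝ :=
  (LinearMap.mk₂ ℝ (fun v w : Model n => g.inner y (tvec (𝓡 n) y₀ y v) (tvec (𝓡 n) y₀ y w))
    (by intros; rw [map_add, map_add]; rfl)
    (by intros; rw [ContinuousLinearMap.map_smul, ContinuousLinearMap.map_smul]; rfl)
    (by intros; rw [map_add, map_add])
    (by intros; rw [ContinuousLinearMap.map_smul, ContinuousLinearMap.map_smul])).toContinuousBilinearMap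

theorem metricCoord_apply (g : Metric n N) (y₀ y : N) (v w : Model n) :
    metricCoord g y₀ y v w = g.inner y (tvec (𝓡 n) y₀ y v) (tvec (𝓡 n) y₀ y w) := rfl

theorem metricCoord_tcoord (g : Metric n N) {y₀ y : N} (hy : y ∈ (chartAt (Model n) y₀).source)
    (v w : Tan n y) :
    metricCoord g y₀ y (tcoord (𝓡 n) y₀ y v) (tcoord (𝓡 n) y₀ y w) = g.inner y v w := by
  rw [metricCoord_apply, tvec_tcoord hy, tvec_tcoord hy]

theorem metricCoord_symm (g : Metric n N) (y₀ y : N) (v w : Model n) :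
    metricCoord g y₀ y v w = metricCoord g y₀ y w v := g.symm y _ _

theorem metricCoord_pos (g : Metric n N) {y₀ y : N} (hy : y ∈ (chartAt (Model n) y₀).source)
    (v : Model n) (hv : v ≠ 0) : 0 < metricCoord g y₀ y v v :=
  g.pos y _ fun h => hv (by rw [← tcoord_tvec (I := 𝓡 n) hy v, h, map_zero])

theorem metricCoord_compat {g : Metric n N} {α : ∀ x : N, Tan n x →L[ℝ] ℝ} {D : Connection n N}
    (h : IsCompatible g α D) {y₀ y : N} (hy : y ∈ (chartAt (Model n) y₀).source) (X v w : Model n) :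
    fderiv ℝ (fun x => metricCoord g y₀ ((extChartAt (𝓡 n) y₀).symm x) v w)
      (extChartAt (𝓡 n) y₀ y) X = α y (tvec (𝓡 n) y₀ y X) * metricCoord g y₀ y v w +
      metricCoord g y₀ y (christoffel D y₀ y X v) w + metricCoord g y₀ y v (christoffel D y₀ y X w) := by
  have hs (v : Model n) := (mdifferentiableAt_section_iff (I := 𝓡 n) hy).2
    (mdifferentiableAt_tcoord_tvec hy v)
  have h1 := h _ _ y (hs v) (hs w) (tvec (𝓡 n) y₀ y X)
  have h2 := (contDiffAt_metric g hy v w).mdifferentiableAt (by simp)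
  rw [mvfderiv_eq_fderiv hy h2, tcoord_tvec hy] at h1
  refine h1.trans ?_
  rw [← metricCoord_tcoord g hy (D _ y _), ← metricCoord_tcoord g hy _ (D _ y _),
    tcoord_covariant_tvec D hy, tcoord_covariant_tvec D hy, tcoord_tvec hy, tcoord_tvec hy]
  rfl

theorem contDiffOn_metricCoord (g : Metric n N) (y₀ : N) :
    ContDiffOn ℝ ∞ (fun x => metricCoord g y₀ ((extChartAt (𝓡 n) y₀).symm x))
      (extChartAt (𝓡 n) y₀).target :=
  contDiffOn_bilin fun v w => contDiffOn_chart (I := 𝓡 n) (h := fun z => metricCoord g y₀ z v w)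
    fun _ hx => contDiffAt_metric g hx v w

theorem contDiffOn_christoffel [T2Space N] [SigmaCompactSpace N] {D : Connection n N}
    (hD : D.ContMDiffCovariantDerivative ∞) (y₀ : N) :
    ContDiffOn ℝ ∞ (fun x => christoffel D y₀ ((extChartAt (𝓡 n) y₀).symm x))
      (extChartAt (𝓡 n) y₀).target :=
  contDiffOn_bilin fun v w => contDiffOn_chart (I := 𝓡 n) (h := fun z => christoffel D y₀ z v w)
    fun _ hx => contMDiffAt_christoffel hD hx v w

end

/-! ### Weyl connections and the Levi-Civita connection. -/

section WeylForm
variable {V : Type*} [NormedAddCommGroup V] [NormedSpace ℝ V]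

/-- The difference between two torsion free connections preserving a conformal structure. -/
def weylForm (b : V →L[ℝ] V →L[ℝ] ℝ) (a : V →L[ℝ] ℝ) (s : V) : V →L[ℝ] V →L[ℝ] V :=
  (2⁻¹ : ℝ) • (ContinuousLinearMap.smulRightL ℝ V V a +
    ContinuousLinearMap.smulRight a (ContinuousLinearMap.id ℝ V) -
    (ContinuousLinearMap.smulRightL ℝ V V).flip s ∘L b)

theorem weylForm_apply (b : V →L[ℝ] V →L[ℝ] ℝ) (a : V →L[ℝ] ℝ) (s u v : V) :
    weylForm b a s u v = (2⁻¹ : ℝ) • (a v • u + a u • v - b u v • s) := rfl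

theorem contDiffWithinAt_inverse_apply {F W : Type*} [NormedAddCommGroup F] [NormedSpace ℝ F]
    [NormedAddCommGroup W] [NormedSpace ℝ W] [CompleteSpace V] {b : F → V →L[ℝ] W} {a : F → W}
    {s : Set F} {x : F} (hb : ContDiffWithinAt ℝ ∞ b s x) (ha : ContDiffWithinAt ℝ ∞ a s x)
    (hi : (b x).IsInvertible) : ContDiffWithinAt ℝ ∞ (fun x => (b x).inverse (a x)) s x := by
  have h1 : ContDiffWithinAt ℝ ∞ (fun x => (b x).inverse) s x :=
    (hi.contDiffAt_map_inverse).comp_contDiffWithinAt x hb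
  exact h1.clm_apply ha

end WeylForm

section
variable {n : ℕ} {N : Type*} [TopologicalSpace N] [ChartedSpace (Model n) N] [IsManifold (𝓡 n) ∞ N]

/-- The vector dual to a form. -/
def sharp (g : Metric n N) (y : N) (a : Tan n y →L[ℝ] ℝ) : Tan n y := (g.inner y).inverse a

theorem inner_sharp (g : Metric n N) (y : N) (a : Tan n y →L[ℝ] ℝ) (w : Tan n y) :
    g.inner y (sharp g y a) w = a w :=
  DFunLike.congr_fun (form_inverse_apply (V := Model n)
    (isInvertible_of_pos (V := Model n) (g.inner y) (g.pos y)) a) w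

/-- The one form relating a Weyl connection to the Levi-Civita connection. -/
def weylOneForm (g : Metric n N) (α : ∀ x : N, Tan n x →L[ℝ] ℝ) (y : N) :
    Tan n y →L[ℝ] Tan n y →L[ℝ] Tan n y :=
  weylForm (V := Model n) (g.inner y) (α y) (sharp g y (α y))

theorem weylOneForm_apply (g : Metric n N) (α : ∀ x : N, Tan n x →L[ℝ] ℝ) (y : N) (u v : Tan n y) :
    weylOneForm g α y u v =
      (2⁻¹ : ℝ) • (α y v • u + α y u • v - g.inner y u v • sharp g y (α y)) := rfl

/-- Smoothness of α is not assumed. It follows by solving the compatibility condition on the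
constant field v for α(v), which is possible since g(v, v) ≠ 0. -/
theorem contMDiffAt_lee [T2Space N] [SigmaCompactSpace N] {g : Metric n N}
    {α : ∀ x : N, Tan n x →L[ℝ] ℝ} {D : Connection n N}
    (hD : D.ContMDiffCovariantDerivative ∞) (h : IsCompatible g α D) {y₀ y : N}
    (hy : y ∈ (chartAt (Model n) y₀).source) (v : Model n) :
    ContMDiffAt (𝓡 n) 𝓘(ℝ, ℝ) ∞ (fun z => α z (tvec (𝓡 n) y₀ z v)) y := by
  by_cases hv : v = 0
  · subst hv
    simp only [map_zero]
    exact contMDiffAt_const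
  refine contMDiffAt_of_chart hy ?_
  have hy' : y ∈ (extChartAt (𝓡 n) y₀).source := by rwa [extChartAt_source]
  have ht : (extChartAt (𝓡 n) y₀).target ∈ 𝓝 (extChartAt (𝓡 n) y₀ y) :=
    (isOpen_extChartAt_target y₀).mem_nhds ((extChartAt (𝓡 n) y₀).map_source hy')
  have hg := (contDiffOn_metricCoord g y₀).contDiffAt ht
  have hΓ := (contDiffOn_christoffel hD y₀).contDiffAt ht
  have hgv : ContDiffAt ℝ ∞ (fun x => metricCoord g y₀ ((extChartAt (𝓡 n) y₀).symm x) v v)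
    (extChartAt (𝓡 n) y₀ y) := (hg.clm_apply contDiffAt_const).clm_apply contDiffAt_const
  have h1 : ContDiffAt ℝ ∞ (fun x => (fderiv ℝ (fun x => metricCoord g y₀
      ((extChartAt (𝓡 n) y₀).symm x) v v) x v - 2 * metricCoord g y₀ ((extChartAt (𝓡 n) y₀).symm x)
      (christoffel D y₀ ((extChartAt (𝓡 n) y₀).symm x) v v) v) /
      metricCoord g y₀ ((extChartAt (𝓡 n) y₀).symm x) v v) (extChartAt (𝓡 n) y₀ y) := by
    refine ContDiffAt.div (ContDiffAt.sub ?_ ?_) hgv ?_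
    · exact (hgv.fderiv_right (m := ∞) (by simp)).clm_apply contDiffAt_const
    · exact contDiffAt_const.mul ((hg.clm_apply ((hΓ.clm_apply contDiffAt_const).clm_apply
        contDiffAt_const)).clm_apply contDiffAt_const)
    · rw [(extChartAt (𝓡 n) y₀).left_inv hy']
      exact (metricCoord_pos g hy v hv).ne'
  refine h1.congr_of_eventuallyEq ?_
  filter_upwards [ht] with x hx
  have hs : (extChartAt (𝓡 n) y₀).symm x ∈ (chartAt (Model n) y₀).source := by
    rw [← extChartAt_source (𝓡 n)]; exact (extChartAt (𝓡 n) y₀).map_target hx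
  have h2 := metricCoord_compat h hs v v v
  rw [(extChartAt (𝓡 n) y₀).right_inv hx] at h2
  rw [eq_div_iff (metricCoord_pos g hs v hv).ne', h2, metricCoord_symm g y₀ _ v (christoffel _ _ _ _ _)]
  ring

theorem contMDiff_weylOneForm [T2Space N] [SigmaCompactSpace N] {g : Metric n N}
    {α : ∀ x : N, Tan n x →L[ℝ] ℝ} {D : Connection n N}
    (hD : D.ContMDiffCovariantDerivative ∞) (h : IsCompatible g α D) {y₀ : N} :
    ContDiffOn ℝ ∞ (fun x => weylForm (metricCoord g y₀ ((extChartAt (𝓡 n) y₀).symm x))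
      ((α ((extChartAt (𝓡 n) y₀).symm x)).comp (tvec (𝓡 n) y₀ ((extChartAt (𝓡 n) y₀).symm x)))
      (tcoord (𝓡 n) y₀ ((extChartAt (𝓡 n) y₀).symm x) (sharp g _ (α ((extChartAt (𝓡 n) y₀).symm x)))))
      (extChartAt (𝓡 n) y₀).target := by
  have hs : ∀ x ∈ (extChartAt (𝓡 n) y₀).target,
      (extChartAt (𝓡 n) y₀).symm x ∈ (chartAt (Model n) y₀).source := fun x hx => by
    rw [← extChartAt_source (𝓡 n)]; exact (extChartAt (𝓡 n) y₀).map_target hx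
  have hα : ContDiffOn ℝ ∞ (fun x => (α ((extChartAt (𝓡 n) y₀).symm x)).comp
      (tvec (𝓡 n) y₀ ((extChartAt (𝓡 n) y₀).symm x))) (extChartAt (𝓡 n) y₀).target :=
    contDiffOn_clm_apply.2 fun v => contDiffOn_chart (I := 𝓡 n)
      (h := fun z => α z (tvec (𝓡 n) y₀ z v)) fun y hy => contMDiffAt_lee hD h hy v
  have hg := contDiffOn_metricCoord g y₀
  have hsh : ContDiffOn ℝ ∞ (fun x => tcoord (𝓡 n) y₀ ((extChartAt (𝓡 n) y₀).symm x)
      (sharp g _ (α ((extChartAt (𝓡 n) y₀).symm x)))) (extChartAt (𝓡 n) y₀).target := by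
    intro x hx
    have hinv (x) (hx : x ∈ (extChartAt (𝓡 n) y₀).target) :=
      isInvertible_of_pos (metricCoord g y₀ ((extChartAt (𝓡 n) y₀).symm x)) (metricCoord_pos g (hs x hx))
    refine (contDiffWithinAt_inverse_apply (hg x hx) (hα x hx) (hinv x hx)).congr_of_mem
      (fun z hz => ?_) hx
    refine form_ext (hinv z hz) fun w => ?_
    rw [form_inverse_apply (hinv z hz)]
    change g.inner _ (tvec _ _ _ _) _ = _
    rw [tvec_tcoord (hs z hz), inner_sharp]
    rfl
  refine contDiffOn_bilin fun v w => ?_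
  simp only [weylForm_apply]
  have e (v : Model n) := hα.clm_apply (contDiffOn_const (c := v))
  exact (contDiffOn_const (c := (2⁻¹ : ℝ))).smul ((((e w).smul (contDiffOn_const (c := v))).add
    ((e v).smul (contDiffOn_const (c := w)))).sub (((hg.clm_apply (contDiffOn_const (c := v))).clm_apply
    (contDiffOn_const (c := w))).smul hsh))

theorem contMDiffCovariantDerivative_addOneForm [T2Space N] [SigmaCompactSpace N] {g : Metric n N}
    {α : ∀ x : N, Tan n x →L[ℝ] ℝ} {D : Connection n N}
    (hD : D.ContMDiffCovariantDerivative ∞) (h : IsCompatible g α D) :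
    (D.addOneForm (weylOneForm g α)).ContMDiffCovariantDerivative ∞ := by
  refine ⟨⟨fun {σ} hσ => ?_⟩⟩
  refine ContMDiffOn.add_section (hD.contMDiff.contMDiff hσ) fun y _ => ?_
  refine ContMDiffAt.contMDiffWithinAt ?_
  have hy := mem_chart_source (Model n) y
  rw [contMDiffAt_hom_iff (A := fun z => weylOneForm g α z (σ z)) (r := ⊤) hy]
  have h1 := (contMDiffAt_section_iff_tcoord (I := 𝓡 n) hy).1 (hσ.contMDiffAt Filter.univ_mem)
  have h2 := contMDiffAt_of_chart (h := fun z => weylForm (metricCoord g y z)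
    ((α z).comp (tvec (𝓡 n) y z)) (tcoord (𝓡 n) y z (sharp g z (α z)))) hy
    ((contMDiff_weylOneForm hD h (y₀ := y)).contDiffAt ((isOpen_extChartAt_target y).mem_nhds
      ((extChartAt (𝓡 n) y).map_source (mem_extChartAt_source y))))
  refine (h2.clm_apply h1).congr_of_eventuallyEq ?_
  filter_upwards [(chartAt (Model n) y).open_source.mem_nhds hy] with z hz
  ext1 v
  change tcoord (𝓡 n) y z (weylOneForm g α z (σ z) (tvec (𝓡 n) y z v)) = _
  rw [weylOneForm_apply, weylForm_apply, ContinuousLinearMap.map_smul, map_sub, map_add,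
    ContinuousLinearMap.map_smul, ContinuousLinearMap.map_smul, ContinuousLinearMap.map_smul,
    tcoord_tvec hz, ContinuousLinearMap.comp_apply, ContinuousLinearMap.comp_apply, tvec_tcoord hz,
    metricCoord_apply, tvec_tcoord hz]

/-- The added tensor (α(v)u + α(u)v - g(u,v) α♯)/2 is symmetric, so the torsion is unchanged. Its
self-adjoint part with respect to g cancels α ⊗ g. -/
theorem exists_isLeviCivita [T2Space N] [SigmaCompactSpace N] {g : Metric n N} {D : Connection n N}
    (hD : IsWeyl g D) : ∃ D₀ : Connection n N, IsLeviCivita g D₀ := by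
  obtain ⟨α, hα⟩ := hD.conformal
  refine ⟨D.addOneForm (weylOneForm g α),
    contMDiffCovariantDerivative_addOneForm hD.smooth hα, ?_, ?_⟩
  · rw [CovariantDerivative.torsion_eq_zero_iff]
    intro X Y y hX hY
    rw [← (CovariantDerivative.torsion_eq_zero_iff (cov := D)).1 hD.torsion_free hX hY]
    change D Y y (X y) + weylOneForm g α y (Y y) (X y) - (D X y (Y y) + weylOneForm g α y (X y) (Y y)) = _
    have : weylOneForm g α y (Y y) (X y) = weylOneForm g α y (X y) (Y y) := by
      rw [weylOneForm_apply, weylOneForm_apply, g.symm y (Y y), add_comm (α y (X y) • Y y)]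
    rw [this]
    abel
  · intro σ τ y hσ hτ v
    rw [hα σ τ y hσ hτ v]
    change _ = _ + g.inner y (D σ y v + weylOneForm g α y (σ y) v) (τ y) +
      g.inner y (σ y) (D τ y v + weylOneForm g α y (τ y) v)
    have e1 : g.inner y (weylOneForm g α y (σ y) v) (τ y) = 2⁻¹ * (α y v * g.inner y (σ y) (τ y) +
        α y (σ y) * g.inner y v (τ y) - g.inner y (σ y) v * α y (τ y)) := by
      rw [weylOneForm_apply, ← inner_sharp g y (α y) (τ y)]
      simp only [map_smul, map_sub, map_add, smul_apply, sub_apply, add_apply, smul_eq_mul]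
    have e2 : g.inner y (σ y) (weylOneForm g α y (τ y) v) = 2⁻¹ * (α y v * g.inner y (σ y) (τ y) +
        α y (τ y) * g.inner y (σ y) v - g.inner y (τ y) v * α y (σ y)) := by
      rw [weylOneForm_apply, ← inner_sharp g y (α y) (σ y), g.symm y _ (σ y)]
      simp only [map_smul, map_sub, map_add, smul_eq_mul]
    have e0 : (0 : Tan n y →L[ℝ] ℝ) v = 0 := rfl
    rw [map_add, map_add, add_apply, e1, e2, g.symm y v (τ y), e0]
    ring

/-- `leviCivita` is a choice, which is meaningful only once a Levi-Civita connection is known to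
exist; here the given Weyl connection supplies one. -/
theorem exists_leviCivita_eq [T2Space N] [SigmaCompactSpace N] {g : Metric n N} {D : Connection n N}
    (hD : IsWeyl g D) : ∃ D₀ : Connection n N, IsLeviCivita g D₀ ∧ leviCivita g = D₀.toFun := by
  obtain ⟨D₀, h⟩ := exists_isLeviCivita hD
  exact Classical.epsilon_spec (p := fun nab => ∃ D : Connection n N, IsLeviCivita g D ∧ nab = D.toFun)
    ⟨D₀.toFun, D₀, h, rfl⟩

end

section
variable {n : ℕ} {N : Type*} [TopologicalSpace N] [ChartedSpace (Model n) N] [IsManifold (𝓡 n) ∞ N]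

theorem IsLeviCivita.isWeyl {g : Metric n N} {D : Connection n N} (h : IsLeviCivita g D) :
    IsWeyl g D := ⟨h.smooth, h.torsion_free, _, h.metric⟩

/-- The difference of two Weyl connections of the same conformal structure. -/
theorem IsWeyl.exists_sub_eq {g : Metric n N} {D D' : Connection n N} (hD : IsWeyl g D)
    (hD' : IsWeyl g D') (y : N) : ∃ β : Tan n y → ℝ, ∀ v w t : Tan n y,
      g.inner y (D' (ext w) y v) t = g.inner y (D (ext w) y v) t +
        (β t * g.inner y v w - β v * g.inner y w t - β w * g.inner y t v) / 2 := by
  obtain ⟨α, hα⟩ := hD.conformal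
  obtain ⟨α', hα'⟩ := hD'.conformal
  refine ⟨fun v => α' y v - α y v, ?_⟩
  have hy := mem_chart_source (Model n) y
  set S : Tan n y → Tan n y → Tan n y → ℝ := fun v w t =>
    g.inner y (D' (ext w) y v) t - g.inner y (D (ext w) y v) t with hS
  have h1 : ∀ (D : Connection n N) (v w t : Tan n y), g.inner y (D (ext w) y v) t =
      metricCoord g y y (christoffel D y y (tcoord (𝓡 n) y y v) (tcoord (𝓡 n) y y w))
        (tcoord (𝓡 n) y y t) := fun D v w t => by
    rw [← metricCoord_tcoord g hy, covariant_ext D hy]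
  have hsymm : ∀ v w t, S v w t = S w v t := fun v w t => by
    simp only [hS, h1, christoffel_symm hD.torsion_free y (tcoord (𝓡 n) y y v),
      christoffel_symm hD'.torsion_free y (tcoord (𝓡 n) y y v)]
  have hcompat : ∀ v w t, S v w t + S v t w = -(α' y v - α y v) * g.inner y w t := fun v w t => by
    have e1 := metricCoord_compat hα hy (tcoord (𝓡 n) y y v) (tcoord (𝓡 n) y y w)
      (tcoord (𝓡 n) y y t)
    have e2 := metricCoord_compat hα' hy (tcoord (𝓡 n) y y v) (tcoord (𝓡 n) y y w)
      (tcoord (𝓡 n) y y t)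
    rw [tvec_tcoord hy, metricCoord_tcoord g hy, metricCoord_symm g y y (tcoord (𝓡 n) y y w),
      ← h1, ← h1] at e1 e2
    simp only [hS]
    linarith
  intro v w t
  -- Koszul's argument: S is symmetric in its first two entries, its symmetrization in the last two
  -- is known, and the alternating sum over cyclic permutations isolates S.
  have a1 := hcompat v w t
  have a2 := hcompat w t v
  have a3 := hcompat t v w
  rw [hsymm w t v] at a2
  rw [hsymm t v w, hsymm w v t] at *
  have e : g.inner y (D' (ext w) y v) t = g.inner y (D (ext w) y v) t + S v w t := by
    simp only [hS]; ring
  rw [e]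
  have a4 := hsymm t w v
  have a5 := hsymm v w t
  linarith

/-- Each Schouten term has a factor which is a product of one of u, v with one of w, t. For tangent
u, v and normal w, t only the curvature remains. -/
theorem weyl_eq_of_orthogonal {g : Metric n N} (hn : ¬ n ≤ 2) {y : N} {u v w t : Tan n y}
    (huw : g.inner y u w = 0) (hvw : g.inner y v w = 0) (hut : g.inner y u t = 0)
    (hvt : g.inner y v t = 0) :
    weyl g y u v w t = -g.inner y (curvature (leviCivita g) y u v w) t := by
  rw [weyl, if_neg hn, huw, hvw, hut, hvt]
  ring

end

section
variable {n : ℕ} {N : Type*} [TopologicalSpace N] [ChartedSpace (Model n) N] [IsManifold (𝓡 n) ∞ N]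

/-- The tangent coordinates as a linear equivalence. -/
def tcoordEquiv {y₀ y : N} (hy : y ∈ (chartAt (Model n) y₀).source) : Tan n y ≃ₗ[ℝ] Model n where
  toLinearMap := tcoord (𝓡 n) y₀ y
  invFun := tvec (𝓡 n) y₀ y
  left_inv := tvec_tcoord hy
  right_inv := tcoord_tvec hy

/-- The orientation is compared with a constant one by means of bases, since positivity of complex
structures is expressed by bases too. -/
theorem IsOrientation.exists_chart {o : ∀ x : N, Orientation ℝ (Tan n x) (Fin n)}
    (ho : IsOrientation o) (y₀ : N) : ∃ oE : Orientation ℝ (Model n) (Fin n), ∀ᶠ y in 𝓝 y₀,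
      ∀ (b : Module.Basis (Fin n) ℝ (Tan n y)) (c : Module.Basis (Fin n) ℝ (Model n)),
        (∀ i, c i = tcoord (𝓡 n) y₀ y (b i)) → (b.orientation = o y ↔ c.orientation = oE) := by
  have h₀ := mem_baseSet (I := 𝓡 n) (mem_chart_source (Model n) y₀)
  refine ⟨Orientation.map (Fin n) ((trivializationAt (Model n) (TangentSpace (𝓡 n) : N → Type)
    y₀).linearEquivAt ℝ y₀ h₀) (o y₀), ?_⟩
  · filter_upwards [ho y₀, (chartAt (Model n) y₀).open_source.mem_nhds (mem_chart_source _ y₀)]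
      with y hy hs b c hc
    have h := hy h₀ (mem_baseSet hs)
    have hbc : c = b.map ((trivializationAt (Model n) (TangentSpace (𝓡 n) : N → Type) y₀).linearEquivAt
        ℝ y (mem_baseSet hs)) := by
      refine Module.Basis.eq_of_apply_eq fun i => ?_
      rw [hc, Module.Basis.map_apply, Trivialization.linearEquivAt_apply,
        trivializationAt_apply_eq_tcoord hs]
    rw [hbc, Module.Basis.orientation_map, ← h]
    exact (Equiv.apply_eq_iff_eq _).symm

end

/-! ### The immersion in charts. -/

/-- An immersion of oriented manifolds of even dimensions, with a metric on the target and a positive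
orthogonal complex structure on the source. -/
structure ConformalImmersion (m k : ℕ)
    (M : Type*) [TopologicalSpace M] [ChartedSpace (Model (m * 2)) M] [IsManifold (𝓡 (m * 2)) ∞ M]
    (N : Type*) [TopologicalSpace N] [ChartedSpace (Model (m * 2 + k * 2)) N]
    [IsManifold (𝓡 (m * 2 + k * 2)) ∞ N] where
  gM : Metric (m * 2) M
  g : Metric (m * 2 + k * 2) N
  oM : ∀ x : M, Orientation ℝ (Tan (m * 2) x) (Fin (m * 2))
  hoM : IsOrientation oM
  oN : ∀ y : N, Orientation ℝ (Tan (m * 2 + k * 2) y) (Fin (m * 2 + k * 2))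
  hoN : IsOrientation oN
  φ : C^∞⟮𝓡 (m * 2), M; 𝓡 (m * 2 + k * 2), N⟯
  hφ : ∀ x : M, Function.Injective (dif φ x)
  J : ∀ x : M, Tan (m * 2) x →L[ℝ] Tan (m * 2) x
  hJ : IsSectionQM gM oM J
  D : Connection (m * 2 + k * 2) N
  hD : IsLeviCivita g D

namespace ConformalImmersion

variable {m k : ℕ}
  {M : Type*} [TopologicalSpace M] [T2Space M] [SigmaCompactSpace M]
  [ChartedSpace (Model (m * 2)) M] [IsManifold (𝓡 (m * 2)) ∞ M]
  {N : Type*} [TopologicalSpace N] [T2Space N] [SigmaCompactSpace N]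
  [ChartedSpace (Model (m * 2 + k * 2)) N] [IsManifold (𝓡 (m * 2 + k * 2)) ∞ N]
  (S : ConformalImmersion m k M N)

/-- The orientation of `M` in the chart at `x₀`. -/
def chartOM (x₀ : M) : Orientation ℝ (Model (m * 2)) (Fin (m * 2)) := (S.hoM.exists_chart x₀).choose

/-- The orientation of `N` in the chart at `φ x₀`. -/
def chartON (x₀ : M) : Orientation ℝ (Model (m * 2 + k * 2)) (Fin (m * 2 + k * 2)) :=
  (S.hoN.exists_chart (S.φ x₀)).choose

/-- The domain of the local form of the immersion at `x₀`. -/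
def dom (x₀ : M) : Set M := interior {x | x ∈ (chartAt (Model (m * 2)) x₀).source ∧
  S.φ x ∈ (chartAt (Model (m * 2 + k * 2)) (S.φ x₀)).source ∧
  (∀ (b : Module.Basis (Fin (m * 2)) ℝ (Tan (m * 2) x))
    (c : Module.Basis (Fin (m * 2)) ℝ (Model (m * 2))),
    (∀ i, c i = tcoord (𝓡 (m * 2)) x₀ x (b i)) → (b.orientation = S.oM x ↔ c.orientation = S.chartOM x₀)) ∧
  (∀ (b : Module.Basis (Fin (m * 2 + k * 2)) ℝ (Tan (m * 2 + k * 2) (S.φ x)))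
    (c : Module.Basis (Fin (m * 2 + k * 2)) ℝ (Model (m * 2 + k * 2))),
    (∀ i, c i = tcoord (𝓡 (m * 2 + k * 2)) (S.φ x₀) (S.φ x) (b i)) →
      (b.orientation = S.oN (S.φ x) ↔ c.orientation = S.chartON x₀))}

theorem isOpen_dom (x₀ : M) : IsOpen (S.dom x₀) := isOpen_interior

theorem mem_dom (x₀ : M) : x₀ ∈ S.dom x₀ := by
  rw [dom, mem_interior_iff_mem_nhds]
  have hc := S.φ.contMDiff.continuous.continuousAt (x := x₀)
  filter_upwards [(chartAt (Model (m * 2)) x₀).open_source.mem_nhds (mem_chart_source _ x₀),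
    hc ((chartAt (Model (m * 2 + k * 2)) (S.φ x₀)).open_source.mem_nhds (mem_chart_source _ _)),
    (S.hoM.exists_chart x₀).choose_spec, hc ((S.hoN.exists_chart (S.φ x₀)).choose_spec)]
    with x h1 h2 h3 h4
  exact ⟨h1, h2, h3, h4⟩

variable {S} {x₀ x : M}

theorem source_of_mem_dom (hx : x ∈ S.dom x₀) : x ∈ (chartAt (Model (m * 2)) x₀).source :=
  (interior_subset hx).1

theorem map_source_of_mem_dom (hx : x ∈ S.dom x₀) :
    S.φ x ∈ (chartAt (Model (m * 2 + k * 2)) (S.φ x₀)).source :=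
  (interior_subset hx).2.1

theorem orientation_iff (hx : x ∈ S.dom x₀) {b : Module.Basis (Fin (m * 2)) ℝ (Tan (m * 2) x)}
    {c : Module.Basis (Fin (m * 2)) ℝ (Model (m * 2))}
    (h : ∀ i, c i = tcoord (𝓡 (m * 2)) x₀ x (b i)) :
    b.orientation = S.oM x ↔ c.orientation = S.chartOM x₀ := (interior_subset hx).2.2.1 b c h

theorem orientation_iff' (hx : x ∈ S.dom x₀)
    {b : Module.Basis (Fin (m * 2 + k * 2)) ℝ (Tan (m * 2 + k * 2) (S.φ x))}
    {c : Module.Basis (Fin (m * 2 + k * 2)) ℝ (Model (m * 2 + k * 2))}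
    (h : ∀ i, c i = tcoord (𝓡 (m * 2 + k * 2)) (S.φ x₀) (S.φ x) (b i)) :
    b.orientation = S.oN (S.φ x) ↔ c.orientation = S.chartON x₀ := (interior_subset hx).2.2.2 b c h

variable (S x₀)

/-- The immersion in coordinates. -/
def map (v : Model (m * 2)) : Model (m * 2 + k * 2) :=
  extChartAt (𝓡 (m * 2 + k * 2)) (S.φ x₀) (S.φ ((extChartAt (𝓡 (m * 2)) x₀).symm v))

/-- The coordinate domain. -/
def U : Set (Model (m * 2)) := (extChartAt (𝓡 (m * 2)) x₀).target ∩
  (extChartAt (𝓡 (m * 2)) x₀).symm ⁻¹' S.dom x₀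

theorem isOpen_U : IsOpen (S.U x₀) :=
  (continuousOn_extChartAt_symm x₀).isOpen_inter_preimage (isOpen_extChartAt_target x₀)
    (S.isOpen_dom x₀)

variable {S x₀}

theorem coord_mem_U (hx : x ∈ S.dom x₀) : extChartAt (𝓡 (m * 2)) x₀ x ∈ S.U x₀ := by
  have hs : x ∈ (extChartAt (𝓡 (m * 2)) x₀).source := by
    rw [extChartAt_source]; exact source_of_mem_dom hx
  exact ⟨(extChartAt (𝓡 (m * 2)) x₀).map_source hs, by
    rw [Set.mem_preimage, (extChartAt (𝓡 (m * 2)) x₀).left_inv hs]; exact hx⟩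

theorem symm_coord (hx : x ∈ S.dom x₀) :
    (extChartAt (𝓡 (m * 2)) x₀).symm (extChartAt (𝓡 (m * 2)) x₀ x) = x :=
  (extChartAt (𝓡 (m * 2)) x₀).left_inv (by rw [extChartAt_source]; exact source_of_mem_dom hx)

theorem contMDiffAt_chart_map (hx : x ∈ S.dom x₀) :
    ContMDiffAt (𝓡 (m * 2)) 𝓘(ℝ, Model (m * 2 + k * 2)) ∞
      (fun z => extChartAt (𝓡 (m * 2 + k * 2)) (S.φ x₀) (S.φ z)) x :=
  (contMDiffAt_extChartAt' (map_source_of_mem_dom hx)).comp x (S.φ.contMDiff x)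

theorem contDiffAt_map {v : Model (m * 2)} (hv : v ∈ S.U x₀) : ContDiffAt ℝ ∞ (S.map x₀) v := by
  have h := (contMDiffAt_chart_iff (source_of_mem_dom hv.2)).1 (contMDiffAt_chart_map hv.2)
  rwa [(extChartAt (𝓡 (m * 2)) x₀).right_inv hv.1] at h

theorem map_mem_target {v : Model (m * 2)} (hv : v ∈ S.U x₀) :
    S.map x₀ v ∈ (extChartAt (𝓡 (m * 2 + k * 2)) (S.φ x₀)).target :=
  (extChartAt _ _).map_source (by rw [extChartAt_source]; exact map_source_of_mem_dom hv.2)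

theorem symm_map {v : Model (m * 2)} (hv : v ∈ S.U x₀) :
    (extChartAt (𝓡 (m * 2 + k * 2)) (S.φ x₀)).symm (S.map x₀ v) =
      S.φ ((extChartAt (𝓡 (m * 2)) x₀).symm v) :=
  (extChartAt _ _).left_inv (by rw [extChartAt_source]; exact map_source_of_mem_dom hv.2)

theorem fderiv_map (hx : x ∈ S.dom x₀) (X : Tan (m * 2) x) :
    fderiv ℝ (S.map x₀) (extChartAt (𝓡 (m * 2)) x₀ x) (tcoord (𝓡 (m * 2)) x₀ x X) =
      tcoord (𝓡 (m * 2 + k * 2)) (S.φ x₀) (S.φ x) (dif S.φ x X) := by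
  rw [tcoord_eq_mfderiv (map_source_of_mem_dom hx)]
  have h1 := mvfderiv_eq_fderiv (source_of_mem_dom hx)
    ((contMDiffAt_chart_map hx).mdifferentiableAt (by simp)) X
  have h2 := mvfderiv_comp_of_mdifferentiableAt (I := 𝓡 (m * 2))
    (mdifferentiableAt_extChartAt (I := 𝓡 (m * 2 + k * 2)) (map_source_of_mem_dom hx))
    ((S.φ.contMDiff x).mdifferentiableAt (by simp)) X
  exact h1.symm.trans h2

end ConformalImmersion

section
variable {E F V W : Type*} [NormedAddCommGroup E] [NormedSpace ℝ E]
    [NormedAddCommGroup F] [NormedSpace ℝ F] [NormedAddCommGroup V] [NormedSpace ℝ V]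
    [NormedAddCommGroup W] [NormedSpace ℝ W]

theorem fderiv_comp_apply {b : F → W} {ψ : E → F} {v : E} (hb : DifferentiableAt ℝ b (ψ v))
    (hψ : DifferentiableAt ℝ ψ v) (X : E) :
    fderiv ℝ (fun v => b (ψ v)) v X = fderiv ℝ b (ψ v) (fderiv ℝ ψ v X) :=
  DFunLike.congr_fun (hb.hasFDerivAt.comp v hψ.hasFDerivAt).fderiv X

theorem fderiv_apply_const {b : E → V →L[ℝ] W} {v : E} (hb : DifferentiableAt ℝ b v) (u : V) (X : E) :
    fderiv ℝ (fun y => b y u) v X = fderiv ℝ b v X u := by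
  rw [(hb.hasFDerivAt.clm_apply (hasFDerivAt_const u _)).fderiv]
  simp

theorem differentiableAt_apply_const {b : E → V →L[ℝ] W} {v : E} (hb : DifferentiableAt ℝ b v)
    (u : V) : DifferentiableAt ℝ (fun y => b y u) v := hb.clm_apply (differentiableAt_const u)

set_option synthInstance.maxHeartbeats 400000 in
theorem fderiv_comp_bilin {b : F → V →L[ℝ] V →L[ℝ] W} {ψ : E → F} {v : E}
    (hb : DifferentiableAt ℝ b (ψ v)) (hψ : DifferentiableAt ℝ ψ v) (X : E) (u w : V) :
    fderiv ℝ (fun v => b (ψ v)) v X u w = fderiv ℝ (fun y => b y u w) (ψ v) (fderiv ℝ ψ v X) := by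
  have h1 := fderiv_comp_apply (W := V →L[ℝ] V →L[ℝ] W) hb hψ X
  have h2 := fderiv_apply_const (W := V →L[ℝ] W) hb u (fderiv ℝ ψ v X)
  have h3 := fderiv_apply_const (differentiableAt_apply_const hb u) w (fderiv ℝ ψ v X)
  exact (DFunLike.congr_fun (DFunLike.congr_fun h1 u) w).trans
    ((DFunLike.congr_fun h2 w).symm.trans h3.symm)

end

namespace ConformalImmersion

variable {m k : ℕ}
  {M : Type*} [TopologicalSpace M] [T2Space M] [SigmaCompactSpace M]
  [ChartedSpace (Model (m * 2)) M] [IsManifold (𝓡 (m * 2)) ∞ M]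
  {N : Type*} [TopologicalSpace N] [T2Space N] [SigmaCompactSpace N]
  [ChartedSpace (Model (m * 2 + k * 2)) N] [IsManifold (𝓡 (m * 2 + k * 2)) ∞ N]
  {S : ConformalImmersion m k M N} {x₀ x : M}

theorem target_source {v : Model (m * 2)} (hv : v ∈ S.U x₀) :
    (extChartAt (𝓡 (m * 2 + k * 2)) (S.φ x₀)).symm (S.map x₀ v) ∈
      (chartAt (Model (m * 2 + k * 2)) (S.φ x₀)).source := by
  rw [symm_map hv]; exact map_source_of_mem_dom hv.2

theorem map_right_inv {v : Model (m * 2)} (hv : v ∈ S.U x₀) :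
    extChartAt (𝓡 (m * 2 + k * 2)) (S.φ x₀)
      ((extChartAt (𝓡 (m * 2 + k * 2)) (S.φ x₀)).symm (S.map x₀ v)) = S.map x₀ v :=
  (extChartAt _ _).right_inv (map_mem_target hv)

theorem contDiffOn_g : ContDiffOn ℝ ∞ (fun v => metricCoord S.g (S.φ x₀)
    ((extChartAt (𝓡 (m * 2 + k * 2)) (S.φ x₀)).symm (S.map x₀ v))) (S.U x₀) :=
  (contDiffOn_metricCoord S.g (S.φ x₀)).comp
    (fun _ hv => (contDiffAt_map hv).contDiffWithinAt) fun _ hv => map_mem_target hv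

theorem contDiffOn_f : ContDiffOn ℝ ∞ (fderiv ℝ (S.map x₀)) (S.U x₀) := fun _ hv =>
  ((contDiffAt_map hv).fderiv_right (m := ∞) (by simp)).contDiffWithinAt

theorem contDiffOn_Γ : ContDiffOn ℝ ∞ (fun v => (christoffel S.D (S.φ x₀)
    ((extChartAt (𝓡 (m * 2 + k * 2)) (S.φ x₀)).symm (S.map x₀ v))).comp (fderiv ℝ (S.map x₀) v))
    (S.U x₀) :=
  ((contDiffOn_christoffel S.hD.smooth (S.φ x₀)).comp
    (fun _ hv => (contDiffAt_map hv).contDiffWithinAt) fun _ hv => map_mem_target hv).clm_comp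
    contDiffOn_f

theorem compat_loc {v : Model (m * 2)} (hv : v ∈ S.U x₀) (X : Model (m * 2))
    (u w : Model (m * 2 + k * 2)) :
    fderiv ℝ (fun v => metricCoord S.g (S.φ x₀)
      ((extChartAt (𝓡 (m * 2 + k * 2)) (S.φ x₀)).symm (S.map x₀ v))) v X u w =
    metricCoord S.g (S.φ x₀) ((extChartAt (𝓡 (m * 2 + k * 2)) (S.φ x₀)).symm (S.map x₀ v))
      (christoffel S.D (S.φ x₀) ((extChartAt (𝓡 (m * 2 + k * 2)) (S.φ x₀)).symm (S.map x₀ v))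
        (fderiv ℝ (S.map x₀) v X) u) w +
    metricCoord S.g (S.φ x₀) ((extChartAt (𝓡 (m * 2 + k * 2)) (S.φ x₀)).symm (S.map x₀ v))
      u (christoffel S.D (S.φ x₀) ((extChartAt (𝓡 (m * 2 + k * 2)) (S.φ x₀)).symm (S.map x₀ v))
        (fderiv ℝ (S.map x₀) v X) w) := by
  have hg := ((contDiffOn_metricCoord S.g (S.φ x₀)).contDiffAt
    ((isOpen_extChartAt_target _).mem_nhds (map_mem_target hv))).differentiableAt (by simp)
  have h2 := metricCoord_compat S.hD.metric (target_source hv) (fderiv ℝ (S.map x₀) v X) u w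
  rw [map_right_inv hv] at h2
  refine (fderiv_comp_bilin hg ((contDiffAt_map hv).differentiableAt (by simp)) X u w).trans
    (h2.trans ?_)
  have : (0 : Tan (m * 2 + k * 2) ((extChartAt (𝓡 (m * 2 + k * 2)) (S.φ x₀)).symm (S.map x₀ v)) →L[ℝ] ℝ)
    (tvec (𝓡 (m * 2 + k * 2)) (S.φ x₀) ((extChartAt (𝓡 (m * 2 + k * 2)) (S.φ x₀)).symm (S.map x₀ v))
      (fderiv ℝ (S.map x₀) v X)) = 0 := rfl
  rw [this]
  ring

theorem contDiffOn_J : ContDiffOn ℝ ∞ (fun v =>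
    (tcoord (𝓡 (m * 2)) x₀ ((extChartAt (𝓡 (m * 2)) x₀).symm v)).comp
      ((S.J ((extChartAt (𝓡 (m * 2)) x₀).symm v)).comp
        (tvec (𝓡 (m * 2)) x₀ ((extChartAt (𝓡 (m * 2)) x₀).symm v)))) (S.U x₀) :=
  (contDiffOn_chart (I := 𝓡 (m * 2)) (h := fun y => (tcoord (𝓡 (m * 2)) x₀ y).comp
    ((S.J y).comp (tvec (𝓡 (m * 2)) x₀ y))) fun y hy =>
      (contMDiffAt_hom_iff (r := ⊤) hy).1 (S.hJ.smooth y)).mono fun _ hv => hv.1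

theorem f_injective {v : Model (m * 2)} (hv : v ∈ S.U x₀) :
    Function.Injective (fderiv ℝ (S.map x₀) v) := by
  intro X Y h
  have hs := source_of_mem_dom hv.2
  have h1 := fderiv_map hv.2 (tvec (𝓡 (m * 2)) x₀ ((extChartAt (𝓡 (m * 2)) x₀).symm v) X)
  have h2 := fderiv_map hv.2 (tvec (𝓡 (m * 2)) x₀ ((extChartAt (𝓡 (m * 2)) x₀).symm v) Y)
  rw [(extChartAt (𝓡 (m * 2)) x₀).right_inv hv.1, tcoord_tvec hs] at h1 h2
  rw [h1, h2] at h
  have h3 := S.hφ _ (tcoord_injective (map_source_of_mem_dom hv.2) h)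
  rw [← tcoord_tvec (I := 𝓡 (m * 2)) hs X, h3, tcoord_tvec hs]

variable (S x₀) in
/-- The local form of the immersion at `x₀`. -/
def loc : LocalImmersion m k (Model (m * 2)) (Model (m * 2 + k * 2)) where
  U := S.U x₀
  isOpen := S.isOpen_U x₀
  g v := metricCoord S.g (S.φ x₀)
    ((extChartAt (𝓡 (m * 2 + k * 2)) (S.φ x₀)).symm (S.map x₀ v))
  f := fderiv ℝ (S.map x₀)
  Γ v := (christoffel S.D (S.φ x₀)
    ((extChartAt (𝓡 (m * 2 + k * 2)) (S.φ x₀)).symm (S.map x₀ v))).comp (fderiv ℝ (S.map x₀) v)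
  J v := (tcoord (𝓡 (m * 2)) x₀ ((extChartAt (𝓡 (m * 2)) x₀).symm v)).comp
      ((S.J ((extChartAt (𝓡 (m * 2)) x₀).symm v)).comp
        (tvec (𝓡 (m * 2)) x₀ ((extChartAt (𝓡 (m * 2)) x₀).symm v)))
  oE := S.chartOM x₀
  oV := S.chartON x₀
  contDiff_g := contDiffOn_g
  contDiff_f := contDiffOn_f
  contDiff_Γ := contDiffOn_Γ
  contDiff_J := contDiffOn_J
  g_symm _ _ := metricCoord_symm _ _ _
  g_pos _ hv := metricCoord_pos _ (target_source hv)
  f_inj _ hv := f_injective hv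
  compat _ hv := compat_loc hv
  J_sq v hv X := by
    have hs := source_of_mem_dom hv.2
    simp only [ContinuousLinearMap.comp_apply]
    rw [tvec_tcoord hs, S.hJ.sq, map_neg, tcoord_tvec hs]

/-- The coordinates of a point of `M`. -/
local notation "κ" => extChartAt (𝓡 (m * 2)) x₀

/-- The coordinates of a vector tangent to `M`. -/
local notation "τ" => tcoord (𝓡 (m * 2)) x₀ x

/-- The coordinates of a vector tangent to `N`. -/
local notation "ν" => tcoord (𝓡 (m * 2 + k * 2)) (S.φ x₀) (S.φ x)

theorem symm_map_coord (hx : x ∈ S.dom x₀) :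
    (extChartAt (𝓡 (m * 2 + k * 2)) (S.φ x₀)).symm (S.map x₀ (κ x)) = S.φ x := by
  rw [symm_map (coord_mem_U hx), symm_coord hx]

theorem loc_g (hx : x ∈ S.dom x₀) (u w : Tan (m * 2 + k * 2) (S.φ x)) :
    (S.loc x₀).g (κ x) (ν u) (ν w) = S.g.inner (S.φ x) u w := by
  change metricCoord S.g (S.φ x₀) ((extChartAt (𝓡 (m * 2 + k * 2)) (S.φ x₀)).symm (S.map x₀ (κ x)))
    _ _ = _
  rw [symm_map_coord hx, metricCoord_tcoord S.g (map_source_of_mem_dom hx)]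

theorem loc_f (hx : x ∈ S.dom x₀) (X : Tan (m * 2) x) :
    (S.loc x₀).f (κ x) (τ X) = ν (dif S.φ x X) := fderiv_map hx X

theorem loc_Γ (hx : x ∈ S.dom x₀) (X : Tan (m * 2) x) :
    (S.loc x₀).Γ (κ x) (τ X) = christoffel S.D (S.φ x₀) (S.φ x) (ν (dif S.φ x X)) := by
  change christoffel S.D (S.φ x₀) ((extChartAt (𝓡 (m * 2 + k * 2)) (S.φ x₀)).symm (S.map x₀ (κ x)))
    (fderiv ℝ (S.map x₀) (κ x) (τ X)) = _
  rw [symm_map_coord hx, fderiv_map hx]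

theorem loc_J (hx : x ∈ S.dom x₀) (X : Tan (m * 2) x) :
    (S.loc x₀).J (κ x) (τ X) = τ (S.J x X) := by
  change tcoord (𝓡 (m * 2)) x₀ ((extChartAt (𝓡 (m * 2)) x₀).symm (κ x))
    (S.J _ (tvec (𝓡 (m * 2)) x₀ ((extChartAt (𝓡 (m * 2)) x₀).symm (κ x)) _)) = _
  rw [symm_coord hx, tvec_tcoord (source_of_mem_dom hx)]

theorem forall_tcoord (hx : x ∈ S.dom x₀) {p : Model (m * 2) → Prop} :
    (∀ X, p X) ↔ ∀ X : Tan (m * 2) x, p (τ X) :=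
  ⟨fun h X => h _, fun h X => by
    rw [← tcoord_tvec (I := 𝓡 (m * 2)) (source_of_mem_dom hx) X]; exact h _⟩

theorem forall_tcoord' (hx : x ∈ S.dom x₀) {p : Model (m * 2 + k * 2) → Prop} :
    (∀ u, p u) ↔ ∀ u : Tan (m * 2 + k * 2) (S.φ x), p (ν u) :=
  ⟨fun h X => h _, fun h X => by
    rw [← tcoord_tvec (I := 𝓡 (m * 2 + k * 2)) (map_source_of_mem_dom hx) X]; exact h _⟩

theorem loc_isNormal (hx : x ∈ S.dom x₀) {u : Tan (m * 2 + k * 2) (S.φ x)} :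
    (S.loc x₀).IsNormal (κ x) (ν u) ↔ u ∈ normal S.φ S.g x := by
  rw [LocalImmersion.IsNormal, forall_tcoord hx]
  simp only [loc_f hx, loc_g hx]
  rfl

end ConformalImmersion

/-! ### Charts of the bundle of endomorphisms, and Q in these charts. -/

variable {m k : ℕ}
  {M : Type*} [TopologicalSpace M] [ChartedSpace (Model (m * 2)) M] [IsManifold (𝓡 (m * 2)) ∞ M]
  {N : Type*} [TopologicalSpace N] [ChartedSpace (Model (m * 2 + k * 2)) N]
  [IsManifold (𝓡 (m * 2 + k * 2)) ∞ N] (φ : C^∞⟮𝓡 (m * 2), M; 𝓡 (m * 2 + k * 2), N⟯)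

local instance topologicalSpace_endTotal : TopologicalSpace (EndTotal φ) := inferInstance

local instance isManifold_endTotal : IsManifold (EndI m k) ∞ (EndTotal φ) := inferInstance

local instance boundaryless_endI : (EndI m k).Boundaryless := inferInstance

/-- The endomorphism given by a point of `EndTotal φ`. -/
def actL (z : EndTotal φ) : Tan (m * 2 + k * 2) (φ z.proj) →L[ℝ] Tan (m * 2 + k * 2) (φ z.proj) := z.2

/-- The matrix of an endomorphism in the chart at `x₀`. -/
def coordEnd (x₀ : M) (z : EndTotal φ) : EndModel m k :=
  (tcoord (𝓡 (m * 2 + k * 2)) (φ x₀) (φ z.proj)).comp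
    ((actL φ z).comp (tvec (𝓡 (m * 2 + k * 2)) (φ x₀) (φ z.proj)))

variable {φ}

/-- The trivialization of the pull-back of `TN`. -/
abbrev pullTriv (φ : C^∞⟮𝓡 (m * 2), M; 𝓡 (m * 2 + k * 2), N⟯) (x₀ : M) :=
  trivializationAt (Model (m * 2 + k * 2)) (φ *ᵖ (TangentSpace (𝓡 (m * 2 + k * 2)) : N → Type)) x₀

theorem pullTriv_baseSet (x₀ x : M) : x ∈ (pullTriv φ x₀).baseSet ↔
    φ x ∈ (chartAt (Model (m * 2 + k * 2)) (φ x₀)).source := by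
  rw [← mem_baseSet_iff (I := 𝓡 (m * 2 + k * 2))]
  exact Iff.rfl

theorem pullTriv_continuousLinearMapAt {x₀ x : M}
    (hx : φ x ∈ (chartAt (Model (m * 2 + k * 2)) (φ x₀)).source)
    (u : Tan (m * 2 + k * 2) (φ x)) :
    (pullTriv φ x₀).continuousLinearMapAt ℝ x u = tcoord (𝓡 (m * 2 + k * 2)) (φ x₀) (φ x) u := by
  have h := congrArg Prod.snd (trivializationAt_apply_eq_tcoord hx u)
  refine Eq.trans ?_ h
  exact congrFun (Trivialization.coe_linearMapAt_of_mem (R := ℝ) (pullTriv φ x₀)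
    ((pullTriv_baseSet x₀ x).2 hx)) u

theorem pullTriv_symmL {x₀ x : M}
    (hx : φ x ∈ (chartAt (Model (m * 2 + k * 2)) (φ x₀)).source)
    (u : Model (m * 2 + k * 2)) :
    (pullTriv φ x₀).symmL ℝ x u = tvec (𝓡 (m * 2 + k * 2)) (φ x₀) (φ x) u := by
  refine tcoord_injective hx ?_
  exact (pullTriv_continuousLinearMapAt hx _).symm.trans
    ((Trivialization.continuousLinearMapAt_symmL (pullTriv φ x₀)
      ((pullTriv_baseSet x₀ x).2 hx) u).trans (tcoord_tvec hx u).symm)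

theorem mem_chartAt_source {z₀ z : EndTotal φ} :
    z ∈ (chartAt (ModelProd (Model (m * 2)) (EndModel m k)) z₀).source ↔
      z.proj ∈ (chartAt (Model (m * 2)) z₀.proj).source ∧
      φ z.proj ∈ (chartAt (Model (m * 2 + k * 2)) (φ z₀.proj)).source := by
  rw [FiberBundle.chartedSpace_chartAt, OpenPartialHomeomorph.trans_source, ← pullTriv_baseSet]
  constructor
  · rintro ⟨h1, h2⟩
    exact ⟨h2.1, h1.1⟩
  · rintro ⟨h1, h2⟩
    exact ⟨⟨h2, h2⟩, ⟨h1, trivial⟩⟩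

/-- The pull-back of TN is trivialized over M by the trivialization of TN at the image point, so the
fibre coordinate is the matrix of the endomorphism in the chart of N. -/
theorem extChartAt_end {z₀ z : EndTotal φ}
    (hz : φ z.proj ∈ (chartAt (Model (m * 2 + k * 2)) (φ z₀.proj)).source) :
    extChartAt (EndI m k) z₀ z = (extChartAt (𝓡 (m * 2)) z₀.proj z.proj, coordEnd φ z₀.proj z) := by
  rw [FiberBundle.extChartAt]
  refine Prod.ext rfl ?_
  ext1 u
  change (pullTriv φ z₀.proj).continuousLinearMapAt ℝ z.proj
    (z.2 ((pullTriv φ z₀.proj).symmL ℝ z.proj u)) = _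
  exact (pullTriv_continuousLinearMapAt hz _).trans (congrArg
    (fun w => tcoord (𝓡 (m * 2 + k * 2)) (φ z₀.proj) (φ z.proj) (actL φ z w)) (pullTriv_symmL hz u))

namespace LocalImmersion
variable {m k : ℕ} {E V : Type*} [NormedAddCommGroup E] [NormedSpace ℝ E]
    [NormedAddCommGroup V] [NormedSpace ℝ V] {S : LocalImmersion m k E V}
variable [FiniteDimensional ℝ E] [FiniteDimensional ℝ V]

/-- For K with K² = -1 on normal vectors, skew-symmetry and orthogonality are equivalent. The
equations with `pr` express that K is extended by zero to tangent vectors. -/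
theorem mem_Q_iff {y : E} {K : V →L[ℝ] V} : (y, K) ∈ S.adapted.Q ↔ y ∈ S.U ∧ (∀ X, K (S.f y X) = 0) ∧
    (∀ u, S.IsNormal y u → S.IsNormal y (K u)) ∧ (∀ u, S.IsNormal y u → K (K u) = -u) ∧
    (∀ u, S.IsNormal y u → ∀ v, S.IsNormal y v → S.g y (K u) (K v) = S.g y u v) ∧ S.Pos y K := by
  constructor
  · rintro ⟨hy, h1, h2, h3, h4, h5⟩
    simp only at hy h1 h2 h3 h4 h5
    have hy' : y ∈ S.U := hy
    have e1 : ∀ w, S.pr y (K w) = K w := DFunLike.congr_fun h1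
    have e2 : ∀ w, K (S.pr y w) = K w := DFunLike.congr_fun h2
    have e3 : ∀ w, K (K w) = -S.pr y w := DFunLike.congr_fun h3
    have e4 : ∀ u w, S.g y (K u) w = -S.g y u (K w) := h4
    refine ⟨hy', fun X => ?_, fun u _ => (isNormal_iff_pr hy').2 (e1 u), fun u hu => ?_,
      fun u hu v hv => ?_, h5⟩
    · rw [← e2, pr_f hy', map_zero]
    · rw [e3, pr_of_isNormal hy' hu]
    · rw [e4, e3, pr_of_isNormal hy' hv, map_neg, neg_neg]
  · rintro ⟨hy, h1, h2, h3, h4, h5⟩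
    have hK : ∀ u, K u = K (S.pr y u) := fun u => by
      have : u = S.f y (S.tan y u) + S.pr y u := by simp [pr]
      conv_lhs => rw [this]
      rw [map_add, h1, zero_add]
    have hn : ∀ u, S.IsNormal y (K u) := fun u => by
      rw [hK]; exact h2 _ (isNormal_pr hy u)
    have hs : ∀ u w, S.IsNormal y w → S.g y (S.pr y u) w = S.g y u w := fun u w hw => by
      rw [pr_adj hy, pr_of_isNormal hy hw]
    refine ⟨hy, ?_, ?_, ?_, fun u v => ?_, h5⟩
    · ext1 u; exact pr_of_isNormal hy (hn u)
    · ext1 u; exact (hK u).symm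
    · ext1 u
      change K (K u) = -S.pr y u
      rw [hK u, h3 _ (isNormal_pr hy u)]
    · change S.g y (K u) v = -S.g y u (K v)
      have a1 : S.g y (K u) v = S.g y (K u) (S.pr y v) := by
        rw [← pr_adj hy, pr_of_isNormal hy (hn u)]
      rw [a1, ← h4 _ (hn u) _ (isNormal_pr hy v), ← hK v, hK u, h3 _ (isNormal_pr hy u), map_neg]
      change -(S.g y (S.pr y u) (K v)) = _
      rw [hs u _ (hn v)]

/-- On normal vectors, the adapted connection and the given one induce the same derivative. -/
theorem g_cov {p : E × (V →L[ℝ] V)} (hp : p ∈ S.adapted.Q) (ξ : E × (V →L[ℝ] V)) {u v : V}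
    (hu : S.IsNormal p.1 u) (hv : S.IsNormal p.1 v) :
    S.g p.1 (S.adapted.cov p ξ u) v =
      S.g p.1 ((ξ.2 + (S.Γ p.1 ξ.1 * p.2 - p.2 * S.Γ p.1 ξ.1)) u) v := by
  obtain ⟨hy, -, hn, -⟩ := mem_Q_iff.1 hp
  have e2 : ∀ w, p.2 (S.pr p.1 w) = p.2 w := DFunLike.congr_fun hp.2.2.1
  have a : ∀ w, S.g p.1 (S.pr p.1 w) v = S.g p.1 w v := fun w => by
    rw [pr_adj hy, pr_of_isNormal hy hv]
  -- The two connections differ by `P` terms, which map normal vectors to tangent ones: these are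
  -- orthogonal to v and annihilated by K.
  have c1 : S.g p.1 (S.P p.1 ξ.1 (p.2 u)) v = 0 := by
    rw [← a, P_normal hy (hn u hu)]; simp
  have c2 : p.2 (S.P p.1 ξ.1 u) = 0 := by
    rw [← e2, P_normal hy hu, map_zero]
  have hΓ : ∀ w, S.Γ' p.1 ξ.1 w = S.Γ p.1 ξ.1 w +
      (S.pr p.1 (S.P p.1 ξ.1 w) + S.pr p.1 (S.P p.1 ξ.1 w) - S.P p.1 ξ.1 w) := by
    intro w
    rw [Γ', adaptAux_apply, two_mul]
    rfl
  have hc : S.adapted.cov p ξ u = ξ.2 u + (S.Γ' p.1 ξ.1 (p.2 u) - p.2 (S.Γ' p.1 ξ.1 u)) := rfl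
  rw [hc, hΓ, hΓ, P_normal hy (hn u hu), P_normal hy hu]
  simp only [add_apply, sub_apply, mul_apply_eq_comp, map_add, map_sub, c1, c2, map_zero, zero_apply]
  ring

end LocalImmersion

namespace ConformalImmersion
variable {m k : ℕ}
  {M : Type*} [TopologicalSpace M] [T2Space M] [SigmaCompactSpace M]
  [ChartedSpace (Model (m * 2)) M] [IsManifold (𝓡 (m * 2)) ∞ M]
  {N : Type*} [TopologicalSpace N] [T2Space N] [SigmaCompactSpace N]
  [ChartedSpace (Model (m * 2 + k * 2)) N] [IsManifold (𝓡 (m * 2 + k * 2)) ∞ N]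
  {S : ConformalImmersion m k M N} {z₀ z : EndTotal S.φ}

variable (S) in
/-- The bundle of positive maximal isotropic spaces of the normal bundle. -/
abbrev Q : Set (EndTotal S.φ) := normalTwistor S.φ S.g S.oM S.oN

theorem coordEnd_apply (hz : z.proj ∈ S.dom z₀.proj) (u : Tan (m * 2 + k * 2) (S.φ z.proj)) :
    coordEnd S.φ z₀.proj z (tcoord (𝓡 (m * 2 + k * 2)) (S.φ z₀.proj) (S.φ z.proj) u) =
      tcoord (𝓡 (m * 2 + k * 2)) (S.φ z₀.proj) (S.φ z.proj) (act S.φ z u) := by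
  simp only [coordEnd, ContinuousLinearMap.comp_apply]
  rw [tvec_tcoord (map_source_of_mem_dom hz)]
  rfl

theorem end_mem_source (hz : z.proj ∈ S.dom z₀.proj) :
    z ∈ (chartAt (ModelProd (Model (m * 2)) (EndModel m k)) z₀).source :=
  mem_chartAt_source.2 ⟨source_of_mem_dom hz, map_source_of_mem_dom hz⟩

theorem extChartAt_end (hz : z.proj ∈ S.dom z₀.proj) :
    extChartAt (EndI m k) z₀ z = (extChartAt (𝓡 (m * 2)) z₀.proj z.proj, coordEnd S.φ z₀.proj z) :=
  Twistor.extChartAt_end (map_source_of_mem_dom hz)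

theorem loc_pos (hz : z.proj ∈ S.dom z₀.proj) :
    (S.loc z₀.proj).Pos (extChartAt (𝓡 (m * 2)) z₀.proj z.proj) (coordEnd S.φ z₀.proj z) ↔
    ∃ (b : Module.Basis (Fin (m * 2)) ℝ (Tan (m * 2) z.proj))
      (c : Module.Basis (Fin (m * 2 + k * 2)) ℝ (Tan (m * 2 + k * 2) (S.φ z.proj))),
      b.orientation = S.oM z.proj ∧ c.orientation = S.oN (S.φ z.proj) ∧
      (∀ i : Fin (m * 2), c (Fin.castAdd (k * 2) i) = dif S.φ z.proj (b i)) ∧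
      (∀ j : Fin (k * 2), c (Fin.natAdd (m * 2) j) ∈ normal S.φ S.g z.proj) ∧
      ∀ j : Fin k, c (Fin.natAdd (m * 2) (finProdFinEquiv (j, 1))) =
        act S.φ z (c (Fin.natAdd (m * 2) (finProdFinEquiv (j, 0)))) := by
  have h1 := source_of_mem_dom hz
  have h2 := map_source_of_mem_dom hz
  have key (b : Module.Basis (Fin (m * 2)) ℝ (Tan (m * 2) z.proj))
      (c : Module.Basis (Fin (m * 2 + k * 2)) ℝ (Tan (m * 2 + k * 2) (S.φ z.proj)))
      (b' : Module.Basis (Fin (m * 2)) ℝ (Model (m * 2)))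
      (c' : Module.Basis (Fin (m * 2 + k * 2)) ℝ (Model (m * 2 + k * 2)))
      (hb : ∀ i, b' i = tcoord (𝓡 (m * 2)) z₀.proj z.proj (b i))
      (hc : ∀ i, c' i = tcoord (𝓡 (m * 2 + k * 2)) (S.φ z₀.proj) (S.φ z.proj) (c i)) :
      (b'.orientation = (S.loc z₀.proj).oE ∧ c'.orientation = (S.loc z₀.proj).oV ∧
        (∀ i : Fin (m * 2), c' (Fin.castAdd (k * 2) i) = (S.loc z₀.proj).f (extChartAt (𝓡 (m * 2)) z₀.proj z.proj) (b' i)) ∧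
        (∀ j : Fin (k * 2), (S.loc z₀.proj).IsNormal (extChartAt (𝓡 (m * 2)) z₀.proj z.proj) (c' (Fin.natAdd (m * 2) j))) ∧
        ∀ j : Fin k, c' (Fin.natAdd (m * 2) (finProdFinEquiv (j, 1))) =
          coordEnd S.φ z₀.proj z (c' (Fin.natAdd (m * 2) (finProdFinEquiv (j, 0))))) ↔
      (b.orientation = S.oM z.proj ∧ c.orientation = S.oN (S.φ z.proj) ∧
      (∀ i : Fin (m * 2), c (Fin.castAdd (k * 2) i) = dif S.φ z.proj (b i)) ∧
      (∀ j : Fin (k * 2), c (Fin.natAdd (m * 2) j) ∈ normal S.φ S.g z.proj) ∧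
      ∀ j : Fin k, c (Fin.natAdd (m * 2) (finProdFinEquiv (j, 1))) =
        act S.φ z (c (Fin.natAdd (m * 2) (finProdFinEquiv (j, 0))))) := by
    refine and_congr (orientation_iff hz hb).symm (and_congr (orientation_iff' hz hc).symm
      (and_congr ?_ (and_congr ?_ ?_)))
    · refine forall_congr' fun i => ?_
      rw [hb, hc, loc_f hz, (tcoord_injective h2).eq_iff]
    · refine forall_congr' fun i => ?_
      rw [hc, loc_isNormal hz]
    · refine forall_congr' fun i => ?_
      rw [hc, hc, coordEnd_apply hz, (tcoord_injective h2).eq_iff]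
  constructor
  · rintro ⟨b', c', h⟩
    refine ⟨b'.map (tcoordEquiv h1).symm, c'.map (tcoordEquiv h2).symm, (key _ _ b' c' ?_ ?_).1 h⟩
    · exact fun i => (tcoord_tvec h1 (b' i)).symm
    · exact fun i => (tcoord_tvec h2 (c' i)).symm
  · rintro ⟨b, c, h⟩
    exact ⟨b.map (tcoordEquiv h1), c.map (tcoordEquiv h2), (key b c _ _ (fun i => rfl)
      (fun i => rfl)).2 h⟩

theorem mem_Q_iff (hz : z.proj ∈ S.dom z₀.proj) :
    z ∈ S.Q ↔ extChartAt (EndI m k) z₀ z ∈ (S.loc z₀.proj).adapted.Q := by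
  rw [extChartAt_end hz, LocalImmersion.mem_Q_iff, loc_pos hz, forall_tcoord hz, forall_tcoord' hz,
    forall_tcoord' hz, forall_tcoord' hz]
  have h2 := map_source_of_mem_dom hz
  have hz0 : ∀ u, tcoord (𝓡 (m * 2 + k * 2)) (S.φ z₀.proj) (S.φ z.proj) u = 0 ↔ u = 0 := fun u => by
    rw [← (tcoord_injective h2).eq_iff, map_zero]
  have hneg : ∀ u v, tcoord (𝓡 (m * 2 + k * 2)) (S.φ z₀.proj) (S.φ z.proj) u =
      -tcoord (𝓡 (m * 2 + k * 2)) (S.φ z₀.proj) (S.φ z.proj) v ↔ u = -v := fun u v => by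
    rw [← (tcoord_injective h2).eq_iff, map_neg]
  constructor
  · intro h
    refine ⟨coord_mem_U hz, fun X => ?_, fun u hu => ?_, fun u hu => ?_, fun u hu => ?_, h.positive⟩
    · rw [loc_f hz, coordEnd_apply hz, hz0]; exact h.tangent X
    · rw [coordEnd_apply hz, loc_isNormal hz]; exact h.normal_mem u ((loc_isNormal hz).1 hu)
    · rw [coordEnd_apply hz, coordEnd_apply hz, hneg]; exact h.sq u ((loc_isNormal hz).1 hu)
    · rw [forall_tcoord' hz]
      intro v hv
      rw [coordEnd_apply hz, coordEnd_apply hz, loc_g hz, loc_g hz]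
      exact h.orthogonal u ((loc_isNormal hz).1 hu) v ((loc_isNormal hz).1 hv)
  · rintro ⟨-, h1, h2, h3, h4, h5⟩
    refine ⟨fun X => ?_, fun u hu => ?_, fun u hu => ?_, fun u hu v hv => ?_, h5⟩
    · have := h1 X; rwa [loc_f hz, coordEnd_apply hz, hz0] at this
    · have := h2 u ((loc_isNormal hz).2 hu); rwa [coordEnd_apply hz, loc_isNormal hz] at this
    · have := h3 u ((loc_isNormal hz).2 hu)
      rwa [coordEnd_apply hz, coordEnd_apply hz, hneg] at this
    · have := h4 u ((loc_isNormal hz).2 hu) _ ((loc_isNormal hz).2 hv)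
      rwa [coordEnd_apply hz, coordEnd_apply hz, loc_g hz, loc_g hz] at this

theorem eventually_mem_dom (hz : z.proj ∈ S.dom z₀.proj) : ∀ᶠ z' : EndTotal S.φ in 𝓝 z,
    z'.proj ∈ S.dom z₀.proj :=
  (FiberBundle.continuous_proj (EndModel m k) (EndFibre S.φ)).continuousAt.eventually
    ((S.isOpen_dom _).mem_nhds hz)

theorem mem_tangentTo_iff (hz : z.proj ∈ S.dom z₀.proj) (hQ : z ∈ S.Q)
    {ξ : TangentSpace (EndI m k) z} : ξ ∈ tangentTo (EndI m k) S.Q z ↔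
      (S.loc z₀.proj).adapted.IsTan (extChartAt (EndI m k) z₀ z) (tcoord (EndI m k) z₀ z ξ) := by
  rw [← AdaptedGeometry.mem_curveTan_iff _ ((mem_Q_iff hz).1 hQ)]
  have htgt : (S.loc z₀.proj).adapted.Q ⊆ (extChartAt (EndI m k) z₀).target := by
    rintro ⟨y, K⟩ h
    rw [FiberBundle.extChartAt_target]
    have hy : y ∈ S.U z₀.proj := h.1
    have : S.φ ((extChartAt (𝓡 (m * 2)) z₀.proj).symm y) ∈ _ := map_source_of_mem_dom hy.2
    rw [← pullTriv_baseSet] at this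
    exact ⟨⟨hy.1, ⟨this, this⟩⟩, trivial⟩
  refine Twistor.mem_tangentTo_iff (end_mem_source hz) htgt ?_ ?_
  · filter_upwards [eventually_mem_dom hz] with z' hz' h
    exact (mem_Q_iff hz').1 h
  · intro y hy
    have h1 := (extChartAt (EndI m k) z₀).right_inv (htgt hy)
    have h2 := (extChartAt (EndI m k) z₀).map_target (htgt hy)
    rw [extChartAt_source, mem_chartAt_source] at h2
    have h3 := Twistor.extChartAt_end h2.2
    rw [h1] at h3
    have hyU : y.1 ∈ S.U z₀.proj := hy.1
    have h4 : ((extChartAt (EndI m k) z₀).symm y).proj ∈ S.dom z₀.proj := by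
      have h5 := congrArg (extChartAt (𝓡 (m * 2)) z₀.proj).symm (congrArg Prod.fst h3)
      rw [(extChartAt (𝓡 (m * 2)) z₀.proj).left_inv (by rw [extChartAt_source]; exact h2.1)] at h5
      rw [← h5]
      exact hyU.2
    exact (mem_Q_iff h4).2 (by rw [h1]; exact hy)

end ConformalImmersion

theorem tcoord_of_eventuallyEq {F : Type*} [NormedAddCommGroup F] [NormedSpace ℝ F] {H : Type*}
    [TopologicalSpace H] {I : ModelWithCorners ℝ F H} {P : Type*} [TopologicalSpace P]
    [ChartedSpace H P] [IsManifold I ∞ P] [I.Boundaryless] {W : Type*} [NormedAddCommGroup W] [NormedSpace ℝ W]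
    (L : F →L[ℝ] W) {x₀ x : P} {h : P → W} (hx : x ∈ (chartAt H x₀).source)
    (hh : (fun z => L (extChartAt I x₀ z)) =ᶠ[𝓝 x] h) (ξ : TangentSpace I x) :
    L (tcoord I x₀ x ξ) = mvfderiv I h x ξ := by
  rw [tcoord_eq_mfderiv hx, ← mvfderiv_congr hh]
  have h1 := mvfderiv_comp_of_mdifferentiableAt (I := I) (L.differentiableAt (x := extChartAt I x₀ x)).mdifferentiableAt
    (mdifferentiableAt_extChartAt (I := I) hx) ξ
  have h5 : mvfderiv 𝓘(ℝ, F) L (extChartAt I x₀ x) = L := by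
    rw [mvfderiv, mfderiv_eq_fderiv, L.fderiv]; rfl
  rw [h5] at h1
  exact h1.symm

/-! ### The vertical part of a tangent vector in charts. -/

namespace ConformalImmersion
variable {m k : ℕ}
  {M : Type*} [TopologicalSpace M] [T2Space M] [SigmaCompactSpace M]
  [ChartedSpace (Model (m * 2)) M] [IsManifold (𝓡 (m * 2)) ∞ M]
  {N : Type*} [TopologicalSpace N] [T2Space N] [SigmaCompactSpace N]
  [ChartedSpace (Model (m * 2 + k * 2)) N] [IsManifold (𝓡 (m * 2 + k * 2)) ∞ N]
  {S : ConformalImmersion m k M N} {z₀ z : EndTotal S.φ}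

theorem mdifferentiableAt_proj (z : EndTotal S.φ) :
    MDifferentiableAt (EndI m k) (𝓡 (m * 2)) (TotalSpace.proj : EndTotal S.φ → M) z :=
  ((contMDiff_proj (n := ∞) (IB := 𝓡 (m * 2)) (EndFibre S.φ)) z).mdifferentiableAt (by simp)

theorem extChartAt_end_eventuallyEq (hz : z.proj ∈ S.dom z₀.proj) :
    extChartAt (EndI m k) z₀ =ᶠ[𝓝 z] fun z =>
      (extChartAt (𝓡 (m * 2)) z₀.proj z.proj, coordEnd S.φ z₀.proj z) := by
  filter_upwards [eventually_mem_dom hz] with z' hz' using extChartAt_end hz'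

theorem mdifferentiableAt_coordEnd (hz : z.proj ∈ S.dom z₀.proj) :
    MDifferentiableAt (EndI m k) 𝓘(ℝ, EndModel m k) (coordEnd S.φ z₀.proj) z := by
  have h := (mdifferentiableAt_extChartAt (I := EndI m k) (end_mem_source hz)).congr_of_eventuallyEq
    (extChartAt_end_eventuallyEq hz).symm
  have h2 : MDifferentiableAt 𝓘(ℝ, Model (m * 2) × EndModel m k) 𝓘(ℝ, EndModel m k) Prod.snd
    (extChartAt (𝓡 (m * 2)) z₀.proj z.proj, coordEnd S.φ z₀.proj z) :=
    differentiableAt_snd.mdifferentiableAt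
  exact MDifferentiableAt.comp z h2 h

theorem tcoord_end_fst (hz : z.proj ∈ S.dom z₀.proj) (ξ : TangentSpace (EndI m k) z) :
    (tcoord (EndI m k) z₀ z ξ).1 = tcoord (𝓡 (m * 2)) z₀.proj z.proj (difProj S.φ z ξ) := by
  have h2 := mvfderiv_comp_of_mdifferentiableAt (I := EndI m k)
    (mdifferentiableAt_extChartAt (I := 𝓡 (m * 2)) (source_of_mem_dom hz))
    (mdifferentiableAt_proj z) ξ
  have h3 := tcoord_of_eventuallyEq (I := EndI m k) (ContinuousLinearMap.fst ℝ _ _)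
    (end_mem_source hz) ((extChartAt_end_eventuallyEq hz).fun_comp Prod.fst) ξ
  rw [tcoord_eq_mfderiv (source_of_mem_dom hz)]
  exact h3.trans h2

theorem tcoord_end_snd (hz : z.proj ∈ S.dom z₀.proj) (ξ : TangentSpace (EndI m k) z) :
    (tcoord (EndI m k) z₀ z ξ).2 = mvfderiv (EndI m k) (coordEnd S.φ z₀.proj) z ξ :=
  tcoord_of_eventuallyEq (I := EndI m k) (ContinuousLinearMap.snd ℝ _ _)
    (end_mem_source hz) ((extChartAt_end_eventuallyEq hz).fun_comp Prod.snd) ξ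

/-- The derivative of the projection to `N`. -/
theorem mfderiv_proj_map (z : EndTotal S.φ) (ξ : TangentSpace (EndI m k) z) :
    mfderiv (EndI m k) (𝓡 (m * 2 + k * 2)) (fun z' : EndTotal S.φ => S.φ z'.proj) z ξ =
      dif S.φ z.proj (difProj S.φ z ξ) :=
  mfderiv_comp_apply z ((S.φ.contMDiff z.proj).mdifferentiableAt (by simp))
    (mdifferentiableAt_proj z) ξ

theorem mdifferentiableAt_proj_map (z : EndTotal S.φ) :
    MDifferentiableAt (EndI m k) (𝓡 (m * 2 + k * 2)) (fun z' : EndTotal S.φ => S.φ z'.proj) z :=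
  MDifferentiableAt.comp z ((S.φ.contMDiff z.proj).mdifferentiableAt (by simp))
    (mdifferentiableAt_proj z)

-- With e the coordinates of the extension of u, the product rule for K(e) produces K(de). The same
-- term comes from K applied to the covariant derivative of the extension and cancels it, leaving dK
-- + [Γ, K].
set_option maxHeartbeats 800000 in
theorem vertical_eq (D : Connection (m * 2 + k * 2) N) (hz : z.proj ∈ S.dom z₀.proj)
    (ξ : TangentSpace (EndI m k) z) (u v : Tan (m * 2 + k * 2) (S.φ z.proj)) :
    let Γ := christoffel D (S.φ z₀.proj) (S.φ z.proj) (tcoord (𝓡 (m * 2 + k * 2)) (S.φ z₀.proj)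
      (S.φ z.proj) (dif S.φ z.proj (difProj S.φ z ξ)))
    let K := coordEnd S.φ z₀.proj z
    vertical S.φ S.g D z ξ u v = (S.loc z₀.proj).g (extChartAt (𝓡 (m * 2)) z₀.proj z.proj)
      (((tcoord (EndI m k) z₀ z ξ).2 + (Γ * K - K * Γ))
        (tcoord (𝓡 (m * 2 + k * 2)) (S.φ z₀.proj) (S.φ z.proj) u))
      (tcoord (𝓡 (m * 2 + k * 2)) (S.φ z₀.proj) (S.φ z.proj) v) := by
  intro Γ K
  have h2 := map_source_of_mem_dom hz
  set e : N → Model (m * 2 + k * 2) := fun y => tcoord (𝓡 (m * 2 + k * 2)) (S.φ z₀.proj) y (ext u y) with he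
  have hde : MDifferentiableAt (𝓡 (m * 2 + k * 2)) 𝓘(ℝ, Model (m * 2 + k * 2)) e (S.φ z.proj) :=
    (mdifferentiableAt_section_iff h2).1 (mdifferentiableAt_ext u)
  have hde' : MDifferentiableAt (EndI m k) 𝓘(ℝ, Model (m * 2 + k * 2))
      (fun z' : EndTotal S.φ => e (S.φ z'.proj)) z :=
    MDifferentiableAt.comp z hde (mdifferentiableAt_proj_map z)
  have hev : (fun z' : EndTotal S.φ => tcoord (𝓡 (m * 2 + k * 2)) (S.φ z₀.proj) (S.φ z'.proj)
      (act S.φ z' (ext u (S.φ z'.proj)))) =ᶠ[𝓝 z]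
      fun z' => coordEnd S.φ z₀.proj z' (e (S.φ z'.proj)) := by
    filter_upwards [eventually_mem_dom hz] with z' hz'
    exact (coordEnd_apply hz' _).symm
  have hU : MDifferentiableAt (EndI m k) 𝓘(ℝ, Model (m * 2 + k * 2)) (fun z' : EndTotal S.φ =>
      tcoord (𝓡 (m * 2 + k * 2)) (S.φ z₀.proj) (S.φ z'.proj)
      (act S.φ z' (ext u (S.φ z'.proj)))) z :=
    ((mdifferentiableAt_coordEnd hz).clm_apply hde').congr_of_eventuallyEq hev
  have hcomp : mvfderiv (EndI m k) (fun z' : EndTotal S.φ => e (S.φ z'.proj)) z ξ =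
      mvfderiv (𝓡 (m * 2 + k * 2)) e (S.φ z.proj) (dif S.φ z.proj (difProj S.φ z ξ)) :=
    (mvfderiv_comp_of_mdifferentiableAt (f := fun z' : EndTotal S.φ => S.φ z'.proj) hde
      (mdifferentiableAt_proj_map z) ξ).trans (congrArg _ (mfderiv_proj_map z ξ))
  have hA : mvfderiv (EndI m k) (fun z' : EndTotal S.φ => tcoord (𝓡 (m * 2 + k * 2)) (S.φ z₀.proj)
      (S.φ z'.proj) (act S.φ z' (ext u (S.φ z'.proj)))) z ξ =
      (tcoord (EndI m k) z₀ z ξ).2 (e (S.φ z.proj)) + K (mvfderiv (𝓡 (m * 2 + k * 2)) e (S.φ z.proj)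
        (dif S.φ z.proj (difProj S.φ z ξ))) :=
    (DFunLike.congr_fun (mvfderiv_congr hev) ξ).trans
      ((mvfderiv_clm_apply (mdifferentiableAt_coordEnd hz) hde' ξ).trans (congrArg₂ (· + ·)
        (congrArg (fun L : EndModel m k => L (e (S.φ z.proj))) (tcoord_end_snd hz ξ).symm)
        (congrArg K hcomp)))
  have hB : tcoord (𝓡 (m * 2 + k * 2)) (S.φ z₀.proj) (S.φ z.proj)
      (act S.φ z (ext u (S.φ z.proj))) =
      K (tcoord (𝓡 (m * 2 + k * 2)) (S.φ z₀.proj) (S.φ z.proj) u) :=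
    (congrArg (fun w => tcoord (𝓡 (m * 2 + k * 2)) (S.φ z₀.proj) (S.φ z.proj) (act S.φ z w))
      (ext_self u)).trans (coordEnd_apply hz u).symm
  have h3 := (tcoord_alongDeriv D (ψ := fun z' : EndTotal S.φ => S.φ z'.proj)
    (U := fun z' => act S.φ z' (ext u (S.φ z'.proj))) h2 (mdifferentiableAt_proj_map z) hU ξ).trans
      (congrArg₂ (· + ·) hA (congrArg₂ (fun a b => christoffel D (S.φ z₀.proj) (S.φ z.proj)
        (tcoord (𝓡 (m * 2 + k * 2)) (S.φ z₀.proj) (S.φ z.proj) a) b) (mfderiv_proj_map z ξ) hB))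
  have h4 := tcoord_covariant D h2 (σ := ext u) hde (dif S.φ z.proj (difProj S.φ z ξ))
  have h5 : e (S.φ z.proj) = tcoord (𝓡 (m * 2 + k * 2)) (S.φ z₀.proj) (S.φ z.proj) u := by
    rw [he]; simp only [ext_self]
  refine (loc_g hz _ _).symm.trans (congrArg (fun w => (S.loc z₀.proj).g
    (extChartAt (𝓡 (m * 2)) z₀.proj z.proj) w
      (tcoord (𝓡 (m * 2 + k * 2)) (S.φ z₀.proj) (S.φ z.proj) v)) ?_)
  refine ((tcoord (𝓡 (m * 2 + k * 2)) (S.φ z₀.proj) (S.φ z.proj)).map_sub _ _).trans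
    ((congrArg₂ (· - ·) h3 ((coordEnd_apply hz _).symm.trans (congrArg K h4))).trans ?_)
  change (tcoord (EndI m k) z₀ z ξ).2 (e (S.φ z.proj)) + K _ + Γ (K _) - K (_ + Γ (e (S.φ z.proj))) =
    (tcoord (EndI m k) z₀ z ξ).2 _ + (Γ (K _) - K (Γ _))
  rw [h5, K.map_add]
  abel

theorem vertical_eq_cov (hz : z.proj ∈ S.dom z₀.proj) (hQ : z ∈ S.Q)
    (ξ : TangentSpace (EndI m k) z) {u v : Tan (m * 2 + k * 2) (S.φ z.proj)}
    (hu : u ∈ normal S.φ S.g z.proj) (hv : v ∈ normal S.φ S.g z.proj) :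
    vertical S.φ S.g S.D z ξ u v = (S.loc z₀.proj).g (extChartAt (𝓡 (m * 2)) z₀.proj z.proj)
      ((S.loc z₀.proj).adapted.cov (extChartAt (EndI m k) z₀ z) (tcoord (EndI m k) z₀ z ξ)
        (tcoord (𝓡 (m * 2 + k * 2)) (S.φ z₀.proj) (S.φ z.proj) u))
      (tcoord (𝓡 (m * 2 + k * 2)) (S.φ z₀.proj) (S.φ z.proj) v) := by
  have key : ∀ (p : Model (m * 2) × EndModel m k) (Γ : EndModel m k),
      p = (extChartAt (𝓡 (m * 2)) z₀.proj z.proj, coordEnd S.φ z₀.proj z) →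
      p ∈ (S.loc z₀.proj).adapted.Q → ∀ ξ' : Model (m * 2) × EndModel m k,
      Γ = (S.loc z₀.proj).Γ (extChartAt (𝓡 (m * 2)) z₀.proj z.proj) ξ'.1 →
      (S.loc z₀.proj).g (extChartAt (𝓡 (m * 2)) z₀.proj z.proj)
        ((ξ'.2 + (Γ * coordEnd S.φ z₀.proj z - coordEnd S.φ z₀.proj z * Γ))
          (tcoord (𝓡 (m * 2 + k * 2)) (S.φ z₀.proj) (S.φ z.proj) u))
        (tcoord (𝓡 (m * 2 + k * 2)) (S.φ z₀.proj) (S.φ z.proj) v) =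
      (S.loc z₀.proj).g (extChartAt (𝓡 (m * 2)) z₀.proj z.proj)
        ((S.loc z₀.proj).adapted.cov p ξ'
          (tcoord (𝓡 (m * 2 + k * 2)) (S.φ z₀.proj) (S.φ z.proj) u))
        (tcoord (𝓡 (m * 2 + k * 2)) (S.φ z₀.proj) (S.φ z.proj) v) := by
    rintro _ _ rfl h ξ' rfl
    exact (LocalImmersion.g_cov h ξ' ((loc_isNormal hz).2 hu) ((loc_isNormal hz).2 hv)).symm
  refine (vertical_eq S.D hz ξ u v).trans (key _ _ (extChartAt_end hz) ((mem_Q_iff hz).1 hQ) _ ?_)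
  rw [tcoord_end_fst hz]
  exact (loc_Γ hz _).symm

end ConformalImmersion

/-! ### Independence of the Weyl connection. -/

theorem IsFrame.exists_eq_sum {m k : ℕ}
    {M : Type*} [TopologicalSpace M] [ChartedSpace (Model (m * 2)) M] [IsManifold (𝓡 (m * 2)) ∞ M]
    {N : Type*} [TopologicalSpace N] [ChartedSpace (Model (m * 2 + k * 2)) N]
    [IsManifold (𝓡 (m * 2 + k * 2)) ∞ N] {φ : C^∞⟮𝓡 (m * 2), M; 𝓡 (m * 2 + k * 2), N⟯}
    {g : Metric (m * 2 + k * 2) N} {x : M} {Z : Fin (m * 2) → Tan (m * 2) x}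
    (hZ : IsFrame φ g x Z) (Y : Tan (m * 2) x) :
    ∃ c : Fin (m * 2) → ℝ, Y = ∑ a, c a • Z a := by
  have hli : LinearIndependent ℝ Z := by
    rw [Fintype.linearIndependent_iff]
    intro c hc a
    have h1 : g.inner (φ x) (dif φ x (∑ i, c i • Z i)) (dif φ x (Z a)) = 0 := by rw [hc]; simp
    have h2 : ∀ a b, g.inner (φ x) (dif φ x (Z a)) (dif φ x (Z b)) = _ := hZ
    simp only [map_sum, sum_apply, ContinuousLinearMap.map_smul, smul_apply, smul_eq_mul] at h1
    simpa [h2] using h1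
  have : FiniteDimensional ℝ (Tan (m * 2) x) := inferInstanceAs (FiniteDimensional ℝ (Model (m * 2)))
  have hc : Fintype.card (Fin (m * 2)) = Module.finrank ℝ (Tan (m * 2) x) := by
    rw [Fintype.card_fin]
    exact (finrank_euclideanSpace_fin (𝕜 := ℝ)).symm
  let b := Module.Basis.mk hli (hli.span_eq_top_of_card_eq_finrank' hc).ge
  refine ⟨b.repr Y, ?_⟩
  have := (b.sum_repr Y).symm
  simpa only [b, Module.Basis.mk_apply] using this

namespace ConformalImmersion
variable {m k : ℕ}
  {M : Type*} [TopologicalSpace M] [T2Space M] [SigmaCompactSpace M]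
  [ChartedSpace (Model (m * 2)) M] [IsManifold (𝓡 (m * 2)) ∞ M]
  {N : Type*} [TopologicalSpace N] [T2Space N] [SigmaCompactSpace N]
  [ChartedSpace (Model (m * 2 + k * 2)) N] [IsManifold (𝓡 (m * 2 + k * 2)) ∞ N]
  {S : ConformalImmersion m k M N}

theorem g_act {z : EndTotal S.φ} (hz : z ∈ S.Q) (u v : Tan (m * 2 + k * 2) (S.φ z.proj)) :
    S.g.inner (S.φ z.proj) (act S.φ z u) v = -S.g.inner (S.φ z.proj) u (act S.φ z v) := by
  have hd := S.mem_dom z.proj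
  have h := (mem_Q_iff hd).1 hz
  rw [extChartAt_end hd] at h
  have h1 := h.2.2.2.2.1 (tcoord (𝓡 (m * 2 + k * 2)) (S.φ z.proj) (S.φ z.proj) u)
    (tcoord (𝓡 (m * 2 + k * 2)) (S.φ z.proj) (S.φ z.proj) v)
  dsimp only at h1
  rw [coordEnd_apply hd, coordEnd_apply hd] at h1
  rw [← loc_g hd, ← loc_g hd]
  exact h1

/-- The vector a is the coordinate derivative in `alongDeriv` and is common to all connections; two
connections can thus be compared through their values on extensions alone. -/
theorem exists_vertical_eq (z : EndTotal S.φ) (ξ : TangentSpace (EndI m k) z)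
    (u v : Tan (m * 2 + k * 2) (S.φ z.proj)) : ∃ a : Tan (m * 2 + k * 2) (S.φ z.proj),
    ∀ D : Connection (m * 2 + k * 2) N, vertical S.φ S.g D z ξ u v = S.g.inner (S.φ z.proj)
      (a + D (ext (act S.φ z u)) (S.φ z.proj) (dif S.φ z.proj (difProj S.φ z ξ)) -
        act S.φ z (D (ext u) (S.φ z.proj) (dif S.φ z.proj (difProj S.φ z ξ)))) v := by
  refine ⟨(trivializationAt (Model (m * 2 + k * 2)) (TangentSpace (𝓡 (m * 2 + k * 2)) : N → Type)
    (S.φ z.proj)).symm (S.φ z.proj) (mvfderiv (EndI m k) (fun q : EndTotal S.φ =>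
      (trivializationAt (Model (m * 2 + k * 2)) (TangentSpace (𝓡 (m * 2 + k * 2)) : N → Type)
        (S.φ z.proj) ⟨S.φ q.proj, act S.φ q (ext u (S.φ q.proj))⟩).2) z ξ), fun D => ?_⟩
  have h1 := mfderiv_proj_map z ξ
  have h2 : act S.φ z (ext u (S.φ z.proj)) = act S.φ z u := congrArg _ (ext_self u)
  exact congrArg₂ (fun a b => S.g.inner (S.φ z.proj) (_ + D (ext a) (S.φ z.proj) b -
    act S.φ z (D (ext u) (S.φ z.proj) (dif S.φ z.proj (difProj S.φ z ξ)))) v) h2 h1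

/-- The vertical part does not depend on the Weyl connection. -/
theorem vertical_eq_of_isWeyl {D D' : Connection (m * 2 + k * 2) N} (hD : IsWeyl S.g D)
    (hD' : IsWeyl S.g D') {z : EndTotal S.φ} (hz : z ∈ S.Q) (ξ : TangentSpace (EndI m k) z)
    {u v : Tan (m * 2 + k * 2) (S.φ z.proj)}
    (hu : u ∈ normal S.φ S.g z.proj) (hv : v ∈ normal S.φ S.g z.proj) :
    vertical S.φ S.g D' z ξ u v = vertical S.φ S.g D z ξ u v := by
  obtain ⟨β, hβ⟩ := hD.exists_sub_eq hD' (S.φ z.proj)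
  have hs : ∀ a b, S.g.inner (S.φ z.proj) a b = S.g.inner (S.φ z.proj) b a := S.g.symm _
  obtain ⟨a, ha⟩ := exists_vertical_eq z ξ u v
  have key : ∀ p p' q q' : Tan (m * 2 + k * 2) (S.φ z.proj), ∀ r s : ℝ,
      S.g.inner (S.φ z.proj) p' v = S.g.inner (S.φ z.proj) p v + r →
      S.g.inner (S.φ z.proj) q' (act S.φ z v) = S.g.inner (S.φ z.proj) q (act S.φ z v) + s →
      r + s = 0 → S.g.inner (S.φ z.proj) (a + p' - act S.φ z q') v =
        S.g.inner (S.φ z.proj) (a + p - act S.φ z q) v := by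
    intro p p' q q' r s h1 h2 h3
    simp only [map_sub, map_add, sub_apply, add_apply]
    rw [g_act hz, g_act hz, h1, h2]
    linear_combination h3
  refine (ha D').trans (Eq.trans ?_ (ha D).symm)
  refine key _ _ _ _ _ _ (hβ (dif S.φ z.proj (difProj S.φ z ξ)) (act S.φ z u) v)
    (hβ (dif S.φ z.proj (difProj S.φ z ξ)) u (act S.φ z v)) ?_
  -- All products of a tangent with a normal vector vanish. With X the projected vector, what
  -- remains is -β(X)/2 times g(Ku, v) + g(u, Kv), which is zero.
  have h1 : S.g.inner (S.φ z.proj) (dif S.φ z.proj (difProj S.φ z ξ)) u = 0 := hu _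
  have h2 : S.g.inner (S.φ z.proj) v (dif S.φ z.proj (difProj S.φ z ξ)) = 0 := (hs _ _).trans (hv _)
  have h3 : S.g.inner (S.φ z.proj) (dif S.φ z.proj (difProj S.φ z ξ)) (act S.φ z u) = 0 :=
    hz.normal_mem u hu _
  have h4 : S.g.inner (S.φ z.proj) (act S.φ z v) (dif S.φ z.proj (difProj S.φ z ξ)) = 0 :=
    (hs _ _).trans (hz.normal_mem v hv _)
  linear_combination (β v / 2) * h3 - (β (act S.φ z u) / 2) * h2 + (β (act S.φ z v) / 2) * h1 -
    (β u / 2) * h4 - (β (dif S.φ z.proj (difProj S.φ z ξ)) / 2) * g_act hz u v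

variable {x : M}

theorem tcoord_alongDeriv_dif (D : Connection (m * 2 + k * 2) N) (X Z : Tan (m * 2) x) :
    tcoord (𝓡 (m * 2 + k * 2)) (S.φ x) (S.φ x)
      (alongDeriv (𝓡 (m * 2)) D S.φ (fun y => dif S.φ y (ext Z y)) x X) =
    fderiv ℝ (S.loc x).f (extChartAt (𝓡 (m * 2)) x x) (tcoord (𝓡 (m * 2)) x x X)
      (tcoord (𝓡 (m * 2)) x x Z) +
    christoffel D (S.φ x) (S.φ x) (tcoord (𝓡 (m * 2 + k * 2)) (S.φ x) (S.φ x) (dif S.φ x X))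
      (tcoord (𝓡 (m * 2 + k * 2)) (S.φ x) (S.φ x) (dif S.φ x Z)) := by
  have hd := S.mem_dom x
  have hx := mem_chart_source (Model (m * 2)) x
  have hf := ((S.loc x).contDiff_f.contDiffAt ((S.loc x).isOpen.mem_nhds
    (coord_mem_U hd))).differentiableAt (by simp)
  have hev : (fun q => tcoord (𝓡 (m * 2 + k * 2)) (S.φ x) (S.φ q) (dif S.φ q (ext Z q))) =ᶠ[𝓝 x]
      fun q => (S.loc x).f (extChartAt (𝓡 (m * 2)) x q) (tcoord (𝓡 (m * 2)) x x Z) := by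
    filter_upwards [(S.isOpen_dom x).mem_nhds hd, tcoord_eventuallyEq_ext Z] with q hq h
    rw [← h, loc_f hq]
  have h1 : DifferentiableAt ℝ (fun v => (S.loc x).f v (tcoord (𝓡 (m * 2)) x x Z))
    (extChartAt (𝓡 (m * 2)) x x) := differentiableAt_apply_const hf _
  have hκ := mdifferentiableAt_extChartAt (I := 𝓡 (m * 2)) hx
  have hU : MDifferentiableAt (𝓡 (m * 2)) 𝓘(ℝ, Model (m * 2 + k * 2)) (fun q =>
      tcoord (𝓡 (m * 2 + k * 2)) (S.φ x) (S.φ q) (dif S.φ q (ext Z q))) x :=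
    (h1.mdifferentiableAt.comp x hκ).congr_of_eventuallyEq hev
  have h2 := tcoord_alongDeriv D (ψ := S.φ) (U := fun y => dif S.φ y (ext Z y))
    (mem_chart_source _ (S.φ x)) ((S.φ.contMDiff x).mdifferentiableAt (by simp)) hU X
  have h3 := mvfderiv_comp_of_mdifferentiableAt (I := 𝓡 (m * 2)) h1.mdifferentiableAt hκ X
  have h4 : mvfderiv 𝓘(ℝ, Model (m * 2)) (fun v => (S.loc x).f v (tcoord (𝓡 (m * 2)) x x Z))
      (extChartAt (𝓡 (m * 2)) x x) = fderiv ℝ (fun v => (S.loc x).f v (tcoord (𝓡 (m * 2)) x x Z))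
      (extChartAt (𝓡 (m * 2)) x x) := by
    rw [mvfderiv, mfderiv_eq_fderiv]; rfl
  rw [h4] at h3
  rw [mvfderiv_congr hev, ext_self] at h2
  refine h2.trans (congrArg (· + _) ?_)
  refine h3.trans ?_
  rw [← tcoord_eq_mfderiv hx]
  exact fderiv_apply_const hf _ _

/-- The second fundamental form is symmetric. -/
theorem g_alongDeriv_dif_symm {D : Connection (m * 2 + k * 2) N} (hD : D.torsion = 0)
    (X Z : Tan (m * 2) x) :
    alongDeriv (𝓡 (m * 2)) D S.φ (fun y => dif S.φ y (ext Z y)) x X =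
      alongDeriv (𝓡 (m * 2)) D S.φ (fun y => dif S.φ y (ext X y)) x Z := by
  refine tcoord_injective (mem_chart_source _ (S.φ x)) ?_
  rw [tcoord_alongDeriv_dif, tcoord_alongDeriv_dif, christoffel_symm hD]
  congr 1
  have h : IsSymmSndFDerivAt ℝ (S.map x) (extChartAt (𝓡 (m * 2)) x x) :=
    (contDiffAt_map (coord_mem_U (S.mem_dom x))).isSymmSndFDerivAt (by simp; norm_cast)
  exact h _ _

/-- Expansion of Y in the orthonormal frame, together with the linearity in Z of the derivative of
the extension of Z at x. -/
theorem g_alongDeriv_dif_sum {D : Connection (m * 2 + k * 2) N} {Z : Fin (m * 2) → Tan (m * 2) x}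
    (hZ : IsFrame S.φ S.g x Z) (X Y : Tan (m * 2) x) (u : Tan (m * 2 + k * 2) (S.φ x)) :
    ∑ a, S.g.inner (S.φ x) (alongDeriv (𝓡 (m * 2)) D S.φ (fun y => dif S.φ y (ext (Z a) y)) x X) u *
      S.g.inner (S.φ x) (dif S.φ x Y) (dif S.φ x (Z a)) =
    S.g.inner (S.φ x) (alongDeriv (𝓡 (m * 2)) D S.φ (fun y => dif S.φ y (ext Y y)) x X) u := by
  obtain ⟨c, hc⟩ := hZ.exists_eq_sum Y
  have hlin : alongDeriv (𝓡 (m * 2)) D S.φ (fun y => dif S.φ y (ext Y y)) x X = ∑ a, c a •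
      alongDeriv (𝓡 (m * 2)) D S.φ (fun y => dif S.φ y (ext (Z a) y)) x X := by
    refine tcoord_injective (mem_chart_source _ (S.φ x)) ?_
    simp only [tcoord_alongDeriv_dif, map_sum, ContinuousLinearMap.map_smul, hc, smul_add,
      Finset.sum_add_distrib]
  rw [hlin]
  simp only [map_sum, sum_apply, ContinuousLinearMap.map_smul, smul_apply, smul_eq_mul]
  refine Finset.sum_congr rfl fun a _ => ?_
  rw [mul_comm]
  congr 1
  rw [hc]
  simp only [map_sum, sum_apply, ContinuousLinearMap.map_smul, smul_apply, smul_eq_mul]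
  simp [show ∀ a b, S.g.inner (S.φ x) (dif S.φ x (Z a)) (dif S.φ x (Z b)) = _ from hZ]

/-- The term `A` does not depend on the Weyl connection. -/
theorem termA_eq_of_isWeyl {D D' : Connection (m * 2 + k * 2) N} (hD : IsWeyl S.g D)
    (hD' : IsWeyl S.g D') {Z : Fin (m * 2) → Tan (m * 2) x}
    (hZ : IsFrame S.φ S.g x Z) (X Y : Tan (m * 2) x) {u v : Tan (m * 2 + k * 2) (S.φ x)}
    (hu : u ∈ normal S.φ S.g x) (hv : v ∈ normal S.φ S.g x) :
    termA S.φ S.g D' x Z X Y u v = termA S.φ S.g D x Z X Y u v := by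
  obtain ⟨β, hβ⟩ := hD.exists_sub_eq hD' (S.φ x)
  have hs : ∀ a b, S.g.inner (S.φ x) a b = S.g.inner (S.φ x) b a := S.g.symm _
  -- Another Weyl connection changes the second fundamental form by a multiple of the metric, the
  -- factor depending on the normal vector only.
  have key : ∀ (X Z : Tan (m * 2) x) {u}, u ∈ normal S.φ S.g x →
      S.g.inner (S.φ x) (alongDeriv (𝓡 (m * 2)) D' S.φ (fun y => dif S.φ y (ext Z y)) x X) u =
      S.g.inner (S.φ x) (alongDeriv (𝓡 (m * 2)) D S.φ (fun y => dif S.φ y (ext Z y)) x X) u +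
        β u * S.g.inner (S.φ x) (dif S.φ x X) (dif S.φ x Z) / 2 := by
    intro X Z u hu
    have e1 := hβ (dif S.φ x X) (dif S.φ x Z) u
    rw [hu Z, hs u, hu X] at e1
    simp only [alongDeriv, ext_self, map_add, add_apply]
    rw [e1]
    ring
  have e (X Y : Tan (m * 2) x) {u} (hu : u ∈ normal S.φ S.g x) := g_alongDeriv_dif_sum (D := D) hZ X Y u
  simp only [termA, key _ _ hu, key _ _ hv]
  -- The terms quadratic in β cancel in each summand. Those linear in β are sums over the frame
  -- which collapse to the second fundamental form on (X, Y) and (Y, X); they cancel by its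
  -- symmetry.
  rw [← sub_eq_zero, ← Finset.sum_sub_distrib]
  have e1 := e X Y hu
  have e2 := e X Y hv
  have e3 := e Y X hu
  have e4 := e Y X hv
  rw [g_alongDeriv_dif_symm hD.torsion_free] at e3 e4
  calc _ = (β v / 2) * ∑ a, S.g.inner (S.φ x) (alongDeriv (𝓡 (m * 2)) D S.φ (fun y => dif S.φ y (ext (Z a) y)) x X) u *
      S.g.inner (S.φ x) (dif S.φ x Y) (dif S.φ x (Z a)) -
      (β v / 2) * ∑ a, S.g.inner (S.φ x) (alongDeriv (𝓡 (m * 2)) D S.φ (fun y => dif S.φ y (ext (Z a) y)) x Y) u *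
      S.g.inner (S.φ x) (dif S.φ x X) (dif S.φ x (Z a)) +
      ((β u / 2) * ∑ a, S.g.inner (S.φ x) (alongDeriv (𝓡 (m * 2)) D S.φ (fun y => dif S.φ y (ext (Z a) y)) x Y) v *
      S.g.inner (S.φ x) (dif S.φ x X) (dif S.φ x (Z a)) -
      (β u / 2) * ∑ a, S.g.inner (S.φ x) (alongDeriv (𝓡 (m * 2)) D S.φ (fun y => dif S.φ y (ext (Z a) y)) x X) v *
      S.g.inner (S.φ x) (dif S.φ x Y) (dif S.φ x (Z a))) := by
        simp only [Finset.mul_sum, ← Finset.sum_sub_distrib, ← Finset.sum_add_distrib]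
        exact Finset.sum_congr rfl fun a _ => by ring
    _ = 0 := by rw [e1, e2, e3, e4]; ring

end ConformalImmersion

/-! ### The curvature of the normal bundle as -(W + A). -/

section
variable {E F V W : Type*} [NormedAddCommGroup E] [NormedSpace ℝ E]
    [NormedAddCommGroup F] [NormedSpace ℝ F] [NormedAddCommGroup V] [NormedSpace ℝ V]
    [NormedAddCommGroup W] [NormedSpace ℝ W]

/-- The exterior derivative of a pulled back one-form. -/
theorem fderiv_pullback_sub {c : F → F →L[ℝ] W} {f : E → F} {v : E} (hc : DifferentiableAt ℝ c (f v))
    (hf : ContDiffAt ℝ ∞ f v) (X Y : E) :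
    fderiv ℝ (fun v => (c (f v)).comp (fderiv ℝ f v)) v X Y -
      fderiv ℝ (fun v => (c (f v)).comp (fderiv ℝ f v)) v Y X =
    fderiv ℝ c (f v) (fderiv ℝ f v X) (fderiv ℝ f v Y) -
      fderiv ℝ c (f v) (fderiv ℝ f v Y) (fderiv ℝ f v X) := by
  have hd := ((hf.fderiv_right (m := ∞) (by simp)).differentiableAt (by simp)).hasFDerivAt
  have h1 := (hc.hasFDerivAt.comp v (hf.differentiableAt (by simp)).hasFDerivAt).clm_comp hd
  have hs : IsSymmSndFDerivAt ℝ f v := hf.isSymmSndFDerivAt (by simp; norm_cast)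
  have e : fderiv ℝ (fun v => (c (f v)).comp (fderiv ℝ f v)) v = _ := h1.fderiv
  have := hs X Y
  rw [e]
  simp [this]

theorem fderiv_apply_apply_const {b : F → F →L[ℝ] V →L[ℝ] W} {y : F} (hb : DifferentiableAt ℝ b y)
    (w : F) (u : V) (X : F) :
    fderiv ℝ (fun y => b y w u) y X = fderiv ℝ b y X w u := by
  have h2 := fderiv_apply_const (W := V →L[ℝ] W) hb w X
  have h3 := fderiv_apply_const (differentiableAt_apply_const hb w) u X
  exact h3.trans (DFunLike.congr_fun h2 u)

end

namespace ConformalImmersion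
variable {m k : ℕ}
  {M : Type*} [TopologicalSpace M] [T2Space M] [SigmaCompactSpace M]
  [ChartedSpace (Model (m * 2)) M] [IsManifold (𝓡 (m * 2)) ∞ M]
  {N : Type*} [TopologicalSpace N] [T2Space N] [SigmaCompactSpace N]
  [ChartedSpace (Model (m * 2 + k * 2)) N] [IsManifold (𝓡 (m * 2 + k * 2)) ∞ N]
  {S : ConformalImmersion m k M N} {x : M}

/-- The curvature of a pulled back connection is the pull-back of the curvature, as the second
derivatives of the immersion are symmetric. -/
theorem loc_curvature (X Y : Tan (m * 2) x) (u : Tan (m * 2 + k * 2) (S.φ x)) :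
    (fderiv ℝ (S.loc x).Γ (extChartAt (𝓡 (m * 2)) x x) (tcoord (𝓡 (m * 2)) x x X)
        (tcoord (𝓡 (m * 2)) x x Y) -
      fderiv ℝ (S.loc x).Γ (extChartAt (𝓡 (m * 2)) x x) (tcoord (𝓡 (m * 2)) x x Y)
        (tcoord (𝓡 (m * 2)) x x X) +
      ((S.loc x).Γ (extChartAt (𝓡 (m * 2)) x x) (tcoord (𝓡 (m * 2)) x x X) *
        (S.loc x).Γ (extChartAt (𝓡 (m * 2)) x x) (tcoord (𝓡 (m * 2)) x x Y) -
       (S.loc x).Γ (extChartAt (𝓡 (m * 2)) x x) (tcoord (𝓡 (m * 2)) x x Y) *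
        (S.loc x).Γ (extChartAt (𝓡 (m * 2)) x x) (tcoord (𝓡 (m * 2)) x x X)))
      (tcoord (𝓡 (m * 2 + k * 2)) (S.φ x) (S.φ x) u) =
    tcoord (𝓡 (m * 2 + k * 2)) (S.φ x) (S.φ x)
      (curvature S.D (S.φ x) (dif S.φ x X) (dif S.φ x Y) u) := by
  have hd := S.mem_dom x
  have hU := coord_mem_U hd
  have hmap : S.map x (extChartAt (𝓡 (m * 2)) x x) =
      extChartAt (𝓡 (m * 2 + k * 2)) (S.φ x) (S.φ x) := by rw [map, symm_coord hd]
  have hc := ((contDiffOn_christoffel S.hD.smooth (S.φ x)).contDiffAt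
    ((isOpen_extChartAt_target _).mem_nhds (map_mem_target hU))).differentiableAt (by simp)
  have h1 := fderiv_pullback_sub (W := Model (m * 2 + k * 2) →L[ℝ] Model (m * 2 + k * 2)) hc
    (contDiffAt_map hU) (tcoord (𝓡 (m * 2)) x x X) (tcoord (𝓡 (m * 2)) x x Y)
  rw [fderiv_map hd, fderiv_map hd] at h1
  have h2 := DFunLike.congr_fun h1 (tcoord (𝓡 (m * 2 + k * 2)) (S.φ x) (S.φ x) u)
  have h3 := h2.trans (congrArg₂ (· - ·) (fderiv_apply_apply_const hc _ _ _).symm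
    (fderiv_apply_apply_const hc _ _ _).symm)
  rw [tcoord_curvature S.hD.smooth, add_apply, loc_Γ hd, loc_Γ hd, ← hmap]
  exact congrArg (· + _) h3

theorem normal_eq_zero (hk : k = 0) {u : Tan (m * 2 + k * 2) (S.φ x)}
    (hu : u ∈ normal S.φ S.g x) : u = 0 := by
  have h1 : FiniteDimensional ℝ (Tan (m * 2) x) := inferInstanceAs (FiniteDimensional ℝ (Model _))
  have h2 : FiniteDimensional ℝ (Tan (m * 2 + k * 2) (S.φ x)) :=
    inferInstanceAs (FiniteDimensional ℝ (Model _))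
  have h3 : Module.finrank ℝ (Tan (m * 2) x) = Module.finrank ℝ (Tan (m * 2 + k * 2) (S.φ x)) :=
    (finrank_euclideanSpace_fin (𝕜 := ℝ)).trans
      (Eq.trans (by rw [hk]; simp) (finrank_euclideanSpace_fin (𝕜 := ℝ)).symm)
  obtain ⟨w, hw⟩ := (LinearMap.injective_iff_surjective_of_finrank_eq_finrank
    (f := (dif S.φ x).toLinearMap) h3).1 (S.hφ x) u
  by_contra h
  have h4 := S.g.pos _ u h
  have h5 := hu w
  rw [show dif S.φ x w = u from hw] at h5
  exact h4.ne' h5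

/-- The curvature of the normal bundle. -/
theorem g_curv_eq (hLC : leviCivita S.g = S.D.toFun) {D : Connection (m * 2 + k * 2) N}
    (hD : IsWeyl S.g D) {Z : Fin (m * 2) → Tan (m * 2) x}
    (hZ : IsFrame S.φ S.g x Z) (X Y : Tan (m * 2) x) {u v : Tan (m * 2 + k * 2) (S.φ x)}
    (hu : u ∈ normal S.φ S.g x) (hv : v ∈ normal S.φ S.g x) :
    (S.loc x).g (extChartAt (𝓡 (m * 2)) x x) ((S.loc x).adapted.curv (extChartAt (𝓡 (m * 2)) x x)
      (tcoord (𝓡 (m * 2)) x x X) (tcoord (𝓡 (m * 2)) x x Y)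
      (tcoord (𝓡 (m * 2 + k * 2)) (S.φ x) (S.φ x) u))
      (tcoord (𝓡 (m * 2 + k * 2)) (S.φ x) (S.φ x) v) =
    -weylPlusA S.φ S.g D x Z X Y u v := by
  have hd := S.mem_dom x
  have hII : ∀ X Z : Tan (m * 2) x, ∀ u : Tan (m * 2 + k * 2) (S.φ x),
      (S.loc x).g (extChartAt (𝓡 (m * 2)) x x)
        (fderiv ℝ (S.loc x).f (extChartAt (𝓡 (m * 2)) x x) (tcoord (𝓡 (m * 2)) x x X)
        (tcoord (𝓡 (m * 2)) x x Z) + (S.loc x).Γ (extChartAt (𝓡 (m * 2)) x x)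
          (tcoord (𝓡 (m * 2)) x x X) ((S.loc x).f (extChartAt (𝓡 (m * 2)) x x)
            (tcoord (𝓡 (m * 2)) x x Z))) (tcoord (𝓡 (m * 2 + k * 2)) (S.φ x) (S.φ x) u) =
      S.g.inner (S.φ x) (alongDeriv (𝓡 (m * 2)) S.D S.φ (fun y => dif S.φ y (ext Z y)) x X) u := by
    intro X Z u
    rw [loc_Γ hd, loc_f hd, ← tcoord_alongDeriv_dif, loc_g hd]
  have h := LocalImmersion.g_curv_normal (S := S.loc x) (coord_mem_U hd)
    (Z := fun a => tcoord (𝓡 (m * 2)) x x (Z a))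
    (by rw [Fintype.card_fin]; exact (finrank_euclideanSpace_fin (𝕜 := ℝ)).symm)
    (fun a b => by rw [loc_f hd, loc_f hd, loc_g hd]; exact hZ a b)
    (tcoord (𝓡 (m * 2)) x x X) (tcoord (𝓡 (m * 2)) x x Y) ((loc_isNormal hd).2 hu)
    ((loc_isNormal hd).2 hv)
  rw [loc_curvature, loc_g hd] at h
  simp only [hII] at h
  refine h.trans ?_
  -- A may be computed with the Levi-Civita connection, for which the Ricci equation was
  -- established.
  rw [weylPlusA, termA_eq_of_isWeyl S.hD.isWeyl hD hZ X Y hu hv]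
  change _ - termA S.φ S.g S.D x Z X Y u v = _
  -- In dimension at most two W is zero by convention, and the curvature term vanishes as well:
  -- either m = 0 and there are no tangent vectors other than 0, or k = 0 and there are no normal
  -- ones.
  by_cases hn : m * 2 + k * 2 ≤ 2
  · have : weyl S.g (S.φ x) (dif S.φ x X) (dif S.φ x Y) u v = 0 := by rw [weyl, if_pos hn]
    have h0 : S.g.inner (S.φ x) (curvature S.D (S.φ x) (dif S.φ x X) (dif S.φ x Y) u) v = 0 := by
      rw [← loc_g hd]
      rcases (by omega : m = 0 ∨ k = 0) with hm | hk
      · have hX : X = 0 := by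
          exact (PiLp.ext fun i => absurd i.2 (by omega) : (show Model (m * 2) from X) = 0)
        rw [hX, map_zero, tcoord_curvature S.hD.smooth]
        simp
      · rw [normal_eq_zero hk hu, tcoord_curvature S.hD.smooth]
        simp
    rw [this, h0]
    ring
  · rw [weyl_eq_of_orthogonal hn (hu X) (hu Y) (hv X) (hv Y), hLC]
    ring

end ConformalImmersion

/-! ### Construction and uniqueness of the almost complex structure on Q. -/

/-- The values are prescribed only at the points of Q. This is an affine condition, so local smooth
extensions of T along Q can be averaged by a partition of unity. -/
theorem exists_isSmoothField_eqOn {F : Type*} [NormedAddCommGroup F] [NormedSpace ℝ F] {H : Type*}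
    [TopologicalSpace H] {I : ModelWithCorners ℝ F H} {P : Type*} [TopologicalSpace P]
    [ChartedSpace H P] [IsManifold I ∞ P] [FiniteDimensional ℝ F] [T2Space P] [SigmaCompactSpace P]
    [I.Boundaryless] (Q : Set P) (T : ∀ z : P, TangentSpace I z)
    (h : ∀ x₀ : P, ∃ X : F → F, ∀ᶠ z in 𝓝 x₀, ContDiffAt ℝ ∞ X (extChartAt I x₀ z) ∧
      (z ∈ Q → tcoord I x₀ z (T z) = X (extChartAt I x₀ z))) :
    ∃ Y : ∀ z : P, TangentSpace I z, IsSmoothField I Y ∧ ∀ z, z ∈ Q → Y z = T z := by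
  refine exists_isSmoothField (fun z => {η | z ∈ Q → η = T z})
    (fun z η hη η' hη' a b _ _ hab hz => ?_) fun x₀ => ?_
  · rw [hη hz, hη' hz, ← add_smul, hab, one_smul]
  · obtain ⟨X, hX⟩ := h x₀
    refine ⟨fun z => tvec I x₀ z (X (extChartAt I x₀ z)), ?_⟩
    filter_upwards [hX, (chartAt H x₀).open_source.mem_nhds (mem_chart_source H x₀)] with z hz hs
    refine ⟨contMDiffAt_tvec hs hz.1, fun hQ => tcoord_injective hs ?_⟩
    rw [tcoord_tvec hs, hz.2 hQ]

namespace LocalImmersion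
variable {m k : ℕ} {E V : Type*} [NormedAddCommGroup E] [NormedSpace ℝ E]
    [NormedAddCommGroup V] [NormedSpace ℝ V] {S : LocalImmersion m k E V}
variable [FiniteDimensional ℝ E] [FiniteDimensional ℝ V]

/-- The characterization of the almost complex structure by its values on normal vectors. -/
theorem eq_cs_iff {p ξ η : E × (V →L[ℝ] V)} (hp : p ∈ S.adapted.Q) (hξ : S.adapted.IsTan p ξ)
    (hη : S.adapted.IsTan p η) : η = S.adapted.cs p ξ ↔ η.1 = S.J p.1 ξ.1 ∧
      ∀ u, S.IsNormal p.1 u → ∀ v, S.IsNormal p.1 v →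
        S.g p.1 (S.adapted.cov p η u) v = S.g p.1 (S.adapted.cov p ξ u) (p.2 v) := by
  have hy : p.1 ∈ S.U := hp.1
  have hK : ∀ u v, S.g p.1 (p.2 u) v = -S.g p.1 u (p.2 v) := hp.2.2.2.2.1
  have hKn : ∀ (A : V →L[ℝ] V) u v, S.g p.1 ((-(p.2 * A)) u) v = S.g p.1 (A u) (p.2 v) :=
    fun A u v => (DFunLike.congr_fun ((S.g p.1).map_neg (p.2 (A u))) v).trans
      ((congrArg Neg.neg (hK (A u) v)).trans (neg_neg _))
  constructor
  · rintro rfl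
    refine ⟨rfl, fun u _ v _ => ?_⟩
    rw [S.adapted.cov_cs]
    exact hKn _ _ _
  · rintro ⟨h1, h2⟩
    refine S.adapted.ext_cov p h1 ?_
    rw [S.adapted.cov_cs]
    ext1 u
    refine form_ext (isInvertible_g hy) fun v => ?_
    have hξ' := hξ.cs _ hp
    rw [AdaptedGeometry.IsTan, S.adapted.cov_cs] at hξ'
    rw [← hη.1, ← hη.2.1, ← hξ'.1, ← hξ'.2.1]
    change S.g p.1 (S.pr p.1 (S.adapted.cov p η (S.pr p.1 u))) v =
      S.g p.1 (S.pr p.1 ((-(p.2 * S.adapted.cov p ξ)) (S.pr p.1 u))) v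
    rw [pr_adj hy, pr_adj hy, h2 _ (isNormal_pr hy u) _ (isNormal_pr hy v), hKn]

end LocalImmersion

namespace ConformalImmersion
variable {m k : ℕ}
  {M : Type*} [TopologicalSpace M] [T2Space M] [SigmaCompactSpace M]
  [ChartedSpace (Model (m * 2)) M] [IsManifold (𝓡 (m * 2)) ∞ M]
  {N : Type*} [TopologicalSpace N] [T2Space N] [SigmaCompactSpace N]
  [ChartedSpace (Model (m * 2 + k * 2)) N] [IsManifold (𝓡 (m * 2 + k * 2)) ∞ N]
  {S : ConformalImmersion m k M N} {z₀ z : EndTotal S.φ}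

/-- The vector `η` is the image of `ξ` under the almost complex structure. -/
def IsImage (z : EndTotal S.φ) (ξ η : TangentSpace (EndI m k) z) : Prop :=
  difProj S.φ z η = S.J z.proj (difProj S.φ z ξ) ∧
    ∀ u ∈ normal S.φ S.g z.proj, ∀ v ∈ normal S.φ S.g z.proj,
      vertical S.φ S.g S.D z η u v = vertical S.φ S.g S.D z ξ u (act S.φ z v)

theorem isImage_iff (hz : z.proj ∈ S.dom z₀.proj) (hQ : z ∈ S.Q) {ξ η : TangentSpace (EndI m k) z}
    (hξ : ξ ∈ tangentTo (EndI m k) S.Q z) (hη : η ∈ tangentTo (EndI m k) S.Q z) :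
    IsImage z ξ η ↔ tcoord (EndI m k) z₀ z η =
      (S.loc z₀.proj).adapted.cs (extChartAt (EndI m k) z₀ z) (tcoord (EndI m k) z₀ z ξ) := by
  have key : ∀ p ξ' η' : Model (m * 2) × EndModel m k,
      p = (extChartAt (𝓡 (m * 2)) z₀.proj z.proj, coordEnd S.φ z₀.proj z) →
      p ∈ (S.loc z₀.proj).adapted.Q → (S.loc z₀.proj).adapted.IsTan p ξ' →
      (S.loc z₀.proj).adapted.IsTan p η' →
      ξ'.1 = tcoord (𝓡 (m * 2)) z₀.proj z.proj (difProj S.φ z ξ) →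
      η'.1 = tcoord (𝓡 (m * 2)) z₀.proj z.proj (difProj S.φ z η) →
      (∀ u ∈ normal S.φ S.g z.proj, ∀ v ∈ normal S.φ S.g z.proj, vertical S.φ S.g S.D z ξ u v =
        (S.loc z₀.proj).g (extChartAt (𝓡 (m * 2)) z₀.proj z.proj)
          ((S.loc z₀.proj).adapted.cov p ξ'
            (tcoord (𝓡 (m * 2 + k * 2)) (S.φ z₀.proj) (S.φ z.proj) u))
          (tcoord (𝓡 (m * 2 + k * 2)) (S.φ z₀.proj) (S.φ z.proj) v)) →
      (∀ u ∈ normal S.φ S.g z.proj, ∀ v ∈ normal S.φ S.g z.proj, vertical S.φ S.g S.D z η u v =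
        (S.loc z₀.proj).g (extChartAt (𝓡 (m * 2)) z₀.proj z.proj)
          ((S.loc z₀.proj).adapted.cov p η'
            (tcoord (𝓡 (m * 2 + k * 2)) (S.φ z₀.proj) (S.φ z.proj) u))
          (tcoord (𝓡 (m * 2 + k * 2)) (S.φ z₀.proj) (S.φ z.proj) v)) →
      (IsImage z ξ η ↔ η' = (S.loc z₀.proj).adapted.cs p ξ') := by
    rintro _ ξ' η' rfl hp h1 h2 e1 e2 v1 v2
    rw [LocalImmersion.eq_cs_iff hp h1 h2]
    dsimp only
    rw [e1, e2, loc_J hz, (tcoord_injective (source_of_mem_dom hz)).eq_iff, forall_tcoord' hz]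
    refine and_congr_right fun _ => forall_congr' fun u => ?_
    rw [loc_isNormal hz, forall_tcoord' hz]
    refine forall_congr' fun hu => forall_congr' fun v => ?_
    rw [loc_isNormal hz]
    refine forall_congr' fun hv' => ?_
    rw [v1 u hu _ (hQ.normal_mem v hv'), v2 u hu v hv', coordEnd_apply hz]
  exact key _ _ _ (extChartAt_end hz) ((mem_Q_iff hz).1 hQ) ((mem_tangentTo_iff hz hQ).1 hξ)
    ((mem_tangentTo_iff hz hQ).1 hη) (tcoord_end_fst hz ξ) (tcoord_end_fst hz η)
    (fun u hu v hv => vertical_eq_cov hz hQ ξ hu hv) (fun u hu v hv => vertical_eq_cov hz hQ η hu hv)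

variable (S) in
/-- The almost complex structure in the chart at `z`. -/
def csT (z : EndTotal S.φ) : TangentSpace (EndI m k) z →L[ℝ] TangentSpace (EndI m k) z :=
  (tvec (EndI m k) z z).comp (((S.loc z.proj).adapted.cs (extChartAt (EndI m k) z z)).comp
    (tcoord (EndI m k) z z))

theorem csT_mem (hQ : z ∈ S.Q) {ξ : TangentSpace (EndI m k) z}
    (hξ : ξ ∈ tangentTo (EndI m k) S.Q z) : S.csT z ξ ∈ tangentTo (EndI m k) S.Q z := by
  have hz := S.mem_dom z.proj
  rw [mem_tangentTo_iff hz hQ] at hξ ⊢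
  simp only [csT, ContinuousLinearMap.comp_apply]
  rw [tcoord_tvec (end_mem_source hz)]
  exact hξ.cs _ ((mem_Q_iff hz).1 hQ)

/-- `csT` is defined by the chart at z itself. The relation `IsImage` mentions no chart and
characterizes it, so the same formula holds in the charts at nearby points; smoothness depends on
this. -/
theorem tcoord_csT (hz : z.proj ∈ S.dom z₀.proj) (hQ : z ∈ S.Q) {ξ : TangentSpace (EndI m k) z}
    (hξ : ξ ∈ tangentTo (EndI m k) S.Q z) : tcoord (EndI m k) z₀ z (S.csT z ξ) =
      (S.loc z₀.proj).adapted.cs (extChartAt (EndI m k) z₀ z) (tcoord (EndI m k) z₀ z ξ) := by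
  have hz' := S.mem_dom z.proj
  rw [← isImage_iff hz hQ hξ (csT_mem hQ hξ), isImage_iff hz' hQ hξ (csT_mem hQ hξ)]
  exact tcoord_tvec (end_mem_source hz') _

theorem isImage_iff_csT (hQ : z ∈ S.Q) {ξ η : TangentSpace (EndI m k) z}
    (hξ : ξ ∈ tangentTo (EndI m k) S.Q z) (hη : η ∈ tangentTo (EndI m k) S.Q z) :
    IsImage z ξ η ↔ S.csT z ξ = η := by
  have hz := S.mem_dom z.proj
  rw [isImage_iff hz hQ hξ hη, ← tcoord_csT hz hQ hξ, (tcoord_injective (end_mem_source hz)).eq_iff,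
    eq_comm]

theorem csT_csT (hQ : z ∈ S.Q) {ξ : TangentSpace (EndI m k) z}
    (hξ : ξ ∈ tangentTo (EndI m k) S.Q z) : S.csT z (S.csT z ξ) = -ξ := by
  have hz := S.mem_dom z.proj
  refine tcoord_injective (end_mem_source hz) ?_
  rw [tcoord_csT hz hQ (csT_mem hQ hξ), tcoord_csT hz hQ hξ, AdaptedGeometry.cs_cs _
    ((mem_Q_iff hz).1 hQ) ((mem_tangentTo_iff hz hQ).1 hξ), ContinuousLinearMap.map_neg]

instance t2Space_endTotal : T2Space (EndTotal S.φ) := t2Space_totalSpace _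

instance sigmaCompactSpace_endTotal : SigmaCompactSpace (EndTotal S.φ) := by
  have h1 : SecondCountableTopology M := ChartedSpace.secondCountable_of_sigmaCompact (Model (m * 2)) M
  have h2 : SecondCountableTopology (EndTotal S.φ) := secondCountableTopology_totalSpace _
  have h3 : LocallyCompactSpace (EndTotal S.φ) :=
    Manifold.locallyCompact_of_finiteDimensional (EndI m k)
  exact sigmaCompactSpace_of_locallyCompact_secondCountable

/-- The coordinate expression of `cs` is smooth also off Q and thus provides the local extensions.
-/
theorem csT_smooth (X : ∀ z : EndTotal S.φ, TangentSpace (EndI m k) z)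
    (hX : IsSmoothField (EndI m k) X) (hXQ : ∀ z ∈ S.Q, X z ∈ tangentTo (EndI m k) S.Q z) :
    ∃ Y : ∀ z : EndTotal S.φ, TangentSpace (EndI m k) z, IsSmoothField (EndI m k) Y ∧
      ∀ z, z ∈ S.Q → Y z = S.csT z (X z) := by
  refine exists_isSmoothField_eqOn (I := EndI m k) S.Q (fun z => S.csT z (X z)) fun z₀ => ?_
  refine ⟨fun y => (S.loc z₀.proj).adapted.cs y
      (tcoord (EndI m k) z₀ ((extChartAt (EndI m k) z₀).symm y) (X ((extChartAt (EndI m k) z₀).symm y))), ?_⟩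
  filter_upwards [eventually_mem_dom (S.mem_dom z₀.proj)] with z hz
  have hs : z ∈ (extChartAt (EndI m k) z₀).source := by
    rw [extChartAt_source]; exact end_mem_source hz
  have hU : (extChartAt (EndI m k) z₀ z).1 ∈ (S.loc z₀.proj).adapted.U :=
    (congrArg Prod.fst (extChartAt_end hz)) ▸ coord_mem_U hz
  refine ⟨(AdaptedGeometry.contDiffAt_cs _ hU).clm_apply
    (isSmoothField_contDiffAt hX ((extChartAt (EndI m k) z₀).map_source hs)), fun hQ => ?_⟩
  refine (tcoord_csT hz hQ (hXQ z hQ)).trans ?_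
  have key : ∀ z', z' = z → (S.loc z₀.proj).adapted.cs (extChartAt (EndI m k) z₀ z)
      (tcoord (EndI m k) z₀ z (X z)) = (S.loc z₀.proj).adapted.cs (extChartAt (EndI m k) z₀ z)
      (tcoord (EndI m k) z₀ z' (X z')) := by rintro _ rfl; rfl
  exact key _ ((extChartAt (EndI m k) z₀).left_inv hs)

variable (S) in
/-- The almost complex structure on the bundle of positive maximal isotropic spaces. -/
def twistor : AlmostComplex (EndI m k) S.Q where
  toFun z := (S.csT z.1).toLinearMap.restrict fun _ h => csT_mem z.2 h
  sq z ξ := Subtype.ext (csT_csT z.2 ξ.2)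
  smooth X hX hXQ := by
    obtain ⟨Y, h1, h2⟩ := csT_smooth X hX fun z hz => hXQ ⟨z, hz⟩
    exact ⟨Y, h1, fun z => h2 z.1 z.2⟩

end ConformalImmersion

namespace ConformalImmersion
variable {m k : ℕ}
  {M : Type*} [TopologicalSpace M] [T2Space M] [SigmaCompactSpace M]
  [ChartedSpace (Model (m * 2)) M] [IsManifold (𝓡 (m * 2)) ∞ M]
  {N : Type*} [TopologicalSpace N] [T2Space N] [SigmaCompactSpace N]
  [ChartedSpace (Model (m * 2 + k * 2)) N] [IsManifold (𝓡 (m * 2 + k * 2)) ∞ N]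
  {S : ConformalImmersion m k M N} {z : EndTotal S.φ}

theorem add_add_neg_cancel_left' {W : Type*} [AddCommGroup W] (a b : W) : a = b + (a + -b) := by
  abel

theorem vertical_add (hQ : z ∈ S.Q) (ξ η : TangentSpace (EndI m k) z)
    {u v : Tan (m * 2 + k * 2) (S.φ z.proj)}
    (hu : u ∈ normal S.φ S.g z.proj) (hv : v ∈ normal S.φ S.g z.proj) :
    vertical S.φ S.g S.D z (ξ + η) u v =
      vertical S.φ S.g S.D z ξ u v + vertical S.φ S.g S.D z η u v := by
  have hz := S.mem_dom z.proj
  have key : ∀ (p ξ' η' ζ' : Model (m * 2) × EndModel m k) (a b), ζ' = ξ' + η' →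
      (S.loc z.proj).g (extChartAt (𝓡 (m * 2)) z.proj z.proj) ((S.loc z.proj).adapted.cov p ζ' a) b =
      (S.loc z.proj).g (extChartAt (𝓡 (m * 2)) z.proj z.proj) ((S.loc z.proj).adapted.cov p ξ' a) b +
      (S.loc z.proj).g (extChartAt (𝓡 (m * 2)) z.proj z.proj) ((S.loc z.proj).adapted.cov p η' a) b := by
    rintro p ξ' η' _ a b rfl
    have : (S.loc z.proj).adapted.cov p (ξ' + η') = (S.loc z.proj).adapted.cov p ξ' +
        (S.loc z.proj).adapted.cov p η' := by
      simp only [AdaptedGeometry.cov, Prod.fst_add, Prod.snd_add, map_add, add_mul, mul_add]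
      abel
    rw [this, add_apply, map_add, add_apply]
  exact (vertical_eq_cov hz hQ _ hu hv).trans ((key _ _ _ _ _ _
    ((tcoord (EndI m k) z z).map_add ξ η)).trans
    (congrArg₂ (· + ·) (vertical_eq_cov hz hQ ξ hu hv).symm (vertical_eq_cov hz hQ η hu hv).symm))

theorem vertical_zero (hQ : z ∈ S.Q) {u v : Tan (m * 2 + k * 2) (S.φ z.proj)}
    (hu : u ∈ normal S.φ S.g z.proj) (hv : v ∈ normal S.φ S.g z.proj) :
    vertical S.φ S.g S.D z 0 u v = 0 := by
  have := vertical_add hQ 0 0 hu hv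
  rw [add_zero] at this
  linarith

theorem vertical_neg (hQ : z ∈ S.Q) (ξ : TangentSpace (EndI m k) z)
    {u v : Tan (m * 2 + k * 2) (S.φ z.proj)}
    (hu : u ∈ normal S.φ S.g z.proj) (hv : v ∈ normal S.φ S.g z.proj) :
    vertical S.φ S.g S.D z (-ξ) u v = -vertical S.φ S.g S.D z ξ u v := by
  have := vertical_add hQ ξ (-ξ) hu hv
  rw [add_neg_cancel, vertical_zero hQ hu hv] at this
  linarith

theorem exists_horizontal (hQ : z ∈ S.Q) (X : Tan (m * 2) z.proj) :
    ∃ η ∈ tangentTo (EndI m k) S.Q z, difProj S.φ z η = X ∧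
      ∀ u ∈ normal S.φ S.g z.proj, ∀ v ∈ normal S.φ S.g z.proj,
        vertical S.φ S.g S.D z η u v = 0 := by
  have hz := S.mem_dom z.proj
  have h1 := tcoord_tvec (I := EndI m k) (end_mem_source hz)
    ((S.loc z.proj).adapted.hor (extChartAt (EndI m k) z z) (tcoord (𝓡 (m * 2)) z.proj z.proj X))
  refine ⟨tvec (EndI m k) z z ((S.loc z.proj).adapted.hor (extChartAt (EndI m k) z z)
    (tcoord (𝓡 (m * 2)) z.proj z.proj X)), ?_, ?_, fun u hu v hv => ?_⟩
  · rw [mem_tangentTo_iff hz hQ, h1]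
    exact AdaptedGeometry.isTan_hor _ _ _
  · refine tcoord_injective (source_of_mem_dom hz) ((tcoord_end_fst hz _).symm.trans ?_)
    exact congrArg Prod.fst h1
  · refine (vertical_eq_cov hz hQ _ hu hv).trans ?_
    have key : ∀ (p ξ' : Model (m * 2) × EndModel m k) (Y a b),
        ξ' = (S.loc z.proj).adapted.hor p Y → (S.loc z.proj).g (extChartAt (𝓡 (m * 2)) z.proj z.proj)
          ((S.loc z.proj).adapted.cov p ξ' a) b = 0 := by
      rintro p _ Y a b rfl
      rw [AdaptedGeometry.cov_hor, zero_apply, map_zero, zero_apply]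
    exact key _ _ _ _ _ h1

variable {D' : Connection (m * 2 + k * 2) N}

/-- A vector ξ + iη is in the +i eigenspace when ξ is mapped to -η. The right-hand side does not
involve D', which gives the independence of the Weyl connection. -/
theorem mem_twistorDistribution_iff (hD' : IsWeyl S.g D')
    {ζ : TangentSpace (EndI m k) z × TangentSpace (EndI m k) z} :
    ζ ∈ twistorDistribution S.φ S.g S.oM S.oN S.J D' z ↔ z ∈ S.Q ∧
      ζ.1 ∈ tangentTo (EndI m k) S.Q z ∧ ζ.2 ∈ tangentTo (EndI m k) S.Q z ∧
      IsImage z ζ.1 (-ζ.2) := by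
  have dadd : ∀ ξ η, difProj S.φ z (ξ + η) = difProj S.φ z ξ + difProj S.φ z η :=
    (difProj S.φ z).map_add
  have dneg : ∀ ξ, difProj S.φ z (-ξ) = -difProj S.φ z ξ := (difProj S.φ z).map_neg
  have Jneg : ∀ X, S.J z.proj (-X) = -S.J z.proj X := (S.J z.proj).map_neg
  constructor
  · rintro ⟨hQ, ζ₀, ⟨t1, t2, h3, h4⟩, ζ₁, ⟨s1, s2, d1, d2, h5⟩, rfl⟩
    refine ⟨hQ, Submodule.add_mem _ t1 s1, Submodule.add_mem _ t2 s2, ?_, fun u hu v hv => ?_⟩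
    · have e1 : difProj S.φ z (ζ₀.1 + ζ₁.1) = difProj S.φ z ζ₀.1 :=
        (dadd _ _).trans ((congrArg _ d1).trans (add_zero _))
      have e2 : difProj S.φ z (ζ₀.2 + ζ₁.2) = difProj S.φ z ζ₀.2 :=
        (dadd _ _).trans ((congrArg _ d2).trans (add_zero _))
      exact (dneg _).trans ((congrArg Neg.neg e2).trans (h4.1.symm.trans
        (congrArg (S.J z.proj) e1.symm)))
    · have hv' := hQ.normal_mem v hv
      have a1 := (h3 u hu _ hv').1
      have a2 := (h3 u hu v hv).2
      have a3 := h5 u hu v hv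
      rw [vertical_eq_of_isWeyl S.hD.isWeyl hD' hQ _ hu hv'] at a1
      rw [vertical_eq_of_isWeyl S.hD.isWeyl hD' hQ _ hu hv] at a2
      rw [vertical_eq_of_isWeyl S.hD.isWeyl hD' hQ _ hu hv,
        vertical_eq_of_isWeyl S.hD.isWeyl hD' hQ _ hu hv'] at a3
      have b1 := vertical_neg hQ (ζ₀.2 + ζ₁.2) hu hv
      have b2 := vertical_add hQ ζ₀.2 ζ₁.2 hu hv
      have b3 := vertical_add hQ ζ₀.1 ζ₁.1 hu hv'
      exact (by linarith : vertical S.φ S.g S.D z (-(ζ₀.2 + ζ₁.2)) u v =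
        vertical S.φ S.g S.D z (ζ₀.1 + ζ₁.1) u (act S.φ z v))
  · rintro ⟨hQ, t1, t2, h1, h2⟩
    -- The horizontal lifts of the projections of the two components give the horizontal summand;
    -- the differences are vertical.
    obtain ⟨η₁, r1, r2, r3⟩ := exists_horizontal hQ (difProj S.φ z ζ.1)
    obtain ⟨η₂, s1, s2, s3⟩ := exists_horizontal hQ (difProj S.φ z ζ.2)
    refine ⟨hQ, (η₁, η₂), ⟨r1, s1, fun u hu v hv => ⟨?_, ?_⟩, ?_, ?_⟩, (ζ.1 + -η₁, ζ.2 + -η₂),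
      ⟨Submodule.add_mem _ t1 (Submodule.neg_mem _ r1), Submodule.add_mem _ t2 (Submodule.neg_mem _ s1),
        ?_, ?_, fun u hu v hv => ?_⟩, ?_⟩
    · exact (vertical_eq_of_isWeyl S.hD.isWeyl hD' hQ _ hu hv).trans (r3 u hu v hv)
    · exact (vertical_eq_of_isWeyl S.hD.isWeyl hD' hQ _ hu hv).trans (s3 u hu v hv)
    · exact (congrArg (S.J z.proj) r2).trans (h1.symm.trans ((dneg _).trans
        (congrArg Neg.neg s2.symm)))
    · have h3 := (Jneg _).symm.trans ((congrArg (S.J z.proj) ((dneg ζ.2).symm.trans h1)).trans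
        (S.hJ.sq _ _))
      exact (congrArg (S.J z.proj) s2).trans ((neg_inj.1 h3).trans r2.symm)
    · exact (dadd _ _).trans ((congrArg _ ((dneg _).trans (congrArg Neg.neg r2))).trans
        (add_neg_cancel _))
    · exact (dadd _ _).trans ((congrArg _ ((dneg _).trans (congrArg Neg.neg s2))).trans
        (add_neg_cancel _))
    · have hv' := hQ.normal_mem v hv
      have h3 := h2 u hu v hv
      rw [vertical_neg hQ _ hu hv] at h3
      refine (vertical_eq_of_isWeyl S.hD.isWeyl hD' hQ _ hu hv).trans
        (Eq.trans ?_ (congrArg Neg.neg (vertical_eq_of_isWeyl S.hD.isWeyl hD' hQ _ hu hv').symm))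
      have b1 := vertical_neg hQ η₁ hu hv'
      have b2 := vertical_neg hQ η₂ hu hv
      have b3 := vertical_add hQ ζ.2 (-η₂) hu hv
      have b4 := vertical_add hQ ζ.1 (-η₁) hu hv'
      have b5 := r3 u hu _ hv'
      have b6 := s3 u hu v hv
      exact (by linarith : vertical S.φ S.g S.D z (ζ.2 + -η₂) u v =
        -vertical S.φ S.g S.D z (ζ.1 + -η₁) u (act S.φ z v))
    · exact Prod.ext (add_add_neg_cancel_left' _ _) (add_add_neg_cancel_left' _ _)

theorem eigenI_twistor (hD' : IsWeyl S.g D') (z : EndTotal S.φ) :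
    S.twistor.eigenI z = twistorDistribution S.φ S.g S.oM S.oN S.J D' z := by
  ext ζ
  rw [mem_twistorDistribution_iff hD']
  constructor
  · rintro ⟨hQ, h1, h2, h3, h4⟩
    exact ⟨hQ, h1, h2, (isImage_iff_csT hQ h1 (Submodule.neg_mem _ h2)).2 h3⟩
  · rintro ⟨hQ, h1, h2, h3⟩
    have h4 := (isImage_iff_csT hQ h1 (Submodule.neg_mem _ h2)).1 h3
    refine ⟨hQ, h1, h2, h4, ?_⟩
    have h5 := csT_csT hQ h1
    rw [h4] at h5
    exact neg_inj.1 (((S.csT z).map_neg ζ.2).symm.trans h5)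

/-- For every tangent ξ the pair (ξ, -Jξ) lies in the +i eigenspace, from which Jξ can be recovered.
-/
theorem _root_.Twistor.AlmostComplex.ext_eigenI {E : Type*} [NormedAddCommGroup E] [NormedSpace ℝ E] {H : Type*}
    [TopologicalSpace H] {I : ModelWithCorners ℝ E H} {P : Type*} [TopologicalSpace P]
    [ChartedSpace H P] [IsManifold I ∞ P] {Q : Set P} {J J' : AlmostComplex I Q}
    (h : ∀ z, J.eigenI z = J'.eigenI z) : J = J' := by
  have : J.toFun = J'.toFun := by
    funext z
    refine LinearMap.ext fun ξ => Subtype.ext ?_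
    have h1 : ((ξ : TangentSpace I z.1), -(J.toFun z ξ : TangentSpace I z.1)) ∈ J.eigenI z := by
      refine ⟨z.2, ξ.2, Submodule.neg_mem _ (J.toFun z ξ).2, (neg_neg _).symm, ?_⟩
      have h2 := J.sq z ξ
      have h3 : J.toFun z (-(J.toFun z ξ)) = ξ := by rw [map_neg, h2, neg_neg]
      exact congrArg Subtype.val h3
    rw [h] at h1
    obtain ⟨_, _, _, h4, -⟩ := h1
    exact ((neg_neg _).symm.trans h4.symm)
  cases J; cases J'; cases this; rfl

theorem isTwistorStructure_iff (hD' : IsWeyl S.g D') (𝒥' : AlmostComplex (EndI m k) S.Q) :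
    IsTwistorStructure S.φ S.g S.oM S.oN S.J D' 𝒥' ↔ 𝒥' = S.twistor := by
  constructor
  · exact fun h => AlmostComplex.ext_eigenI fun z => (h z).trans (eigenI_twistor hD' z).symm
  · rintro rfl z
    exact eigenI_twistor hD' z

end ConformalImmersion

/-! ### Integrability on Q and on M as pointwise conditions. -/

namespace ConformalImmersion
variable {m k : ℕ}
  {M : Type*} [TopologicalSpace M] [T2Space M] [SigmaCompactSpace M]
  [ChartedSpace (Model (m * 2)) M] [IsManifold (𝓡 (m * 2)) ∞ M]
  {N : Type*} [TopologicalSpace N] [T2Space N] [SigmaCompactSpace N]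
  [ChartedSpace (Model (m * 2 + k * 2)) N] [IsManifold (𝓡 (m * 2 + k * 2)) ∞ N]
  {S : ConformalImmersion m k M N} {z₀ z : EndTotal S.φ}

theorem mem_eigenNegI_twistor {ζ : TangentSpace (EndI m k) z × TangentSpace (EndI m k) z} :
    ζ ∈ S.twistor.eigenNegI z ↔ z ∈ S.Q ∧ ζ.1 ∈ tangentTo (EndI m k) S.Q z ∧
      S.csT z ζ.1 = ζ.2 := by
  constructor
  · rintro ⟨hQ, h1, -, h3, -⟩
    exact ⟨hQ, h1, h3⟩
  · rintro ⟨hQ, h1, h3⟩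
    exact ⟨hQ, h1, h3 ▸ csT_mem hQ h1, h3, (congrArg (S.csT z) h3.symm).trans (csT_csT hQ h1)⟩

theorem mem_eigenNegI_twistor_iff (hz : z.proj ∈ S.dom z₀.proj)
    {ζ : TangentSpace (EndI m k) z × TangentSpace (EndI m k) z} :
    ζ ∈ S.twistor.eigenNegI z ↔ z ∈ S.Q ∧
      (S.loc z₀.proj).adapted.IsTan (extChartAt (EndI m k) z₀ z) (tcoord (EndI m k) z₀ z ζ.1) ∧
      (S.loc z₀.proj).adapted.cs (extChartAt (EndI m k) z₀ z) (tcoord (EndI m k) z₀ z ζ.1) =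
        tcoord (EndI m k) z₀ z ζ.2 := by
  rw [mem_eigenNegI_twistor]
  refine and_congr_right fun hQ => ?_
  rw [mem_tangentTo_iff hz hQ]
  refine and_congr_right fun h1 => ?_
  rw [← tcoord_csT hz hQ ((mem_tangentTo_iff hz hQ).2 h1),
    (tcoord_injective (end_mem_source hz)).eq_iff]

theorem eventually_local_section {X₁ X₂ : ∀ z : EndTotal S.φ, TangentSpace (EndI m k) z}
    (h : ∀ z ∈ S.Q, (X₁ z, X₂ z) ∈ S.twistor.eigenNegI z) (z : EndTotal S.φ) :
    ∀ᶠ q in 𝓝 (extChartAt (EndI m k) z z), q ∈ (S.loc z.proj).adapted.Q →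
      (S.loc z.proj).adapted.IsTan q (tcoord (EndI m k) z ((extChartAt (EndI m k) z).symm q)
        (X₁ ((extChartAt (EndI m k) z).symm q))) ∧
      (S.loc z.proj).adapted.cs q (tcoord (EndI m k) z ((extChartAt (EndI m k) z).symm q)
        (X₁ ((extChartAt (EndI m k) z).symm q))) =
        tcoord (EndI m k) z ((extChartAt (EndI m k) z).symm q)
          (X₂ ((extChartAt (EndI m k) z).symm q)) := by
  have h0 := continuousAt_extChartAt_symm (I := EndI m k) z
  rw [ContinuousAt, extChartAt_to_inv] at h0
  have h1 := h0.eventually (eventually_mem_dom (S.mem_dom z.proj))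
  filter_upwards [h1, extChartAt_target_mem_nhds (I := EndI m k) z] with q hq ht hQ
  generalize hz' : (extChartAt (EndI m k) z).symm q = z' at hq
  have hq' : extChartAt (EndI m k) z z' = q := hz' ▸ (extChartAt (EndI m k) z).right_inv ht
  subst hq'
  have hQ' : z' ∈ S.Q := (mem_Q_iff hq).2 hQ
  exact ((mem_eigenNegI_twistor_iff hq).1 (h z' hQ')).2

variable (S) in
/-- The integrability condition at `z` on the vectors `a + iJa` and `b + iJb`. -/
def IntegrableAt (z : EndTotal S.φ) (a b : Tan (m * 2) z.proj) : Prop :=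
  (S.loc z.proj).adapted.nijJ (extChartAt (𝓡 (m * 2)) z.proj z.proj)
    (tcoord (𝓡 (m * 2)) z.proj z.proj a) (tcoord (𝓡 (m * 2)) z.proj z.proj b) = 0 ∧
  ∀ u v, (S.loc z.proj).IsNormal (extChartAt (𝓡 (m * 2)) z.proj z.proj) u →
    (S.loc z.proj).IsNormal (extChartAt (𝓡 (m * 2)) z.proj z.proj) v →
    (S.loc z.proj).obstruction (extChartAt (𝓡 (m * 2)) z.proj z.proj) (coordEnd S.φ z.proj z)
      (tcoord (𝓡 (m * 2)) z.proj z.proj a) (tcoord (𝓡 (m * 2)) z.proj z.proj b) u v = 0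

-- The bracket condition is tensorial, and of the values of the fields at z only the projections to
-- M matter. This is `lieBracket_iff` read in the chart at z.
set_option maxHeartbeats 800000 in
theorem mlieBracket_mem_iff {X₁ X₂ Y₁ Y₂ : ∀ z : EndTotal S.φ, TangentSpace (EndI m k) z}
    (hX₁ : IsSmoothField (EndI m k) X₁) (hX₂ : IsSmoothField (EndI m k) X₂)
    (hY₁ : IsSmoothField (EndI m k) Y₁) (hY₂ : IsSmoothField (EndI m k) Y₂)
    (hX : ∀ z ∈ S.Q, (X₁ z, X₂ z) ∈ S.twistor.eigenNegI z)
    (hY : ∀ z ∈ S.Q, (Y₁ z, Y₂ z) ∈ S.twistor.eigenNegI z) (hQ : z ∈ S.Q) :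
    (VectorField.mlieBracket (EndI m k) X₁ Y₁ z - VectorField.mlieBracket (EndI m k) X₂ Y₂ z,
      VectorField.mlieBracket (EndI m k) X₁ Y₂ z + VectorField.mlieBracket (EndI m k) X₂ Y₁ z) ∈
        S.twistor.eigenNegI z ↔
      S.IntegrableAt z (difProj S.φ z (X₁ z)) (difProj S.φ z (Y₁ z)) := by
  have hz := S.mem_dom z.proj
  have hp := (mem_Q_iff hz).1 hQ
  have hd : ∀ {X : ∀ z : EndTotal S.φ, TangentSpace (EndI m k) z}, IsSmoothField (EndI m k) X →
      DifferentiableAt ℝ (fun y => tcoord (EndI m k) z ((extChartAt (EndI m k) z).symm y)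
        (X ((extChartAt (EndI m k) z).symm y))) (extChartAt (EndI m k) z z) := fun h =>
    (isSmoothField_contDiffAt h (mem_extChartAt_target z)).differentiableAt (by simp)
  have hv : ∀ X : ∀ z : EndTotal S.φ, TangentSpace (EndI m k) z,
      (tcoord (EndI m k) z ((extChartAt (EndI m k) z).symm (extChartAt (EndI m k) z z))
        (X ((extChartAt (EndI m k) z).symm (extChartAt (EndI m k) z z)))).1 =
      tcoord (𝓡 (m * 2)) z.proj z.proj (difProj S.φ z (X z)) := by
    intro X
    have key : ∀ z', z' = z → (tcoord (EndI m k) z z' (X z')).1 =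
      tcoord (𝓡 (m * 2)) z.proj z.proj (difProj S.φ z (X z)) := by
      rintro _ rfl
      exact tcoord_end_fst hz _
    exact key _ (extChartAt_to_inv z)
  obtain ⟨hA, -, hiff⟩ := LocalImmersion.lieBracket_iff _ hp (hd hX₁) (hd hX₂) (hd hY₁) (hd hY₂)
    (eventually_local_section hX z) (eventually_local_section hY z)
  have e1 : tcoord (EndI m k) z z (VectorField.mlieBracket (EndI m k) X₁ Y₁ z -
      VectorField.mlieBracket (EndI m k) X₂ Y₂ z) = _ :=
    ((tcoord (EndI m k) z z).map_sub _ _).trans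
      (congrArg₂ (· - ·) (tcoord_mlieBracket X₁ Y₁) (tcoord_mlieBracket X₂ Y₂))
  have e2 : tcoord (EndI m k) z z (VectorField.mlieBracket (EndI m k) X₁ Y₂ z +
      VectorField.mlieBracket (EndI m k) X₂ Y₁ z) = _ :=
    ((tcoord (EndI m k) z z).map_add _ _).trans
      (congrArg₂ (· + ·) (tcoord_mlieBracket X₁ Y₂) (tcoord_mlieBracket X₂ Y₁))
  have key : ∀ p : Model (m * 2) × EndModel m k,
      p = (extChartAt (𝓡 (m * 2)) z.proj z.proj, coordEnd S.φ z.proj z) →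
      ∀ A B A' B' a b a' b', a = a' → b = b' → A' = A → B' = B →
      (S.loc z.proj).adapted.IsTan p A →
      ((S.loc z.proj).adapted.cs p A = B ↔ (S.loc z.proj).adapted.nijJ p.1 a b = 0 ∧
        ∀ u v, (S.loc z.proj).IsNormal p.1 u → (S.loc z.proj).IsNormal p.1 v →
          (S.loc z.proj).obstruction p.1 p.2 a b u v = 0) →
      ((z ∈ S.Q ∧ (S.loc z.proj).adapted.IsTan p A' ∧ (S.loc z.proj).adapted.cs p A' = B') ↔
        (S.loc z.proj).adapted.nijJ (extChartAt (𝓡 (m * 2)) z.proj z.proj) a' b' = 0 ∧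
        ∀ u v, (S.loc z.proj).IsNormal (extChartAt (𝓡 (m * 2)) z.proj z.proj) u →
        (S.loc z.proj).IsNormal (extChartAt (𝓡 (m * 2)) z.proj z.proj) v →
        (S.loc z.proj).obstruction (extChartAt (𝓡 (m * 2)) z.proj z.proj)
          (coordEnd S.φ z.proj z) a' b' u v = 0) := by
    rintro _ rfl A B _ _ a b _ _ rfl rfl rfl rfl hA h
    exact ⟨fun h' => h.1 h'.2.2, fun h' => ⟨hQ, hA, h.2 h'⟩⟩
  exact (mem_eigenNegI_twistor_iff hz).trans
    (key _ (extChartAt_end hz) _ _ _ _ _ _ _ _ (hv X₁) (hv Y₁) e1 e2 hA hiff)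

/-- Near z the horizontal lift of a field with constant coordinates is tangent to Q. It is extended
globally and paired with its image under the almost complex structure. -/
theorem exists_section (a : Tan (m * 2) z.proj) :
    ∃ X₁ X₂ : ∀ z : EndTotal S.φ, TangentSpace (EndI m k) z, IsSmoothField (EndI m k) X₁ ∧
      IsSmoothField (EndI m k) X₂ ∧ (∀ z ∈ S.Q, (X₁ z, X₂ z) ∈ S.twistor.eigenNegI z) ∧
      difProj S.φ z (X₁ z) = a := by
  have hz := S.mem_dom z.proj
  have hU : ∀ {z'}, z'.proj ∈ S.dom z.proj →
      (extChartAt (EndI m k) z z').1 ∈ (S.loc z.proj).adapted.U := fun h =>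
    (congrArg Prod.fst (extChartAt_end h)) ▸ coord_mem_U h
  obtain ⟨X₁, h1, h2, h3⟩ := exists_isSmoothField_extending (I := EndI m k)
    -- The infimum over proofs of z' ∈ Q imposes tangency at points of Q and no condition elsewhere.
    (fun z' => ⨅ _ : z' ∈ S.Q, tangentTo (EndI m k) S.Q z') (x₀ := z)
    (X := fun z' => tvec (EndI m k) z z' ((S.loc z.proj).adapted.hor (extChartAt (EndI m k) z z')
      (tcoord (𝓡 (m * 2)) z.proj z.proj a))) (by
    filter_upwards [eventually_mem_dom hz] with z' hz'
    refine ⟨contMDiffAt_tvec (X := fun q => (S.loc z.proj).adapted.hor q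
      (tcoord (𝓡 (m * 2)) z.proj z.proj a)) (end_mem_source hz')
      (AdaptedGeometry.contDiffAt_hor _ (hU hz') contDiffAt_const), ?_⟩
    refine (Submodule.mem_iInf _).2 fun hQ' => ?_
    rw [mem_tangentTo_iff hz' hQ', tcoord_tvec (end_mem_source hz')]
    exact AdaptedGeometry.isTan_hor _ _ _)
  have h4 : ∀ z ∈ S.Q, X₁ z ∈ tangentTo (EndI m k) S.Q z := fun z' hz' =>
    (Submodule.mem_iInf _).1 (h2 z') hz'
  obtain ⟨X₂, h5, h6⟩ := csT_smooth X₁ h1 h4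
  refine ⟨X₁, X₂, h1, h5, fun z' hz' => mem_eigenNegI_twistor.2 ⟨hz', h4 z' hz', (h6 z' hz').symm⟩, ?_⟩
  refine tcoord_injective (source_of_mem_dom hz) ((tcoord_end_fst hz _).symm.trans ?_)
  refine congrArg Prod.fst ((congrArg (tcoord (EndI m k) z z) h3).trans
    (tcoord_tvec (end_mem_source hz) _))

theorem isIntegrable_twistor_iff :
    S.twistor.IsIntegrable ↔ ∀ z ∈ S.Q, ∀ a b, S.IntegrableAt z a b := by
  constructor
  · intro h z hQ a b
    obtain ⟨X₁, X₂, hX₁, hX₂, hX, rfl⟩ := exists_section (S := S) a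
    obtain ⟨Y₁, Y₂, hY₁, hY₂, hY, rfl⟩ := exists_section (S := S) b
    exact (mlieBracket_mem_iff hX₁ hX₂ hY₁ hY₂ hX hY hQ).1
      (h X₁ X₂ Y₁ Y₂ hX₁ hX₂ hY₁ hY₂ hX hY z hQ)
  · intro h X₁ X₂ Y₁ Y₂ hX₁ hX₂ hY₁ hY₂ hX hY z hQ
    exact (mlieBracket_mem_iff hX₁ hX₂ hY₁ hY₂ hX hY hQ).2 (h z hQ _ _)

end ConformalImmersion

/-- Allows `lieBracket_sub_of_eqOn` to be used on M itself, where no tangency condition is present.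
-/
theorem mem_curveTan_univ {W : Type*} [NormedAddCommGroup W] [NormedSpace ℝ W] (p v : W) :
    v ∈ curveTan Set.univ p := by
  refine mem_curveTan (c := fun t => p + t • v) (Filter.Eventually.of_forall fun t => ⟨?_, trivial⟩)
    (by simp) ?_
  · fun_prop
  · have h : HasDerivAt (fun t : ℝ => p + t • v) ((1 : ℝ) • v) 0 :=
      ((hasDerivAt_id (0 : ℝ)).smul_const v).const_add p
    rw [h.deriv, one_smul]

namespace ConformalImmersion
variable {m k : ℕ}
  {M : Type*} [TopologicalSpace M] [T2Space M] [SigmaCompactSpace M]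
  [ChartedSpace (Model (m * 2)) M] [IsManifold (𝓡 (m * 2)) ∞ M]
  {N : Type*} [TopologicalSpace N] [T2Space N] [SigmaCompactSpace N]
  [ChartedSpace (Model (m * 2 + k * 2)) N] [IsManifold (𝓡 (m * 2 + k * 2)) ∞ N]
  {S : ConformalImmersion m k M N} {x : M}

theorem mem_eigenNegI {ζ : Tan (m * 2) x × Tan (m * 2) x} :
    ζ ∈ eigenNegI S.J x ↔ S.J x ζ.1 = ζ.2 :=
  ⟨fun h => h.1, fun h => ⟨h, (congrArg _ h.symm).trans (S.hJ.sq x _)⟩⟩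

theorem isSmoothField_J {X : ∀ x : M, Tan (m * 2) x} (hX : IsSmoothField (𝓡 (m * 2)) X) :
    IsSmoothField (𝓡 (m * 2)) fun x => S.J x (X x) :=
  ContMDiff.clm_bundle_apply S.hJ.smooth hX

variable (S) in
/-- The Nijenhuis tensor of the almost complex structure, in coordinates. -/
def nij (x : M) (a b : Tan (m * 2) x) : Model (m * 2) :=
  (S.loc x).adapted.nijJ (extChartAt (𝓡 (m * 2)) x x) (tcoord (𝓡 (m * 2)) x x a)
    (tcoord (𝓡 (m * 2)) x x b)

/-- The computation made for Q, with the whole model space in place of Q and J in place of `cs`. -/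
theorem mlieBracket_mem_eigenNegI_iff {X₁ X₂ Y₁ Y₂ : ∀ x : M, Tan (m * 2) x}
    (hX₁ : IsSmoothField (𝓡 (m * 2)) X₁) (hX₂ : IsSmoothField (𝓡 (m * 2)) X₂)
    (hY₁ : IsSmoothField (𝓡 (m * 2)) Y₁) (hY₂ : IsSmoothField (𝓡 (m * 2)) Y₂)
    (hX : ∀ x, S.J x (X₁ x) = X₂ x) (hY : ∀ x, S.J x (Y₁ x) = Y₂ x) (x : M) :
    (VectorField.mlieBracket (𝓡 (m * 2)) X₁ Y₁ x - VectorField.mlieBracket (𝓡 (m * 2)) X₂ Y₂ x,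
      VectorField.mlieBracket (𝓡 (m * 2)) X₁ Y₂ x + VectorField.mlieBracket (𝓡 (m * 2)) X₂ Y₁ x) ∈
        eigenNegI S.J x ↔ S.nij x (X₁ x) (Y₁ x) = 0 := by
  have hx := S.mem_dom x
  have hs := source_of_mem_dom hx
  have hd : ∀ {X : ∀ x : M, Tan (m * 2) x}, IsSmoothField (𝓡 (m * 2)) X →
      DifferentiableAt ℝ (fun y => tcoord (𝓡 (m * 2)) x ((extChartAt (𝓡 (m * 2)) x).symm y)
        (X ((extChartAt (𝓡 (m * 2)) x).symm y))) (extChartAt (𝓡 (m * 2)) x x) := fun h =>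
    (isSmoothField_contDiffAt h (mem_extChartAt_target x)).differentiableAt (by simp)
  have hv : ∀ X : ∀ x : M, Tan (m * 2) x,
      tcoord (𝓡 (m * 2)) x ((extChartAt (𝓡 (m * 2)) x).symm (extChartAt (𝓡 (m * 2)) x x))
        (X ((extChartAt (𝓡 (m * 2)) x).symm (extChartAt (𝓡 (m * 2)) x x))) =
      tcoord (𝓡 (m * 2)) x x (X x) := fun X => by
    rw [extChartAt_to_inv]
  have hJ : DifferentiableAt ℝ (S.loc x).J (extChartAt (𝓡 (m * 2)) x x) :=
    ((S.loc x).contDiff_J.contDiffAt ((S.loc x).isOpen.mem_nhds (coord_mem_U hx))).differentiableAt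
      (by simp)
  have hev : ∀ {X Y : ∀ x : M, Tan (m * 2) x}, (∀ x, S.J x (X x) = Y x) →
      ∀ᶠ q in 𝓝 (extChartAt (𝓡 (m * 2)) x x), q ∈ (Set.univ : Set (Model (m * 2))) →
      (S.loc x).J q (tcoord (𝓡 (m * 2)) x ((extChartAt (𝓡 (m * 2)) x).symm q)
        (X ((extChartAt (𝓡 (m * 2)) x).symm q))) =
      tcoord (𝓡 (m * 2)) x ((extChartAt (𝓡 (m * 2)) x).symm q)
        (Y ((extChartAt (𝓡 (m * 2)) x).symm q)) := by
    intro X Y h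
    filter_upwards [(S.loc x).isOpen.mem_nhds (coord_mem_U hx)] with q hq _
    have h1 := loc_J hq.2 (X ((extChartAt (𝓡 (m * 2)) x).symm q))
    rw [(extChartAt (𝓡 (m * 2)) x).right_inv hq.1] at h1
    rw [h1, h]
  have hneg : ∀ {X Y : ∀ x : M, Tan (m * 2) x}, (∀ x, S.J x (X x) = Y x) →
      ∀ᶠ q in 𝓝 (extChartAt (𝓡 (m * 2)) x x), q ∈ (Set.univ : Set (Model (m * 2))) →
      (S.loc x).J q (tcoord (𝓡 (m * 2)) x ((extChartAt (𝓡 (m * 2)) x).symm q)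
        (Y ((extChartAt (𝓡 (m * 2)) x).symm q))) =
      -tcoord (𝓡 (m * 2)) x ((extChartAt (𝓡 (m * 2)) x).symm q)
        (X ((extChartAt (𝓡 (m * 2)) x).symm q)) := by
    intro X Y h
    filter_upwards [hev (X := Y) (Y := fun x => -X x) fun x => by rw [← h, S.hJ.sq]] with q hq hq'
    exact (hq hq').trans ((tcoord (𝓡 (m * 2)) x ((extChartAt (𝓡 (m * 2)) x).symm q)).map_neg _)
  have key := lieBracket_sub_of_eqOn (Q := Set.univ) hJ (hd hX₁) (hd hX₂) (hd hY₁) (hd hY₂)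
    (mem_curveTan_univ _ _) (mem_curveTan_univ _ _) (mem_curveTan_univ _ _)
    (mem_curveTan_univ _ _) (hev hX) (hneg hX) (hev hY) (hneg hY)
  rw [← tcoord_mlieBracket X₁ Y₁, ← tcoord_mlieBracket X₁ Y₂, ← tcoord_mlieBracket X₂ Y₁,
    ← tcoord_mlieBracket X₂ Y₂, hv, hv, hv, hv, ← hX, ← hY] at key
  rw [mem_eigenNegI, ← (tcoord_injective hs).eq_iff, ← loc_J hx, eq_comm, ← sub_eq_zero,
    (tcoord (𝓡 (m * 2)) x x).map_add, (tcoord (𝓡 (m * 2)) x x).map_sub, key, ← loc_J hx, ← loc_J hx]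
  rfl

theorem exists_isSmoothField_eq (a : Tan (m * 2) x) :
    ∃ X : ∀ x : M, Tan (m * 2) x, IsSmoothField (𝓡 (m * 2)) X ∧ X x = a := by
  have hs := mem_chart_source (Model (m * 2)) x
  obtain ⟨X, h1, -, h2⟩ := exists_isSmoothField_extending (I := 𝓡 (m * 2)) (fun _ => ⊤) (x₀ := x)
    (X := fun y => tvec (𝓡 (m * 2)) x y (tcoord (𝓡 (m * 2)) x x a)) (by
      filter_upwards [(chartAt (Model (m * 2)) x).open_source.mem_nhds hs] with y hy
      exact ⟨contMDiffAt_tvec (X := fun _ => tcoord (𝓡 (m * 2)) x x a) hy contDiffAt_const, trivial⟩)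
  exact ⟨X, h1, h2.trans (tvec_tcoord hs a)⟩

theorem isInvolutive_eigenNegI_iff :
    IsInvolutive (𝓡 (m * 2)) (Set.univ : Set M) (eigenNegI S.J) ↔ ∀ x a b, S.nij x a b = 0 := by
  constructor
  · intro h x a b
    obtain ⟨X, hX, rfl⟩ := exists_isSmoothField_eq a
    obtain ⟨Y, hY, rfl⟩ := exists_isSmoothField_eq b
    exact (mlieBracket_mem_eigenNegI_iff hX (isSmoothField_J hX) hY (isSmoothField_J hY)
      (fun _ => rfl) (fun _ => rfl) x).1 (h _ _ _ _ hX (isSmoothField_J hX) hY (isSmoothField_J hY)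
        (fun _ _ => mem_eigenNegI.2 rfl) (fun _ _ => mem_eigenNegI.2 rfl) x trivial)
  · intro h X₁ X₂ Y₁ Y₂ hX₁ hX₂ hY₁ hY₂ hX hY x _
    exact (mlieBracket_mem_eigenNegI_iff hX₁ hX₂ hY₁ hY₂ (fun x => mem_eigenNegI.1 (hX x trivial))
      (fun x => mem_eigenNegI.1 (hY x trivial)) x).2 (h x _ _)

end ConformalImmersion

/-! ### From the curvature condition to the condition on W + A. -/

namespace LocalImmersion
variable {m k : ℕ} {E V : Type*} [NormedAddCommGroup E] [NormedSpace ℝ E]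
    [NormedAddCommGroup V] [NormedSpace ℝ V] (S : LocalImmersion m k E V)
variable [FiniteDimensional ℝ E] [FiniteDimensional ℝ V]

/-- The curvature form, on isotropic vectors of the submanifold and of the normal space. -/
def curvatureObstruction (y : E) (K : V →L[ℝ] V) (X Y : E) (u v : V) : ℝ :=
  S.g y (S.adapted.curvRe y X Y u) v - S.g y (S.adapted.curvRe y X Y (K u)) (K v) -
    S.g y (S.adapted.curvIm y X Y u) (K v) - S.g y (S.adapted.curvIm y X Y (K u)) v

theorem g_curv_skew_symm {y : E} (hy : y ∈ S.U) (X Y : E) (u v : V) :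
    S.g y (S.adapted.curv y X Y u) v = -S.g y (S.adapted.curv y X Y v) u := by
  rw [← S.g_symm y hy u]
  exact S.adapted.g_curv_skew hy X Y u v

/-- The two expressions differ by the sign of the imaginary part of the curvature, that is, by
conjugation of q. They are exchanged by `switch_condition`, which applies since metric curvature is
skew on normal vectors. -/
theorem forall_obstruction_iff {y : E} (hy : y ∈ S.U) (X Y : E) :
    (∀ K, (y, K) ∈ S.adapted.Q → ∀ u v, S.IsNormal y u → S.IsNormal y v →
      S.obstruction y K X Y u v = 0) ↔
    ∀ K, (y, K) ∈ S.adapted.Q → ∀ u v, S.IsNormal y u → S.IsNormal y v →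
      S.curvatureObstruction y K X Y u v = 0 := by
  have s₁ : ∀ u v, (S.g y).comp (S.adapted.curvRe y X Y) u v =
      -(S.g y).comp (S.adapted.curvRe y X Y) v u := fun u v => by
    simp only [ContinuousLinearMap.comp_apply, AdaptedGeometry.curvRe, sub_apply, map_sub]
    rw [S.g_curv_skew_symm hy _ _ u, S.g_curv_skew_symm hy _ _ u]
    ring
  have s₂ : ∀ u v, (S.g y).comp (S.adapted.curvIm y X Y) u v =
      -(S.g y).comp (S.adapted.curvIm y X Y) v u := fun u v => by
    simp only [ContinuousLinearMap.comp_apply, AdaptedGeometry.curvIm, add_apply, map_add]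
    rw [S.g_curv_skew_symm hy _ _ u, S.g_curv_skew_symm hy _ _ u]
    ring
  constructor
  · intro h K hK u v hu hv
    exact S.switch_condition _ _ s₁ s₂ (fun K hK u v hu hv => h K hK u v hu hv) hK hu hv
  · intro h K hK u v hu hv
    -- The converse is the same statement with the opposite imaginary part.
    have h1 := S.switch_condition _ (-((S.g y).comp (S.adapted.curvIm y X Y))) s₁
      (fun u v => congrArg Neg.neg (s₂ u v)) (fun K hK u v hu hv => ?_) hK hu hv
    · simp only [neg_apply, ContinuousLinearMap.comp_apply, sub_neg_eq_add] at h1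
      exact h1
    · simp only [neg_apply, ContinuousLinearMap.comp_apply, ← sub_eq_add_neg]
      exact h K hK u v hu hv

end LocalImmersion

theorem extC_eq {V U : Type*} (T : V → V → U → U → ℝ) (a b : V × V) (c d : U × U) :
    extC T a b c d =
      (((T a.1 b.1 c.1 d.1 - T a.2 b.2 c.1 d.1) - (T a.1 b.1 c.2 d.2 - T a.2 b.2 c.2 d.2) -
        (T a.1 b.2 c.1 d.2 + T a.2 b.1 c.1 d.2) - (T a.1 b.2 c.2 d.1 + T a.2 b.1 c.2 d.1) : ℝ) : ℂ) +
      (((T a.1 b.2 c.1 d.1 + T a.2 b.1 c.1 d.1) - (T a.1 b.2 c.2 d.2 + T a.2 b.1 c.2 d.2) +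
        (T a.1 b.1 c.1 d.2 - T a.2 b.2 c.1 d.2) + (T a.1 b.1 c.2 d.1 - T a.2 b.2 c.2 d.1) : ℝ) : ℂ) *
        Complex.I := by
  have h3 : Complex.I ^ 3 = -Complex.I := Complex.I_pow_three
  have h4 : Complex.I ^ 4 = 1 := Complex.I_pow_four
  simp only [extC, Fin.sum_univ_two, Fin.val_zero, Fin.val_one, Matrix.cons_val_zero,
    Matrix.cons_val_one]
  norm_num [Complex.I_sq, h3, h4]
  ring

theorem extC_eq_zero_iff {V U : Type*} (T : V → V → U → U → ℝ) (a b : V × V) (c d : U × U) :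
    extC T a b c d = 0 ↔
      ((T a.1 b.1 c.1 d.1 - T a.2 b.2 c.1 d.1) - (T a.1 b.1 c.2 d.2 - T a.2 b.2 c.2 d.2) -
        (T a.1 b.2 c.1 d.2 + T a.2 b.1 c.1 d.2) - (T a.1 b.2 c.2 d.1 + T a.2 b.1 c.2 d.1) = 0) ∧
      ((T a.1 b.2 c.1 d.1 + T a.2 b.1 c.1 d.1) - (T a.1 b.2 c.2 d.2 + T a.2 b.1 c.2 d.2) +
        (T a.1 b.1 c.1 d.2 - T a.2 b.2 c.1 d.2) + (T a.1 b.1 c.2 d.1 - T a.2 b.2 c.2 d.1) = 0) := by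
  rw [extC_eq]
  constructor
  · intro h
    have h1 := congrArg Complex.re h
    have h2 := congrArg Complex.im h
    rw [Complex.add_re, Complex.ofReal_re, Complex.re_ofReal_mul, Complex.I_re, mul_zero, add_zero,
      Complex.zero_re] at h1
    rw [Complex.add_im, Complex.ofReal_im, Complex.im_ofReal_mul, Complex.I_im, mul_one, zero_add,
      Complex.zero_im] at h2
    exact ⟨h1, h2⟩
  · rintro ⟨h1, h2⟩
    rw [h1, h2]
    simp

namespace ConformalImmersion
variable {m k : ℕ}
  {M : Type*} [TopologicalSpace M] [T2Space M] [SigmaCompactSpace M]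
  [ChartedSpace (Model (m * 2)) M] [IsManifold (𝓡 (m * 2)) ∞ M]
  {N : Type*} [TopologicalSpace N] [T2Space N] [SigmaCompactSpace N]
  [ChartedSpace (Model (m * 2 + k * 2)) N] [IsManifold (𝓡 (m * 2 + k * 2)) ∞ N]
  {S : ConformalImmersion m k M N} {x : M} {z : EndTotal S.φ}

theorem exists_coordEnd_eq (x : M) (K : EndModel m k) :
    ∃ z : EndTotal S.φ, z.proj = x ∧ coordEnd S.φ x z = K := by
  have hx := map_source_of_mem_dom (S.mem_dom x)
  let L : Tan (m * 2 + k * 2) (S.φ x) →L[ℝ] Tan (m * 2 + k * 2) (S.φ x) :=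
    (tvec (𝓡 (m * 2 + k * 2)) (S.φ x) (S.φ x)).comp
      (K.comp (tcoord (𝓡 (m * 2 + k * 2)) (S.φ x) (S.φ x)))
  refine ⟨⟨x, L⟩, rfl, ?_⟩
  ext1 u
  change tcoord (𝓡 (m * 2 + k * 2)) (S.φ x) (S.φ x) (L (tvec (𝓡 (m * 2 + k * 2)) (S.φ x) (S.φ x) u)) = K u
  simp only [L, ContinuousLinearMap.comp_apply]
  rw [tcoord_tvec hx, tcoord_tvec hx]

theorem mem_Q_iff_coordEnd (hx : z.proj = x) : z ∈ S.Q ↔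
    (extChartAt (𝓡 (m * 2)) x x, coordEnd S.φ x z) ∈ (S.loc x).adapted.Q := by
  subst hx
  rw [← extChartAt_end (S.mem_dom z.proj), mem_Q_iff (S.mem_dom z.proj)]

theorem exists_isFrame (x : M) : ∃ Z, IsFrame S.φ S.g x Z := by
  have hx := S.mem_dom x
  obtain ⟨Z, hZ⟩ := (S.loc x).exists_frame (coord_mem_U hx) (finrank_euclideanSpace_fin (𝕜 := ℝ))
  refine ⟨fun a => tvec (𝓡 (m * 2)) x x (Z a), fun a b => ?_⟩
  rw [← loc_g hx, ← loc_f hx, ← loc_f hx, tcoord_tvec (source_of_mem_dom hx),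
    tcoord_tvec (source_of_mem_dom hx), hZ]

/-- Every point of M must lie under Q if integrability on Q is to imply that of J. In codimension
zero the fibre can only consist of the zero endomorphism, and it is nonempty when the orientations
agree. -/
theorem exists_mem_Q_proj_eq (hk : k = 0 → ∀ x : M, ∃ z ∈ S.Q, z.proj = x) (x : M) :
    ∃ z ∈ S.Q, z.proj = x := by
  by_cases h : k = 0
  · exact hk h x
  · have hx := S.mem_dom x
    obtain ⟨b, hb, -⟩ := S.hJ.positive x
    obtain ⟨K, hK⟩ := (S.loc x).exists_mem_Q (coord_mem_U hx) (finrank_euclideanSpace_fin (𝕜 := ℝ))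
      (finrank_euclideanSpace_fin (𝕜 := ℝ)) h (b.map (tcoordEquiv (source_of_mem_dom hx)))
      ((orientation_iff hx fun _ => rfl).1 hb)
    obtain ⟨z, hz, rfl⟩ := exists_coordEnd_eq (S := S) x K
    exact ⟨z, (mem_Q_iff_coordEnd hz).2 hK, hz⟩

/-- The curvature of the adapted connection determines the condition on `W + A`. -/
theorem extC_weylPlusA_iff (hLC : leviCivita S.g = S.D.toFun) {D : Connection (m * 2 + k * 2) N}
    (hD : IsWeyl S.g D) (hQ : z ∈ S.Q) {Z : Fin (m * 2) → Tan (m * 2) z.proj}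
    (hZ : IsFrame S.φ S.g z.proj Z) :
    (∀ a ∈ eigenNegI S.J z.proj, ∀ b ∈ eigenNegI S.J z.proj, ∀ c ∈ isotropicSpace S.φ S.g z,
      ∀ d ∈ isotropicSpace S.φ S.g z, extC (weylPlusA S.φ S.g D z.proj Z) a b c d = 0) ↔
    ∀ a b, ∀ u v, (S.loc z.proj).IsNormal (extChartAt (𝓡 (m * 2)) z.proj z.proj) u →
      (S.loc z.proj).IsNormal (extChartAt (𝓡 (m * 2)) z.proj z.proj) v →
      (S.loc z.proj).curvatureObstruction (extChartAt (𝓡 (m * 2)) z.proj z.proj)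
        (coordEnd S.φ z.proj z) a b u v = 0 := by
  have hz := S.mem_dom z.proj
  set L := S.loc z.proj with hL
  set κ := extChartAt (𝓡 (m * 2)) z.proj z.proj with hκ
  set K := coordEnd S.φ z.proj z with hK
  set T := weylPlusA S.φ S.g D z.proj Z with hT
  let τ : Tan (m * 2) z.proj → Model (m * 2) := fun a => tcoord (𝓡 (m * 2)) z.proj z.proj a
  let ν : Tan (m * 2 + k * 2) (S.φ z.proj) → Model (m * 2 + k * 2) :=
    fun u => tcoord (𝓡 (m * 2 + k * 2)) (S.φ z.proj) (S.φ z.proj) u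
  have hQ' : ∀ {u}, u ∈ normal S.φ S.g z.proj → act S.φ z u ∈ normal S.φ S.g z.proj :=
    fun h => hQ.normal_mem _ h
  have hT' : ∀ X Y u v, u ∈ normal S.φ S.g z.proj → v ∈ normal S.φ S.g z.proj →
      T X Y u v = -L.g κ (L.adapted.curv κ (τ X) (τ Y) (ν u)) (ν v) := fun X Y u v hu hv => by
    rw [hT, ← neg_neg (weylPlusA S.φ S.g D z.proj Z X Y u v), ← g_curv_eq hLC hD hZ X Y hu hv]
  have hJ : ∀ X, τ (S.J z.proj X) = L.adapted.J κ (τ X) := fun X => (loc_J hz X).symm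
  have hν : ∀ u, ν (act S.φ z u) = K (ν u) := fun u => (coordEnd_apply hz u).symm
  have hc : ∀ a b u v, L.curvatureObstruction κ K a b u v =
      (L.g κ (L.adapted.curv κ a b u) v - L.g κ (L.adapted.curv κ (L.adapted.J κ a) (L.adapted.J κ b) u) v) -
      (L.g κ (L.adapted.curv κ a b (K u)) (K v) -
        L.g κ (L.adapted.curv κ (L.adapted.J κ a) (L.adapted.J κ b) (K u)) (K v)) -
      (L.g κ (L.adapted.curv κ a (L.adapted.J κ b) u) (K v) +
        L.g κ (L.adapted.curv κ (L.adapted.J κ a) b u) (K v)) -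
      (L.g κ (L.adapted.curv κ a (L.adapted.J κ b) (K u)) v +
        L.g κ (L.adapted.curv κ (L.adapted.J κ a) b (K u)) v) := fun a b u v => by
    simp only [LocalImmersion.curvatureObstruction, AdaptedGeometry.curvRe, AdaptedGeometry.curvIm,
      sub_apply, add_apply, map_sub, map_add]
  have hKK : ∀ v ∈ normal S.φ S.g z.proj, K (K (ν v)) = -ν v := fun v hv => by
    rw [← hν, ← hν, hQ.sq v hv]
    exact ContinuousLinearMap.map_neg _ _
  constructor
  · intro h a b u v hu hv
    obtain ⟨a, rfl⟩ : ∃ a', τ a' = a := ⟨_, tcoord_tvec (source_of_mem_dom hz) a⟩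
    obtain ⟨b, rfl⟩ : ∃ a', τ a' = b := ⟨_, tcoord_tvec (source_of_mem_dom hz) b⟩
    obtain ⟨u, rfl⟩ : ∃ a', ν a' = u := ⟨_, tcoord_tvec (map_source_of_mem_dom hz) u⟩
    obtain ⟨v, rfl⟩ : ∃ a', ν a' = v := ⟨_, tcoord_tvec (map_source_of_mem_dom hz) v⟩
    rw [hL, loc_isNormal hz] at hu hv
    -- The real part of the complex equation is, up to sign, the curvature form.
    have h1 := ((extC_eq_zero_iff _ _ _ _ _).1 (h (a, S.J z.proj a) (mem_eigenNegI.2 rfl)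
      (b, S.J z.proj b) (mem_eigenNegI.2 rfl) (u, act S.φ z u) ⟨hu, rfl⟩ (v, act S.φ z v)
      ⟨hv, rfl⟩)).1
    dsimp only at h1
    simp only [hT' _ _ _ _ hu hv, hT' _ _ _ _ (hQ' hu) hv, hT' _ _ _ _ hu (hQ' hv),
      hT' _ _ _ _ (hQ' hu) (hQ' hv), hJ, hν] at h1
    rw [hc]
    linarith
  · rintro h ⟨a, a'⟩ ha ⟨b, b'⟩ hb ⟨u, u'⟩ ⟨hu, hu'⟩ ⟨v, v'⟩ ⟨hv, hv'⟩
    rw [mem_eigenNegI] at ha hb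
    dsimp only at ha hb hu hu' hv hv'
    subst ha hb hu' hv'
    rw [extC_eq_zero_iff]
    dsimp only
    simp only [hT' _ _ _ _ hu hv, hT' _ _ _ _ (hQ' hu) hv, hT' _ _ _ _ hu (hQ' hv),
      hT' _ _ _ _ (hQ' hu) (hQ' hv), hJ, hν]
    have h1 := h (τ a) (τ b) (ν u) (ν v) ((loc_isNormal hz).2 hu) ((loc_isNormal hz).2 hv)
    -- Replacing v by Kv multiplies v + iKv by -i, and so yields the imaginary part.
    have h2 := h (τ a) (τ b) (ν u) (ν (act S.φ z v)) ((loc_isNormal hz).2 hu)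
      ((loc_isNormal hz).2 (hQ' hv))
    rw [hc] at h1 h2
    simp only [hν, hKK v hv, map_neg] at h2
    constructor
    · linarith
    · linarith

/-- The horizontal obstruction gives the integrability of J. The vertical one is converted to W + A
over the whole fibre at a point at once, because conjugate spaces can be exchanged only if all K of
the fibre are available. -/
theorem isIntegrable_twistor_iff_weylPlusA (hLC : leviCivita S.g = S.D.toFun)
    {D : Connection (m * 2 + k * 2) N} (hD : IsWeyl S.g D)
    (hk : k = 0 → ∀ x : M, ∃ z ∈ S.Q, z.proj = x) :
    S.twistor.IsIntegrable ↔
      IsInvolutive (𝓡 (m * 2)) (Set.univ : Set M) (eigenNegI S.J) ∧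
      ∀ z ∈ S.Q, ∀ Z : Fin (m * 2) → Tan (m * 2) z.proj, IsFrame S.φ S.g z.proj Z →
        ∀ a ∈ eigenNegI S.J z.proj, ∀ b ∈ eigenNegI S.J z.proj,
        ∀ c ∈ isotropicSpace S.φ S.g z, ∀ d ∈ isotropicSpace S.φ S.g z,
          extC (weylPlusA S.φ S.g D z.proj Z) a b c d = 0 := by
  rw [isIntegrable_twistor_iff, isInvolutive_eigenNegI_iff]
  have hsurj : ∀ (x : M) (a : Model (m * 2)), ∃ a', tcoord (𝓡 (m * 2)) x x a' = a := fun x a =>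
    ⟨_, tcoord_tvec (source_of_mem_dom (S.mem_dom x)) a⟩
  constructor
  · refine fun h => ⟨fun x a b => ?_, fun z hQ Z hZ => ?_⟩
    · obtain ⟨z, hQ, rfl⟩ := exists_mem_Q_proj_eq hk x
      exact (h z hQ a b).1
    · rw [extC_weylPlusA_iff hLC hD hQ hZ]
      intro a b
      obtain ⟨a, rfl⟩ := hsurj z.proj a
      obtain ⟨b, rfl⟩ := hsurj z.proj b
      refine ((S.loc z.proj).forall_obstruction_iff (coord_mem_U (S.mem_dom z.proj)) _ _).1 ?_ _
        ((mem_Q_iff_coordEnd rfl).1 hQ)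
      -- Any K in the local fibre comes from a point z' of Q over the same point of M, and
      -- integrability is used there.
      intro K hK
      obtain ⟨z', h1, rfl⟩ := exists_coordEnd_eq (S := S) z.proj K
      have hQ' := (mem_Q_iff_coordEnd h1).2 hK
      have key : ∀ x, z'.proj = x → ∀ a b : Tan (m * 2) x,
          ∀ u v, (S.loc x).IsNormal (extChartAt (𝓡 (m * 2)) x x) u →
          (S.loc x).IsNormal (extChartAt (𝓡 (m * 2)) x x) v →
          (S.loc x).obstruction (extChartAt (𝓡 (m * 2)) x x) (coordEnd S.φ x z')
            (tcoord (𝓡 (m * 2)) x x a) (tcoord (𝓡 (m * 2)) x x b) u v = 0 := by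
        rintro _ rfl a b
        exact (h z' hQ' a b).2
      exact key _ h1 a b
  · rintro ⟨h1, h2⟩ z hQ a b
    refine ⟨h1 z.proj a b, ?_⟩
    refine ((S.loc z.proj).forall_obstruction_iff (coord_mem_U (S.mem_dom z.proj)) _ _).2 ?_ _
        ((mem_Q_iff_coordEnd rfl).1 hQ)
    intro K hK
    obtain ⟨z', hz', rfl⟩ := exists_coordEnd_eq (S := S) z.proj K
    have hQ' := (mem_Q_iff_coordEnd hz').2 hK
    obtain ⟨Z, hZ⟩ := exists_isFrame (S := S) z'.proj
    have h3 := (extC_weylPlusA_iff hLC hD hQ' hZ).1 (h2 z' hQ' Z hZ)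
    have key : ∀ x, z'.proj = x → ∀ a b u v, (S.loc x).IsNormal (extChartAt (𝓡 (m * 2)) x x) u →
          (S.loc x).IsNormal (extChartAt (𝓡 (m * 2)) x x) v →
          (S.loc x).curvatureObstruction (extChartAt (𝓡 (m * 2)) x x) (coordEnd S.φ x z') a b u v = 0 := by
      rintro _ rfl
      exact h3
    exact key _ hz' _ _

end ConformalImmersion

end Twistor

end

theorem corollary3p2 {m k : ℕ}
    {M : Type*} [TopologicalSpace M] [T2Space M] [SigmaCompactSpace M]
    [ChartedSpace (Model (m * 2)) M] [IsManifold (𝓡 (m * 2)) ∞ M]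
    {N : Type*} [TopologicalSpace N] [T2Space N] [SigmaCompactSpace N]
    [ChartedSpace (Model (m * 2 + k * 2)) N] [IsManifold (𝓡 (m * 2 + k * 2)) ∞ N]
    -- the conformal structures, given by representatives
    (gM : Metric (m * 2) M) (gN : Metric (m * 2 + k * 2) N)
    -- the orientations
    (oM : ∀ x : M, Orientation ℝ (Tan (m * 2) x) (Fin (m * 2))) (hoM : IsOrientation oM)
    (oN : ∀ y : N, Orientation ℝ (Tan (m * 2 + k * 2) y) (Fin (m * 2 + k * 2)))
    (hoN : IsOrientation oN)
    -- the immersion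
    (φ : C^∞⟮𝓡 (m * 2), M; 𝓡 (m * 2 + k * 2), N⟯) (hφ : ∀ x : M, Function.Injective (dif φ x))
    -- in codimension zero the immersion preserves the orientations
    (hk : k = 0 → ∀ x : M, ∃ z ∈ normalTwistor φ gN oM oN, z.proj = x)
    -- the section of the bundle of positive maximal isotropic spaces on the submanifold
    (J : ∀ x : M, Tan (m * 2) x →L[ℝ] Tan (m * 2) x) (hJ : IsSectionQM gM oM J)
    -- the Weyl connection
    (D : Connection (m * 2 + k * 2) N) (hD : IsWeyl gN D) :
    ∃ 𝒥 : AlmostComplex (EndI m k) (normalTwistor φ gN oM oN),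
      (∀ D' : Connection (m * 2 + k * 2) N, IsWeyl gN D' →
        ∀ 𝒥' : AlmostComplex (EndI m k) (normalTwistor φ gN oM oN),
          IsTwistorStructure φ gN oM oN J D' 𝒥' ↔ 𝒥' = 𝒥) ∧
      (𝒥.IsIntegrable ↔
        IsInvolutive (𝓡 (m * 2)) (Set.univ : Set M) (Twistor.eigenNegI J) ∧
        ∀ z ∈ normalTwistor φ gN oM oN, ∀ Z : Fin (m * 2) → Tan (m * 2) z.proj,
          IsFrame φ gN z.proj Z →
          ∀ a ∈ Twistor.eigenNegI J z.proj, ∀ b ∈ Twistor.eigenNegI J z.proj,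
          ∀ c ∈ isotropicSpace φ gN z, ∀ d ∈ isotropicSpace φ gN z,
            extC (weylPlusA φ gN D z.proj Z) a b c d = 0) := by
  -- The structure is built with the connection D₀ that underlies the chosen `leviCivita`, so that
  -- the curvature in `weyl` is the one computed; D enters only through A.
  obtain ⟨D₀, hD₀, hLC⟩ := exists_leviCivita_eq hD
  let S : ConformalImmersion m k M N := ⟨gM, gN, oM, hoM, oN, hoN, φ, hφ, J, hJ, D₀, hD₀⟩
  exact ⟨S.twistor, fun D' hD' 𝒥' => ConformalImmersion.isTwistorStructure_iff (S := S) hD' 𝒥',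
    ConformalImmersion.isIntegrable_twistor_iff_weylPlusA (S := S) hLC hD hk⟩
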